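/- Let $\sigma>1$, $a>0$, $g(s)=as^\sigma$ and $G(s)=\int_0^s g$. **Objects.** For $\omega>0$ let $Q_\omega$ be the positive even $H^1(\mathbb R)$ solution of $Q_\omega''=Q_\omega-Q_\omega^3-\frac{g(\omega Q_\omega^2)}{\omega}Q_\omega$. Put $$L_+=-\partial_y^2+1-3Q_\omega^2-\tfrac{g(\omega Q_\omega^2)}{\omega}-2Q_\omega^2g'(\omega Q_\omega^2),\qquad S^*=-\tfrac1{Q_\omega}\,\partial_y\,Q_\omega,\qquad M_\pm=-\partial_y^2+1+a_\omega^\pm,$$ $$a_\omega^+=\tfrac{g(\omega Q_\omega^2)}{\omega}-2\tfrac{G(\omega Q_\omega^2)}{\omega^2Q_\omega^2},\qquad a_\omega^-=5\tfrac{g(\omega Q_\omega^2)}{\omega}-6\tfrac{G(\omega Q_\omega^2)}{\omega^2Q_\omega^2}-2Q_\omega^2g'(\omega Q_\omega^2).$$ Let $\lambda=1-\alpha^2$ with $0<\alpha<1$ and let $W_1,W_2\in H^2(\mathbb R)$ be smooth with $M_+W_1=\lambda W_2$, $M_-W_2=\lambda W_1$, normalized by $\frac12\int_{\mathbb R}(a_\omega^+W_1+a_\omega^-W_2)=-2\alpha$;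 set $V_1=(S^*)^2W_1$, $V_2=\lambda^{-1}L_+V_1$ (the internal mode). Let $h_1,h_2$ be smooth, even and bounded with $M_+h_1=2\lambda h_2$, $M_-h_2=2\lambda h_1$, normalized by $\frac12(h_1(0)+h_2(0))=-1$; set $g_1=(S^*)^2h_1$, $g_2=\frac1{2\lambda}L_+g_1$. With $\langle u,v\rangle=\int_{\mathbb R}uv$, define $$G_1=V_1^2Q_\omega\big(3+3g'(\omega Q_\omega^2)+2\omega Q_\omega^2g''(\omega Q_\omega^2)\big)-V_2^2Q_\omega\big(1+g'(\omega Q_\omega^2)\big),\qquad G_2=2V_1V_2Q_\omega\big(1+g'(\omega Q_\omega^2)\big),$$ $$G_1^\top=G_1-\frac{\langle G_1,V_1\rangle}{\langle V_1,V_2\rangle}V_2,\qquad G_2^\perp=G_2-\frac{\langle G_2,V_2\rangle}{\langle V_1,V_2\rangle}V_1,\qquad \Gamma(\omega)=\int_{\mathbb R}\big(G_1^\top g_1+G_2^\perp g_2\big)\,dy.$$ **Claim.** There are $\omega_0>0$ and $C>0$, depending only on $\sigma$ and $a$, such that for all $0<\omega<\omega_0$ objects as above exist, and for any such objects the integral defining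 $\Gamma(\omega)$ converges absolutely and $$\big|\Gamma(\omega)-a\,\Gamma_0(\sigma)\,\omega^{\sigma-1}\big|\le C\,\omega^{2(\sigma-1)}.$$ Here, with $Q=\sqrt2\,\mathrm{sech}$, $$\Gamma_0(\sigma)=\int_{\mathbb R}\Big(Q^2\Delta_4^0\cos y+\frac{2Q'}{Q}\Delta_5^0\sin y\Big)dy,$$ an absolutely convergent integral, where $$\begin{aligned}\Delta_4^0={}&(13Q^2-16)Q^2D^0-8Q'Q(D^0)'+2Q\big(3(1-Q^2)^2-1\big)T_1^0+6Q(2-Q^2)^2T_2^0\\&+4(2-3Q^2)Q'(T_1^0)'+4(4-3Q^2)Q'(T_2^0)'+2\sigma^2Q^{2\sigma-1}\\&-\Big(\tfrac{4(\sigma+2)}{\sigma+1}+(2\sigma+1)^2\Big)Q^{2\sigma+1}+\Big(\tfrac{8}{\sigma+1}+(\sigma+1)(2\sigma+1)\Big)Q^{2\sigma+3},\\ \Delta_5^0={}&(2-30Q^2+29Q^4-8Q^6)D^0-8Q^3Q'(D^0)'+2Q(2-Q^2)(2-3Q^2)T_1^0+2Q(3Q^4-10Q^2+12)T_2^0\\&+16(1-Q^2)Q'(T_1^0)'+8(2-Q^2)Q'(T_2^0)'+2\sigma(\sigma+1)Q^{2\sigma-1}-\Big(\tfrac{16}{\sigma+1}+2\sigma+(2\sigma+1)^2\Big)Q^{2\sigma+1}\\&+\Big(\tfrac{4(4-\sigma)}{\sigma+1}+(\sigma+1)(2\sigma+1)\Big)Q^{2\sigma+3}-\tfrac{4}{\sigma+1}Q^{2\sigma+5},\end{aligned}$$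 $$T_1^0(y)=-\frac{(\sigma-1)^2}{2(\sigma+1)}\int_{\mathbb R}|y-z|\,Q(z)^{2\sigma}dz,\qquad T_2^0(y)=-\frac{\sqrt2\,\sigma(\sigma-1)}{4(\sigma+1)}\int_{\mathbb R}e^{-\sqrt2|y-z|}Q(z)^{2\sigma}dz,$$ $$D^0(y)=-Q'(y)\int_0^yA\,Q^{2\sigma+1}+A(y)\frac{Q(y)^{2\sigma+2}}{2\sigma+2},\qquad A(y)=\frac{\sqrt2}{4\cosh y}\big(3y\tanh y+\sinh^2y-2\big).$$ -/

import Mathlib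

namespace FermiRule

open MeasureTheory

noncomputable section

/-! Solitons, linearized operators, the internal mode, and the quantity `Γ(ω)`,
for a general nonlinearity `g`. Everything is written in the rescaled variable
`y = √ω x`; `R` stands for the rescaled soliton `Q_ω`. -/

/-- The primitive `G(s) = ∫₀ˢ g`. -/
def primitive (g : ℝ → ℝ) (s : ℝ) : ℝ := ∫ t in (0 : ℝ)..s, g t

/-- The `L²(ℝ)` scalar product of real functions. -/
def ip (f k : ℝ → ℝ) : ℝ := ∫ y, f y * k y

/-- `R = Q_ω` is the positive even `H¹` solution of
`R'' = R - R³ - (g(ω R²)/ω) R`. -/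
structure IsSoliton (g : ℝ → ℝ) (ω : ℝ) (R : ℝ → ℝ) : Prop where
  contDiff : ContDiff ℝ 2 R
  pos : ∀ y, 0 < R y
  even : ∀ y, R (-y) = R y
  memLp : MemLp R 2 volume
  memLp_deriv : MemLp (deriv R) 2 volume
  equation : ∀ y, deriv (deriv R) y = R y - R y ^ 3 - g (ω * R y ^ 2) / ω * R y

/-- `L₊ = -∂² + 1 - 3R² - g(ωR²)/ω - 2R² g'(ωR²)`. -/
def Lplus (g : ℝ → ℝ) (ω : ℝ) (R f : ℝ → ℝ) (y : ℝ) : ℝ :=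
  -deriv (deriv f) y + f y - 3 * R y ^ 2 * f y - g (ω * R y ^ 2) / ω * f y
    - 2 * R y ^ 2 * deriv g (ω * R y ^ 2) * f y

/-- `S* = -(1/R) ∂ R`. -/
def Sstar (R f : ℝ → ℝ) (y : ℝ) : ℝ :=
  -(1 / R y) * deriv (fun x => R x * f x) y

/-- `a⁺ = g(ωR²)/ω - 2 G(ωR²)/(ω²R²)`. -/
def aPlus (g : ℝ → ℝ) (ω : ℝ) (R : ℝ → ℝ) (y : ℝ) : ℝ :=
  g (ω * R y ^ 2) / ω - 2 * (primitive g (ω * R y ^ 2) / (ω ^ 2 * R y ^ 2))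

/-- `a⁻ = 5 g(ωR²)/ω - 6 G(ωR²)/(ω²R²) - 2R² g'(ωR²)`. -/
def aMinus (g : ℝ → ℝ) (ω : ℝ) (R : ℝ → ℝ) (y : ℝ) : ℝ :=
  5 * (g (ω * R y ^ 2) / ω) - 6 * (primitive g (ω * R y ^ 2) / (ω ^ 2 * R y ^ 2))
    - 2 * R y ^ 2 * deriv g (ω * R y ^ 2)

/-- `M₊ = -∂² + 1 + a⁺`. -/
def Mplus (g : ℝ → ℝ) (ω : ℝ) (R f : ℝ → ℝ) (y : ℝ) : ℝ :=
  -deriv (deriv f) y + f y + aPlus g ω R y * f y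

/-- `M₋ = -∂² + 1 + a⁻`. -/
def Mminus (g : ℝ → ℝ) (ω : ℝ) (R f : ℝ → ℝ) (y : ℝ) : ℝ :=
  -deriv (deriv f) y + f y + aMinus g ω R y * f y

/-- A smooth function all of whose derivatives up to order two are square integrable. -/
structure IsSmoothH2 (f : ℝ → ℝ) : Prop where
  contDiff : ContDiff ℝ (⊤ : ℕ∞) f
  memLp : MemLp f 2 volume
  memLp_deriv : MemLp (deriv f) 2 volume
  memLp_deriv_deriv : MemLp (deriv (deriv f)) 2 volume

/-- `(W₁, W₂)` is the (normalized) internal mode of `M₊ W₁ = λ W₂`, `M₋ W₂ = λ W₁`, with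
eigenvalue `λ = 1 - α²`, `0 < α < 1`. The normalization `½ ∫ (a⁺ W₁ + a⁻ W₂) = -2α` is the
one for which `W₁` and `W₂` tend to `1` as `ω → 0`. -/
structure IsInternalMode (g : ℝ → ℝ) (ω : ℝ) (R : ℝ → ℝ) (α : ℝ) (W₁ W₂ : ℝ → ℝ) : Prop where
  alpha_pos : 0 < α
  alpha_lt_one : α < 1
  smooth₁ : IsSmoothH2 W₁
  smooth₂ : IsSmoothH2 W₂
  eq₁ : ∀ y, Mplus g ω R W₁ y = (1 - α ^ 2) * W₂ y
  eq₂ : ∀ y, Mminus g ω R W₂ y = (1 - α ^ 2) * W₁ y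
  normalization : (1 / 2) * ∫ y, (aPlus g ω R y * W₁ y + aMinus g ω R y * W₂ y) = -2 * α

/-- `(h₁, h₂)` is the bounded even smooth solution of `M₊ h₁ = 2λ h₂`, `M₋ h₂ = 2λ h₁`
normalized by `(h₁(0) + h₂(0)) / 2 = -1`. -/
structure IsRadiationMode (g : ℝ → ℝ) (ω : ℝ) (R : ℝ → ℝ) (lam : ℝ) (h₁ h₂ : ℝ → ℝ) :
    Prop where
  contDiff₁ : ContDiff ℝ (⊤ : ℕ∞) h₁
  contDiff₂ : ContDiff ℝ (⊤ : ℕ∞) h₂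
  even₁ : ∀ y, h₁ (-y) = h₁ y
  even₂ : ∀ y, h₂ (-y) = h₂ y
  bounded : ∃ B : ℝ, ∀ y, |h₁ y| ≤ B ∧ |h₂ y| ≤ B
  eq₁ : ∀ y, Mplus g ω R h₁ y = 2 * lam * h₂ y
  eq₂ : ∀ y, Mminus g ω R h₂ y = 2 * lam * h₁ y
  normalization : (h₁ 0 + h₂ 0) / 2 = -1

/-- All the objects entering the definition of `Γ(ω)`. -/
structure IsFermiTuple (g : ℝ → ℝ) (ω : ℝ) (R : ℝ → ℝ) (α : ℝ) (W₁ W₂ h₁ h₂ : ℝ → ℝ) :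
    Prop where
  soliton : IsSoliton g ω R
  mode : IsInternalMode g ω R α W₁ W₂
  radiation : IsRadiationMode g ω R (1 - α ^ 2) h₁ h₂

/-- `V₁ = (S*)² W₁`, and likewise `g₁ = (S*)² h₁`. -/
def firstComponent (R f : ℝ → ℝ) : ℝ → ℝ := Sstar R (Sstar R f)

/-- `V₂ = μ⁻¹ L₊ (S*)² W₁` with `μ = λ`, and likewise `g₂ = μ⁻¹ L₊ (S*)² h₁` with `μ = 2λ`. -/
def secondComponent (g : ℝ → ℝ) (ω : ℝ) (R : ℝ → ℝ) (μ : ℝ) (f : ℝ → ℝ) (y : ℝ) : ℝ :=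
  μ⁻¹ * Lplus g ω R (firstComponent R f) y

/-- `G₁ = V₁² R (3 + 3g'(ωR²) + 2ωR² g''(ωR²)) - V₂² R (1 + g'(ωR²))`. -/
def Gone (g : ℝ → ℝ) (ω : ℝ) (R V₁ V₂ : ℝ → ℝ) (y : ℝ) : ℝ :=
  V₁ y ^ 2 * R y * (3 + 3 * deriv g (ω * R y ^ 2)
      + 2 * ω * R y ^ 2 * deriv (deriv g) (ω * R y ^ 2))
    - V₂ y ^ 2 * R y * (1 + deriv g (ω * R y ^ 2))

/-- `G₂ = 2 V₁ V₂ R (1 + g'(ωR²))`. -/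
def Gtwo (g : ℝ → ℝ) (ω : ℝ) (R V₁ V₂ : ℝ → ℝ) (y : ℝ) : ℝ :=
  2 * V₁ y * V₂ y * R y * (1 + deriv g (ω * R y ^ 2))

/-- `G₁^⊤ g₁ + G₂^⊥ g₂` with `G₁^⊤ = G₁ - (⟨G₁, V₁⟩ / ⟨V₁, V₂⟩) V₂` and
`G₂^⊥ = G₂ - (⟨G₂, V₂⟩ / ⟨V₁, V₂⟩) V₁`. -/
def fermiDensity (g : ℝ → ℝ) (ω : ℝ) (R V₁ V₂ g₁ g₂ : ℝ → ℝ) (y : ℝ) : ℝ :=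
  (Gone g ω R V₁ V₂ y - ip (Gone g ω R V₁ V₂) V₁ / ip V₁ V₂ * V₂ y) * g₁ y
    + (Gtwo g ω R V₁ V₂ y - ip (Gtwo g ω R V₁ V₂) V₂ / ip V₁ V₂ * V₁ y) * g₂ y

/-- The integrand of `Γ(ω)`, in terms of `Q_ω`, `α`, `W₁` and `h₁`. -/
def fermiIntegrand (g : ℝ → ℝ) (ω : ℝ) (R : ℝ → ℝ) (α : ℝ) (W₁ h₁ : ℝ → ℝ) : ℝ → ℝ :=
  fermiDensity g ω R
    (firstComponent R W₁) (secondComponent g ω R (1 - α ^ 2) W₁)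
    (firstComponent R h₁) (secondComponent g ω R (2 * (1 - α ^ 2)) h₁)

/-- `Γ(ω) = ∫ (G₁^⊤ g₁ + G₂^⊥ g₂)`. -/
def fermiGamma (g : ℝ → ℝ) (ω : ℝ) (R : ℝ → ℝ) (α : ℝ) (W₁ h₁ : ℝ → ℝ) : ℝ :=
  ∫ y, fermiIntegrand g ω R α W₁ h₁ y

/-! The power nonlinearity and the explicit constant `Γ₀(σ)`. -/

/-- `g(s) = a s^σ`. -/
def powerNL (a σ : ℝ) (s : ℝ) : ℝ := a * s ^ σ

/-- `Q = √2 sech`. -/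
def Q (y : ℝ) : ℝ := √2 / Real.cosh y

/-- The even solution of `-A'' + A - 3Q²A = 0` with `Q''A - Q'A' = 1`. -/
def A (y : ℝ) : ℝ :=
  √2 / (4 * Real.cosh y) * (3 * y * Real.tanh y + Real.sinh y ^ 2 - 2)

/-- `D⁰ = (L₊⁰)⁻¹ Q^{2σ+1}`, in explicit form. -/
def D0 (σ : ℝ) (y : ℝ) : ℝ :=
  -deriv Q y * (∫ z in (0 : ℝ)..y, A z * Q z ^ (2 * σ + 1))
    + A y * (Q y ^ (2 * σ + 2) / (2 * σ + 2))

def T1 (σ : ℝ) (y : ℝ) : ℝ :=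
  -((σ - 1) ^ 2 / (2 * (σ + 1))) * ∫ z, |y - z| * Q z ^ (2 * σ)

def T2 (σ : ℝ) (y : ℝ) : ℝ :=
  -(√2 * σ * (σ - 1) / (4 * (σ + 1))) * ∫ z, Real.exp (-√2 * |y - z|) * Q z ^ (2 * σ)

def Delta4 (σ : ℝ) (y : ℝ) : ℝ :=
  (13 * Q y ^ 2 - 16) * Q y ^ 2 * D0 σ y - 8 * deriv Q y * Q y * deriv (D0 σ) y
    + 2 * Q y * (3 * (1 - Q y ^ 2) ^ 2 - 1) * T1 σ y
    + 6 * Q y * (2 - Q y ^ 2) ^ 2 * T2 σ y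
    + 4 * (2 - 3 * Q y ^ 2) * deriv Q y * deriv (T1 σ) y
    + 4 * (4 - 3 * Q y ^ 2) * deriv Q y * deriv (T2 σ) y
    + 2 * σ ^ 2 * Q y ^ (2 * σ - 1)
    - (4 * (σ + 2) / (σ + 1) + (2 * σ + 1) ^ 2) * Q y ^ (2 * σ + 1)
    + (8 / (σ + 1) + (σ + 1) * (2 * σ + 1)) * Q y ^ (2 * σ + 3)

def Delta5 (σ : ℝ) (y : ℝ) : ℝ :=
  (2 - 30 * Q y ^ 2 + 29 * Q y ^ 4 - 8 * Q y ^ 6) * D0 σ y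
    - 8 * Q y ^ 3 * deriv Q y * deriv (D0 σ) y
    + 2 * Q y * (2 - Q y ^ 2) * (2 - 3 * Q y ^ 2) * T1 σ y
    + 2 * Q y * (3 * Q y ^ 4 - 10 * Q y ^ 2 + 12) * T2 σ y
    + 16 * (1 - Q y ^ 2) * deriv Q y * deriv (T1 σ) y
    + 8 * (2 - Q y ^ 2) * deriv Q y * deriv (T2 σ) y
    + 2 * σ * (σ + 1) * Q y ^ (2 * σ - 1)
    - (16 / (σ + 1) + 2 * σ + (2 * σ + 1) ^ 2) * Q y ^ (2 * σ + 1)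
    + (4 * (4 - σ) / (σ + 1) + (σ + 1) * (2 * σ + 1)) * Q y ^ (2 * σ + 3)
    - 4 / (σ + 1) * Q y ^ (2 * σ + 5)

/-- The integrand `Q² Δ₄⁰ cos y + (2Q'/Q) Δ₅⁰ sin y` of `Γ₀(σ)`. -/
def Gamma0Integrand (σ : ℝ) (y : ℝ) : ℝ :=
  Q y ^ 2 * Delta4 σ y * Real.cos y + 2 * deriv Q y / Q y * Delta5 σ y * Real.sin y

/-- `Γ₀(σ)`. -/
def Gamma0 (σ : ℝ) : ℝ := ∫ y, Gamma0Integrand σ y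

end

end FermiRule

/-!
Everything depends on `a` and `ω` through `ε = a ω^(σ-1)` alone, and `Γ` is expanded up to `O(ε²)`
at `ε = 0`.

*Exact reduction.* Write `u = R²`, `w = ε R^(2σ)`, `x = ε R^(2σ-2)`, `p = R'/R`. The soliton equation
and its first integral make derivatives of these quantities polynomial in them, and the systems
`M₊ f₁ = μ f₂`, `M₋ f₂ = μ f₁` express `(S*)² f₁` and `μ⁻¹ L₊ (S*)² f₁` through `f₁`, `f₂`, `f₁'`,
`f₂'` (`modeOne`, `modeTwo`); moreover `L₊ V₁ = μ V₂` and `L₋ V₂ = μ V₁`. Since the modes belong to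
the different eigenvalues `λ` and `2λ`, `⟨V₂, g₁⟩ = ⟨V₁, g₂⟩ = 0`, so the projections in `G₁^⊤`,
`G₂^⊥` do not contribute. Replacing `g₂` by `(2λ)⁻¹ L₊ g₁` and integrating by parts, and subtracting
a multiple of `R g₁`, which is a total derivative, gives `Γ = ∫ R ψ g₁` with an explicit `ψ`
(`integral_fermiIntegrand`).

*Cancellation.* As `ε → 0`, `R → Q`, `W₁, W₂ → 1`, `V₁ → 1 - Q²`, `V₂ → 1`, and `ψ → 0`. Hence only the
limit `g₁⁰ = Q² cos y + 2 (Q'/Q) sin y` of `g₁` and the first order term `ψ₁` of `ψ` are needed: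
`Γ = ε ∫ Q ψ₁ g₁⁰ + O(ε²)` (`Expands.psi`, `exists_fermiGamma_bound`). The function `ψ₁` is built
from `D⁰`, `T₁⁰`, `T₂⁰`, the first order terms of `R`, `(W₁ + W₂)/2`, `(W₁ - W₂)/2`. Finally
`Q ψ₁ g₁⁰` differs from the integrand of `Γ₀(σ)` by the derivative of `Q (P cos y + N sin y)`
with `P` and `N` of polynomial growth (`hasDerivAt_primitive`, `integral_psiLimit`).

*A priori estimates.* The reciprocal `v = 1/R` solves `v'' = v + ε (σ-1)/(σ+1) v^(1-2σ)`; Duhamel's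
formula gives `R ≤ Q` and the expansion of `R` relative to `Q` (`exists_recip_bound_one`). For
`s = (W₁ + W₂)/2` and `d = (W₁ - W₂)/2` the system reads `s'' = α² s + F`, `d'' = (2 - α²) d + G`
with `F`, `G` of size `ε R^(2σ)`, and the normalization is `∫ F = -2α`. So `s` is the potential of
`F` for the kernel `-e^{-α|y-z|}/(2α)`, equivalently `1` plus the integral of `F` against
`(1 - e^{-α|y-z|})/(2α)`, a kernel that converges to `|y-z|/2` (`exists_mode_expansion`). For the
radiation mode `s'' = -k² s + F` with `k² = 1 - 2α²`, and `s = -cos(k y) + O(ε)`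
(`exists_radiation_bound`). All estimates allow polynomial weights in `y`, which the factor `R ≤ Q`
absorbs.

*Existence.* Soliton, internal mode and radiation mode are fixed points of contractions given by the
same integral formulas (`exists_soliton`, `exists_modePair`, `exists_radiationPair`). In the internal
mode the rate `α = -½ ∫ F` is itself a function of the unknowns; it is positive because
`a⁺ + a⁻` has negative integral.
-/

namespace FermiRule

open MeasureTheory Set Filter Topology

/-! ### Linear second order equations on the line -/

/-- Duhamel's formula for `u'' = m u + F`, in terms of the fundamental solutions
`C` (`C(0) = 1`, `C'(0) = 0`) and `S` (`S(0) = 0`, `S'(0) = 1`) of `u'' = m u`. -/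
theorem duhamel {m : ℝ} {C S : ℝ → ℝ} (hC : ∀ t, HasDerivAt C (m * S t) t)
    (hS : ∀ t, HasDerivAt S (C t) t) (C0 : C 0 = 1) (S0 : S 0 = 0) {u u' F : ℝ → ℝ}
    (hu : ∀ y, HasDerivAt u (u' y) y) (hu' : ∀ y, HasDerivAt u' (m * u y + F y) y)
    (hF : Continuous F) (y : ℝ) :
    u y = C y * u 0 + S y * u' 0 + ∫ z in (0 : ℝ)..y, S (y - z) * F z ∧
    u' y = m * S y * u 0 + C y * u' 0 + ∫ z in (0 : ℝ)..y, C (y - z) * F z := by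
  have cC : Continuous C := continuous_iff_continuousAt.2 fun t => (hC t).continuousAt
  have cS : Continuous S := continuous_iff_continuousAt.2 fun t => (hS t).continuousAt
  have hsub : ∀ z, HasDerivAt (fun z => y - z) (-1) z := fun z => by
    simpa using (hasDerivAt_id z).const_sub y
  have dS : ∀ z, HasDerivAt (fun z => S (y - z)) (-C (y - z)) z := fun z =>
    ((hS (y - z)).comp z (hsub z)).congr_deriv (by ring)
  have dC : ∀ z, HasDerivAt (fun z => C (y - z)) (-(m * S (y - z))) z := fun z =>
    ((hC (y - z)).comp z (hsub z)).congr_deriv (by ring)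
  constructor
  · have h := intervalIntegral.integral_eq_sub_of_hasDerivAt (a := 0) (b := y)
      (f := fun z => S (y - z) * u' z + C (y - z) * u z) (f' := fun z => S (y - z) * F z)
      (fun z _ => (((dS z).fun_mul (hu' z)).fun_add ((dC z).fun_mul (hu z))).congr_deriv (by ring))
      ((by fun_prop : Continuous fun z => S (y - z) * F z).intervalIntegrable _ _)
    simp only [sub_self, sub_zero, C0, S0] at h
    linarith
  · have h := intervalIntegral.integral_eq_sub_of_hasDerivAt (a := 0) (b := y)
      (f := fun z => C (y - z) * u' z + m * S (y - z) * u z) (f' := fun z => C (y - z) * F z)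
      (fun z _ => (((dC z).fun_mul (hu' z)).fun_add
        (((dS z).const_mul m).fun_mul (hu z))).congr_deriv (by ring))
      ((by fun_prop : Continuous fun z => C (y - z) * F z).intervalIntegrable _ _)
    simp only [sub_self, sub_zero, C0, S0] at h
    linarith

theorem duhamel_hyp {κ : ℝ} (hκ : κ ≠ 0) {u u' F : ℝ → ℝ}
    (hu : ∀ y, HasDerivAt u (u' y) y) (hu' : ∀ y, HasDerivAt u' (κ ^ 2 * u y + F y) y)
    (hF : Continuous F) (y : ℝ) :
    u y = Real.cosh (κ * y) * u 0 + Real.sinh (κ * y) / κ * u' 0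
      + ∫ z in (0 : ℝ)..y, Real.sinh (κ * (y - z)) / κ * F z ∧
    u' y = κ ^ 2 * (Real.sinh (κ * y) / κ) * u 0 + Real.cosh (κ * y) * u' 0
      + ∫ z in (0 : ℝ)..y, Real.cosh (κ * (y - z)) * F z := by
  have hid : ∀ t, HasDerivAt (fun t => κ * t) κ t := fun t => by
    simpa using (hasDerivAt_id t).const_mul κ
  refine duhamel (m := κ ^ 2) (C := fun t => Real.cosh (κ * t))
    (S := fun t => Real.sinh (κ * t) / κ) (fun t => ?_) (fun t => ?_) (by simp) (by simp)
    hu hu' hF y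
  · exact ((Real.hasDerivAt_cosh (κ * t)).comp t (hid t)).congr_deriv (by field_simp)
  · exact (((Real.hasDerivAt_sinh (κ * t)).comp t (hid t)).div_const κ).congr_deriv
      (by field_simp)

theorem duhamel_trig {k : ℝ} (hk : k ≠ 0) {u u' F : ℝ → ℝ}
    (hu : ∀ y, HasDerivAt u (u' y) y) (hu' : ∀ y, HasDerivAt u' (-k ^ 2 * u y + F y) y)
    (hF : Continuous F) (y : ℝ) :
    u y = Real.cos (k * y) * u 0 + Real.sin (k * y) / k * u' 0
      + ∫ z in (0 : ℝ)..y, Real.sin (k * (y - z)) / k * F z ∧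
    u' y = -k ^ 2 * (Real.sin (k * y) / k) * u 0 + Real.cos (k * y) * u' 0
      + ∫ z in (0 : ℝ)..y, Real.cos (k * (y - z)) * F z := by
  have hid : ∀ t, HasDerivAt (fun t => k * t) k t := fun t => by
    simpa using (hasDerivAt_id t).const_mul k
  refine duhamel (m := -k ^ 2) (C := fun t => Real.cos (k * t))
    (S := fun t => Real.sin (k * t) / k) (fun t => ?_) (fun t => ?_) (by simp) (by simp)
    hu hu' hF y
  · exact ((Real.hasDerivAt_cos (k * t)).comp t (hid t)).congr_deriv (by field_simp)
  · exact (((Real.hasDerivAt_sin (k * t)).comp t (hid t)).div_const k).congr_deriv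
      (by field_simp)

/-- A bounded solution of `e'' = κ² e` on the whole line vanishes. -/
theorem eq_zero_of_bounded {κ : ℝ} (hκ : 0 < κ) {e e' : ℝ → ℝ}
    (he : ∀ y, HasDerivAt e (e' y) y) (he' : ∀ y, HasDerivAt e' (κ ^ 2 * e y) y)
    {M : ℝ} (hM : ∀ y, |e y| ≤ M) (y : ℝ) : e y = 0 ∧ e' y = 0 := by
  have hD := fun y => duhamel_hyp hκ.ne' (F := fun _ => 0) he (by simpa using he')
    continuous_const y
  simp only [mul_zero, intervalIntegral.integral_zero, add_zero] at hD
  have key : ∀ A B : ℝ, (∀ t, 0 ≤ t → |A * Real.exp t + B * Real.exp (-t)| ≤ M) → A = 0 := by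
    intro A B h
    by_contra hA
    have hA' : 0 < |A| := abs_pos.2 hA
    have hM0 : 0 ≤ M := (abs_nonneg _).trans (hM 0)
    have ht : 0 ≤ (M + |B|) / |A| := by positivity
    have h1 := h _ ht
    set t := (M + |B|) / |A| with htd
    have h2 : |A| * Real.exp t ≤ M + |B| := by
      have : |A * Real.exp t| ≤ |A * Real.exp t + B * Real.exp (-t)| + |B * Real.exp (-t)| := by
        have := abs_sub (A * Real.exp t + B * Real.exp (-t)) (B * Real.exp (-t))
        simpa using this
      rw [abs_mul, abs_of_pos (Real.exp_pos t), abs_mul, abs_of_pos (Real.exp_pos (-t))] at this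
      have h3 : |B| * Real.exp (-t) ≤ |B| * 1 := by
        gcongr
        exact Real.exp_le_one_iff.2 (by linarith)
      linarith
    have h3 : |A| * (t + 1) ≤ |A| * Real.exp t := by
      gcongr
      exact Real.add_one_le_exp t
    have h4 : |A| * t = M + |B| := by
      rw [htd]; field_simp
    nlinarith
  have hform : ∀ y, e y = (e 0 + e' 0 / κ) / 2 * Real.exp (κ * y)
      + (e 0 - e' 0 / κ) / 2 * Real.exp (-(κ * y)) := by
    intro y
    rw [(hD y).1, Real.cosh_eq, Real.sinh_eq]
    field_simp
    ring
  have h1 : (e 0 + e' 0 / κ) / 2 = 0 := by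
    apply key _ ((e 0 - e' 0 / κ) / 2)
    intro t _
    have := hM (t / κ)
    rwa [hform, mul_div_cancel₀ _ hκ.ne'] at this
  have h2 : (e 0 - e' 0 / κ) / 2 = 0 := by
    apply key _ ((e 0 + e' 0 / κ) / 2)
    intro t _
    have := hM (-t / κ)
    rw [hform, mul_div_cancel₀ _ hκ.ne', neg_neg] at this
    rwa [add_comm]
  have h3 : e 0 = 0 := by linarith
  have h4 : e' 0 = 0 := by
    have : e' 0 / κ = 0 := by linarith
    simpa [hκ.ne'] using this
  rw [(hD y).1, (hD y).2, h3, h4]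
  simp

/-! ### Green's function of `-∂² + κ²` -/

theorem hasDerivAt_integral_Iic {f : ℝ → ℝ} (hf : Continuous f)
    (hi : ∀ b, IntegrableOn f (Iic b)) (y : ℝ) :
    HasDerivAt (fun y => ∫ z in Iic y, f z) (f y) y := by
  have h1 : (fun y => ∫ z in Iic y, f z)
      = fun y => (∫ z in Iic (0 : ℝ), f z) + ∫ z in (0 : ℝ)..y, f z := by
    funext y
    rw [← intervalIntegral.integral_Iic_sub_Iic (hi 0) (hi y)]; ring
  rw [h1]
  exact (intervalIntegral.integral_hasDerivAt_right (hf.intervalIntegrable _ _)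
    hf.aestronglyMeasurable.stronglyMeasurableAtFilter hf.continuousAt).const_add _

theorem hasDerivAt_integral_Ioi {f : ℝ → ℝ} (hf : Continuous f)
    (hi : ∀ b, IntegrableOn f (Ioi b)) (y : ℝ) :
    HasDerivAt (fun y => ∫ z in Ioi y, f z) (-f y) y := by
  have h1 : (fun y => ∫ z in Ioi y, f z)
      = fun y => (∫ z in Ioi (0 : ℝ), f z) - ∫ z in (0 : ℝ)..y, f z := by
    funext y
    rw [← intervalIntegral.integral_Ioi_sub_Ioi' (hi 0) (hi y)]; ring
  rw [h1]
  exact (intervalIntegral.integral_hasDerivAt_right (hf.intervalIntegrable _ _)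
    hf.aestronglyMeasurable.stronglyMeasurableAtFilter hf.continuousAt).const_sub _

/-- `∫_{z < y} e^{-κ(y-z)} f(z) dz`. -/
noncomputable def leftConv (κ : ℝ) (f : ℝ → ℝ) (y : ℝ) : ℝ :=
  ∫ z in Iic y, Real.exp (-κ * (y - z)) * f z

/-- `∫_{z > y} e^{-κ(z-y)} f(z) dz`. -/
noncomputable def rightConv (κ : ℝ) (f : ℝ → ℝ) (y : ℝ) : ℝ :=
  ∫ z in Ioi y, Real.exp (-κ * (z - y)) * f z

/-- The solution `-(1/2κ) ∫ e^{-κ|y-z|} f(z) dz` of `u'' = κ² u + f`. -/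
noncomputable def green (κ : ℝ) (f : ℝ → ℝ) (y : ℝ) : ℝ :=
  -(1 / (2 * κ)) * (leftConv κ f y + rightConv κ f y)

/-- The derivative of `green κ f`. -/
noncomputable def greenDeriv (κ : ℝ) (f : ℝ → ℝ) (y : ℝ) : ℝ :=
  (1 / 2) * (leftConv κ f y - rightConv κ f y)

section Green
variable {κ B : ℝ} {f : ℝ → ℝ}

theorem exp_kernel_integrableOn_Iic (hκ : 0 < κ) (y b : ℝ) :
    IntegrableOn (fun z => Real.exp (-κ * (y - z))) (Iic b) := by
  have h := (integrableOn_exp_mul_Iic hκ b).const_mul (Real.exp (-κ * y))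
  refine IntegrableOn.congr_fun h (fun z _ => ?_) measurableSet_Iic
  simp only [← Real.exp_add]; congr 1; ring

theorem exp_kernel_integrableOn_Ioi (hκ : 0 < κ) (y b : ℝ) :
    IntegrableOn (fun z => Real.exp (-κ * (z - y))) (Ioi b) := by
  have h := (integrableOn_exp_mul_Ioi (a := -κ) (by linarith) b).const_mul (Real.exp (κ * y))
  refine IntegrableOn.congr_fun h (fun z _ => ?_) measurableSet_Ioi
  simp only [← Real.exp_add]; congr 1; ring

theorem left_kernel_integrable (hκ : 0 < κ) (hf : Continuous f) (hB : ∀ z, |f z| ≤ B) (y b : ℝ) :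
    IntegrableOn (fun z => Real.exp (-κ * (y - z)) * f z) (Iic b) :=
  (exp_kernel_integrableOn_Iic hκ y b).mul_bdd (c := B) hf.aestronglyMeasurable.restrict
    (ae_of_all _ hB)

theorem right_kernel_integrable (hκ : 0 < κ) (hf : Continuous f) (hB : ∀ z, |f z| ≤ B) (y b : ℝ) :
    IntegrableOn (fun z => Real.exp (-κ * (z - y)) * f z) (Ioi b) :=
  (exp_kernel_integrableOn_Ioi hκ y b).mul_bdd (c := B) hf.aestronglyMeasurable.restrict
    (ae_of_all _ hB)

theorem hasDerivAt_leftConv (hκ : 0 < κ) (hf : Continuous f) (hB : ∀ z, |f z| ≤ B) (y : ℝ) :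
    HasDerivAt (leftConv κ f) (f y - κ * leftConv κ f y) y := by
  have h1 : leftConv κ f = fun y => Real.exp (-κ * y) * ∫ z in Iic y, Real.exp (κ * z) * f z := by
    funext y
    rw [leftConv, ← integral_const_mul]
    congr 1; funext z
    rw [← mul_assoc, ← Real.exp_add]; congr 2; ring
  have hi : ∀ b, IntegrableOn (fun z => Real.exp (κ * z) * f z) (Iic b) := fun b => by
    simpa using left_kernel_integrable hκ hf hB 0 b
  have h2 := hasDerivAt_integral_Iic (f := fun z => Real.exp (κ * z) * f z) (by fun_prop) hi y
  have h3 : HasDerivAt (fun y => Real.exp (-κ * y)) (-κ * Real.exp (-κ * y)) y := by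
    have := ((hasDerivAt_id y).const_mul (-κ)).exp
    simpa [mul_comm] using this
  have h4 := h3.fun_mul h2
  rw [h1]
  refine h4.congr_deriv ?_
  have : Real.exp (-κ * y) * (Real.exp (κ * y) * f y) = f y := by
    rw [← mul_assoc, ← Real.exp_add]; simp
  rw [this]; ring

theorem hasDerivAt_rightConv (hκ : 0 < κ) (hf : Continuous f) (hB : ∀ z, |f z| ≤ B) (y : ℝ) :
    HasDerivAt (rightConv κ f) (κ * rightConv κ f y - f y) y := by
  have h1 : rightConv κ f = fun y => Real.exp (κ * y) * ∫ z in Ioi y, Real.exp (-κ * z) * f z := by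
    funext y
    rw [rightConv, ← integral_const_mul]
    congr 1; funext z
    rw [← mul_assoc, ← Real.exp_add]; congr 2; ring
  have hi : ∀ b, IntegrableOn (fun z => Real.exp (-κ * z) * f z) (Ioi b) := fun b => by
    simpa using right_kernel_integrable hκ hf hB 0 b
  have h2 := hasDerivAt_integral_Ioi (f := fun z => Real.exp (-κ * z) * f z) (by fun_prop) hi y
  have h3 : HasDerivAt (fun y => Real.exp (κ * y)) (κ * Real.exp (κ * y)) y := by
    have := ((hasDerivAt_id y).const_mul κ).exp
    simpa [mul_comm] using this
  have h4 := h3.fun_mul h2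
  rw [h1]
  refine h4.congr_deriv ?_
  have : Real.exp (κ * y) * (Real.exp (-κ * y) * f y) = f y := by
    rw [← mul_assoc, ← Real.exp_add]; simp
  rw [mul_neg, this]; ring

theorem hasDerivAt_green (hκ : 0 < κ) (hf : Continuous f) (hB : ∀ z, |f z| ≤ B) (y : ℝ) :
    HasDerivAt (green κ f) (greenDeriv κ f y) y := by
  have h := ((hasDerivAt_leftConv hκ hf hB y).add (hasDerivAt_rightConv hκ hf hB y)).const_mul
    (-(1 / (2 * κ)))
  refine h.congr_deriv ?_
  rw [greenDeriv]; field_simp; ring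

theorem hasDerivAt_greenDeriv (hκ : 0 < κ) (hf : Continuous f) (hB : ∀ z, |f z| ≤ B) (y : ℝ) :
    HasDerivAt (greenDeriv κ f) (κ ^ 2 * green κ f y + f y) y := by
  have h := ((hasDerivAt_leftConv hκ hf hB y).sub (hasDerivAt_rightConv hκ hf hB y)).const_mul
    (1 / 2)
  refine h.congr_deriv ?_
  rw [green]; field_simp; ring

theorem leftConv_kernel_integral (hκ : 0 < κ) (y : ℝ) :
    ∫ z in Iic y, Real.exp (-κ * (y - z)) = 1 / κ := by
  have : (fun z => Real.exp (-κ * (y - z))) = fun z => Real.exp (-κ * y) * Real.exp (κ * z) := by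
    funext z; rw [← Real.exp_add]; congr 1; ring
  rw [this, integral_const_mul, integral_exp_mul_Iic hκ, mul_div_assoc', ← Real.exp_add]
  simp

theorem rightConv_kernel_integral (hκ : 0 < κ) (y : ℝ) :
    ∫ z in Ioi y, Real.exp (-κ * (z - y)) = 1 / κ := by
  have : (fun z => Real.exp (-κ * (z - y))) = fun z => Real.exp (κ * y) * Real.exp (-κ * z) := by
    funext z; rw [← Real.exp_add]; congr 1; ring
  rw [this, integral_const_mul, integral_exp_mul_Ioi (by linarith), mul_div_assoc', mul_neg,
    ← Real.exp_add]
  simp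

theorem abs_leftConv_le (hκ : 0 < κ) (hB : ∀ z, |f z| ≤ B) (y : ℝ) :
    |leftConv κ f y| ≤ B / κ := by
  have h := norm_integral_le_of_norm_le (μ := volume.restrict (Iic y))
    (f := fun z => Real.exp (-κ * (y - z)) * f z)
    ((exp_kernel_integrableOn_Iic hκ y y).mul_const B) (ae_of_all _ fun z => by
      rw [Real.norm_eq_abs, abs_mul, abs_of_pos (Real.exp_pos _)]
      gcongr
      exact hB z)
  rw [integral_mul_const, leftConv_kernel_integral hκ] at h
  rw [div_eq_mul_one_div, mul_comm]
  exact h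

theorem abs_rightConv_le (hκ : 0 < κ) (hB : ∀ z, |f z| ≤ B) (y : ℝ) :
    |rightConv κ f y| ≤ B / κ := by
  have h := norm_integral_le_of_norm_le (μ := volume.restrict (Ioi y))
    (f := fun z => Real.exp (-κ * (z - y)) * f z)
    ((exp_kernel_integrableOn_Ioi hκ y y).mul_const B) (ae_of_all _ fun z => by
      rw [Real.norm_eq_abs, abs_mul, abs_of_pos (Real.exp_pos _)]
      gcongr
      exact hB z)
  rw [integral_mul_const, rightConv_kernel_integral hκ] at h
  rw [div_eq_mul_one_div, mul_comm]
  exact h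

theorem abs_green_le (hκ : 0 < κ) (hB : ∀ z, |f z| ≤ B) (y : ℝ) :
    |green κ f y| ≤ B / κ ^ 2 := by
  rw [green, abs_mul, abs_neg, abs_of_pos (by positivity)]
  have h1 := abs_leftConv_le hκ hB y
  have h2 := abs_rightConv_le hκ hB y
  have h3 := abs_add_le (leftConv κ f y) (rightConv κ f y)
  calc 1 / (2 * κ) * |leftConv κ f y + rightConv κ f y| ≤ 1 / (2 * κ) * (B / κ + B / κ) := by
        gcongr; linarith
    _ = B / κ ^ 2 := by field_simp; ring

theorem abs_greenDeriv_le (hκ : 0 < κ) (hB : ∀ z, |f z| ≤ B) (y : ℝ) :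
    |greenDeriv κ f y| ≤ B / κ := by
  rw [greenDeriv, abs_mul, abs_of_pos (by norm_num : (0:ℝ) < 1 / 2)]
  have h1 := abs_leftConv_le hκ hB y
  have h2 := abs_rightConv_le hκ hB y
  have h3 := abs_sub (leftConv κ f y) (rightConv κ f y)
  linarith

theorem continuous_of_hasDerivAt {u u' : ℝ → ℝ} (h : ∀ y, HasDerivAt u (u' y) y) :
    Continuous u := continuous_iff_continuousAt.2 fun y => (h y).continuousAt

/-- The bounded solution of `u'' = κ² u + f` with bounded `f` is `green κ f`. -/
theorem eq_green (hκ : 0 < κ) (hf : Continuous f) (hB : ∀ z, |f z| ≤ B) {u u' : ℝ → ℝ}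
    (hu : ∀ y, HasDerivAt u (u' y) y) (hu' : ∀ y, HasDerivAt u' (κ ^ 2 * u y + f y) y)
    {M : ℝ} (hM : ∀ y, |u y| ≤ M) (y : ℝ) : u y = green κ f y ∧ u' y = greenDeriv κ f y := by
  have h := eq_zero_of_bounded hκ (e := fun y => u y - green κ f y)
    (e' := fun y => u' y - greenDeriv κ f y)
    (fun y => (hu y).sub (hasDerivAt_green hκ hf hB y))
    (fun y => ((hu' y).fun_sub (hasDerivAt_greenDeriv hκ hf hB y)).congr_deriv (by ring))
    (M := M + B / κ ^ 2) (fun y => (abs_sub _ _).trans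
      (add_le_add (hM y) (abs_green_le hκ hB y))) y
  exact ⟨by linarith [h.1], by linarith [h.2]⟩

theorem leftConv_add_rightConv (hκ : 0 ≤ κ) (hf : Integrable f) (y : ℝ) :
    leftConv κ f y + rightConv κ f y = ∫ z, Real.exp (-κ * |y - z|) * f z := by
  have hi : Integrable fun z => Real.exp (-κ * |y - z|) * f z := by
    refine hf.bdd_mul (c := 1) (by fun_prop) (ae_of_all _ fun z => ?_)
    rw [Real.norm_eq_abs, abs_of_pos (Real.exp_pos _)]
    exact Real.exp_le_one_iff.2 (by nlinarith [abs_nonneg (y - z)])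
  rw [← intervalIntegral.integral_Iic_add_Ioi (b := y) hi.integrableOn hi.integrableOn]
  congr 1
  · refine setIntegral_congr_fun measurableSet_Iic fun z hz => ?_
    have : |y - z| = y - z := abs_of_nonneg (sub_nonneg.2 hz)
    simp only [this]
  · refine setIntegral_congr_fun measurableSet_Ioi fun z hz => ?_
    have : |y - z| = z - y := by
      rw [abs_sub_comm]; exact abs_of_pos (sub_pos.2 hz)
    simp only [this]

theorem green_eq_integral (hκ : 0 ≤ κ) (hf : Integrable f) (y : ℝ) :
    green κ f y = -(1 / (2 * κ)) * ∫ z, Real.exp (-κ * |y - z|) * f z := by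
  rw [green, leftConv_add_rightConv hκ hf]

end Green

/-! ### Polynomial weights against exponential decay -/

theorem one_le_weight (k : ℕ) (y : ℝ) : 1 ≤ (1 + |y|) ^ k :=
  one_le_pow₀ (by linarith [abs_nonneg y])

theorem weight_mono {k l : ℕ} (h : k ≤ l) (y : ℝ) : (1 + |y|) ^ k ≤ (1 + |y|) ^ l :=
  pow_le_pow_right₀ (by linarith [abs_nonneg y]) h

theorem integrable_exp_neg_mul_abs {c : ℝ} (hc : 0 < c) :
    Integrable fun y : ℝ => Real.exp (-c * |y|) := by
  rw [← integrableOn_univ, ← Iic_union_Ioi (a := (0 : ℝ))]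
  refine IntegrableOn.union ?_ ?_
  · refine IntegrableOn.congr_fun (integrableOn_exp_mul_Iic hc 0) (fun z hz => ?_)
      measurableSet_Iic
    have : |z| = -z := abs_of_nonpos hz
    simp only [this]; congr 1; ring
  · refine IntegrableOn.congr_fun (integrableOn_exp_mul_Ioi (a := -c) (by linarith) 0)
      (fun z hz => ?_) measurableSet_Ioi
    have : |z| = z := abs_of_pos hz
    simp only [this]

theorem exists_weight_mul_exp_le {c : ℝ} (hc : 0 < c) (k : ℕ) : ∃ C : ℝ, 0 < C ∧
    ∀ y : ℝ, (1 + |y|) ^ k * Real.exp (-c * |y|) ≤ C * Real.exp (-(c / 2) * |y|) := by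
  refine ⟨(k.factorial : ℝ) / (c / 2) ^ k * Real.exp (c / 2), by positivity, fun y => ?_⟩
  have h := Real.pow_div_factorial_le_exp (c / 2 * (1 + |y|)) (by positivity) k
  have h1 : (1 + |y|) ^ k ≤ (k.factorial : ℝ) / (c / 2) ^ k * Real.exp (c / 2 * (1 + |y|)) := by
    rw [mul_pow, div_le_iff₀ (by positivity)] at h
    rw [div_mul_eq_mul_div, le_div_iff₀ (by positivity)]
    linarith
  calc (1 + |y|) ^ k * Real.exp (-c * |y|)
      ≤ (k.factorial : ℝ) / (c / 2) ^ k * Real.exp (c / 2 * (1 + |y|)) * Real.exp (-c * |y|) := by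
        gcongr
    _ = _ := by
        rw [mul_assoc, mul_assoc, ← Real.exp_add, ← Real.exp_add]; congr 2; ring

theorem integrable_weight_mul_exp {c : ℝ} (hc : 0 < c) (k : ℕ) :
    Integrable fun y : ℝ => (1 + |y|) ^ k * Real.exp (-c * |y|) := by
  obtain ⟨C, _, h⟩ := exists_weight_mul_exp_le hc k
  refine ((integrable_exp_neg_mul_abs (half_pos hc)).const_mul C).mono'
    (by fun_prop) (ae_of_all _ fun y => ?_)
  rw [Real.norm_eq_abs, abs_of_nonneg (by positivity)]
  exact h y

theorem tendsto_exp_neg_mul_abs {c : ℝ} (hc : 0 < c) {l : Filter ℝ}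
    (hl : Tendsto (fun y : ℝ => |y|) l atTop) :
    Tendsto (fun y : ℝ => Real.exp (-c * |y|)) l (𝓝 0) := by
  refine Real.tendsto_exp_atBot.comp ?_
  exact (tendsto_const_mul_atBot_of_neg (by linarith)).2 hl

theorem tendsto_zero_of_le_weight {c C : ℝ} (hc : 0 < c) {k : ℕ} {f : ℝ → ℝ}
    (hf : ∀ y, |f y| ≤ C * ((1 + |y|) ^ k * Real.exp (-c * |y|))) {l : Filter ℝ}
    (hl : Tendsto (fun y : ℝ => |y|) l atTop) : Tendsto f l (𝓝 0) := by
  obtain ⟨C', hC', h⟩ := exists_weight_mul_exp_le hc k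
  have h2 := (tendsto_exp_neg_mul_abs (half_pos hc) hl).const_mul (|C| * C')
  rw [mul_zero] at h2
  refine squeeze_zero_norm (fun y => ?_) h2
  calc ‖f y‖ ≤ C * ((1 + |y|) ^ k * Real.exp (-c * |y|)) := hf y
    _ ≤ |C| * ((1 + |y|) ^ k * Real.exp (-c * |y|)) := by gcongr; exact le_abs_self C
    _ ≤ |C| * (C' * Real.exp (-(c / 2) * |y|)) := by gcongr |C| * ?_; exact h y
    _ = _ := by ring

/-! ### First order expansions with polynomial growth -/

section Expansion
variable {ι : Type*}

/-- A family of functions with a common polynomial bound. -/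
def UnifPoly (F : ι → ℝ → ℝ) : Prop :=
  ∃ C : ℝ, ∃ k : ℕ, 0 ≤ C ∧ ∀ i y, |F i y| ≤ C * (1 + |y|) ^ k

theorem UnifPoly.add {F G : ι → ℝ → ℝ} (hF : UnifPoly F) (hG : UnifPoly G) :
    UnifPoly fun i y => F i y + G i y := by
  obtain ⟨C, k, hC, h⟩ := hF
  obtain ⟨C', k', hC', h'⟩ := hG
  refine ⟨C + C', max k k', by positivity, fun i y => ?_⟩
  calc |F i y + G i y| ≤ |F i y| + |G i y| := abs_add_le _ _
    _ ≤ C * (1 + |y|) ^ k + C' * (1 + |y|) ^ k' := add_le_add (h i y) (h' i y)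
    _ ≤ C * (1 + |y|) ^ (max k k') + C' * (1 + |y|) ^ (max k k') := by
        gcongr C * ?_ + C' * ?_
        · exact weight_mono (le_max_left _ _) y
        · exact weight_mono (le_max_right _ _) y
    _ = _ := by ring

theorem UnifPoly.mul {F G : ι → ℝ → ℝ} (hF : UnifPoly F) (hG : UnifPoly G) :
    UnifPoly fun i y => F i y * G i y := by
  obtain ⟨C, k, hC, h⟩ := hF
  obtain ⟨C', k', hC', h'⟩ := hG
  refine ⟨C * C', k + k', by positivity, fun i y => ?_⟩
  rw [abs_mul]
  calc |F i y| * |G i y| ≤ (C * (1 + |y|) ^ k) * (C' * (1 + |y|) ^ k') :=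
        mul_le_mul (h i y) (h' i y) (abs_nonneg _) (by positivity)
    _ = _ := by ring

theorem UnifPoly.of_bound {F : ι → ℝ → ℝ} {C : ℝ} (h : ∀ i y, |F i y| ≤ C) : UnifPoly F :=
  ⟨|C|, 0, abs_nonneg C, fun i y => by simpa using (h i y).trans (le_abs_self C)⟩

theorem UnifPoly.const (c : ℝ) : UnifPoly fun (_ : ι) (_ : ℝ) => c :=
  UnifPoly.of_bound fun _ _ => le_rfl

theorem UnifPoly.neg {F : ι → ℝ → ℝ} (hF : UnifPoly F) : UnifPoly fun i y => -F i y := by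
  obtain ⟨C, k, hC, h⟩ := hF
  exact ⟨C, k, hC, fun i y => by rw [abs_neg]; exact h i y⟩

theorem UnifPoly.sub {F G : ι → ℝ → ℝ} (hF : UnifPoly F) (hG : UnifPoly G) :
    UnifPoly fun i y => F i y - G i y := by
  simpa only [sub_eq_add_neg] using hF.add hG.neg

variable {e : ι → ℝ}

/-- `F = F₀ + e F₁ + O(e²)`, with all terms of polynomial growth, uniformly in the family. -/
def Expands (e : ι → ℝ) (F : ι → ℝ → ℝ) (F₀ F₁ : ℝ → ℝ) : Prop :=
  UnifPoly (fun _ : ι => F₀) ∧ UnifPoly (fun _ : ι => F₁) ∧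
    ∃ r : ι → ℝ → ℝ, UnifPoly r ∧ ∀ i y, F i y = F₀ y + e i * F₁ y + e i ^ 2 * r i y

/-- `F = F₀ + O(e)`, with all terms of polynomial growth, uniformly in the family. -/
def Approx (e : ι → ℝ) (F : ι → ℝ → ℝ) (F₀ : ℝ → ℝ) : Prop :=
  UnifPoly (fun _ : ι => F₀) ∧
    ∃ r : ι → ℝ → ℝ, UnifPoly r ∧ ∀ i y, F i y = F₀ y + e i * r i y

theorem UnifPoly.param (he : ∀ i, 0 < e i ∧ e i ≤ 1) : UnifPoly fun i (_ : ℝ) => e i :=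
  UnifPoly.of_bound (C := 1) fun i _ => by rw [abs_of_pos (he i).1]; exact (he i).2

theorem Expands.congr {F : ι → ℝ → ℝ} {F₀ F₁ G₀ G₁ : ℝ → ℝ} (h : Expands e F F₀ F₁)
    (h₀ : ∀ y, F₀ y = G₀ y) (h₁ : ∀ y, F₁ y = G₁ y) : Expands e F G₀ G₁ := by
  rwa [← funext h₀, ← funext h₁]

theorem Approx.congr {F : ι → ℝ → ℝ} {F₀ G₀ : ℝ → ℝ} (h : Approx e F F₀)
    (h₀ : ∀ y, F₀ y = G₀ y) : Approx e F G₀ := by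
  rwa [← funext h₀]

theorem Expands.const (c : ℝ) :
    Expands e (fun _ _ => c) (fun _ => c) (fun _ => 0) :=
  ⟨UnifPoly.const c, UnifPoly.const 0, fun _ _ => 0, UnifPoly.const 0, fun i y => by ring⟩

theorem Expands.add {F G : ι → ℝ → ℝ} {F₀ F₁ G₀ G₁ : ℝ → ℝ} (hF : Expands e F F₀ F₁)
    (hG : Expands e G G₀ G₁) :
    Expands e (fun i y => F i y + G i y) (fun y => F₀ y + G₀ y) (fun y => F₁ y + G₁ y) := by
  obtain ⟨a0, a1, r, hr, h⟩ := hF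
  obtain ⟨b0, b1, r', hr', h'⟩ := hG
  exact ⟨a0.add b0, a1.add b1, _, hr.add hr', fun i y => by simp only [h, h']; ring⟩

theorem Expands.neg {F : ι → ℝ → ℝ} {F₀ F₁ : ℝ → ℝ} (hF : Expands e F F₀ F₁) :
    Expands e (fun i y => -F i y) (fun y => -F₀ y) (fun y => -F₁ y) := by
  obtain ⟨a0, a1, r, hr, h⟩ := hF
  exact ⟨a0.neg, a1.neg, _, hr.neg, fun i y => by simp only [h]; ring⟩

theorem Expands.sub {F G : ι → ℝ → ℝ} {F₀ F₁ G₀ G₁ : ℝ → ℝ} (hF : Expands e F F₀ F₁)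
    (hG : Expands e G G₀ G₁) :
    Expands e (fun i y => F i y - G i y) (fun y => F₀ y - G₀ y) (fun y => F₁ y - G₁ y) := by
  simpa only [sub_eq_add_neg] using hF.add hG.neg

theorem Expands.mul (he : ∀ i, 0 < e i ∧ e i ≤ 1) {F G : ι → ℝ → ℝ} {F₀ F₁ G₀ G₁ : ℝ → ℝ}
    (hF : Expands e F F₀ F₁) (hG : Expands e G G₀ G₁) :
    Expands e (fun i y => F i y * G i y) (fun y => F₀ y * G₀ y)
      (fun y => F₀ y * G₁ y + F₁ y * G₀ y) := by
  obtain ⟨a0, a1, r, hr, h⟩ := hF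
  obtain ⟨b0, b1, r', hr', h'⟩ := hG
  have ee := UnifPoly.param (e := e) he
  refine ⟨a0.mul b0, (a0.mul b1).add (a1.mul b0), fun i y => F₀ y * r' i y + F₁ y * G₁ y
    + r i y * G₀ y + e i * (F₁ y * r' i y + r i y * G₁ y) + e i * e i * (r i y * r' i y), ?_, ?_⟩
  · exact ((((a0.mul hr').add (a1.mul b1)).add (hr.mul b0)).add
      (ee.mul ((a1.mul hr').add (hr.mul b1)))).add ((ee.mul ee).mul (hr.mul hr'))
  · intro i y; simp only [h, h']; ring

/-- The expansion of `1 / F` when `F = 1 + O(e)`. -/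
theorem Expands.inv (he : ∀ i, 0 < e i ∧ e i ≤ 1) {F : ι → ℝ → ℝ} {F₁ : ℝ → ℝ}
    (hF : Expands e F (fun _ => 1) F₁) {c : ℝ} (hc : 0 < c) (hpos : ∀ i y, c ≤ F i y) :
    Expands e (fun i y => (F i y)⁻¹) (fun _ => 1) (fun y => -F₁ y) := by
  obtain ⟨a0, a1, r, hr, h⟩ := hF
  have ee := UnifPoly.param (e := e) he
  have hinv : UnifPoly fun i y => (F i y)⁻¹ := UnifPoly.of_bound (C := c⁻¹) fun i y => by
    have := hc.trans_le (hpos i y)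
    rw [abs_of_pos (inv_pos.2 this)]
    exact inv_anti₀ hc (hpos i y)
  refine ⟨a0, a1.neg, fun i y => (-r i y + F₁ y * F₁ y + e i * (F₁ y * r i y)) * (F i y)⁻¹,
    ((hr.neg.add (a1.mul a1)).add (ee.mul (a1.mul hr))).mul hinv, fun i y => ?_⟩
  have hne : F i y ≠ 0 := (hc.trans_le (hpos i y)).ne'
  field_simp
  rw [h]; ring

theorem Expands.approx (he : ∀ i, 0 < e i ∧ e i ≤ 1) {F : ι → ℝ → ℝ} {F₀ F₁ : ℝ → ℝ}
    (hF : Expands e F F₀ F₁) : Approx e F F₀ := by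
  obtain ⟨a0, a1, r, hr, h⟩ := hF
  have ee := UnifPoly.param (e := e) he
  exact ⟨a0, _, a1.add (ee.mul hr), fun i y => by simp only [h]; ring⟩

/-- `e F` has a first order expansion as soon as `F = F₀ + O(e)`. -/
theorem Approx.expands_mul {F : ι → ℝ → ℝ} {F₀ : ℝ → ℝ} (hF : Approx e F F₀) :
    Expands e (fun i y => e i * F i y) (fun _ => 0) F₀ := by
  obtain ⟨a0, r, hr, h⟩ := hF
  exact ⟨UnifPoly.const 0, a0, r, hr, fun i y => by simp only [h]; ring⟩

theorem Approx.add {F G : ι → ℝ → ℝ} {F₀ G₀ : ℝ → ℝ} (hF : Approx e F F₀)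
    (hG : Approx e G G₀) : Approx e (fun i y => F i y + G i y) (fun y => F₀ y + G₀ y) := by
  obtain ⟨a0, r, hr, h⟩ := hF
  obtain ⟨b0, r', hr', h'⟩ := hG
  exact ⟨a0.add b0, _, hr.add hr', fun i y => by simp only [h, h']; ring⟩

theorem Approx.neg {F : ι → ℝ → ℝ} {F₀ : ℝ → ℝ} (hF : Approx e F F₀) :
    Approx e (fun i y => -F i y) (fun y => -F₀ y) := by
  obtain ⟨a0, r, hr, h⟩ := hF
  exact ⟨a0.neg, _, hr.neg, fun i y => by simp only [h]; ring⟩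

theorem Approx.sub {F G : ι → ℝ → ℝ} {F₀ G₀ : ℝ → ℝ} (hF : Approx e F F₀)
    (hG : Approx e G G₀) : Approx e (fun i y => F i y - G i y) (fun y => F₀ y - G₀ y) := by
  simpa only [sub_eq_add_neg] using hF.add hG.neg

theorem Approx.mul (he : ∀ i, 0 < e i ∧ e i ≤ 1) {F G : ι → ℝ → ℝ} {F₀ G₀ : ℝ → ℝ}
    (hF : Approx e F F₀) (hG : Approx e G G₀) :
    Approx e (fun i y => F i y * G i y) (fun y => F₀ y * G₀ y) := by
  obtain ⟨a0, r, hr, h⟩ := hF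
  obtain ⟨b0, r', hr', h'⟩ := hG
  have ee := UnifPoly.param (e := e) he
  exact ⟨a0.mul b0, fun i y => F₀ y * r' i y + r i y * G₀ y + e i * (r i y * r' i y),
    ((a0.mul hr').add (hr.mul b0)).add (ee.mul (hr.mul hr')), fun i y => by simp only [h, h']; ring⟩

theorem Expands.mul_approx (he : ∀ i, 0 < e i ∧ e i ≤ 1) {F G : ι → ℝ → ℝ} {F₁ G₀ : ℝ → ℝ}
    (hF : Expands e F (fun _ => 0) F₁) (hG : Approx e G G₀) :
    Expands e (fun i y => F i y * G i y) (fun _ => 0) (fun y => F₁ y * G₀ y) := by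
  obtain ⟨_, a1, r, hr, h⟩ := hF
  obtain ⟨b0, r', hr', h'⟩ := hG
  have ee := UnifPoly.param (e := e) he
  exact ⟨UnifPoly.const 0, a1.mul b0,
    fun i y => F₁ y * r' i y + r i y * G₀ y + e i * (r i y * r' i y),
    ((a1.mul hr').add (hr.mul b0)).add (ee.mul (hr.mul hr')), fun i y => by simp only [h, h']; ring⟩

theorem Expands.of_bound (he : ∀ i, 0 < e i) {F : ι → ℝ → ℝ} {F₀ F₁ : ℝ → ℝ}
    (h₀ : UnifPoly (fun _ : ι => F₀)) (h₁ : UnifPoly (fun _ : ι => F₁)) {C : ℝ} {k : ℕ}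
    (h : ∀ i y, |F i y - F₀ y - e i * F₁ y| ≤ C * e i ^ 2 * (1 + |y|) ^ k) :
    Expands e F F₀ F₁ := by
  refine ⟨h₀, h₁, fun i y => (F i y - F₀ y - e i * F₁ y) / e i ^ 2,
    ⟨|C|, k, abs_nonneg C, fun i y => ?_⟩, fun i y => ?_⟩
  · have := he i
    rw [abs_div, abs_of_pos (pow_pos this 2), div_le_iff₀ (by positivity)]
    calc _ ≤ C * e i ^ 2 * (1 + |y|) ^ k := h i y
      _ ≤ |C| * e i ^ 2 * (1 + |y|) ^ k := by gcongr; exact le_abs_self C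
      _ = _ := by ring
  · have := (he i).ne'
    field_simp; ring

theorem Approx.of_bound (he : ∀ i, 0 < e i) {F : ι → ℝ → ℝ} {F₀ : ℝ → ℝ}
    (h₀ : UnifPoly (fun _ : ι => F₀)) {C : ℝ} {k : ℕ}
    (h : ∀ i y, |F i y - F₀ y| ≤ C * e i * (1 + |y|) ^ k) : Approx e F F₀ := by
  refine ⟨h₀, fun i y => (F i y - F₀ y) / e i,
    ⟨|C|, k, abs_nonneg C, fun i y => ?_⟩, fun i y => ?_⟩
  · have := he i
    rw [abs_div, abs_of_pos this, div_le_iff₀ (by positivity)]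
    calc _ ≤ C * e i * (1 + |y|) ^ k := h i y
      _ ≤ |C| * e i * (1 + |y|) ^ k := by gcongr; exact le_abs_self C
      _ = _ := by ring
  · have := (he i).ne'
    field_simp; ring

end Expansion

/-! ### The cubic soliton and the explicit functions built from it -/

theorem Q_pos (y : ℝ) : 0 < Q y := div_pos (by positivity) (Real.cosh_pos y)

theorem sqrt_two_sq : √2 ^ 2 = (2 : ℝ) := Real.sq_sqrt (by norm_num)

theorem Q_mul_cosh (y : ℝ) : Q y * Real.cosh y = √2 := by
  rw [Q, div_mul_cancel₀ _ (Real.cosh_pos y).ne']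

theorem tanh_sq (y : ℝ) : Real.tanh y ^ 2 = 1 - Q y ^ 2 / 2 := by
  have h := Real.cosh_sq y
  have hc := (Real.cosh_pos y).ne'
  rw [Real.tanh_eq_sinh_div_cosh, Q]
  field_simp
  rw [sqrt_two_sq]
  linarith

theorem hasDerivAt_Q (y : ℝ) : HasDerivAt Q (-(Real.tanh y * Q y)) y := by
  have h := (hasDerivAt_const y (√2)).fun_div (Real.hasDerivAt_cosh y) (Real.cosh_pos y).ne'
  refine h.congr_deriv ?_
  have hc := (Real.cosh_pos y).ne'
  rw [Real.tanh_eq_sinh_div_cosh, Q]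
  field_simp
  ring

theorem deriv_Q (y : ℝ) : deriv Q y = -(Real.tanh y * Q y) := (hasDerivAt_Q y).deriv

theorem hasDerivAt_tanh (y : ℝ) : HasDerivAt Real.tanh (Q y ^ 2 / 2) y := by
  have h := (Real.hasDerivAt_sinh y).fun_div (Real.hasDerivAt_cosh y) (Real.cosh_pos y).ne'
  have e : Real.tanh = fun y => Real.sinh y / Real.cosh y := by
    funext y; exact Real.tanh_eq_sinh_div_cosh y
  rw [e]
  refine h.congr_deriv ?_
  have hc := (Real.cosh_pos y).ne'
  have := Real.cosh_sq y
  rw [Q]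
  field_simp
  rw [sqrt_two_sq]
  linarith

theorem continuous_Q : Continuous Q := continuous_of_hasDerivAt hasDerivAt_Q

theorem continuous_tanh' : Continuous Real.tanh := continuous_of_hasDerivAt hasDerivAt_tanh

theorem abs_tanh_le (y : ℝ) : |Real.tanh y| ≤ 1 := by
  have h := tanh_sq y
  have : Real.tanh y ^ 2 ≤ 1 := by nlinarith [sq_nonneg (Q y)]
  exact (sq_le_one_iff_abs_le_one _).1 this

theorem Q_le_exp (y : ℝ) : Q y ≤ 2 * √2 * Real.exp (-|y|) := by
  rw [Q, div_le_iff₀ (Real.cosh_pos y), ← Real.cosh_abs y, Real.cosh_eq]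
  have h1 : Real.exp (-|y|) * Real.exp |y| = 1 := by rw [← Real.exp_add]; simp
  have h2 := Real.exp_pos (-|y|)
  have : 2 * √2 * Real.exp (-|y|) * ((Real.exp |y| + Real.exp (-|y|)) / 2)
      = √2 * (Real.exp (-|y|) * Real.exp |y|) + √2 * Real.exp (-|y|) ^ 2 := by ring
  rw [this, h1]
  nlinarith [Real.sqrt_nonneg 2, sq_nonneg (Real.exp (-|y|)),
    mul_nonneg (Real.sqrt_nonneg 2) (sq_nonneg (Real.exp (-|y|)))]

theorem Q_le (y : ℝ) : Q y ≤ √2 := by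
  rw [Q]; exact div_le_self (by positivity) (Real.one_le_cosh y)

theorem Q_zero : Q 0 = √2 := by simp [Q]

theorem Q_neg (y : ℝ) : Q (-y) = Q y := by simp [Q]

theorem Q_rpow_pos (t y : ℝ) : 0 < Q y ^ t := Real.rpow_pos_of_pos (Q_pos y) t

theorem Q_rpow_le {t : ℝ} (ht : 0 ≤ t) (y : ℝ) : Q y ^ t ≤ √2 ^ t :=
  Real.rpow_le_rpow (Q_pos y).le (Q_le y) ht

theorem Q_rpow_le_exp {t : ℝ} (ht : 0 ≤ t) (y : ℝ) :
    Q y ^ t ≤ (2 * √2) ^ t * Real.exp (-t * |y|) := by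
  have h := Real.rpow_le_rpow (Q_pos y).le (Q_le_exp y) ht
  rwa [Real.mul_rpow (by positivity) (Real.exp_pos _).le, ← Real.exp_mul,
    show -|y| * t = -t * |y| by ring] at h

theorem hasDerivAt_Q_rpow (t y : ℝ) :
    HasDerivAt (fun y => Q y ^ t) (-(t * Real.tanh y * Q y ^ t)) y := by
  have h := (hasDerivAt_Q y).rpow_const (p := t) (Or.inl (Q_pos y).ne')
  refine h.congr_deriv ?_
  have : Q y ^ t = Q y ^ (t - 1) * Q y := by
    conv_lhs => rw [show t = t - 1 + 1 by ring, Real.rpow_add (Q_pos y), Real.rpow_one]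
  rw [this]; ring

@[fun_prop]
theorem continuous_Q_rpow (t : ℝ) : Continuous fun y => Q y ^ t :=
  continuous_of_hasDerivAt (hasDerivAt_Q_rpow t)

theorem integrable_weight_mul_Q_rpow {t : ℝ} (ht : 0 < t) (k : ℕ) :
    Integrable fun y : ℝ => (1 + |y|) ^ k * Q y ^ t := by
  refine ((integrable_weight_mul_exp ht k).const_mul ((2 * √2) ^ t)).mono'
    (by fun_prop) (ae_of_all _ fun y => ?_)
  rw [Real.norm_eq_abs, abs_of_nonneg (mul_nonneg (by positivity) (Q_rpow_pos t y).le)]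
  calc (1 + |y|) ^ k * Q y ^ t ≤ (1 + |y|) ^ k * ((2 * √2) ^ t * Real.exp (-t * |y|)) := by
        gcongr; exact Q_rpow_le_exp ht.le y
    _ = _ := by ring

theorem integrable_weight_mul_Q (k : ℕ) : Integrable fun y : ℝ => (1 + |y|) ^ k * Q y := by
  simpa using integrable_weight_mul_Q_rpow (t := 1) one_pos k

theorem Q_rpow_add_one (t y : ℝ) : Q y ^ (t + 1) = Q y ^ t * Q y := by
  rw [Real.rpow_add (Q_pos y), Real.rpow_one]

theorem Q_rpow_add_two (t y : ℝ) : Q y ^ (t + 2) = Q y ^ t * Q y ^ 2 := by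
  rw [Real.rpow_add (Q_pos y)]; norm_cast

theorem Q_rpow_sub_one (t y : ℝ) : Q y ^ (t - 1) = Q y ^ t / Q y := by
  rw [Real.rpow_sub (Q_pos y), Real.rpow_one]

/-- The derivative of `A`. -/
noncomputable def ADeriv (y : ℝ) : ℝ :=
  √2 / 4 * (6 * Real.sinh y / Real.cosh y ^ 2
    + 3 * y * (2 / Real.cosh y ^ 3 - 1 / Real.cosh y) + Real.sinh y)

theorem A_eq (y : ℝ) : A y = √2 / 4 *
    (3 * y * (Real.sinh y / Real.cosh y ^ 2) + Real.cosh y - 3 / Real.cosh y) := by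
  have hc := (Real.cosh_pos y).ne'
  have := Real.cosh_sq y
  rw [A, Real.tanh_eq_sinh_div_cosh]
  have h2 : Real.sinh y ^ 2 = Real.cosh y ^ 2 - 1 := by linarith
  rw [h2]; field_simp; ring

theorem hasDerivAt_A (y : ℝ) : HasDerivAt A (ADeriv y) y := by
  have hc := (Real.cosh_pos y).ne'
  have h1 := (Real.hasDerivAt_sinh y).fun_div ((Real.hasDerivAt_cosh y).fun_pow 2) (pow_ne_zero 2 hc)
  have h2 := ((((hasDerivAt_id' y).const_mul 3).fun_mul h1).fun_add
    (Real.hasDerivAt_cosh y)).fun_sub ((hasDerivAt_const y (3 : ℝ)).fun_div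
      (Real.hasDerivAt_cosh y) hc)
  have h3 := h2.const_mul (√2 / 4)
  rw [show A = _ from funext A_eq]
  refine h3.congr_deriv ?_
  rw [ADeriv]
  congr 1
  have hs : Real.sinh y ^ 2 = Real.cosh y ^ 2 - 1 := by linarith [Real.cosh_sq y]
  field_simp
  norm_num
  ring_nf
  rw [hs]
  ring

theorem hasDerivAt_ADeriv (y : ℝ) : HasDerivAt ADeriv ((1 - 3 * Q y ^ 2) * A y) y := by
  have hc := (Real.cosh_pos y).ne'
  have h1 := ((Real.hasDerivAt_sinh y).const_mul 6).fun_div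
    ((Real.hasDerivAt_cosh y).fun_pow 2) (pow_ne_zero 2 hc)
  have h4 := ((hasDerivAt_const y (2 : ℝ)).fun_div ((Real.hasDerivAt_cosh y).fun_pow 3)
    (pow_ne_zero 3 hc)).fun_sub ((hasDerivAt_const y (1 : ℝ)).fun_div
      (Real.hasDerivAt_cosh y) hc)
  have h2 := (h1.fun_add (((hasDerivAt_id' y).const_mul 3).fun_mul h4)).fun_add
    (Real.hasDerivAt_sinh y)
  have h3 := h2.const_mul (√2 / 4)
  refine h3.congr_deriv ?_
  rw [A_eq, Q, div_pow, sqrt_two_sq]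
  rw [show ∀ a b : ℝ, a * (√2 / 4 * b) = √2 / 4 * (a * b) by intros; ring]
  congr 1
  have hs : Real.sinh y ^ 2 = Real.cosh y ^ 2 - 1 := by linarith [Real.cosh_sq y]
  field_simp
  norm_num
  ring_nf
  rw [hs]
  ring

theorem wronskian_A (y : ℝ) :
    (Q y - Q y ^ 3) * A y + Real.tanh y * Q y * ADeriv y = 1 := by
  have hc := (Real.cosh_pos y).ne'
  have hs : Real.sinh y ^ 2 = Real.cosh y ^ 2 - 1 := by linarith [Real.cosh_sq y]
  have h3 : √2 ^ 3 = 2 * √2 := by rw [pow_succ, sqrt_two_sq]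
  have h4 : √2 * √2 = 2 := Real.mul_self_sqrt (by norm_num)
  rw [A_eq, ADeriv, Real.tanh_eq_sinh_div_cosh, Q, div_pow, h3]
  field_simp
  ring_nf
  rw [hs, sqrt_two_sq]
  ring

theorem continuous_A : Continuous A := continuous_of_hasDerivAt hasDerivAt_A

/-- The derivative of `D0 σ`. -/
noncomputable def D0Deriv (σ y : ℝ) : ℝ :=
  -(Q y - Q y ^ 3) * (∫ z in (0 : ℝ)..y, A z * Q z ^ (2 * σ + 1))
    + ADeriv y * (Q y ^ (2 * σ + 2) / (2 * σ + 2))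

section
variable {σ : ℝ}

theorem hasDerivAt_D0_integral (σ y : ℝ) :
    HasDerivAt (fun y => ∫ z in (0 : ℝ)..y, A z * Q z ^ (2 * σ + 1))
      (A y * Q y ^ (2 * σ + 1)) y := by
  have hc : Continuous fun z => A z * Q z ^ (2 * σ + 1) :=
    continuous_A.mul (continuous_Q_rpow _)
  exact intervalIntegral.integral_hasDerivAt_right (hc.intervalIntegrable _ _)
    hc.aestronglyMeasurable.stronglyMeasurableAtFilter hc.continuousAt

theorem hasDerivAt_tanh_mul_Q (y : ℝ) :
    HasDerivAt (fun y => Real.tanh y * Q y) (-(Q y - Q y ^ 3)) y :=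
  ((hasDerivAt_tanh y).fun_mul (hasDerivAt_Q y)).congr_deriv (by
    linear_combination -Q y * tanh_sq y)

theorem hasDerivAt_D0 (hσ : 1 < σ) (y : ℝ) : HasDerivAt (D0 σ) (D0Deriv σ y) y := by
  have h1 := ((hasDerivAt_tanh_mul_Q y).fun_mul (hasDerivAt_D0_integral σ y)).fun_add
    ((hasDerivAt_A y).fun_mul ((hasDerivAt_Q_rpow (2 * σ + 2) y).div_const (2 * σ + 2)))
  have e : D0 σ = fun y => Real.tanh y * Q y * (∫ z in (0 : ℝ)..y, A z * Q z ^ (2 * σ + 1))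
      + A y * (Q y ^ (2 * σ + 2) / (2 * σ + 2)) := by
    funext y; rw [D0, deriv_Q, neg_neg]
  rw [e]
  refine h1.congr_deriv ?_
  rw [D0Deriv, Q_rpow_add_one, Q_rpow_add_two]
  have : 2 * σ + 2 ≠ 0 := by linarith
  field_simp
  ring

theorem hasDerivAt_D0Deriv (hσ : 1 < σ) (y : ℝ) :
    HasDerivAt (D0Deriv σ) ((1 - 3 * Q y ^ 2) * D0 σ y - Q y ^ (2 * σ) * Q y) y := by
  have h1 := (((hasDerivAt_Q y).fun_sub ((hasDerivAt_Q y).fun_pow 3)).fun_neg.fun_mul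
    (hasDerivAt_D0_integral σ y)).fun_add
    ((hasDerivAt_ADeriv y).fun_mul ((hasDerivAt_Q_rpow (2 * σ + 2) y).div_const (2 * σ + 2)))
  refine h1.congr_deriv ?_
  have hw := wronskian_A y
  rw [D0, deriv_Q, Q_rpow_add_one, Q_rpow_add_two]
  have : 2 * σ + 2 ≠ 0 := by linarith
  set I := ∫ z in (0 : ℝ)..y, A z * Q z ^ (2 * σ + 1)
  field_simp
  simp only [Nat.cast_ofNat, show (3 : ℕ) - 1 = 2 from rfl]
  linear_combination (-2 * (σ + 1) * Q y ^ (2 * σ)) * Q y * hw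

/-- The first integral of the linearized soliton equation. -/
theorem D0_first_integral (hσ : 1 < σ) (y : ℝ) :
    Real.tanh y * Q y * D0Deriv σ y
      = -(Q y - Q y ^ 3) * D0 σ y + Q y ^ (2 * σ) * Q y ^ 2 / (2 * (σ + 1)) := by
  have hw := wronskian_A y
  rw [D0, D0Deriv, deriv_Q, Q_rpow_add_two]
  have : 2 * σ + 2 ≠ 0 := by linarith
  have : σ + 1 ≠ 0 := by linarith
  set I := ∫ z in (0 : ℝ)..y, A z * Q z ^ (2 * σ + 1)
  field_simp
  linear_combination Q y ^ (2 * σ) * Q y ^ 2 * hw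

/-- The first variation `-D⁰/Q²` of the reciprocal of the soliton. -/
noncomputable def recipVar (σ y : ℝ) : ℝ := -D0 σ y / Q y ^ 2

/-- The derivative of `recipVar σ`. -/
noncomputable def recipVarDeriv (σ y : ℝ) : ℝ :=
  -(D0Deriv σ y + 2 * Real.tanh y * D0 σ y) / Q y ^ 2

theorem hasDerivAt_recipVar (hσ : 1 < σ) (y : ℝ) :
    HasDerivAt (recipVar σ) (recipVarDeriv σ y) y := by
  have hQ := (Q_pos y).ne'
  have h := (hasDerivAt_D0 hσ y).fun_neg.fun_div ((hasDerivAt_Q y).fun_pow 2) (pow_ne_zero 2 hQ)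
  refine h.congr_deriv ?_
  rw [recipVarDeriv]; field_simp; norm_num; ring

theorem hasDerivAt_recipVarDeriv (hσ : 1 < σ) (y : ℝ) :
    HasDerivAt (recipVarDeriv σ)
      (recipVar σ y + (σ - 1) / (σ + 1) * (Q y ^ (2 * σ) / Q y)) y := by
  have hQ := (Q_pos y).ne'
  have h := (((hasDerivAt_D0Deriv hσ y).fun_add (((hasDerivAt_tanh y).const_mul 2).fun_mul
    (hasDerivAt_D0 hσ y))).fun_neg).fun_div ((hasDerivAt_Q y).fun_pow 2) (pow_ne_zero 2 hQ)
  refine h.congr_deriv ?_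
  have h1 := D0_first_integral hσ y
  have h2 := tanh_sq y
  have : σ + 1 ≠ 0 := by linarith
  have h3 : (2 * (σ + 1)) * (Real.tanh y * Q y * D0Deriv σ y)
      = -(2 * (σ + 1)) * (Q y - Q y ^ 3) * D0 σ y + Q y ^ (2 * σ) * Q y ^ 2 := by
    rw [h1]; field_simp
  rw [recipVar]; field_simp
  norm_num
  linear_combination -2 * h3 + (-4 * (σ + 1) * Q y * D0 σ y) * h2

theorem recipVar_zero (hσ : 1 < σ) : recipVar σ 0 = √2 ^ (2 * σ) / (2 * √2 * (σ + 1)) := by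
  have : 2 * σ + 2 ≠ 0 := by linarith
  have : σ + 1 ≠ 0 := by linarith
  have h2 : (√2 : ℝ) ≠ 0 := by positivity
  rw [recipVar, D0, A_eq, Q_rpow_add_two, Q_zero]
  simp
  field_simp
  rw [sqrt_two_sq]; norm_num

theorem recipVarDeriv_zero : recipVarDeriv σ 0 = 0 := by
  simp [recipVarDeriv, D0Deriv, ADeriv]

end

theorem duhamel_cosh {u u' F : ℝ → ℝ} (hu : ∀ y, HasDerivAt u (u' y) y)
    (hu' : ∀ y, HasDerivAt u' (u y + F y) y) (hF : Continuous F) (y : ℝ) :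
    u y = Real.cosh y * u 0 + Real.sinh y * u' 0
      + ∫ z in (0 : ℝ)..y, Real.sinh (y - z) * F z ∧
    u' y = Real.sinh y * u 0 + Real.cosh y * u' 0
      + ∫ z in (0 : ℝ)..y, Real.cosh (y - z) * F z := by
  have h := duhamel (m := 1) (C := Real.cosh) (S := Real.sinh)
    (fun t => by simpa using Real.hasDerivAt_cosh t) Real.hasDerivAt_sinh (by simp) (by simp)
    hu (by simpa using hu') hF y
  simpa using h

theorem abs_sinh_le_cosh (y : ℝ) : |Real.sinh y| ≤ Real.cosh y := by
  refine abs_le_of_sq_le_sq' ?_ (Real.cosh_pos y).le |> abs_le.2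
  linarith [Real.cosh_sq y]

theorem abs_integral_kernel_le {K F : ℝ → ℝ} (hK : ∀ t, |K t| ≤ Real.cosh t) {B : ℝ}
    (hF : ∀ z, |F z| ≤ B) (y : ℝ) :
    |∫ z in (0 : ℝ)..y, K (y - z) * F z| ≤ B * Real.cosh y := by
  have hB : 0 ≤ B := (abs_nonneg _).trans (hF 0)
  have hi : IntervalIntegrable (fun z => B * Real.cosh (y - z)) volume 0 y := by
    apply Continuous.intervalIntegrable; fun_prop
  have h := intervalIntegral.norm_integral_le_abs_of_norm_le (a := 0) (b := y) (μ := volume)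
    (f := fun z => K (y - z) * F z) (g := fun z => B * Real.cosh (y - z))
    (Filter.Eventually.of_forall fun z => by
      rw [Real.norm_eq_abs, abs_mul, mul_comm]
      exact mul_le_mul (hF z) (hK _) (abs_nonneg _) hB) hi
  have h2 : ∫ z in (0 : ℝ)..y, B * Real.cosh (y - z) = B * Real.sinh y := by
    have := intervalIntegral.integral_eq_sub_of_hasDerivAt (a := 0) (b := y)
      (f := fun z => -B * Real.sinh (y - z)) (f' := fun z => B * Real.cosh (y - z))
      (fun z _ => (((Real.hasDerivAt_sinh (y - z)).comp z
        ((hasDerivAt_id' z).const_sub y)).const_mul (-B)).congr_deriv (by ring)) hi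
    rw [this]; simp
  rw [h2, abs_mul, abs_of_nonneg hB] at h
  exact h.trans (by gcongr; exact abs_sinh_le_cosh y)

theorem abs_Q_mul_le {B x y : ℝ} (h : |x| ≤ B * Real.cosh y) : |Q y * x| ≤ √2 * B := by
  rw [abs_mul, abs_of_pos (Q_pos y)]
  calc Q y * |x| ≤ Q y * (B * Real.cosh y) := by gcongr; exact (Q_pos y).le
    _ = Q y * Real.cosh y * B := by ring
    _ = _ := by rw [Q_mul_cosh]

section
variable {σ : ℝ}

theorem Q_rpow_div_Q_le (hσ : 1 < σ) (y : ℝ) : |Q y ^ (2 * σ) / Q y| ≤ √2 ^ (2 * σ - 1) := by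
  rw [← Q_rpow_sub_one, abs_of_pos (Q_rpow_pos _ _)]
  exact Q_rpow_le (by linarith) y

theorem continuous_Q_rpow_div_Q (σ : ℝ) : Continuous fun y => Q y ^ (2 * σ) / Q y := by
  simp_rw [← Q_rpow_sub_one]; fun_prop

theorem exists_recipVar_bound (hσ : 1 < σ) : ∃ C, 0 < C ∧ ∀ y,
    |recipVar σ y| ≤ C * Real.cosh y ∧ |recipVarDeriv σ y| ≤ C * Real.cosh y := by
  have hc : 0 < (σ - 1) / (σ + 1) := div_pos (by linarith) (by linarith)
  set B := (σ - 1) / (σ + 1) * √2 ^ (2 * σ - 1) with hB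
  have hFB : ∀ y, |(σ - 1) / (σ + 1) * (Q y ^ (2 * σ) / Q y)| ≤ B := fun y => by
    rw [abs_mul, abs_of_pos hc]
    exact mul_le_mul_of_nonneg_left (Q_rpow_div_Q_le hσ y) hc.le
  have hB0 : 0 < B := by positivity
  refine ⟨|recipVar σ 0| + B, by positivity, fun y => ?_⟩
  have h := duhamel_cosh (hasDerivAt_recipVar hσ) (hasDerivAt_recipVarDeriv hσ)
    ((continuous_Q_rpow_div_Q σ).const_mul _) y
  rw [recipVarDeriv_zero] at h
  rw [h.1, h.2]
  have h1 := abs_integral_kernel_le abs_sinh_le_cosh hFB y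
  have h2 := abs_integral_kernel_le (K := Real.cosh)
    (fun t => (abs_of_pos (Real.cosh_pos t)).le) hFB y
  have hch := Real.cosh_pos y
  constructor
  · rw [mul_zero, add_zero]
    refine (abs_add_le _ _).trans ?_
    rw [abs_mul, abs_of_pos hch]; linarith
  · rw [mul_zero, add_zero]
    refine (abs_add_le _ _).trans ?_
    rw [abs_mul]
    have := mul_le_mul_of_nonneg_right (abs_sinh_le_cosh y) (abs_nonneg (recipVar σ 0))
    linarith

/-- `D⁰` and its derivative decay like `Q`. -/
theorem exists_D0_bound (hσ : 1 < σ) : ∃ C, 0 < C ∧ ∀ y,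
    |D0 σ y / Q y| ≤ C ∧ |D0Deriv σ y / Q y| ≤ C := by
  obtain ⟨C, hC, h⟩ := exists_recipVar_bound hσ
  refine ⟨3 * (√2 * C), by positivity, fun y => ?_⟩
  have hQ := (Q_pos y).ne'
  have e1 : D0 σ y / Q y = -(Q y * recipVar σ y) := by rw [recipVar]; field_simp
  have e2 : D0Deriv σ y / Q y
      = -(Q y * recipVarDeriv σ y) + 2 * Real.tanh y * (Q y * recipVar σ y) := by
    rw [recipVar, recipVarDeriv]; field_simp; ring
  have b1 := abs_Q_mul_le (h y).1
  have b2 := abs_Q_mul_le (h y).2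
  have hp : 0 < √2 * C := by positivity
  constructor
  · rw [e1, abs_neg]; linarith
  · rw [e2]
    refine (abs_add_le _ _).trans ?_
    rw [abs_neg, abs_mul (2 * Real.tanh y), abs_mul 2, abs_two]
    nlinarith [abs_tanh_le y, abs_nonneg (Q y * recipVar σ y), abs_nonneg (Real.tanh y)]

/-! ### Convolution with `|y - z| / 2` -/

/-- The solution `½ ∫ |y - z| f(z) dz` of `u'' = f`. -/
noncomputable def absConv (f : ℝ → ℝ) (y : ℝ) : ℝ := (1 / 2) * ∫ z, |y - z| * f z

theorem greenDeriv_zero_eq (f : ℝ → ℝ) (y : ℝ) :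
    greenDeriv 0 f y = (1 / 2) * ((∫ z in Iic y, f z) - ∫ z in Ioi y, f z) := by
  simp [greenDeriv, leftConv, rightConv]

section AbsConv
variable {f : ℝ → ℝ}

theorem integrable_of_weight (hf : Continuous f)
    (hi : Integrable fun z => (1 + |z|) * |f z|) : Integrable f ∧ Integrable fun z => z * f z := by
  constructor
  · refine hi.mono' hf.aestronglyMeasurable (ae_of_all _ fun z => ?_)
    rw [Real.norm_eq_abs]; nlinarith [abs_nonneg z, abs_nonneg (f z)]
  · refine hi.mono' (continuous_id.mul hf).aestronglyMeasurable (ae_of_all _ fun z => ?_)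
    rw [Real.norm_eq_abs, abs_mul]; nlinarith [abs_nonneg z, abs_nonneg (f z)]

theorem hasDerivAt_greenDeriv_zero (hf : Continuous f)
    (hi : Integrable fun z => (1 + |z|) * |f z|) (y : ℝ) :
    HasDerivAt (greenDeriv 0 f) (f y) y := by
  have h0 := (integrable_of_weight hf hi).1
  rw [show greenDeriv 0 f = _ from funext (greenDeriv_zero_eq f)]
  exact (((hasDerivAt_integral_Iic hf (fun _ => h0.integrableOn) y).fun_sub
    (hasDerivAt_integral_Ioi hf (fun _ => h0.integrableOn) y)).const_mul (1 / 2)).congr_deriv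
    (by ring)

theorem hasDerivAt_absConv (hf : Continuous f)
    (hi : Integrable fun z => (1 + |z|) * |f z|) (y : ℝ) :
    HasDerivAt (absConv f) (greenDeriv 0 f y) y := by
  obtain ⟨h0, h1⟩ := integrable_of_weight hf hi
  have hc : Continuous fun z => z * f z := continuous_id.mul hf
  have e : absConv f = fun y => (1 / 2) * (y * ((∫ z in Iic y, f z) - ∫ z in Ioi y, f z)
      - ((∫ z in Iic y, z * f z) - ∫ z in Ioi y, z * f z)) := by
    funext y
    have hi' : Integrable fun z => |y - z| * f z := by
      refine (hi.const_mul (1 + |y|)).mono' (by fun_prop) (ae_of_all _ fun z => ?_)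
      rw [Real.norm_eq_abs, abs_mul, abs_abs]
      have := abs_sub y z
      nlinarith [abs_nonneg y, abs_nonneg z, abs_nonneg (f z), mul_nonneg (abs_nonneg y)
        (abs_nonneg z), mul_nonneg (mul_nonneg (abs_nonneg y) (abs_nonneg z)) (abs_nonneg (f z)),
        mul_le_mul_of_nonneg_right this (abs_nonneg (f z))]
    rw [absConv, ← intervalIntegral.integral_Iic_add_Ioi (b := y) hi'.integrableOn hi'.integrableOn]
    have e1 : ∫ z in Iic y, |y - z| * f z = y * (∫ z in Iic y, f z) - ∫ z in Iic y, z * f z := by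
      rw [← integral_const_mul, ← integral_sub (h0.integrableOn.const_mul y) h1.integrableOn]
      refine setIntegral_congr_fun measurableSet_Iic fun z hz => ?_
      simp only [abs_of_nonneg (sub_nonneg.2 (show z ≤ y from hz))]; ring
    have e2 : ∫ z in Ioi y, |y - z| * f z = (∫ z in Ioi y, z * f z) - y * ∫ z in Ioi y, f z := by
      rw [← integral_const_mul, ← integral_sub h1.integrableOn (h0.integrableOn.const_mul y)]
      refine setIntegral_congr_fun measurableSet_Ioi fun z hz => ?_
      simp only [abs_sub_comm y z, abs_of_pos (sub_pos.2 (show y < z from hz))]; ring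
    rw [e1, e2]; ring
  rw [e]
  have hd := ((((hasDerivAt_id' y).fun_mul
    ((hasDerivAt_integral_Iic hf (fun _ => h0.integrableOn) y).fun_sub
      (hasDerivAt_integral_Ioi hf (fun _ => h0.integrableOn) y))).fun_sub
    ((hasDerivAt_integral_Iic hc (fun _ => h1.integrableOn) y).fun_sub
      (hasDerivAt_integral_Ioi hc (fun _ => h1.integrableOn) y)))).const_mul (1 / 2)
  refine hd.congr_deriv ?_
  rw [greenDeriv_zero_eq]; ring

theorem abs_sub_le_weight (y z : ℝ) : |y - z| ≤ (1 + |y|) * (1 + |z|) := by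
  have := abs_sub y z
  nlinarith [abs_nonneg y, abs_nonneg z, mul_nonneg (abs_nonneg y) (abs_nonneg z)]

theorem abs_absConv_le (hi : Integrable fun z => (1 + |z|) * |f z|) (y : ℝ) :
    |absConv f y| ≤ (1 / 2) * ((1 + |y|) * ∫ z, (1 + |z|) * |f z|) := by
  rw [absConv, abs_mul, abs_of_pos (by norm_num : (0 : ℝ) < 1 / 2), ← integral_const_mul]
  gcongr
  refine norm_integral_le_of_norm_le (μ := volume) (f := fun z => |y - z| * f z)
    (hi.const_mul _) (ae_of_all _ fun z => ?_)
  rw [Real.norm_eq_abs, abs_mul, abs_abs]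
  nlinarith [mul_le_mul_of_nonneg_right (abs_sub_le_weight y z) (abs_nonneg (f z))]

theorem abs_greenDeriv_le_integral {κ : ℝ} (hκ : 0 ≤ κ) (hi : Integrable f) (y : ℝ) :
    |greenDeriv κ f y| ≤ (1 / 2) * ∫ z, |f z| := by
  rw [greenDeriv, abs_mul, abs_of_pos (by norm_num : (0 : ℝ) < 1 / 2),
    ← intervalIntegral.integral_Iic_add_Ioi (b := y) hi.abs.integrableOn hi.abs.integrableOn]
  gcongr
  refine (abs_sub _ _).trans (add_le_add ?_ ?_)
  · refine norm_integral_le_of_norm_le (μ := volume.restrict (Iic y))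
      (f := fun z => Real.exp (-κ * (y - z)) * f z) hi.abs.integrableOn
      ((ae_restrict_iff' measurableSet_Iic).2 (ae_of_all _ fun z hz => ?_))
    rw [Real.norm_eq_abs, abs_mul, abs_of_pos (Real.exp_pos _)]
    refine mul_le_of_le_one_left (abs_nonneg _) (Real.exp_le_one_iff.2 ?_)
    nlinarith [show z ≤ y from hz]
  · refine norm_integral_le_of_norm_le (μ := volume.restrict (Ioi y))
      (f := fun z => Real.exp (-κ * (z - y)) * f z) hi.abs.integrableOn
      ((ae_restrict_iff' measurableSet_Ioi).2 (ae_of_all _ fun z hz => ?_))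
    rw [Real.norm_eq_abs, abs_mul, abs_of_pos (Real.exp_pos _)]
    refine mul_le_of_le_one_left (abs_nonneg _) (Real.exp_le_one_iff.2 ?_)
    nlinarith [show y < z from hz]

end AbsConv

/-! ### The functions `T₁⁰` and `T₂⁰` -/

/-- The source of `T₁⁰`. -/
noncomputable def source1 (σ y : ℝ) : ℝ := -((σ - 1) ^ 2 / (σ + 1)) * Q y ^ (2 * σ)

/-- The source of `T₂⁰`. -/
noncomputable def source2 (σ y : ℝ) : ℝ := σ * (σ - 1) / (σ + 1) * Q y ^ (2 * σ)

theorem continuous_source1 (σ : ℝ) : Continuous (source1 σ) := by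
  unfold source1; fun_prop

theorem continuous_source2 (σ : ℝ) : Continuous (source2 σ) := by
  unfold source2; fun_prop

theorem integrable_weight_source1 (hσ : 1 < σ) :
    Integrable fun z => (1 + |z|) * |source1 σ z| := by
  have h := (integrable_weight_mul_Q_rpow (t := 2 * σ) (by linarith) 1).const_mul
    |-((σ - 1) ^ 2 / (σ + 1))|
  refine h.congr (ae_of_all _ fun z => ?_)
  simp only [source1]
  rw [abs_mul, abs_of_pos (Q_rpow_pos _ _), pow_one]; ring

theorem abs_source2_le (hσ : 1 < σ) (z : ℝ) :
    |source2 σ z| ≤ σ * (σ - 1) / (σ + 1) * √2 ^ (2 * σ) := by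
  have : 0 < σ * (σ - 1) / (σ + 1) := div_pos (by nlinarith) (by linarith)
  rw [source2, abs_mul, abs_of_pos this, abs_of_pos (Q_rpow_pos _ _)]
  exact mul_le_mul_of_nonneg_left (Q_rpow_le (by linarith) z) this.le

theorem T1_eq_absConv (σ : ℝ) : T1 σ = absConv (source1 σ) := by
  funext y
  simp only [T1, absConv, source1]
  rw [show (fun z => |y - z| * (-((σ - 1) ^ 2 / (σ + 1)) * Q z ^ (2 * σ)))
    = fun z => -((σ - 1) ^ 2 / (σ + 1)) * (|y - z| * Q z ^ (2 * σ)) by funext z; ring,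
    integral_const_mul]
  rw [mul_comm 2 (σ + 1), ← div_div]; ring

theorem T2_eq_green (hσ : 1 < σ) : T2 σ = green √2 (source2 σ) := by
  funext y
  have hi : Integrable (source2 σ) := by
    have := (integrable_weight_mul_Q_rpow (t := 2 * σ) (by linarith) 0).const_mul
      (σ * (σ - 1) / (σ + 1))
    simp only [pow_zero, one_mul] at this
    exact this
  rw [green_eq_integral (by positivity) hi]
  simp only [T2, source2]
  rw [show (fun z => Real.exp (-√2 * |y - z|) * (σ * (σ - 1) / (σ + 1) * Q z ^ (2 * σ)))
    = fun z => σ * (σ - 1) / (σ + 1) * (Real.exp (-√2 * |y - z|) * Q z ^ (2 * σ)) by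
      funext z; ring, integral_const_mul]
  have h2 : (√2 : ℝ) ≠ 0 := by positivity
  have h3 : σ + 1 ≠ 0 := by linarith
  have h4 : √2 / 4 = 1 / (2 * √2) := by
    rw [div_eq_div_iff (by norm_num) (by positivity)]
    linear_combination 2 * sqrt_two_sq
  rw [mul_comm 4 (σ + 1), ← div_div]
  linear_combination (-(σ * (σ - 1) / (σ + 1)) * ∫ z, Real.exp (-√2 * |y - z|) * Q z ^ (2 * σ)) * h4

/-- The derivative of `T1 σ`. -/
noncomputable def T1Deriv (σ : ℝ) : ℝ → ℝ := greenDeriv 0 (source1 σ)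

/-- The derivative of `T2 σ`. -/
noncomputable def T2Deriv (σ : ℝ) : ℝ → ℝ := greenDeriv √2 (source2 σ)

theorem hasDerivAt_T1 (hσ : 1 < σ) (y : ℝ) : HasDerivAt (T1 σ) (T1Deriv σ y) y := by
  rw [T1_eq_absConv]
  exact hasDerivAt_absConv (continuous_source1 σ) (integrable_weight_source1 hσ) y

theorem hasDerivAt_T1Deriv (hσ : 1 < σ) (y : ℝ) :
    HasDerivAt (T1Deriv σ) (source1 σ y) y :=
  hasDerivAt_greenDeriv_zero (continuous_source1 σ) (integrable_weight_source1 hσ) y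

theorem hasDerivAt_T2 (hσ : 1 < σ) (y : ℝ) : HasDerivAt (T2 σ) (T2Deriv σ y) y := by
  rw [T2_eq_green hσ]
  exact hasDerivAt_green (by positivity) (continuous_source2 σ) (abs_source2_le hσ) y

theorem hasDerivAt_T2Deriv (hσ : 1 < σ) (y : ℝ) :
    HasDerivAt (T2Deriv σ) (2 * T2 σ y + source2 σ y) y := by
  have h := hasDerivAt_greenDeriv (κ := √2) (by positivity) (continuous_source2 σ) (abs_source2_le hσ) y
  rwa [sqrt_two_sq, ← T2_eq_green hσ] at h

section
variable {ι : Type*}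

theorem unifPoly_T1 (hσ : 1 < σ) : UnifPoly fun _ : ι => T1 σ := by
  refine ⟨1 / 2 * ∫ z, (1 + |z|) * |source1 σ z|, 1, by positivity, fun _ y => ?_⟩
  rw [T1_eq_absConv]
  refine (abs_absConv_le (integrable_weight_source1 hσ) y).trans (le_of_eq ?_)
  ring

theorem unifPoly_T1Deriv (hσ : 1 < σ) : UnifPoly fun _ : ι => T1Deriv σ :=
  UnifPoly.of_bound fun _ y => abs_greenDeriv_le_integral le_rfl
    (integrable_of_weight (continuous_source1 σ) (integrable_weight_source1 hσ)).1 y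

theorem unifPoly_T2 (hσ : 1 < σ) : UnifPoly fun _ : ι => T2 σ :=
  UnifPoly.of_bound fun _ y => by
    rw [T2_eq_green hσ]
    exact abs_green_le (by positivity) (abs_source2_le hσ) y

theorem unifPoly_T2Deriv (hσ : 1 < σ) : UnifPoly fun _ : ι => T2Deriv σ :=
  UnifPoly.of_bound fun _ y => abs_greenDeriv_le (by positivity) (abs_source2_le hσ) y

end
end

/-! ### The soliton: a priori estimates -/

/-- The profile equation for the power nonlinearity, in terms of `ε = a ω^(σ-1)`, together with
its first integral. -/
structure IsProfile (σ ε : ℝ) (R : ℝ → ℝ) : Prop where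
  pos : ∀ y, 0 < R y
  even : ∀ y, R (-y) = R y
  hasDerivAt : ∀ y, HasDerivAt R (deriv R y) y
  hasDerivAt_deriv : ∀ y, HasDerivAt (deriv R) (R y - R y ^ 3 - ε * R y ^ (2 * σ) * R y) y
  energy : ∀ y, deriv R y ^ 2
    = R y ^ 2 - R y ^ 4 / 2 - ε / (σ + 1) * R y ^ (2 * σ) * R y ^ 2

section
variable {σ ε a ω : ℝ} {R : ℝ → ℝ}

theorem powerNL_soliton (hω : 0 < ω) {r : ℝ} (hr : 0 < r) :
    powerNL a σ (ω * r ^ 2) / ω = a * ω ^ (σ - 1) * r ^ (2 * σ) := by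
  rw [powerNL, Real.mul_rpow hω.le (by positivity), Real.rpow_sub hω, Real.rpow_one,
    Real.rpow_mul hr.le, Real.rpow_two]
  ring

theorem hasDerivAt_comp_rpow {f : ℝ → ℝ} {f' t y : ℝ} (hf : HasDerivAt f f' y) (hpos : 0 < f y) :
    HasDerivAt (fun y => f y ^ t) (t * f y ^ t * (f' / f y)) y := by
  have h := hf.rpow_const (p := t) (Or.inl hpos.ne')
  refine h.congr_deriv ?_
  rw [Real.rpow_sub hpos, Real.rpow_one]
  ring

theorem deriv_even_zero (hev : ∀ y, R (-y) = R y) (hd : ∀ y, HasDerivAt R (deriv R y) y) :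
    deriv R 0 = 0 := by
  have h1 : HasDerivAt (fun y => R (-y)) (-deriv R (-0)) 0 := by
    have := (hd (-0)).comp 0 (hasDerivAt_neg (0 : ℝ))
    exact this.congr_deriv (by ring)
  have h2 : (fun y => R (-y)) = R := funext hev
  rw [h2, neg_zero] at h1
  have := h1.unique (hd 0)
  linarith

theorem IsSoliton.isProfile (hσ : 1 < σ) (hω : 0 < ω) (h : IsSoliton (powerNL a σ) ω R) :
    IsProfile σ (a * ω ^ (σ - 1)) R := by
  set ε := a * ω ^ (σ - 1) with hε
  have hd : ∀ y, HasDerivAt R (deriv R y) y := fun y =>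
    (h.contDiff.differentiable (by norm_num) y).hasDerivAt
  have hd2 : ∀ y, HasDerivAt (deriv R) (R y - R y ^ 3 - ε * R y ^ (2 * σ) * R y) y := fun y => by
    have h1 : ContDiff ℝ 1 (deriv R) := by
      have := (contDiff_succ_iff_deriv (n := 1)).1 h.contDiff
      exact this.2.2
    have := (h1.differentiable (by norm_num) y).hasDerivAt
    rwa [h.equation, powerNL_soliton hω (h.pos y), ← hε] at this
  refine ⟨h.pos, h.even, hd, hd2, ?_⟩
  have hσ1 : σ + 1 ≠ 0 := by linarith
  set E : ℝ → ℝ := fun y => deriv R y ^ 2 - (R y ^ 2 - R y ^ 4 / 2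
    - ε / (σ + 1) * R y ^ (2 * σ) * R y ^ 2) with hE
  have hE' : ∀ y, HasDerivAt E 0 y := fun y => by
    have hR := h.pos y
    have h1 := ((hd2 y).fun_pow 2).fun_sub ((((hd y).fun_pow 2).fun_sub
      (((hd y).fun_pow 4).div_const 2)).fun_sub
      (((hasDerivAt_comp_rpow (t := 2 * σ) (hd y) hR).const_mul (ε / (σ + 1))).fun_mul
        ((hd y).fun_pow 2)))
    refine h1.congr_deriv ?_
    simp only [Nat.cast_ofNat, Nat.add_one_sub_one, pow_one]
    field_simp
    ring
  have hEc : ∀ y, E y = E 0 := fun y =>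
    is_const_of_deriv_eq_zero (fun x => (hE' x).differentiableAt) (fun x => (hE' x).deriv) y 0
  have i1 : Integrable fun y => R y ^ 2 := h.memLp.integrable_sq
  have i2 : Integrable fun y => deriv R y ^ 2 := h.memLp_deriv.integrable_sq
  have i3 : Integrable fun y => R y * deriv R y := h.memLp.integrable_mul h.memLp_deriv
  have t1 : Tendsto (fun y => R y ^ 2) atTop (𝓝 0) :=
    tendsto_zero_of_hasDerivAt_of_integrableOn_Ioi (a := 0)
      (f' := fun y => 2 * (R y * deriv R y))
      (fun y _ => ((hd y).fun_pow 2).congr_deriv (by norm_num; ring))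
      (i3.const_mul 2).integrableOn i1.integrableOn
  have t2 : Tendsto (fun y => deriv R y ^ 2) atTop (𝓝 (E 0)) := by
    have e1 : (fun y => deriv R y ^ 2) = fun y => E 0 + (R y ^ 2 - (R y ^ 2) ^ 2 / 2
        - ε / (σ + 1) * (R y ^ 2) ^ σ * R y ^ 2) := by
      funext y
      rw [← hEc y, hE]
      have : (R y ^ 2) ^ σ = R y ^ (2 * σ) := by rw [Real.rpow_mul (h.pos y).le, Real.rpow_two]
      simp only [this]; ring
    rw [e1]
    have t3 : Tendsto (fun y => (R y ^ 2) ^ σ) atTop (𝓝 0) := by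
      have := t1.rpow_const (p := σ) (Or.inr (by linarith))
      rwa [Real.zero_rpow (by linarith)] at this
    have := ((t1.sub ((t1.pow 2).div_const 2)).sub ((t3.const_mul (ε / (σ + 1))).mul t1)).const_add
      (E 0)
    simpa using this
  have hE0 : E 0 = 0 := by
    have := (i2.integrableOn (s := Ioi (0 : ℝ)))
    by_contra hne
    have hpos : 0 < E 0 := lt_of_le_of_ne
      (ge_of_tendsto' t2 fun y => sq_nonneg _) (Ne.symm hne)
    have hev : ∀ᶠ y in atTop, E 0 / 2 < deriv R y ^ 2 :=
      t2.eventually (lt_mem_nhds (by linarith))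
    obtain ⟨b, hb⟩ := hev.exists_forall_of_atTop
    have i4 : IntegrableOn (fun _ : ℝ => E 0 / 2) (Ioi b) := by
      refine Integrable.mono' (i2.integrableOn (s := Ioi b)) aestronglyMeasurable_const
        ((ae_restrict_iff' measurableSet_Ioi).2 (ae_of_all _ fun y hy => ?_))
      rw [Real.norm_eq_abs, abs_of_pos (by linarith)]
      exact (hb y (le_of_lt hy)).le
    rw [integrableOn_const_iff] at i4
    rcases i4 with h0 | h0
    · rw [enorm_eq_zero] at h0; linarith
    · simp at h0
  intro y
  have := hEc y
  rw [hE0, hE] at this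
  simp only at this
  linarith

end

theorem exp_sub_one_abs_le (x : ℝ) : |Real.exp x - 1| ≤ |x| * Real.exp |x| := by
  have h1 := Real.add_one_le_exp x
  have h2 := Real.add_one_le_exp (-x)
  have h3 : Real.exp x * Real.exp (-x) = 1 := by rw [← Real.exp_add]; simp
  have h4 : Real.exp x ≤ Real.exp |x| := Real.exp_le_exp.2 (le_abs_self x)
  have h5 : 1 ≤ Real.exp |x| := Real.one_le_exp (abs_nonneg x)
  have hp := Real.exp_pos x
  rw [abs_le]
  constructor
  · nlinarith [neg_abs_le x, abs_nonneg x]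
  · have h6 : Real.exp x - 1 ≤ x * Real.exp x := by nlinarith
    have h7 : x * Real.exp x ≤ |x| * Real.exp |x| :=
      mul_le_mul (le_abs_self x) h4 hp.le (abs_nonneg x)
    linarith

/-- Powers are Lipschitz on `[1/2, 1]`, at the point `1`. -/
theorem abs_rpow_sub_one_le (t : ℝ) {ρ : ℝ} (h1 : 1 / 2 ≤ ρ) (h2 : ρ ≤ 1) :
    |ρ ^ t - 1| ≤ 2 * |t| * Real.exp |t| * (1 - ρ) := by
  have hρ : 0 < ρ := by linarith
  have hl : |Real.log ρ| ≤ 2 * (1 - ρ) := by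
    have := Real.one_sub_inv_le_log_of_pos hρ
    have h3 : ρ⁻¹ ≤ 1 + 2 * (1 - ρ) := by
      rw [inv_le_iff_one_le_mul₀ hρ]; nlinarith
    rw [abs_of_nonpos (Real.log_nonpos hρ.le h2)]; linarith
  rw [Real.rpow_def_of_pos hρ]
  refine (exp_sub_one_abs_le _).trans ?_
  rw [abs_mul]
  have h4 : |Real.log ρ| * |t| ≤ |t| := by
    nlinarith [abs_nonneg t, abs_nonneg (Real.log ρ)]
  calc |Real.log ρ| * |t| * Real.exp (|Real.log ρ| * |t|)
      ≤ 2 * (1 - ρ) * |t| * Real.exp |t| := by gcongr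
    _ = _ := by ring

section
variable {σ ε : ℝ} {R : ℝ → ℝ}

/-- The derivative of `1 / R`. -/
noncomputable def recipDeriv (R : ℝ → ℝ) (y : ℝ) : ℝ := -deriv R y / R y ^ 2

theorem IsProfile.hasDerivAt_recip (h : IsProfile σ ε R) (y : ℝ) :
    HasDerivAt (fun y => (R y)⁻¹) (recipDeriv R y) y :=
  (h.hasDerivAt y).fun_inv (h.pos y).ne'

theorem IsProfile.continuous (h : IsProfile σ ε R) : Continuous R :=
  continuous_of_hasDerivAt h.hasDerivAt

theorem IsProfile.continuous_rpow (h : IsProfile σ ε R) (t : ℝ) : Continuous fun y => R y ^ t :=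
  h.continuous.rpow_const fun y => Or.inl (h.pos y).ne'

/-- The reciprocal of the soliton solves `v'' = v + ε (σ-1)/(σ+1) v^(1-2σ)`. -/
theorem IsProfile.hasDerivAt_recipDeriv (hσ : 1 < σ) (h : IsProfile σ ε R) (y : ℝ) :
    HasDerivAt (recipDeriv R)
      ((R y)⁻¹ + ε * ((σ - 1) / (σ + 1)) * (R y ^ (2 * σ) / R y)) y := by
  have hR := (h.pos y).ne'
  have hd := (h.hasDerivAt_deriv y).fun_neg.fun_div ((h.hasDerivAt y).fun_pow 2) (pow_ne_zero 2 hR)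
  refine hd.congr_deriv ?_
  have he := h.energy y
  have hσ1 : σ + 1 ≠ 0 := by linarith
  have he2 : (σ + 1) * deriv R y ^ 2 = (σ + 1) * (R y ^ 2 - R y ^ 4 / 2)
      - ε * R y ^ (2 * σ) * R y ^ 2 := by
    rw [he]; field_simp
  simp only [Nat.cast_ofNat, Nat.add_one_sub_one, pow_one]
  field_simp
  linear_combination 2 * he2

theorem IsProfile.zero_eq (h : IsProfile σ ε R) :
    (R 0)⁻¹ ^ 2 = 1 / 2 + ε / (σ + 1) * (R 0 ^ (2 * σ) / R 0 ^ 2) := by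
  have h0 := deriv_even_zero h.even h.hasDerivAt
  have he := h.energy 0
  have hR := (h.pos 0).ne'
  rw [h0] at he
  have : R 0 ^ 2 * (1 - R 0 ^ 2 / 2 - ε / (σ + 1) * R 0 ^ (2 * σ)) = 0 := by
    linear_combination -he
  have h1 : 1 - R 0 ^ 2 / 2 - ε / (σ + 1) * R 0 ^ (2 * σ) = 0 := by
    rcases mul_eq_zero.1 this with h2 | h2
    · exact absurd h2 (pow_ne_zero 2 hR)
    · exact h2
  have h2 : (R 0)⁻¹ ^ 2 * R 0 ^ 2 = 1 := by field_simp
  have h3 : R 0 ^ (2 * σ) / R 0 ^ 2 * R 0 ^ 2 = R 0 ^ (2 * σ) := by field_simp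
  apply mul_right_cancel₀ (pow_ne_zero 2 hR)
  linear_combination h2 + h1 - ε / (σ + 1) * h3

theorem IsProfile.recip_duhamel (hσ : 1 < σ) (h : IsProfile σ ε R) (y : ℝ) :
    (R y)⁻¹ = Real.cosh y * (R 0)⁻¹
      + ∫ z in (0 : ℝ)..y, Real.sinh (y - z) * (ε * ((σ - 1) / (σ + 1)) * (R z ^ (2 * σ) / R z)) ∧
    recipDeriv R y = Real.sinh y * (R 0)⁻¹
      + ∫ z in (0 : ℝ)..y,
        Real.cosh (y - z) * (ε * ((σ - 1) / (σ + 1)) * (R z ^ (2 * σ) / R z)) := by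
  have h1 := duhamel_cosh h.hasDerivAt_recip (h.hasDerivAt_recipDeriv hσ)
    (((h.continuous_rpow (2 * σ)).div₀ h.continuous fun y => (h.pos y).ne').const_mul _) y
  have h0 : recipDeriv R 0 = 0 := by
    simp [recipDeriv, deriv_even_zero h.even h.hasDerivAt]
  simpa [h0] using h1

theorem IsProfile.le_Q (hσ : 1 < σ) (hε : 0 < ε) (h : IsProfile σ ε R) (y : ℝ) : R y ≤ Q y := by
  wlog hy : 0 ≤ y generalizing y
  · rw [← h.even, ← Q_neg]
    exact this (-y) (by linarith)
  have hc : 0 < (σ - 1) / (σ + 1) := div_pos (by linarith) (by linarith)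
  have h0 := h.zero_eq
  have h1 : 1 / √2 ≤ (R 0)⁻¹ := by
    have hp := inv_pos.2 (h.pos 0)
    have h2 : 0 ≤ ε / (σ + 1) * (R 0 ^ (2 * σ) / R 0 ^ 2) := by
      have := h.pos 0
      have : 0 < σ + 1 := by linarith
      positivity
    apply le_of_sq_le_sq _ hp.le
    rw [h0, div_pow, sqrt_two_sq]; linarith
  have h3 : 0 ≤ ∫ z in (0 : ℝ)..y,
      Real.sinh (y - z) * (ε * ((σ - 1) / (σ + 1)) * (R z ^ (2 * σ) / R z)) := by
    apply intervalIntegral.integral_nonneg hy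
    intro z hz
    have := h.pos z
    have : 0 ≤ Real.sinh (y - z) := Real.sinh_nonneg_iff.2 (by linarith [hz.2])
    positivity
  have h4 : (Q y)⁻¹ ≤ (R y)⁻¹ := by
    rw [(h.recip_duhamel hσ y).1, Q, inv_div]
    have : Real.cosh y * (1 / √2) ≤ Real.cosh y * (R 0)⁻¹ := by
      gcongr
    rw [mul_one_div] at this
    linarith
  exact (inv_le_inv₀ (Q_pos y) (h.pos y)).1 h4

theorem IsProfile.recip_ge (hσ : 1 < σ) (hε : 0 < ε) (h : IsProfile σ ε R) (y : ℝ) :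
    (Q y)⁻¹ ≤ (R y)⁻¹ := inv_anti₀ (h.pos y) (h.le_Q hσ hε y)

theorem IsProfile.rpow_le (hσ : 1 < σ) (hε : 0 < ε) (h : IsProfile σ ε R) {t : ℝ} (ht : 0 ≤ t)
    (y : ℝ) : R y ^ t ≤ Q y ^ t := Real.rpow_le_rpow (h.pos y).le (h.le_Q hσ hε y) ht

end

section
variable {σ ε : ℝ} {R : ℝ → ℝ}

theorem inv_Q_eq (y : ℝ) : (Q y)⁻¹ = Real.cosh y * (1 / √2) := by
  rw [Q, inv_div]; ring

theorem integral_kernel_sub {K F G : ℝ → ℝ} (hK : Continuous K) (hF : Continuous F)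
    (hG : Continuous G) (y : ℝ) :
    (∫ z in (0 : ℝ)..y, K (y - z) * F z) - ∫ z in (0 : ℝ)..y, K (y - z) * G z
      = ∫ z in (0 : ℝ)..y, K (y - z) * (F z - G z) := by
  rw [← intervalIntegral.integral_sub ((by fun_prop : Continuous _).intervalIntegrable _ _)
    ((by fun_prop : Continuous _).intervalIntegrable _ _)]
  congr 1; funext z; ring

/-- Zeroth order estimate for the soliton: `1/R = 1/Q + O(ε cosh)`. -/
theorem exists_recip_bound_zero (hσ : 1 < σ) : ∃ C, 0 < C ∧ ∀ ε R, 0 < ε → IsProfile σ ε R →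
    |(R 0)⁻¹ - 1 / √2| ≤ C * ε ∧ ∀ y, |(R y)⁻¹ - (Q y)⁻¹| ≤ C * ε * Real.cosh y := by
  have hσ1 : 0 < σ + 1 := by linarith
  have hc : 0 < (σ - 1) / (σ + 1) := div_pos (by linarith) (by linarith)
  set C1 := 1 / (σ + 1) * √2 ^ (2 * σ - 2) with hC1
  set C2 := (σ - 1) / (σ + 1) * √2 ^ (2 * σ - 1) with hC2
  have p1 : 0 < C1 := by positivity
  have p2 : 0 < C2 := by positivity
  refine ⟨C1 + C2, by positivity, fun ε R hε h => ?_⟩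
  have hR0 := h.pos 0
  have hs2 : 1 ≤ √2 := Real.one_le_sqrt.2 (by norm_num)
  have h0 : |(R 0)⁻¹ - 1 / √2| ≤ C1 * ε := by
    have e1 := h.zero_eq
    have e2 : R 0 ^ (2 * σ) / R 0 ^ 2 = R 0 ^ (2 * σ - 2) := by
      rw [Real.rpow_sub hR0]; norm_cast
    have e3 : R 0 ^ (2 * σ - 2) ≤ √2 ^ (2 * σ - 2) :=
      (h.rpow_le hσ hε (by linarith) 0).trans (Q_rpow_le (by linarith) 0)
    have e4 : 1 / √2 ≤ (R 0)⁻¹ := by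
      have := h.recip_ge hσ hε 0
      rwa [Q_zero, ← one_div √2] at this
    have e5 : (1 / √2) ^ 2 = (1 : ℝ) / 2 := by rw [div_pow, sqrt_two_sq]; norm_num
    have e6 : 0 < R 0 ^ (2 * σ - 2) := Real.rpow_pos_of_pos hR0 _
    rw [e2] at e1
    rw [abs_of_nonneg (by linarith)]
    have e7 : ((R 0)⁻¹ - 1 / √2) * ((R 0)⁻¹ + 1 / √2) = ε / (σ + 1) * R 0 ^ (2 * σ - 2) := by
      linear_combination e1 - e5
    have e8 : 1 ≤ (R 0)⁻¹ + 1 / √2 := by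
      have : √2 / 2 = 1 / √2 := by
        rw [div_eq_div_iff (by norm_num) (by positivity)]
        linear_combination sqrt_two_sq
      linarith
    calc (R 0)⁻¹ - 1 / √2 ≤ ((R 0)⁻¹ - 1 / √2) * ((R 0)⁻¹ + 1 / √2) :=
          le_mul_of_one_le_right (by linarith) e8
      _ = ε / (σ + 1) * R 0 ^ (2 * σ - 2) := e7
      _ ≤ ε / (σ + 1) * √2 ^ (2 * σ - 2) := by gcongr
      _ = C1 * ε := by rw [hC1]; ring
  refine ⟨h0.trans (by nlinarith), fun y => ?_⟩
  rw [(h.recip_duhamel hσ y).1, inv_Q_eq]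
  have hF : ∀ z, |ε * ((σ - 1) / (σ + 1)) * (R z ^ (2 * σ) / R z)| ≤ C2 * ε := fun z => by
    have hRz := h.pos z
    have e2 : R z ^ (2 * σ) / R z = R z ^ (2 * σ - 1) := by
      rw [Real.rpow_sub hRz, Real.rpow_one]
    rw [e2, abs_of_nonneg (mul_nonneg (by positivity) (Real.rpow_pos_of_pos hRz _).le)]
    calc ε * ((σ - 1) / (σ + 1)) * R z ^ (2 * σ - 1)
        ≤ ε * ((σ - 1) / (σ + 1)) * √2 ^ (2 * σ - 1) := by
          have ht : 0 ≤ 2 * σ - 1 := by linarith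
          exact mul_le_mul_of_nonneg_left ((h.rpow_le hσ hε ht z).trans (Q_rpow_le ht z))
            (by positivity)
      _ = C2 * ε := by rw [hC2]; ring
  have h1 := abs_integral_kernel_le abs_sinh_le_cosh hF y
  have hch := Real.cosh_pos y
  set I := ∫ z in (0 : ℝ)..y, Real.sinh (y - z) * (ε * ((σ - 1) / (σ + 1)) * (R z ^ (2 * σ) / R z))
  calc |Real.cosh y * (R 0)⁻¹ + I - Real.cosh y * (1 / √2)|
      = |Real.cosh y * ((R 0)⁻¹ - 1 / √2) + I| := by congr 1; ring
    _ ≤ |Real.cosh y * ((R 0)⁻¹ - 1 / √2)| + |I| := abs_add_le _ _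
    _ ≤ Real.cosh y * (C1 * ε) + C2 * ε * Real.cosh y := by
        rw [abs_mul, abs_of_pos hch]; gcongr
    _ = _ := by ring

/-- Powers of the soliton are powers of `Q`, up to a relative error `O(ε)`. -/
theorem exists_rpow_bound (hσ : 1 < σ) : ∃ ε₀, 0 < ε₀ ∧ ∀ t : ℝ, ∃ C, 0 < C ∧ ∀ ε R, 0 < ε →
    ε ≤ ε₀ → IsProfile σ ε R → ∀ y, |R y ^ t - Q y ^ t| ≤ C * ε * Q y ^ t := by
  obtain ⟨C, hC, hb⟩ := exists_recip_bound_zero hσ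
  refine ⟨1 / (√2 * C), by positivity, fun t => ⟨2 * |t| * Real.exp |t| * (√2 * C) + 1,
    by positivity, fun ε R hε hε0 h y => ?_⟩⟩
  have hQ := Q_pos y
  have hR := h.pos y
  have hle := h.le_Q hσ hε y
  have h1 := (hb ε R hε h).2 y
  have hz : √2 * C * ε ≤ 1 := by
    rw [le_div_iff₀ (by positivity)] at hε0; linarith
  -- `1 - R/Q = (R/Q) (Q/R - 1)` is controlled by the zeroth order estimate
  have h2 : Q y / R y - 1 ≤ √2 * C * ε := by
    have h3 := abs_Q_mul_le h1
    have : Q y * ((R y)⁻¹ - (Q y)⁻¹) = Q y / R y - 1 := by field_simp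
    rw [this] at h3
    linarith [le_abs_self (Q y / R y - 1)]
  have h4 : R y / Q y ≤ 1 := (div_le_one hQ).2 hle
  have h5 : 1 - R y / Q y ≤ √2 * C * ε := by
    have : 1 - R y / Q y = R y / Q y * (Q y / R y - 1) := by field_simp
    rw [this]
    have h6 : 0 ≤ Q y / R y - 1 := by rw [sub_nonneg, one_le_div hR]; exact hle
    exact (mul_le_of_le_one_left h6 h4).trans h2
  have h7 : 1 / 2 ≤ R y / Q y := by
    rw [div_le_div_iff₀ (by norm_num) hQ]
    have : Q y / R y ≤ 2 := by linarith
    rw [div_le_iff₀ hR] at this; linarith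
  have h8 := abs_rpow_sub_one_le t h7 h4
  rw [Real.div_rpow hR.le hQ.le] at h8
  have hQt := Q_rpow_pos t y
  have h9 : R y ^ t - Q y ^ t = Q y ^ t * (R y ^ t / Q y ^ t - 1) := by field_simp
  rw [h9, abs_mul, abs_of_pos hQt]
  have hnn : 0 ≤ 2 * |t| * Real.exp |t| := by positivity
  calc Q y ^ t * |R y ^ t / Q y ^ t - 1|
      ≤ Q y ^ t * (2 * |t| * Real.exp |t| * (√2 * C * ε)) := by
        gcongr; exact h8.trans (by gcongr)
    _ ≤ _ := by nlinarith [mul_pos hε hQt]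

/-- First order estimate for the soliton: `1/R = 1/Q + ε v₁ + O(ε² cosh)` where `v₁ = -D⁰/Q²`,
and likewise for the derivative. -/
theorem exists_recip_bound_one (hσ : 1 < σ) : ∃ ε₀, 0 < ε₀ ∧ ∃ C, 0 < C ∧ ∀ ε R, 0 < ε →
    ε ≤ ε₀ → IsProfile σ ε R → ∀ y,
    |(R y)⁻¹ - (Q y)⁻¹ - ε * recipVar σ y| ≤ C * ε ^ 2 * Real.cosh y ∧
    |recipDeriv R y - Real.sinh y * (1 / √2) - ε * recipVarDeriv σ y|
      ≤ C * ε ^ 2 * Real.cosh y := by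
  have hσ1 : 0 < σ + 1 := by linarith
  have hc : 0 < (σ - 1) / (σ + 1) := div_pos (by linarith) (by linarith)
  obtain ⟨C0, hC0, hb0⟩ := exists_recip_bound_zero hσ
  obtain ⟨ε₀, hε₀, hpow⟩ := exists_rpow_bound hσ
  obtain ⟨K1, hK1, hp1⟩ := hpow (2 * σ - 1)
  obtain ⟨K2, hK2, hp2⟩ := hpow (2 * σ - 2)
  set q1 : ℝ := √2 ^ (2 * σ - 1) with hq1
  set q2 : ℝ := √2 ^ (2 * σ - 2) with hq2
  have pq1 : 0 < q1 := by positivity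
  have pq2 : 0 < q2 := by positivity
  set B1 := 1 / (σ + 1) * (K2 * q2) + 1 / (σ + 1) * q2 * C0 with hB1
  set B2 := (σ - 1) / (σ + 1) * (K1 * q1) with hB2
  have pB1 : 0 < B1 := by positivity
  have pB2 : 0 < B2 := by positivity
  refine ⟨ε₀, hε₀, B1 + B2, by positivity, fun ε R hε hεle h => ?_⟩
  have hR0 := h.pos 0
  have hs2 : 1 ≤ √2 := Real.one_le_sqrt.2 (by norm_num)
  have hs : √2 / 2 = 1 / √2 := by
    rw [div_eq_div_iff (by norm_num) (by positivity)]
    linear_combination sqrt_two_sq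
  have h0 : |(R 0)⁻¹ - 1 / √2 - ε * recipVar σ 0| ≤ B1 * ε ^ 2 := by
    have e1 := h.zero_eq
    have e2 : R 0 ^ (2 * σ) / R 0 ^ 2 = R 0 ^ (2 * σ - 2) := by
      rw [Real.rpow_sub hR0]; norm_cast
    have e3 : √2 ^ (2 * σ) = q2 * 2 := by
      rw [hq2, Real.rpow_sub (by positivity), Real.rpow_two, sqrt_two_sq]; ring
    have e4 : recipVar σ 0 * √2 = q2 / (σ + 1) := by
      rw [recipVar_zero hσ, e3]; field_simp
    have e5 : (1 / √2) ^ 2 = (1 : ℝ) / 2 := by rw [div_pow, sqrt_two_sq]; norm_num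
    have e6 : |R 0 ^ (2 * σ - 2) - q2| ≤ K2 * q2 * ε := by
      have := hp2 ε R hε hεle h 0
      rw [Q_zero] at this
      linarith
    have e7 := (hb0 ε R hε h).1
    have e9 : 1 / √2 ≤ (R 0)⁻¹ := by
      have := h.recip_ge hσ hε 0
      rwa [Q_zero, ← one_div √2] at this
    rw [e2] at e1
    set x := (R 0)⁻¹ - 1 / √2 - ε * recipVar σ 0 with hx
    have hsum : 1 ≤ (R 0)⁻¹ + 1 / √2 := by linarith
    -- multiply by `v(0) + 1/√2` and use the equation satisfied by `v(0)²`
    have e8 : x * ((R 0)⁻¹ + 1 / √2) = ε / (σ + 1) * (R 0 ^ (2 * σ - 2) - q2)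
        - ε * recipVar σ 0 * ((R 0)⁻¹ - 1 / √2) := by
      have : ε * recipVar σ 0 * (2 * (1 / √2)) = ε / (σ + 1) * q2 := by
        rw [← hs]; linear_combination ε * e4
      rw [hx]
      linear_combination e1 - e5 - this
    have e10 : |recipVar σ 0| ≤ 1 / (σ + 1) * q2 := by
      have : 0 ≤ recipVar σ 0 := by rw [recipVar_zero hσ]; positivity
      rw [abs_of_nonneg this]
      calc recipVar σ 0 ≤ recipVar σ 0 * √2 := le_mul_of_one_le_right this hs2
        _ = _ := by rw [e4]; ring
    calc |x| ≤ |x| * |(R 0)⁻¹ + 1 / √2| :=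
          le_mul_of_one_le_right (abs_nonneg x) (hsum.trans (le_abs_self _))
      _ = |ε / (σ + 1) * (R 0 ^ (2 * σ - 2) - q2) - ε * recipVar σ 0 * ((R 0)⁻¹ - 1 / √2)| := by
          rw [← abs_mul, e8]
      _ ≤ ε / (σ + 1) * (K2 * q2 * ε) + ε * (1 / (σ + 1) * q2) * (C0 * ε) := by
          refine (abs_sub _ _).trans (add_le_add ?_ ?_)
          · rw [abs_mul, abs_of_pos (by positivity)]; gcongr
          · rw [abs_mul, abs_mul, abs_of_pos hε]; gcongr
      _ = B1 * ε ^ 2 := by rw [hB1]; ring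
  have hF : ∀ z, |ε * ((σ - 1) / (σ + 1)) * (R z ^ (2 * σ) / R z)
      - ε * ((σ - 1) / (σ + 1) * (Q z ^ (2 * σ) / Q z))| ≤ B2 * ε ^ 2 := fun z => by
    have hRz := h.pos z
    have e2 : R z ^ (2 * σ) / R z = R z ^ (2 * σ - 1) := by
      rw [Real.rpow_sub hRz, Real.rpow_one]
    rw [e2, ← Q_rpow_sub_one, ← mul_assoc, ← mul_sub, abs_mul, abs_of_pos (by positivity)]
    calc ε * ((σ - 1) / (σ + 1)) * |R z ^ (2 * σ - 1) - Q z ^ (2 * σ - 1)|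
        ≤ ε * ((σ - 1) / (σ + 1)) * (K1 * ε * q1) := by
          gcongr
          refine (hp1 ε R hε hεle h z).trans ?_
          gcongr
          exact Q_rpow_le (by linarith) z
      _ = _ := by rw [hB2]; ring
  intro y
  have hch := Real.cosh_pos y
  have cF : Continuous fun z => ε * ((σ - 1) / (σ + 1)) * (R z ^ (2 * σ) / R z) :=
    ((h.continuous_rpow (2 * σ)).div₀ h.continuous fun y => (h.pos y).ne').const_mul _
  have cG : Continuous fun z => (σ - 1) / (σ + 1) * (Q z ^ (2 * σ) / Q z) :=
    (continuous_Q_rpow_div_Q σ).const_mul _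
  have hd := duhamel_cosh (hasDerivAt_recipVar hσ) (hasDerivAt_recipVarDeriv hσ) cG y
  rw [recipVarDeriv_zero] at hd
  have hexp : ∀ K : ℝ → ℝ, ε * ∫ z in (0 : ℝ)..y, K (y - z) *
      ((σ - 1) / (σ + 1) * (Q z ^ (2 * σ) / Q z)) = ∫ z in (0 : ℝ)..y, K (y - z) *
      (ε * ((σ - 1) / (σ + 1) * (Q z ^ (2 * σ) / Q z))) := fun K => by
    rw [← intervalIntegral.integral_const_mul]; congr 1; funext z; ring
  constructor
  · have h1 := abs_integral_kernel_le abs_sinh_le_cosh hF y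
    rw [← integral_kernel_sub Real.continuous_sinh cF (cG.const_mul ε), ← hexp] at h1
    rw [(h.recip_duhamel hσ y).1, inv_Q_eq, hd.1]
    set I := ∫ z in (0 : ℝ)..y, Real.sinh (y - z) *
      (ε * ((σ - 1) / (σ + 1)) * (R z ^ (2 * σ) / R z))
    set J := ∫ z in (0 : ℝ)..y, Real.sinh (y - z) * ((σ - 1) / (σ + 1) * (Q z ^ (2 * σ) / Q z))
    calc _ = |Real.cosh y * ((R 0)⁻¹ - 1 / √2 - ε * recipVar σ 0) + (I - ε * J)| := by
          congr 1; ring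
      _ ≤ |Real.cosh y * ((R 0)⁻¹ - 1 / √2 - ε * recipVar σ 0)| + |I - ε * J| := abs_add_le _ _
      _ ≤ Real.cosh y * (B1 * ε ^ 2) + B2 * ε ^ 2 * Real.cosh y := by
          rw [abs_mul, abs_of_pos hch]; gcongr
      _ = _ := by ring
  · have h1 := abs_integral_kernel_le (K := Real.cosh)
      (fun t => (abs_of_pos (Real.cosh_pos t)).le) hF y
    rw [← integral_kernel_sub Real.continuous_cosh cF (cG.const_mul ε), ← hexp] at h1
    rw [(h.recip_duhamel hσ y).2, hd.2]
    set I := ∫ z in (0 : ℝ)..y, Real.cosh (y - z) *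
      (ε * ((σ - 1) / (σ + 1)) * (R z ^ (2 * σ) / R z))
    set J := ∫ z in (0 : ℝ)..y, Real.cosh (y - z) * ((σ - 1) / (σ + 1) * (Q z ^ (2 * σ) / Q z))
    calc _ = |Real.sinh y * ((R 0)⁻¹ - 1 / √2 - ε * recipVar σ 0) + (I - ε * J)| := by
          congr 1; ring
      _ ≤ |Real.sinh y * ((R 0)⁻¹ - 1 / √2 - ε * recipVar σ 0)| + |I - ε * J| := abs_add_le _ _
      _ ≤ Real.cosh y * (B1 * ε ^ 2) + B2 * ε ^ 2 * Real.cosh y := by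
          rw [abs_mul]; gcongr; exact abs_sinh_le_cosh y
      _ = _ := by ring

end

/-! ### The coupled system and its image under `(S*)²` -/

/-- The logarithmic derivative `R'/R`. -/
noncomputable def logD (R : ℝ → ℝ) (y : ℝ) : ℝ := deriv R y / R y

/-- The potential `g(ωR²)/ω = ε R^(2σ)`. -/
noncomputable def pot (σ ε : ℝ) (R : ℝ → ℝ) (y : ℝ) : ℝ := ε * R y ^ (2 * σ)

/-- `(f₁, f₂)` solves `M₊ f₁ = μ f₂`, `M₋ f₂ = μ f₁`. Here `a⁺ = (1 - 2/(σ+1)) ε R^(2σ)` and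
`a⁻ = (5 - 6/(σ+1) - 2σ) ε R^(2σ)`. -/
structure IsCoupled (σ ε : ℝ) (R : ℝ → ℝ) (μ : ℝ) (f₁ f₂ : ℝ → ℝ) : Prop where
  hd₁ : ∀ y, HasDerivAt f₁ (deriv f₁ y) y
  hd₂ : ∀ y, HasDerivAt f₂ (deriv f₂ y) y
  hdd₁ : ∀ y, HasDerivAt (deriv f₁)
    ((1 + (1 - 2 * (σ + 1)⁻¹) * pot σ ε R y) * f₁ y - μ * f₂ y) y
  hdd₂ : ∀ y, HasDerivAt (deriv f₂)
    ((1 + (5 - 6 * (σ + 1)⁻¹ - 2 * σ) * pot σ ε R y) * f₂ y - μ * f₁ y) y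

/-- `(S*)² f₁`, written without second derivatives by means of the coupled system. -/
noncomputable def modeOne (σ ε : ℝ) (R : ℝ → ℝ) (μ : ℝ) (f₁ f₂ : ℝ → ℝ) (y : ℝ) : ℝ :=
  (2 + (1 - 2 * (σ + 1)⁻¹) * pot σ ε R y - R y ^ 2 - pot σ ε R y) * f₁ y
    + 2 * logD R y * deriv f₁ y - μ * f₂ y

/-- The derivative of `modeOne`. -/
noncomputable def modeOneDeriv (σ ε : ℝ) (R : ℝ → ℝ) (μ : ℝ) (f₁ f₂ : ℝ → ℝ) (y : ℝ) : ℝ :=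
  2 * logD R y * (1 - R y ^ 2 - pot σ ε R y) * f₁ y - 2 * logD R y * μ * f₂ y
    + 2 * (1 - R y ^ 2 - pot σ ε R y) * deriv f₁ y - μ * deriv f₂ y

/-- `μ⁻¹ L₊ (S*)² f₁`, written without second derivatives by means of the coupled system. -/
noncomputable def modeTwo (σ ε : ℝ) (R : ℝ → ℝ) (μ : ℝ) (f₁ f₂ : ℝ → ℝ) (y : ℝ) : ℝ :=
  -μ * f₁ y + (2 + 2 * (1 - 2 * (σ + 1)⁻¹) * pot σ ε R y) * f₂ y + 2 * logD R y * deriv f₂ y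

/-- The derivative of `modeTwo`. -/
noncomputable def modeTwoDeriv (σ ε : ℝ) (R : ℝ → ℝ) (μ : ℝ) (f₁ f₂ : ℝ → ℝ) (y : ℝ) : ℝ :=
  -2 * logD R y * μ * f₁ y + (2 + 2 * (1 - 2 * (σ + 1)⁻¹) * pot σ ε R y) * logD R y * f₂ y
    - μ * deriv f₁ y + (2 - 2 * (σ + 1)⁻¹ * pot σ ε R y - R y ^ 2) * deriv f₂ y

section
variable {σ ε μ : ℝ} {R f₁ f₂ : ℝ → ℝ}

theorem IsProfile.hasDerivAt_logD (h : IsProfile σ ε R) (y : ℝ) :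
    HasDerivAt (logD R) (1 - R y ^ 2 - pot σ ε R y - logD R y ^ 2) y := by
  have hR := (h.pos y).ne'
  refine ((h.hasDerivAt_deriv y).fun_div (h.hasDerivAt y) hR).congr_deriv ?_
  rw [logD, pot]; field_simp

theorem IsProfile.hasDerivAt_sq (h : IsProfile σ ε R) (y : ℝ) :
    HasDerivAt (fun y => R y ^ 2) (2 * logD R y * R y ^ 2) y := by
  have hR := (h.pos y).ne'
  refine ((h.hasDerivAt y).fun_pow 2).congr_deriv ?_
  rw [logD]; field_simp; norm_num; ring

theorem IsProfile.hasDerivAt_pot (h : IsProfile σ ε R) (y : ℝ) :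
    HasDerivAt (pot σ ε R) (2 * σ * logD R y * pot σ ε R y) y := by
  refine ((hasDerivAt_comp_rpow (t := 2 * σ) (h.hasDerivAt y) (h.pos y)).const_mul ε).congr_deriv ?_
  rw [logD, pot]; ring

theorem IsProfile.deriv_eq (h : IsProfile σ ε R) (y : ℝ) : deriv R y = logD R y * R y := by
  rw [logD, div_mul_cancel₀ _ (h.pos y).ne']

theorem IsProfile.logD_sq (hσ : 1 < σ) (h : IsProfile σ ε R) (y : ℝ) :
    logD R y ^ 2 = 1 - R y ^ 2 / 2 - (σ + 1)⁻¹ * pot σ ε R y := by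
  have hR := (h.pos y).ne'
  have : σ + 1 ≠ 0 := by linarith
  rw [logD, pot, div_pow, h.energy]
  field_simp

theorem hasDerivAt_modeOne (hσ : 1 < σ) (h : IsProfile σ ε R) (hf : IsCoupled σ ε R μ f₁ f₂)
    (y : ℝ) : HasDerivAt (modeOne σ ε R μ f₁ f₂) (modeOneDeriv σ ε R μ f₁ f₂ y) y := by
  have hp := h.logD_sq hσ y
  have ht : σ * (σ + 1)⁻¹ - 1 + (σ + 1)⁻¹ = 0 := by
    have : σ + 1 ≠ 0 := by linarith
    field_simp; ring
  have hd := (((((((h.hasDerivAt_pot y).const_mul (1 - 2 * (σ + 1)⁻¹)).const_add 2).fun_sub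
    (h.hasDerivAt_sq y)).fun_sub (h.hasDerivAt_pot y)).fun_mul (hf.hd₁ y)).fun_add
    (((h.hasDerivAt_logD y).const_mul 2).fun_mul (hf.hdd₁ y))).fun_sub ((hf.hd₂ y).const_mul μ)
  refine hd.congr_deriv ?_
  rw [modeOneDeriv]
  linear_combination (-2 * deriv f₁ y) * hp + (-4 * f₁ y * logD R y * pot σ ε R y) * ht

theorem hasDerivAt_modeTwo (hσ : 1 < σ) (h : IsProfile σ ε R) (hf : IsCoupled σ ε R μ f₁ f₂)
    (y : ℝ) : HasDerivAt (modeTwo σ ε R μ f₁ f₂) (modeTwoDeriv σ ε R μ f₁ f₂ y) y := by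
  have hp := h.logD_sq hσ y
  have ht : σ * (σ + 1)⁻¹ - 1 + (σ + 1)⁻¹ = 0 := by
    have : σ + 1 ≠ 0 := by linarith
    field_simp; ring
  have hd := (((hf.hd₁ y).const_mul (-μ)).fun_add
    ((((h.hasDerivAt_pot y).const_mul (2 * (1 - 2 * (σ + 1)⁻¹))).const_add 2).fun_mul
      (hf.hd₂ y))).fun_add (((h.hasDerivAt_logD y).const_mul 2).fun_mul (hf.hdd₂ y))
  refine hd.congr_deriv ?_
  rw [modeTwoDeriv]
  linear_combination (-2 * deriv f₂ y) * hp + (-8 * f₂ y * logD R y * pot σ ε R y) * ht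

/-- `L₊ V₁ = μ V₂`. -/
theorem hasDerivAt_modeOneDeriv (hσ : 1 < σ) (h : IsProfile σ ε R)
    (hf : IsCoupled σ ε R μ f₁ f₂) (y : ℝ) :
    HasDerivAt (modeOneDeriv σ ε R μ f₁ f₂)
      ((1 - 3 * R y ^ 2 - (1 + 2 * σ) * pot σ ε R y) * modeOne σ ε R μ f₁ f₂ y
        - μ * modeTwo σ ε R μ f₁ f₂ y) y := by
  have hp := h.logD_sq hσ y
  have hK := ((h.hasDerivAt_sq y).const_sub 1).fun_sub (h.hasDerivAt_pot y)
  have hd := ((((((h.hasDerivAt_logD y).const_mul 2).fun_mul hK).fun_mul (hf.hd₁ y)).fun_sub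
    ((((h.hasDerivAt_logD y).const_mul 2).mul_const μ).fun_mul (hf.hd₂ y))).fun_add
    ((hK.const_mul 2).fun_mul (hf.hdd₁ y))).fun_sub ((hf.hdd₂ y).const_mul μ)
  refine hd.congr_deriv ?_
  rw [modeOne, modeTwo]
  linear_combination (-2 * f₁ y - 4 * σ * f₁ y * pot σ ε R y - 2 * f₁ y * R y ^ 2
    + 2 * f₁ y * pot σ ε R y + 2 * μ * f₂ y) * hp

/-- `L₋ V₂ = μ V₁`, with `L₋ = -∂² + 1 - R² - ε R^(2σ)`. -/
theorem hasDerivAt_modeTwoDeriv (hσ : 1 < σ) (h : IsProfile σ ε R)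
    (hf : IsCoupled σ ε R μ f₁ f₂) (y : ℝ) :
    HasDerivAt (modeTwoDeriv σ ε R μ f₁ f₂)
      ((1 - R y ^ 2 - pot σ ε R y) * modeTwo σ ε R μ f₁ f₂ y
        - μ * modeOne σ ε R μ f₁ f₂ y) y := by
  have hp := h.logD_sq hσ y
  have ht : σ * (σ + 1)⁻¹ - 1 + (σ + 1)⁻¹ = 0 := by
    have : σ + 1 ≠ 0 := by linarith
    field_simp; ring
  have hw := h.hasDerivAt_pot y
  have hd := ((((((h.hasDerivAt_logD y).const_mul (-2)).mul_const μ).fun_mul (hf.hd₁ y)).fun_add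
    ((((hw.const_mul (2 * (1 - 2 * (σ + 1)⁻¹))).const_add 2).fun_mul
      (h.hasDerivAt_logD y)).fun_mul (hf.hd₂ y))).fun_sub ((hf.hdd₁ y).const_mul μ)).fun_add
    ((((hw.const_mul (2 * (σ + 1)⁻¹)).const_sub 2).fun_sub (h.hasDerivAt_sq y)).fun_mul
      (hf.hdd₂ y))
  refine hd.congr_deriv ?_
  rw [modeOne, modeTwo]
  set w := pot σ ε R y
  set t := (σ + 1)⁻¹
  linear_combination (2 * f₁ y * μ - 2 * f₂ y - 8 * f₂ y * σ * t * w + 4 * f₂ y * σ * w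
    + 4 * f₂ y * t * w - 2 * f₂ y * w) * hp + (8 * f₂ y * t * w ^ 2 + 4 * f₂ y * R y ^ 2 * w
    - 8 * f₂ y * w - 4 * deriv f₂ y * logD R y * w) * ht

theorem Sstar_eq (h : IsProfile σ ε R) {f : ℝ → ℝ} {f' y : ℝ} (hf : HasDerivAt f f' y) :
    Sstar R f y = -(f' + logD R y * f y) := by
  have hR := (h.pos y).ne'
  rw [Sstar, ((h.hasDerivAt y).fun_mul hf).deriv, logD]
  field_simp
  ring

theorem firstComponent_eq (h : IsProfile σ ε R) (hf : IsCoupled σ ε R μ f₁ f₂) :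
    firstComponent R f₁ = modeOne σ ε R μ f₁ f₂ := by
  have e1 : Sstar R f₁ = fun y => -(deriv f₁ y + logD R y * f₁ y) :=
    funext fun y => Sstar_eq h (hf.hd₁ y)
  funext y
  have hd := ((hf.hdd₁ y).fun_add ((h.hasDerivAt_logD y).fun_mul (hf.hd₁ y))).fun_neg
  rw [firstComponent, e1, Sstar_eq h hd, modeOne]
  ring

theorem deriv_deriv_eq {u u' u'' : ℝ → ℝ} (h1 : ∀ y, HasDerivAt u (u' y) y)
    (h2 : ∀ y, HasDerivAt u' (u'' y) y) (y : ℝ) : deriv (deriv u) y = u'' y := by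
  have : deriv u = u' := funext fun y => (h1 y).deriv
  rw [this, (h2 y).deriv]

end

section
variable {σ a ω μ : ℝ} {R f₁ f₂ : ℝ → ℝ}

theorem hasDerivAt_powerNL (a σ : ℝ) {s : ℝ} (hs : 0 < s) :
    HasDerivAt (powerNL a σ) (a * σ * s ^ (σ - 1)) s := by
  have := (Real.hasDerivAt_rpow_const (p := σ) (Or.inl hs.ne')).const_mul a
  exact this.congr_deriv (by ring)

theorem deriv_powerNL_soliton (hω : 0 < ω) {r : ℝ} (hr : 0 < r) :
    deriv (powerNL a σ) (ω * r ^ 2) = a * ω ^ (σ - 1) * σ * r ^ (2 * σ - 2) := by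
  rw [(hasDerivAt_powerNL a σ (by positivity)).deriv, Real.mul_rpow hω.le (by positivity),
    show 2 * σ - 2 = 2 * (σ - 1) by ring, Real.rpow_mul hr.le, Real.rpow_two]
  ring

theorem deriv_deriv_powerNL_soliton (hω : 0 < ω) {r : ℝ} (hr : 0 < r) :
    ω * r ^ 2 * deriv (deriv (powerNL a σ)) (ω * r ^ 2)
      = a * ω ^ (σ - 1) * σ * (σ - 1) * r ^ (2 * σ - 2) := by
  have hs : 0 < ω * r ^ 2 := by positivity
  have e : deriv (powerNL a σ) =ᶠ[𝓝 (ω * r ^ 2)] fun s => a * σ * s ^ (σ - 1) := by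
    filter_upwards [lt_mem_nhds hs] with s hs
    exact (hasDerivAt_powerNL a σ hs).deriv
  have h2 := (Real.hasDerivAt_rpow_const (p := σ - 1) (Or.inl hs.ne')).const_mul (a * σ)
  rw [e.deriv_eq, h2.deriv, Real.rpow_sub_one hs.ne' (σ - 1), Real.mul_rpow hω.le (by positivity),
    show 2 * σ - 2 = 2 * (σ - 1) by ring, Real.rpow_mul hr.le, Real.rpow_two]
  field_simp

theorem primitive_powerNL_soliton (hσ : 1 < σ) (hω : 0 < ω) {r : ℝ} (hr : 0 < r) :
    primitive (powerNL a σ) (ω * r ^ 2) / (ω ^ 2 * r ^ 2)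
      = a * ω ^ (σ - 1) * (σ + 1)⁻¹ * r ^ (2 * σ) := by
  have hs : 0 < ω * r ^ 2 := by positivity
  have : σ + 1 ≠ 0 := by linarith
  have e : primitive (powerNL a σ) (ω * r ^ 2) = a * ((ω * r ^ 2) ^ (σ + 1) / (σ + 1)) := by
    simp only [primitive, powerNL]
    rw [intervalIntegral.integral_const_mul, integral_rpow (Or.inl (by linarith)),
      Real.zero_rpow this]
    ring
  rw [e, Real.rpow_add_one hs.ne', Real.mul_rpow hω.le (by positivity), Real.rpow_sub_one hω.ne',
    Real.rpow_mul hr.le, Real.rpow_two]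
  field_simp

theorem aPlus_eq (hσ : 1 < σ) (hω : 0 < ω) (hR : ∀ y, 0 < R y) (y : ℝ) :
    aPlus (powerNL a σ) ω R y = (1 - 2 * (σ + 1)⁻¹) * pot σ (a * ω ^ (σ - 1)) R y := by
  rw [aPlus, powerNL_soliton hω (hR y), primitive_powerNL_soliton hσ hω (hR y), pot]
  ring

theorem sq_mul_deriv_powerNL (hω : 0 < ω) {r : ℝ} (hr : 0 < r) :
    2 * r ^ 2 * deriv (powerNL a σ) (ω * r ^ 2)
      = 2 * σ * (a * ω ^ (σ - 1) * r ^ (2 * σ)) := by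
  rw [deriv_powerNL_soliton hω hr, Real.rpow_sub hr, Real.rpow_two]
  field_simp

theorem aMinus_eq (hσ : 1 < σ) (hω : 0 < ω) (hR : ∀ y, 0 < R y) (y : ℝ) :
    aMinus (powerNL a σ) ω R y
      = (5 - 6 * (σ + 1)⁻¹ - 2 * σ) * pot σ (a * ω ^ (σ - 1)) R y := by
  rw [aMinus, powerNL_soliton hω (hR y), primitive_powerNL_soliton hσ hω (hR y),
    sq_mul_deriv_powerNL hω (hR y), pot]
  ring

theorem isCoupled_of_eq (hσ : 1 < σ) (hω : 0 < ω) (hR : ∀ y, 0 < R y)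
    (c₁ : ContDiff ℝ (⊤ : ℕ∞) f₁) (c₂ : ContDiff ℝ (⊤ : ℕ∞) f₂)
    (e₁ : ∀ y, Mplus (powerNL a σ) ω R f₁ y = μ * f₂ y)
    (e₂ : ∀ y, Mminus (powerNL a σ) ω R f₂ y = μ * f₁ y) :
    IsCoupled σ (a * ω ^ (σ - 1)) R μ f₁ f₂ := by
  have hd : ∀ f : ℝ → ℝ, ContDiff ℝ (⊤ : ℕ∞) f → (∀ y, HasDerivAt f (deriv f y) y) ∧
      ∀ y, HasDerivAt (deriv f) (deriv (deriv f) y) y := fun f hf => by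
    have h2 := contDiff_infty_iff_deriv.1 hf
    have h3 := contDiff_infty_iff_deriv.1 h2.2
    exact ⟨fun y => (h2.1 y).hasDerivAt, fun y => (h3.1 y).hasDerivAt⟩
  refine ⟨(hd f₁ c₁).1, (hd f₂ c₂).1, fun y => ?_, fun y => ?_⟩
  · refine ((hd f₁ c₁).2 y).congr_deriv ?_
    have := e₁ y
    rw [Mplus, aPlus_eq hσ hω hR] at this
    linarith
  · refine ((hd f₂ c₂).2 y).congr_deriv ?_
    have := e₂ y
    rw [Mminus, aMinus_eq hσ hω hR] at this
    linarith

theorem secondComponent_eq (hσ : 1 < σ) (hω : 0 < ω) (hμ : μ ≠ 0)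
    (h : IsProfile σ (a * ω ^ (σ - 1)) R) (hf : IsCoupled σ (a * ω ^ (σ - 1)) R μ f₁ f₂) :
    secondComponent (powerNL a σ) ω R μ f₁ = modeTwo σ (a * ω ^ (σ - 1)) R μ f₁ f₂ := by
  funext y
  rw [secondComponent, firstComponent_eq h hf, Lplus,
    deriv_deriv_eq (hasDerivAt_modeOne hσ h hf) (hasDerivAt_modeOneDeriv hσ h hf),
    powerNL_soliton hω (h.pos y), sq_mul_deriv_powerNL hω (h.pos y)]
  have e : a * ω ^ (σ - 1) * R y ^ (2 * σ) = pot σ (a * ω ^ (σ - 1)) R y := rfl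
  rw [e]
  field_simp
  ring

end

/-! ### The internal mode: a priori estimates -/

/-- The coefficient `(a⁺ + a⁻)/(2 ε R^(2σ))`. -/
noncomputable def coef1 (σ : ℝ) : ℝ := -((σ - 1) ^ 2 / (σ + 1))

/-- The coefficient `(a⁺ - a⁻)/(2 ε R^(2σ))`. -/
noncomputable def coef2 (σ : ℝ) : ℝ := σ * (σ - 1) / (σ + 1)

/-- The coupling term `ε R^(2σ) (c₁ s + c₂ d)`. -/
noncomputable def coupling (σ ε : ℝ) (R : ℝ → ℝ) (c₁ c₂ : ℝ) (s d : ℝ → ℝ) (y : ℝ) : ℝ :=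
  pot σ ε R y * (c₁ * s y + c₂ * d y)

section
variable {σ ε μ : ℝ} {R f₁ f₂ : ℝ → ℝ}

/-- Half sum and half difference of a solution of the coupled system. -/
theorem IsCoupled.half_sum (hσ : 1 < σ) (hf : IsCoupled σ ε R μ f₁ f₂) (y : ℝ) :
    HasDerivAt (fun y => (f₁ y + f₂ y) / 2) ((deriv f₁ y + deriv f₂ y) / 2) y ∧
    HasDerivAt (fun y => (deriv f₁ y + deriv f₂ y) / 2)
      ((1 - μ) * ((f₁ y + f₂ y) / 2) + coupling σ ε R (coef1 σ) (coef2 σ)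
        (fun y => (f₁ y + f₂ y) / 2) (fun y => (f₁ y - f₂ y) / 2) y) y := by
  have : σ + 1 ≠ 0 := by linarith
  refine ⟨((hf.hd₁ y).fun_add (hf.hd₂ y)).div_const 2,
    (((hf.hdd₁ y).fun_add (hf.hdd₂ y)).div_const 2).congr_deriv ?_⟩
  rw [coupling, coef1, coef2]
  field_simp
  ring

theorem IsCoupled.half_diff (hσ : 1 < σ) (hf : IsCoupled σ ε R μ f₁ f₂) (y : ℝ) :
    HasDerivAt (fun y => (f₁ y - f₂ y) / 2) ((deriv f₁ y - deriv f₂ y) / 2) y ∧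
    HasDerivAt (fun y => (deriv f₁ y - deriv f₂ y) / 2)
      ((1 + μ) * ((f₁ y - f₂ y) / 2) + coupling σ ε R (coef2 σ) (coef1 σ)
        (fun y => (f₁ y + f₂ y) / 2) (fun y => (f₁ y - f₂ y) / 2) y) y := by
  have : σ + 1 ≠ 0 := by linarith
  refine ⟨((hf.hd₁ y).fun_sub (hf.hd₂ y)).div_const 2,
    (((hf.hdd₁ y).fun_sub (hf.hdd₂ y)).div_const 2).congr_deriv ?_⟩
  rw [coupling, coef1, coef2]
  field_simp
  ring

/-- A bound for the coefficients of the coupling terms. -/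
noncomputable def coefBound (σ : ℝ) : ℝ := |coef1 σ| + |coef2 σ|

theorem coefBound_pos (hσ : 1 < σ) : 0 < coefBound σ := by
  have h2 : 0 < coef2 σ := div_pos (by nlinarith) (by linarith)
  have := abs_pos.2 h2.ne'
  have := abs_nonneg (coef1 σ)
  unfold coefBound; linarith

theorem pot_pos (hε : 0 < ε) (h : IsProfile σ ε R) (y : ℝ) : 0 < pot σ ε R y :=
  mul_pos hε (Real.rpow_pos_of_pos (h.pos y) _)

theorem pot_le (hσ : 1 < σ) (hε : 0 < ε) (h : IsProfile σ ε R) (y : ℝ) :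
    pot σ ε R y ≤ ε * Q y ^ (2 * σ) :=
  mul_le_mul_of_nonneg_left (h.rpow_le hσ hε (by linarith) y) hε.le

theorem continuous_pot (h : IsProfile σ ε R) : Continuous (pot σ ε R) :=
  (h.continuous_rpow _).const_mul _

theorem continuous_coupling (h : IsProfile σ ε R) (c₁ c₂ : ℝ) {s d : ℝ → ℝ} (hs : Continuous s)
    (hd : Continuous d) : Continuous (coupling σ ε R c₁ c₂ s d) :=
  (continuous_pot h).mul ((hs.const_mul c₁).add (hd.const_mul c₂))

theorem abs_coupling_le (hσ : 1 < σ) (hε : 0 < ε) (h : IsProfile σ ε R) {c₁ c₂ : ℝ}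
    (hc : |c₁| + |c₂| ≤ coefBound σ) (s d : ℝ → ℝ) (y : ℝ) :
    |coupling σ ε R c₁ c₂ s d y| ≤ coefBound σ * ε * (Q y ^ (2 * σ) * (|s y| + |d y|)) := by
  rw [coupling, abs_mul, abs_of_pos (pot_pos hε h y)]
  have h1 : |c₁ * s y + c₂ * d y| ≤ coefBound σ * (|s y| + |d y|) := by
    refine (abs_add_le _ _).trans ?_
    rw [abs_mul, abs_mul]
    nlinarith [abs_nonneg c₁, abs_nonneg c₂, abs_nonneg (s y), abs_nonneg (d y),
      mul_nonneg (abs_nonneg c₁) (abs_nonneg (d y)), mul_nonneg (abs_nonneg c₂) (abs_nonneg (s y))]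
  calc pot σ ε R y * |c₁ * s y + c₂ * d y|
      ≤ (ε * Q y ^ (2 * σ)) * (coefBound σ * (|s y| + |d y|)) := by
        have := Q_rpow_pos (2 * σ) y
        exact mul_le_mul (pot_le hσ hε h y) h1 (abs_nonneg _) (by positivity)
    _ = _ := by ring

theorem coef_le₁ (σ : ℝ) : |coef1 σ| + |coef2 σ| ≤ coefBound σ := le_rfl

theorem coef_le₂ (σ : ℝ) : |coef2 σ| + |coef1 σ| ≤ coefBound σ := (add_comm _ _).le

end

theorem one_sub_exp_bounds {x : ℝ} (hx : 0 ≤ x) :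
    0 ≤ 1 - Real.exp (-x) ∧ 1 - Real.exp (-x) ≤ x ∧ x - x ^ 2 / 2 ≤ 1 - Real.exp (-x) := by
  refine ⟨by linarith [Real.exp_le_one_iff.2 (neg_nonpos.2 hx)],
    by linarith [Real.add_one_le_exp (-x)], ?_⟩
  have h1 := Real.quadratic_le_exp_of_nonneg hx
  have h2 : Real.exp x * Real.exp (-x) = 1 := by rw [← Real.exp_add]; simp
  have h3 := Real.exp_pos (-x)
  have h4 : Real.exp (-x) * (1 + x + x ^ 2 / 2) ≤ 1 := by nlinarith
  have h5 : 1 ≤ (1 - x + x ^ 2 / 2) * (1 + x + x ^ 2 / 2) := by nlinarith [sq_nonneg (x ^ 2)]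
  have h6 : 0 < 1 + x + x ^ 2 / 2 := by positivity
  have h7 : Real.exp (-x) ≤ 1 - x + x ^ 2 / 2 := by
    by_contra hcon
    push Not at hcon
    nlinarith
  linarith

section Kernel
variable {α : ℝ} {F : ℝ → ℝ}

/-- The kernel `(1 - e^{-αr})/(2α)` and its expansion at `α = 0`. -/
theorem smallKernel_bounds (hα : 0 < α) {r : ℝ} (hr : 0 ≤ r) :
    |(1 - Real.exp (-α * r)) / (2 * α)| ≤ r / 2 ∧
    |(1 - Real.exp (-α * r)) / (2 * α) - r / 2| ≤ α * r ^ 2 / 4 := by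
  obtain ⟨h1, h2, h3⟩ := one_sub_exp_bounds (mul_nonneg hα.le hr)
  rw [neg_mul]
  constructor
  · rw [abs_of_nonneg (by positivity), div_le_iff₀ (by positivity)]
    linarith
  · have : (1 - Real.exp (-(α * r))) / (2 * α) - r / 2
        = (1 - Real.exp (-(α * r)) - α * r) / (2 * α) := by field_simp
    rw [this, abs_div, abs_of_nonpos (by linarith), abs_of_pos (by positivity),
      div_le_iff₀ (by positivity)]
    nlinarith

/-- `green α F` plus the constant `1 + ∫ F / (2α)`, which vanishes under the normalization
`∫ F = -2α` of the internal mode. Unlike `green α F`, it stays bounded as `α → 0`. -/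
noncomputable def shiftedGreen (α : ℝ) (F : ℝ → ℝ) (y : ℝ) : ℝ :=
  1 + 1 / (2 * α) * (∫ z, F z) + green α F y

theorem shiftedGreen_eq {α : ℝ} (hα : 0 < α) {F : ℝ → ℝ} (hF : Integrable F) (y : ℝ) :
    Integrable (fun z => (1 - Real.exp (-α * |y - z|)) / (2 * α) * F z) ∧
    shiftedGreen α F y = 1 + ∫ z, (1 - Real.exp (-α * |y - z|)) / (2 * α) * F z := by
  have hi : Integrable fun z => Real.exp (-α * |y - z|) * F z := by
    refine hF.bdd_mul (c := 1) (by fun_prop) (ae_of_all _ fun z => ?_)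
    rw [Real.norm_eq_abs, abs_of_pos (Real.exp_pos _)]
    exact Real.exp_le_one_iff.2 (by nlinarith [abs_nonneg (y - z)])
  have e : (fun z => (1 - Real.exp (-α * |y - z|)) / (2 * α) * F z)
      = fun z => 1 / (2 * α) * F z - 1 / (2 * α) * (Real.exp (-α * |y - z|) * F z) := by
    funext z; ring
  rw [e]
  refine ⟨(hF.const_mul _).sub (hi.const_mul _), ?_⟩
  rw [integral_sub (hF.const_mul _) (hi.const_mul _), integral_const_mul, integral_const_mul,
    shiftedGreen, green_eq_integral hα.le hF]
  ring

theorem green_eq_one_add (hα : 0 < α) (hF : Integrable F) (hn : ∫ z, F z = -2 * α) (y : ℝ) :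
    Integrable (fun z => (1 - Real.exp (-α * |y - z|)) / (2 * α) * F z) ∧
    green α F y = 1 + ∫ z, (1 - Real.exp (-α * |y - z|)) / (2 * α) * F z := by
  obtain ⟨h1, h2⟩ := shiftedGreen_eq hα hF y
  refine ⟨h1, ?_⟩
  rw [← h2, shiftedGreen, hn]
  field_simp
  ring

theorem abs_green_le_integral {κ : ℝ} (hκ : 0 < κ) (hF : Integrable F) (y : ℝ) :
    |green κ F y| ≤ 1 / (2 * κ) * ∫ z, |F z| := by
  rw [green_eq_integral hκ.le hF, abs_mul, abs_neg, abs_of_pos (by positivity)]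
  gcongr
  refine norm_integral_le_of_norm_le (μ := volume) (f := fun z => Real.exp (-κ * |y - z|) * F z)
    hF.abs (ae_of_all _ fun z => ?_)
  rw [Real.norm_eq_abs, abs_mul, abs_of_pos (Real.exp_pos _)]
  exact mul_le_of_le_one_left (abs_nonneg _)
    (Real.exp_le_one_iff.2 (by nlinarith [abs_nonneg (y - z)]))

theorem abs_setIntegral_le {f g : ℝ → ℝ} {S : Set ℝ} (hS : MeasurableSet S)
    (hg : Integrable g) (h : ∀ z ∈ S, |f z| ≤ g z) : |∫ z in S, f z| ≤ ∫ z in S, g z :=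
  norm_integral_le_of_norm_le (μ := volume.restrict S) (f := f) hg.integrableOn
    ((ae_restrict_iff' hS).2 (ae_of_all _ h))

/-- Comparison of `greenDeriv α F` with its limit as `α → 0`. -/
theorem abs_greenDeriv_sub_le (hα : 0 < α) {G : ℝ → ℝ} (hF : Continuous F)
    (hiF : Integrable fun z => (1 + |z|) * |F z|) (hiG : Integrable G) (y : ℝ) :
    |greenDeriv α F y - greenDeriv 0 G y|
      ≤ 1 / 2 * ∫ z, (|F z - G z| + α * ((1 + |y|) * ((1 + |z|) * |F z|))) := by
  have h0 := (integrable_of_weight hF hiF).1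
  have hg : Integrable fun z => |F z - G z| + α * ((1 + |y|) * ((1 + |z|) * |F z|)) :=
    (h0.sub hiG).abs.add ((hiF.const_mul _).const_mul α)
  have key : ∀ {r : ℝ} (z : ℝ), 0 ≤ r → r ≤ (1 + |y|) * (1 + |z|) →
      |Real.exp (-α * r) * F z - G z| ≤ |F z - G z| + α * ((1 + |y|) * ((1 + |z|) * |F z|)) := by
    intro r z hr hr'
    obtain ⟨h1, h2, _⟩ := one_sub_exp_bounds (mul_nonneg hα.le hr)
    have e : Real.exp (-α * r) * F z - G z = (F z - G z) - (1 - Real.exp (-(α * r))) * F z := by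
      rw [neg_mul]; ring
    rw [e]
    refine (abs_sub _ _).trans ?_
    rw [abs_mul, abs_of_nonneg h1]
    have : (1 - Real.exp (-(α * r))) * |F z| ≤ α * ((1 + |y|) * (1 + |z|)) * |F z| := by
      gcongr
      exact h2.trans (by gcongr)
    linarith
  have hl : |leftConv α F y - leftConv 0 G y|
      ≤ ∫ z in Iic y, (|F z - G z| + α * ((1 + |y|) * ((1 + |z|) * |F z|))) := by
    have i1 : IntegrableOn (fun z => Real.exp (-α * (y - z)) * F z) (Iic y) := by
      refine Integrable.mono' h0.abs.integrableOn (by fun_prop)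
        ((ae_restrict_iff' measurableSet_Iic).2 (ae_of_all _ fun z hz => ?_))
      rw [Real.norm_eq_abs, abs_mul, abs_of_pos (Real.exp_pos _)]
      exact mul_le_of_le_one_left (abs_nonneg _)
        (Real.exp_le_one_iff.2 (by nlinarith [show z ≤ y from hz]))
    have e : leftConv 0 G y = ∫ z in Iic y, G z := by simp [leftConv]
    rw [e, leftConv, ← integral_sub i1 hiG.integrableOn]
    refine abs_setIntegral_le measurableSet_Iic hg fun z hz => key z (sub_nonneg.2 hz) ?_
    exact (le_abs_self _).trans (abs_sub_le_weight y z)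
  have hr : |rightConv α F y - rightConv 0 G y|
      ≤ ∫ z in Ioi y, (|F z - G z| + α * ((1 + |y|) * ((1 + |z|) * |F z|))) := by
    have i1 : IntegrableOn (fun z => Real.exp (-α * (z - y)) * F z) (Ioi y) := by
      refine Integrable.mono' h0.abs.integrableOn (by fun_prop)
        ((ae_restrict_iff' measurableSet_Ioi).2 (ae_of_all _ fun z hz => ?_))
      rw [Real.norm_eq_abs, abs_mul, abs_of_pos (Real.exp_pos _)]
      exact mul_le_of_le_one_left (abs_nonneg _)
        (Real.exp_le_one_iff.2 (by nlinarith [show y < z from hz]))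
    have e : rightConv 0 G y = ∫ z in Ioi y, G z := by simp [rightConv]
    rw [e, rightConv, ← integral_sub i1 hiG.integrableOn]
    refine abs_setIntegral_le measurableSet_Ioi hg fun z hz =>
      key z (sub_nonneg.2 (le_of_lt hz)) ?_
    rw [← neg_sub y z]
    exact (neg_le_abs _).trans (abs_sub_le_weight y z)
  rw [← intervalIntegral.integral_Iic_add_Ioi (b := y) hg.integrableOn hg.integrableOn,
    greenDeriv, greenDeriv]
  calc |1 / 2 * (leftConv α F y - rightConv α F y) - 1 / 2 * (leftConv 0 G y - rightConv 0 G y)|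
      = 1 / 2 * |(leftConv α F y - leftConv 0 G y) - (rightConv α F y - rightConv 0 G y)| := by
        rw [← abs_of_pos (by norm_num : (0 : ℝ) < 1 / 2), ← abs_mul]
        congr 1
        rw [abs_of_pos (by norm_num : (0 : ℝ) < 1 / 2)]; ring
    _ ≤ _ := by
        gcongr
        exact (abs_sub _ _).trans (add_le_add hl hr)

end Kernel

/-- A square integrable function with square integrable derivative is bounded. -/
theorem exists_bound_of_memLp {u u' : ℝ → ℝ} (hu : ∀ y, HasDerivAt u (u' y) y)
    (hc : Continuous u') (h0 : MemLp u 2 volume) (h1 : MemLp u' 2 volume) :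
    ∃ M, ∀ y, |u y| ≤ M := by
  have hi : Integrable fun y => 2 * (u y * u' y) := (h0.integrable_mul h1).const_mul 2
  have hcu := continuous_of_hasDerivAt hu
  refine ⟨Real.sqrt (u 0 ^ 2 + ∫ y, |2 * (u y * u' y)|), fun y => Real.abs_le_sqrt ?_⟩
  have h := intervalIntegral.integral_eq_sub_of_hasDerivAt (a := 0) (b := y)
    (f := fun y => u y ^ 2) (f' := fun y => 2 * (u y * u' y))
    (fun z _ => ((hu z).fun_pow 2).congr_deriv (by norm_num; ring))
    ((by fun_prop : Continuous fun y => 2 * (u y * u' y)).intervalIntegrable _ _)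
  have h2 := intervalIntegral.norm_integral_le_integral_norm_uIoc (a := 0) (b := y)
    (f := fun y => 2 * (u y * u' y)) (μ := volume)
  have h3 : ∫ y in uIoc 0 y, ‖2 * (u y * u' y)‖ ≤ ∫ y, |2 * (u y * u' y)| :=
    setIntegral_le_integral hi.norm (ae_of_all _ fun _ => abs_nonneg _)
  have h4 := le_abs_self (∫ z in (0 : ℝ)..y, 2 * (u z * u' z))
  rw [Real.norm_eq_abs] at h2
  linarith

/-- The internal mode in the variables `s = (W₁ + W₂)/2`, `d = (W₁ - W₂)/2`, in which the
constant coefficient parts of the two equations decouple. Boundedness is assumed in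
place of membership in `H²`, which follows from it. -/
structure IsModePair (σ ε : ℝ) (R : ℝ → ℝ) (α : ℝ) (s s' d d' : ℝ → ℝ) : Prop where
  alpha_pos : 0 < α
  alpha_lt_one : α < 1
  hs : ∀ y, HasDerivAt s (s' y) y
  hs' : ∀ y, HasDerivAt s' (α ^ 2 * s y + coupling σ ε R (coef1 σ) (coef2 σ) s d y) y
  hd : ∀ y, HasDerivAt d (d' y) y
  hd' : ∀ y, HasDerivAt d' ((2 - α ^ 2) * d y + coupling σ ε R (coef2 σ) (coef1 σ) s d y) y
  bounded : ∃ B, ∀ y, |s y| ≤ B ∧ |d y| ≤ B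
  normalization : ∫ y, coupling σ ε R (coef1 σ) (coef2 σ) s d y = -2 * α

/-- The moments `∫ (1+|z|)^k Q^(2σ)`. -/
noncomputable def moment (σ : ℝ) (k : ℕ) : ℝ := ∫ z, (1 + |z|) ^ k * Q z ^ (2 * σ)

theorem moment_nonneg (σ : ℝ) (k : ℕ) : 0 ≤ moment σ k :=
  integral_nonneg fun z => mul_nonneg (by positivity) (Q_rpow_pos _ z).le

section
variable {σ ε α : ℝ} {R s s' d d' : ℝ → ℝ}

theorem integrable_of_abs_le_weight_Q (hσ : 1 < σ) {F : ℝ → ℝ} (hF : Continuous F) {C : ℝ} {k : ℕ}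
    (h : ∀ z, |F z| ≤ C * ((1 + |z|) ^ k * Q z ^ (2 * σ))) (l : ℕ) :
    Integrable (fun z => (1 + |z|) ^ l * |F z|) ∧
      ∫ z, (1 + |z|) ^ l * |F z| ≤ C * moment σ (l + k) := by
  have hi := (integrable_weight_mul_Q_rpow (t := 2 * σ) (by linarith) (l + k)).const_mul C
  have hb : ∀ z, (1 + |z|) ^ l * |F z| ≤ C * ((1 + |z|) ^ (l + k) * Q z ^ (2 * σ)) := fun z => by
    calc _ ≤ (1 + |z|) ^ l * (C * ((1 + |z|) ^ k * Q z ^ (2 * σ))) :=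
          mul_le_mul_of_nonneg_left (h z) (by positivity)
      _ = _ := by ring
  have h1 : Integrable (fun z => (1 + |z|) ^ l * |F z|) :=
    hi.mono' (by fun_prop) (ae_of_all _ fun z => by
      rw [Real.norm_eq_abs, abs_of_nonneg (by positivity)]; exact hb z)
  refine ⟨h1, ?_⟩
  rw [moment, ← integral_const_mul]
  exact integral_mono h1 hi hb

/-- The zeroth order description of the internal mode: `s = 1`, `d = 0`. The bound is closed on the
single number `M = ∫ (1 + |z|) Q^(2σ) (|s| + |d|)`: Green's formula gives `|s - 1| ≲ ε M (1 + |y|)`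
and `|d| ≲ ε M`, hence `M ≲ 1 + ε M`. -/
theorem IsModePair.abs_sub_one_le (hσ : 1 < σ) (hε : 0 < ε) (h : IsProfile σ ε R)
    (hm : IsModePair σ ε R α s s' d d') (hsmall : coefBound σ * moment σ 2 * ε ≤ 1 / 2) :
    α ≤ coefBound σ * moment σ 2 * ε ∧
    ∀ y, |s y - 1| ≤ coefBound σ * moment σ 2 * ε * (1 + |y|) ∧
      |d y| ≤ coefBound σ * moment σ 2 * ε := by
  have hα := hm.alpha_pos
  have hα1 := hm.alpha_lt_one
  obtain ⟨B, hB⟩ := hm.bounded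
  have hcs := continuous_of_hasDerivAt hm.hs
  have hcd := continuous_of_hasDerivAt hm.hd
  set K := coefBound σ
  have hK : 0 < K := coefBound_pos hσ
  set J := moment σ 2
  have hJ : 0 ≤ J := moment_nonneg _ _
  set F := coupling σ ε R (coef1 σ) (coef2 σ) s d with hF
  set G := coupling σ ε R (coef2 σ) (coef1 σ) s d with hG
  have hcF : Continuous F := continuous_coupling h _ _ hcs hcd
  have hcG : Continuous G := continuous_coupling h _ _ hcs hcd
  have hFb : ∀ z, |F z| ≤ K * ε * (Q z ^ (2 * σ) * (|s z| + |d z|)) :=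
    abs_coupling_le hσ hε h (coef_le₁ σ) s d
  have hGb : ∀ z, |G z| ≤ K * ε * (Q z ^ (2 * σ) * (|s z| + |d z|)) :=
    abs_coupling_le hσ hε h (coef_le₂ σ) s d
  set m : ℝ → ℝ := fun z => (1 + |z|) * (Q z ^ (2 * σ) * (|s z| + |d z|)) with hmdef
  have hm0 : ∀ z, 0 ≤ m z := fun z => by have := Q_rpow_pos (2 * σ) z; positivity
  have him : Integrable m := by
    refine ((integrable_weight_mul_Q_rpow (t := 2 * σ) (by linarith) 1).const_mul (B + B)).mono'
      (by fun_prop) (ae_of_all _ fun z => ?_)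
    rw [Real.norm_eq_abs, abs_of_nonneg (hm0 z), hmdef, pow_one]
    have := Q_rpow_pos (2 * σ) z
    calc (1 + |z|) * (Q z ^ (2 * σ) * (|s z| + |d z|))
        ≤ (1 + |z|) * (Q z ^ (2 * σ) * (B + B)) := by
          refine mul_le_mul_of_nonneg_left (mul_le_mul_of_nonneg_left ?_ this.le) (by positivity)
          linarith [hB z]
      _ = _ := by ring
  set M := ∫ z, m z with hM
  have hM0 : 0 ≤ M := integral_nonneg hm0
  have le_m : ∀ z, Q z ^ (2 * σ) * (|s z| + |d z|) ≤ m z := fun z => by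
    have := Q_rpow_pos (2 * σ) z
    exact le_mul_of_one_le_left (by positivity) (by linarith [abs_nonneg z])
  have absint : ∀ {H : ℝ → ℝ}, Continuous H →
      (∀ z, |H z| ≤ K * ε * (Q z ^ (2 * σ) * (|s z| + |d z|))) →
      Integrable H ∧ ∫ z, |H z| ≤ K * ε * M := by
    intro H hc hb
    have hb' : ∀ z, |H z| ≤ K * ε * m z := fun z =>
      (hb z).trans (mul_le_mul_of_nonneg_left (le_m z) (by positivity))
    have hi : Integrable H := (him.const_mul (K * ε)).mono' hc.aestronglyMeasurable
      (ae_of_all _ fun z => by rw [Real.norm_eq_abs]; exact hb' z)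
    refine ⟨hi, ?_⟩
    rw [hM, ← integral_const_mul]
    exact integral_mono hi.abs (him.const_mul _) hb'
  obtain ⟨hiF, hFM⟩ := absint hcF hFb
  obtain ⟨hiG, hGM⟩ := absint hcG hGb
  -- the bounded solution `s` is the Green potential of `F`, and the normalization makes it `1 + O(ε)`
  have bdd : ∀ {H : ℝ → ℝ}, (∀ z, |H z| ≤ K * ε * (Q z ^ (2 * σ) * (|s z| + |d z|))) →
      ∀ z, |H z| ≤ K * ε * (√2 ^ (2 * σ) * (B + B)) := fun hb z => by
    have := Q_rpow_pos (2 * σ) z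
    have h2 := Q_rpow_le (t := 2 * σ) (by linarith) z
    refine (hb z).trans (mul_le_mul_of_nonneg_left ?_ (by positivity))
    exact mul_le_mul h2 (by linarith [hB z]) (by positivity) (by positivity)
  have hs1 : ∀ y, |s y - 1| ≤ 1 / 2 * (K * ε * M) * (1 + |y|) := fun y => by
    have e1 := (eq_green hα hcF (bdd hFb) hm.hs hm.hs' (fun y => (hB y).1) y).1
    obtain ⟨_, e2⟩ := green_eq_one_add hα hiF hm.normalization y
    rw [e1, e2, add_sub_cancel_left]
    have : 1 / 2 * (K * ε * M) * (1 + |y|) = ∫ z, (1 / 2 * (K * ε) * (1 + |y|)) * m z := by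
      rw [integral_const_mul, hM]; ring
    rw [this]
    refine norm_integral_le_of_norm_le (μ := volume)
      (f := fun z => (1 - Real.exp (-α * |y - z|)) / (2 * α) * F z) (him.const_mul _)
      (ae_of_all _ fun z => ?_)
    rw [Real.norm_eq_abs, abs_mul]
    calc _ ≤ ((1 + |y|) * (1 + |z|) / 2) * (K * ε * (Q z ^ (2 * σ) * (|s z| + |d z|))) := by
          refine mul_le_mul ?_ (hFb z) (abs_nonneg _) (by positivity)
          exact (smallKernel_bounds hα (abs_nonneg _)).1.trans
            (by have := abs_sub_le_weight y z; linarith)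
      _ = _ := by rw [hmdef]; ring
  have hd1 : ∀ y, |d y| ≤ 1 / 2 * (K * ε * M) := fun y => by
    have hκ2 : (1 : ℝ) ≤ 2 - α ^ 2 := by nlinarith
    have hκ : 1 ≤ √(2 - α ^ 2) := by simpa using Real.sqrt_le_sqrt hκ2
    have e1 := (eq_green (κ := √(2 - α ^ 2)) (by linarith) hcG (bdd hGb) hm.hd
      (fun y => by rw [Real.sq_sqrt (by linarith)]; exact hm.hd' y) (fun y => (hB y).2) y).1
    rw [e1]
    refine (abs_green_le_integral (by linarith) hiG y).trans ?_
    refine mul_le_mul ?_ hGM (integral_nonneg fun _ => abs_nonneg _) (by norm_num)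
    exact one_div_le_one_div_of_le (by norm_num) (by linarith)
  have hMJ : M ≤ (1 + K * ε * M) * J := by
    have hi := (integrable_weight_mul_Q_rpow (t := 2 * σ) (by linarith) 2).const_mul (1 + K * ε * M)
    have e : J = ∫ z, (1 + |z|) ^ 2 * Q z ^ (2 * σ) := rfl
    rw [e, ← integral_const_mul]
    refine integral_mono him hi fun z => ?_
    have hq := Q_rpow_pos (2 * σ) z
    have hn : |s z| + |d z| ≤ (1 + K * ε * M) * (1 + |z|) := by
      have h1 := hs1 z
      have h2 := hd1 z
      have h3 : |s z| ≤ |s z - 1| + 1 := by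
        have := abs_add_le (s z - 1) 1; simpa using this
      have h4 : 0 ≤ K * ε * M := by positivity
      nlinarith [abs_nonneg z, mul_nonneg h4 (abs_nonneg z)]
    calc m z ≤ (1 + |z|) * (Q z ^ (2 * σ) * ((1 + K * ε * M) * (1 + |z|))) :=
          mul_le_mul_of_nonneg_left (mul_le_mul_of_nonneg_left hn hq.le) (by positivity)
      _ = _ := by ring
  have hM2 : M ≤ 2 * J := by nlinarith
  have hfin : 1 / 2 * (K * ε * M) ≤ K * J * ε := by
    have : 0 < K * ε := by positivity
    nlinarith
  refine ⟨?_, fun y => ⟨(hs1 y).trans (by gcongr), (hd1 y).trans hfin⟩⟩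
  have h1 : |∫ z, F z| ≤ ∫ z, |F z| := norm_integral_le_integral_norm F
  rw [hm.normalization, abs_mul, abs_neg, abs_two, abs_of_pos hα] at h1
  linarith

theorem green_const_mul (κ c : ℝ) (f : ℝ → ℝ) (y : ℝ) :
    greenDeriv κ (fun z => c * f z) y = c * greenDeriv κ f y := by
  have e : ∀ a z : ℝ, Real.exp a * (c * f z) = c * (Real.exp a * f z) := fun a z => by ring
  simp only [greenDeriv, leftConv, rightConv, e, integral_const_mul]
  ring

set_option maxHeartbeats 1000000 in
/-- The first order expansion of the internal mode: `s = 1 + ε T₁ + O(ε²)`, `d = ε T₂ + O(ε²)`. -/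
theorem exists_mode_expansion (hσ : 1 < σ) : ∃ ε₀, 0 < ε₀ ∧ ∃ C, 0 < C ∧ ∀ ε R α s s' d d',
    0 < ε → ε ≤ ε₀ → IsProfile σ ε R → IsModePair σ ε R α s s' d d' → α ≤ C * ε ∧ ∀ y,
    |s y - 1 - ε * T1 σ y| ≤ C * ε ^ 2 * (1 + |y|) ^ 2 ∧
    |s' y - ε * T1Deriv σ y| ≤ C * ε ^ 2 * (1 + |y|) ^ 2 ∧
    |d y - ε * T2 σ y| ≤ C * ε ^ 2 * (1 + |y|) ^ 2 ∧
    |d' y - ε * T2Deriv σ y| ≤ C * ε ^ 2 * (1 + |y|) ^ 2 := by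
  obtain ⟨ε₁, hε₁, hpow⟩ := exists_rpow_bound hσ
  obtain ⟨P, hP, hpow⟩ := hpow (2 * σ)
  have hK : 0 < coefBound σ := coefBound_pos hσ
  set K := coefBound σ with hKdef
  have hJ : 0 ≤ moment σ 2 := moment_nonneg _ _
  set A := K * moment σ 2 with hA
  have hA0 : 0 ≤ A := by positivity
  -- bounds for the coupling terms and their expansions
  set C1 := 2 * K * (2 + A) with hC1
  set C2 := K * P + 2 * K * A with hC2
  have hC10 : 0 < C1 := by positivity
  have hC20 : 0 < C2 := by positivity
  have hJ3 := moment_nonneg σ 3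
  have hJ2 := moment_nonneg σ 2
  obtain ⟨q1, hq1, hq1b⟩ := exists_weight_mul_exp_le (c := 2 * σ) (by linarith) 1
  set E1 := C2 * ((2 * √2) ^ (2 * σ) * q1) + A ^ 3 with hE1
  have hE10 : 0 < E1 := by positivity
  set D := A + (A * C1 * moment σ 3 + C2 * moment σ 2) + E1 with hD
  refine ⟨min ε₁ (min 1 (1 / (2 * (A + 1)))), by positivity, D, by positivity,
    fun ε R α s s' d d' hε hle h hm => ?_⟩
  have hle1 := hle.trans (min_le_left _ _)
  have hle2 : ε ≤ 1 := hle.trans ((min_le_right _ _).trans (min_le_left _ _))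
  have hle3 := hle.trans ((min_le_right _ _).trans (min_le_right _ _))
  rw [le_div_iff₀ (by positivity)] at hle3
  obtain ⟨hα1, hsd⟩ := hm.abs_sub_one_le hσ hε h (by nlinarith)
  rw [← hKdef, ← hA] at hα1 hsd
  have hα := hm.alpha_pos
  obtain ⟨B, hB⟩ := hm.bounded
  have hcs := continuous_of_hasDerivAt hm.hs
  have hcd := continuous_of_hasDerivAt hm.hd
  have hn : ∀ z, |s z| + |d z| ≤ (1 + 2 * (A * ε)) * (1 + |z|) := fun z => by
    have h1 := (hsd z).1
    have h2 := (hsd z).2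
    have h3 : |s z| ≤ |s z - 1| + 1 := by
      have := abs_add_le (s z - 1) 1; simpa using this
    have h4 : 0 ≤ A * ε := by positivity
    nlinarith [abs_nonneg z, mul_nonneg h4 (abs_nonneg z)]
  have bound : ∀ {c₁ c₂ : ℝ}, |c₁| + |c₂| ≤ K → ∀ z,
      |coupling σ ε R c₁ c₂ s d z| ≤ C1 * ε * ((1 + |z|) ^ 1 * Q z ^ (2 * σ)) ∧
      |coupling σ ε R c₁ c₂ s d z - ε * (c₁ * Q z ^ (2 * σ))|
        ≤ C2 * ε ^ 2 * ((1 + |z|) ^ 1 * Q z ^ (2 * σ)) := by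
    intro c₁ c₂ hc z
    have hq := Q_rpow_pos (2 * σ) z
    have hz : 1 ≤ 1 + |z| := by linarith [abs_nonneg z]
    constructor
    · refine (abs_coupling_le hσ hε h hc s d z).trans ?_
      calc K * ε * (Q z ^ (2 * σ) * (|s z| + |d z|))
          ≤ K * ε * (Q z ^ (2 * σ) * ((1 + 2 * (A * 1)) * (1 + |z|))) := by
            refine mul_le_mul_of_nonneg_left (mul_le_mul_of_nonneg_left ((hn z).trans ?_) hq.le)
              (by positivity)
            gcongr
        _ = K * (1 + 2 * A) * (ε * ((1 + |z|) * Q z ^ (2 * σ))) := by ring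
        _ ≤ C1 * (ε * ((1 + |z|) * Q z ^ (2 * σ))) := by
            refine mul_le_mul_of_nonneg_right ?_ (by positivity)
            rw [hC1]; nlinarith
        _ = _ := by ring
    · have e : coupling σ ε R c₁ c₂ s d z - ε * (c₁ * Q z ^ (2 * σ))
          = ε * ((R z ^ (2 * σ) - Q z ^ (2 * σ)) * c₁)
            + coupling σ ε R c₁ c₂ (fun z => s z - 1) d z := by
        simp only [coupling, pot]; ring
      rw [e]
      have h1 : |ε * ((R z ^ (2 * σ) - Q z ^ (2 * σ)) * c₁)|
          ≤ ε * ((P * ε * Q z ^ (2 * σ)) * K) := by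
        rw [abs_mul, abs_mul, abs_of_pos hε]
        refine mul_le_mul_of_nonneg_left ?_ hε.le
        exact mul_le_mul (hpow ε R hε hle1 h z) (by linarith [abs_nonneg c₂]) (abs_nonneg _)
          (by positivity)
      have h2 := abs_coupling_le hσ hε h hc (fun z => s z - 1) d z
      have h3 : K * ε * (Q z ^ (2 * σ) * (|s z - 1| + |d z|))
          ≤ K * ε * (Q z ^ (2 * σ) * (2 * (A * ε * (1 + |z|)))) := by
        refine mul_le_mul_of_nonneg_left (mul_le_mul_of_nonneg_left ?_ hq.le) (by positivity)
        have := (hsd z).1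
        have := (hsd z).2
        have h4 : 0 ≤ A * ε := by positivity
        nlinarith [abs_nonneg z, mul_nonneg h4 (abs_nonneg z)]
      have h5 : ε * ((P * ε * Q z ^ (2 * σ)) * K)
          ≤ ε * ((P * ε * Q z ^ (2 * σ)) * K) * (1 + |z|) :=
        le_mul_of_one_le_right (by positivity) hz
      calc _ ≤ _ := (abs_add_le _ _).trans (add_le_add (h1.trans h5) (h2.trans h3))
        _ = _ := by rw [hC2]; ring
  set F := coupling σ ε R (coef1 σ) (coef2 σ) s d with hF
  set G := coupling σ ε R (coef2 σ) (coef1 σ) s d with hG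
  have hcF : Continuous F := continuous_coupling h _ _ hcs hcd
  have hcG : Continuous G := continuous_coupling h _ _ hcs hcd
  have hFb := fun z => (bound (coef_le₁ σ) z).1
  have hFs := fun z => (bound (coef_le₁ σ) z).2
  have hGs := fun z => (bound (coef_le₂ σ) z).2
  rw [← hF] at hFb hFs
  rw [← hG] at hGs
  have hcdiff : Continuous fun z => F z - ε * (coef1 σ * Q z ^ (2 * σ)) := by fun_prop
  obtain ⟨iF1, -⟩ := integrable_of_abs_le_weight_Q hσ hcF hFb 1
  obtain ⟨iF2, bF2⟩ := integrable_of_abs_le_weight_Q hσ hcF hFb 2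
  obtain ⟨iS1, bS1⟩ := integrable_of_abs_le_weight_Q hσ hcdiff hFs 1
  simp only [pow_one] at iF1 iS1 bS1
  have hiF : Integrable F := (integrable_of_weight hcF iF1).1
  have Fbdd : ∃ N, ∀ z, |F z| ≤ N := by
    refine ⟨K * ε * (√2 ^ (2 * σ) * (B + B)), fun z => ?_⟩
    have := Q_rpow_pos (2 * σ) z
    have h2 := Q_rpow_le (t := 2 * σ) (by linarith) z
    refine (abs_coupling_le hσ hε h (coef_le₁ σ) s d z).trans
      (mul_le_mul_of_nonneg_left ?_ (by positivity))
    exact mul_le_mul h2 (by linarith [hB z]) (by positivity) (by positivity)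
  obtain ⟨N, hN⟩ := Fbdd
  have src1 : ∀ z, ε * source1 σ z = ε * (coef1 σ * Q z ^ (2 * σ)) := fun z => rfl
  have hw : ∀ y : ℝ, 1 ≤ (1 + |y|) ^ 2 := one_le_weight 2
  have iS0 := integrable_of_weight (continuous_source1 σ) (integrable_weight_source1 hσ)
  have hsg := fun y => eq_green hα hcF hN hm.hs hm.hs' (fun y => (hB y).1) y
  have hDs : ∀ y, |s y - 1 - ε * T1 σ y|
      ≤ (A * C1 * moment σ 3 + C2 * moment σ 2) * ε ^ 2 * (1 + |y|) ^ 2 := fun y => by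
    obtain ⟨i1, e2⟩ := green_eq_one_add hα hiF hm.normalization y
    have i2 : Integrable fun z => |y - z| * source1 σ z := by
      refine ((integrable_weight_source1 hσ).const_mul (1 + |y|)).mono'
        ((by have := continuous_source1 σ; fun_prop :
          Continuous fun z => |y - z| * source1 σ z)).aestronglyMeasurable (ae_of_all _ fun z => ?_)
      rw [Real.norm_eq_abs, abs_mul, abs_abs]
      have := mul_le_mul_of_nonneg_right (abs_sub_le_weight y z) (abs_nonneg (source1 σ z))
      linarith
    have e3 : s y - 1 - ε * T1 σ y = ∫ z, ((1 - Real.exp (-α * |y - z|)) / (2 * α) * F z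
        - ε / 2 * (|y - z| * source1 σ z)) := by
      rw [integral_sub i1 (i2.const_mul _), integral_const_mul, (hsg y).1, e2, T1_eq_absConv,
        absConv]
      ring
    have hdom : Integrable fun z => (1 + |y|) ^ 2 * (α / 4 * ((1 + |z|) ^ 2 * |F z|)
        + 1 / 2 * ((1 + |z|) * |F z - ε * (coef1 σ * Q z ^ (2 * σ))|)) :=
      ((iF2.const_mul _).add (iS1.const_mul _)).const_mul _
    have hle : |s y - 1 - ε * T1 σ y| ≤ ∫ z, (1 + |y|) ^ 2 * (α / 4 * ((1 + |z|) ^ 2 * |F z|)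
        + 1 / 2 * ((1 + |z|) * |F z - ε * (coef1 σ * Q z ^ (2 * σ))|)) := by
      rw [e3]
      refine norm_integral_le_of_norm_le (μ := volume)
        (f := fun z => (1 - Real.exp (-α * |y - z|)) / (2 * α) * F z
          - ε / 2 * (|y - z| * source1 σ z)) hdom (ae_of_all _ fun z => ?_)
      have e4 : (1 - Real.exp (-α * |y - z|)) / (2 * α) * F z - ε / 2 * (|y - z| * source1 σ z)
          = ((1 - Real.exp (-α * |y - z|)) / (2 * α) - |y - z| / 2) * F z
            + |y - z| / 2 * (F z - ε * (coef1 σ * Q z ^ (2 * σ))) := by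
        rw [← src1]; ring
      rw [Real.norm_eq_abs, e4]
      have hr := abs_sub_le_weight y z
      have hr0 := abs_nonneg (y - z)
      have hr2 : |y - z| ^ 2 ≤ (1 + |y|) ^ 2 * (1 + |z|) ^ 2 := by
        rw [← mul_pow]; exact pow_le_pow_left₀ hr0 hr 2
      have hr3 : |y - z| ≤ (1 + |y|) ^ 2 * (1 + |z|) := hr.trans
        (mul_le_mul_of_nonneg_right (by nlinarith [abs_nonneg y]) (by positivity))
      refine (abs_add_le _ _).trans ?_
      rw [abs_mul, abs_mul (|y - z| / 2), abs_of_nonneg (by positivity : 0 ≤ |y - z| / 2)]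
      have t1 := mul_le_mul_of_nonneg_right (smallKernel_bounds hα hr0).2 (abs_nonneg (F z))
      have t2 : α * |y - z| ^ 2 / 4 * |F z| ≤ α * ((1 + |y|) ^ 2 * (1 + |z|) ^ 2) / 4 * |F z| := by
        gcongr
      have t3 : |y - z| / 2 * |F z - ε * (coef1 σ * Q z ^ (2 * σ))|
          ≤ (1 + |y|) ^ 2 * (1 + |z|) / 2 * |F z - ε * (coef1 σ * Q z ^ (2 * σ))| :=
        mul_le_mul_of_nonneg_right (by linarith) (abs_nonneg _)
      refine (add_le_add (t1.trans t2) t3).trans (le_of_eq (by ring))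
    refine hle.trans ?_
    rw [integral_const_mul, integral_add (iF2.const_mul _) (iS1.const_mul _), integral_const_mul,
      integral_const_mul]
    have t1 : α / 4 * ∫ z, (1 + |z|) ^ 2 * |F z| ≤ A * ε / 4 * (C1 * ε * moment σ (2 + 1)) :=
      mul_le_mul (by linarith) bF2 (integral_nonneg fun _ => by positivity) (by positivity)
    norm_num at t1 bS1
    have t0 : 0 ≤ A * ε * (C1 * ε * moment σ 3) := by positivity
    have t2 : 0 ≤ C2 * ε ^ 2 * moment σ 2 := by positivity
    have t3 : (1 + |y|) ^ 2 * (α / 4 * (∫ z, (1 + |z|) ^ 2 * |F z|)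
        + 1 / 2 * ∫ z, (1 + |z|) * |F z - ε * (coef1 σ * Q z ^ (2 * σ))|)
        ≤ (1 + |y|) ^ 2 * ((A * C1 * moment σ 3 + C2 * moment σ 2) * ε ^ 2) :=
      mul_le_mul_of_nonneg_left (by linarith) (by positivity)
    linarith
  have hDs' : ∀ y, |s' y - ε * T1Deriv σ y|
      ≤ (A * C1 * moment σ 3 + C2 * moment σ 2) * ε ^ 2 * (1 + |y|) ^ 2 := fun y => by
    have hl := abs_greenDeriv_sub_le hα hcF (G := fun z => ε * source1 σ z) iF1
      (iS0.1.const_mul ε) y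
    rw [green_const_mul, ← (hsg y).2] at hl
    refine hl.trans ?_
    have b1 : ∫ z, (1 + |z|) * |F z| ≤ C1 * ε * moment σ 2 := by
      have := (integrable_of_abs_le_weight_Q hσ hcF hFb 1).2
      simpa only [pow_one] using this
    have m23 : moment σ 2 ≤ moment σ 3 := by
      refine integral_mono (integrable_weight_mul_Q_rpow (by linarith) 2)
        (integrable_weight_mul_Q_rpow (by linarith) 3) fun z => ?_
      exact mul_le_mul_of_nonneg_right (weight_mono (by norm_num) z) (Q_rpow_pos _ z).le
    have iS00 := (integrable_of_weight hcdiff iS1).1.abs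
    have b0 : ∫ z, |F z - ε * source1 σ z| ≤ C2 * ε ^ 2 * moment σ 2 := by
      simp only [src1]
      refine le_trans (integral_mono iS00 iS1 fun z => ?_) bS1
      exact le_mul_of_one_le_left (abs_nonneg _) (by linarith [abs_nonneg z])
    rw [integral_add (by simpa only [src1] using iS00) ((iF1.const_mul _).const_mul _),
      integral_const_mul, integral_const_mul]
    have t1 : α * ((1 + |y|) * ∫ z, (1 + |z|) * |F z|)
        ≤ A * ε * ((1 + |y|) ^ 2 * (C1 * ε * moment σ 3)) := by
      refine mul_le_mul hα1 (mul_le_mul (by nlinarith [abs_nonneg y])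
        (b1.trans (by gcongr)) (integral_nonneg fun _ => by positivity) (by positivity))
        (mul_nonneg (by positivity) (integral_nonneg fun _ => by positivity)) (by positivity)
    have t2 : C2 * ε ^ 2 * moment σ 2 ≤ C2 * ε ^ 2 * moment σ 2 * (1 + |y|) ^ 2 :=
      le_mul_of_one_le_right (by positivity) (hw y)
    have t3 : 0 ≤ A * ε * ((1 + |y|) ^ 2 * (C1 * ε * moment σ 3)) := by positivity
    have t4 : 0 ≤ C2 * ε ^ 2 * moment σ 2 * (1 + |y|) ^ 2 := by positivity
    linarith
  have hDd : ∀ y, |d y - ε * T2 σ y| ≤ E1 * ε ^ 2 ∧ |d' y - ε * T2Deriv σ y| ≤ E1 * ε ^ 2 := by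
    intro y
    set H : ℝ → ℝ := fun z => G z - ε * (coef2 σ * Q z ^ (2 * σ)) - α ^ 2 * d z with hH
    have hHb : ∀ z, |H z| ≤ E1 * ε ^ 2 := fun z => by
      have h1 := hGs z
      have h2 : (1 + |z|) ^ 1 * Q z ^ (2 * σ) ≤ (2 * √2) ^ (2 * σ) * q1 := by
        have h3 := Q_rpow_le_exp (t := 2 * σ) (by linarith) z
        have h4 := hq1b z
        have h5 : Real.exp (-(2 * σ / 2) * |z|) ≤ 1 :=
          Real.exp_le_one_iff.2 (by nlinarith [abs_nonneg z])
        calc (1 + |z|) ^ 1 * Q z ^ (2 * σ)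
            ≤ (1 + |z|) ^ 1 * ((2 * √2) ^ (2 * σ) * Real.exp (-(2 * σ) * |z|)) :=
              mul_le_mul_of_nonneg_left h3 (by positivity)
          _ = (2 * √2) ^ (2 * σ) * ((1 + |z|) ^ 1 * Real.exp (-(2 * σ) * |z|)) := by ring
          _ ≤ (2 * √2) ^ (2 * σ) * q1 := by
              refine mul_le_mul_of_nonneg_left (h4.trans ?_) (by positivity)
              exact mul_le_of_le_one_right hq1.le h5
      have h6 : |α ^ 2 * d z| ≤ A ^ 3 * ε ^ 2 := by
        rw [abs_mul, abs_of_nonneg (sq_nonneg α)]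
        calc α ^ 2 * |d z| ≤ (A * ε) ^ 2 * (A * ε) :=
              mul_le_mul (pow_le_pow_left₀ hα.le hα1 2) (hsd z).2 (abs_nonneg _) (by positivity)
          _ = A ^ 3 * ε ^ 2 * ε := by ring
          _ ≤ A ^ 3 * ε ^ 2 := mul_le_of_le_one_right (by positivity) hle2
      refine (abs_sub _ _).trans ?_
      have h7 := mul_le_mul_of_nonneg_left h2 (by positivity : 0 ≤ C2 * ε ^ 2)
      rw [hE1]
      linarith
    have hsq : (√2 : ℝ) ^ 2 = 2 := sqrt_two_sq
    have h2 : ∀ y, |T2 σ y| ≤ σ * (σ - 1) / (σ + 1) * √2 ^ (2 * σ) / √2 ^ 2 := fun y => by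
      rw [T2_eq_green hσ]
      exact abs_green_le (by positivity) (abs_source2_le hσ) y
    have key := eq_green (κ := √2) (u := fun y => d y - ε * T2 σ y)
      (u' := fun y => d' y - ε * T2Deriv σ y) (by positivity) (f := H) (by fun_prop) hHb
      (fun y => (hm.hd y).fun_sub ((hasDerivAt_T2 hσ y).const_mul ε))
      (fun y => ((hm.hd' y).fun_sub ((hasDerivAt_T2Deriv hσ y).const_mul ε)).congr_deriv (by
        rw [hsq, hH, show source2 σ y = coef2 σ * Q y ^ (2 * σ) from rfl,
          show coupling σ ε R (coef2 σ) (coef1 σ) s d y = G y from rfl]; ring))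
      (M := B + |ε| * (σ * (σ - 1) / (σ + 1) * √2 ^ (2 * σ) / √2 ^ 2))
      (fun y => (abs_sub _ _).trans (by
        rw [abs_mul]
        exact add_le_add (hB y).2 (mul_le_mul_of_nonneg_left (h2 y) (abs_nonneg _)))) y
    rw [key.1, key.2]
    have hE : 0 ≤ E1 * ε ^ 2 := by positivity
    refine ⟨(abs_green_le (by positivity) hHb y).trans ?_,
      (abs_greenDeriv_le (by positivity) hHb y).trans ?_⟩
    · exact div_le_self hE (by rw [hsq]; norm_num)
    · exact div_le_self hE (by nlinarith [Real.sqrt_nonneg (2 : ℝ)])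
  have p1 : 0 ≤ A * C1 * moment σ 3 + C2 * moment σ 2 := by positivity
  have lift1 : ∀ y : ℝ, (A * C1 * moment σ 3 + C2 * moment σ 2) * ε ^ 2 * (1 + |y|) ^ 2
      ≤ D * ε ^ 2 * (1 + |y|) ^ 2 := fun y => by
    gcongr; linarith
  have lift2 : ∀ y : ℝ, E1 * ε ^ 2 ≤ D * ε ^ 2 * (1 + |y|) ^ 2 := fun y =>
    (le_mul_of_one_le_right (by positivity) (hw y)).trans (by gcongr; linarith)
  refine ⟨hα1.trans (by gcongr; linarith), fun y => ⟨(hDs y).trans (lift1 y),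
    (hDs' y).trans (lift1 y), (hDd y).1.trans (lift2 y), (hDd y).2.trans (lift2 y)⟩⟩

end

section
variable {κ α B : ℝ} {F : ℝ → ℝ}

/-- A source decaying at rate `2α ≤ 2κ` produces a potential decaying at rate `α`. -/
theorem abs_conv_le_exp (hα : 0 < α) (hκ : α ≤ κ)
    (hB : ∀ z, |F z| ≤ B * Real.exp (-(2 * α) * |z|)) (y : ℝ) :
    |leftConv κ F y| ≤ B * (∫ z, Real.exp (-α * |z|)) * Real.exp (-α * |y|) ∧
    |rightConv κ F y| ≤ B * (∫ z, Real.exp (-α * |z|)) * Real.exp (-α * |y|) := by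
  have hB0 : 0 ≤ B := by have := (abs_nonneg _).trans (hB 0); simpa using this
  have hi := (integrable_exp_neg_mul_abs hα).const_mul (B * Real.exp (-α * |y|))
  have e : B * (∫ z, Real.exp (-α * |z|)) * Real.exp (-α * |y|)
      = ∫ z, B * Real.exp (-α * |y|) * Real.exp (-α * |z|) := by
    rw [integral_const_mul]; ring
  have key : ∀ {r z : ℝ}, 0 ≤ r → |y| ≤ r + |z| →
      |Real.exp (-κ * r) * F z| ≤ B * Real.exp (-α * |y|) * Real.exp (-α * |z|) := by
    intro r z hr hz
    rw [abs_mul, abs_of_pos (Real.exp_pos _)]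
    calc Real.exp (-κ * r) * |F z| ≤ Real.exp (-κ * r) * (B * Real.exp (-(2 * α) * |z|)) :=
          mul_le_mul_of_nonneg_left (hB z) (Real.exp_pos _).le
      _ = B * Real.exp (-κ * r + -(2 * α) * |z|) := by rw [Real.exp_add]; ring
      _ ≤ B * Real.exp (-α * |y| + -α * |z|) := by
          refine mul_le_mul_of_nonneg_left (Real.exp_le_exp.2 ?_) hB0
          nlinarith [mul_le_mul_of_nonneg_right hκ hr]
      _ = _ := by rw [Real.exp_add]; ring
  have hpos : ∀ z : ℝ, 0 ≤ B * Real.exp (-α * |y|) * Real.exp (-α * |z|) := fun z => by positivity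
  rw [e]
  refine ⟨(abs_setIntegral_le measurableSet_Iic hi fun z hz => key (sub_nonneg.2 hz) ?_).trans
    (setIntegral_le_integral hi (ae_of_all _ hpos)),
    (abs_setIntegral_le measurableSet_Ioi hi fun z hz => key (sub_nonneg.2 (le_of_lt hz)) ?_).trans
    (setIntegral_le_integral hi (ae_of_all _ hpos))⟩
  · have := abs_add_le (y - z) z
    rwa [sub_add_cancel, abs_of_nonneg (sub_nonneg.2 hz)] at this
  · have := abs_add_le (y - z) z
    rwa [sub_add_cancel, abs_sub_comm, abs_of_nonneg (sub_nonneg.2 (le_of_lt hz))] at this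

theorem abs_green_le_exp (hα : 0 < α) (hκ : α ≤ κ)
    (hB : ∀ z, |F z| ≤ B * Real.exp (-(2 * α) * |z|)) (y : ℝ) :
    |green κ F y| ≤ (1 / κ) * (B * ∫ z, Real.exp (-α * |z|)) * Real.exp (-α * |y|) ∧
    |greenDeriv κ F y| ≤ (B * ∫ z, Real.exp (-α * |z|)) * Real.exp (-α * |y|) := by
  obtain ⟨h1, h2⟩ := abs_conv_le_exp hα hκ hB y
  have hκ0 : 0 < κ := hα.trans_le hκ
  constructor
  · rw [green, abs_mul, abs_neg, abs_of_pos (by positivity)]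
    calc 1 / (2 * κ) * |leftConv κ F y + rightConv κ F y|
        ≤ 1 / (2 * κ) * (B * (∫ z, Real.exp (-α * |z|)) * Real.exp (-α * |y|)
          + B * (∫ z, Real.exp (-α * |z|)) * Real.exp (-α * |y|)) :=
          mul_le_mul_of_nonneg_left ((abs_add_le _ _).trans (add_le_add h1 h2)) (by positivity)
      _ = _ := by field_simp; ring
  · rw [greenDeriv, abs_mul, abs_of_pos (by norm_num)]
    have := abs_sub (leftConv κ F y) (rightConv κ F y)
    linarith

end

section
variable {σ ε a ω α : ℝ} {R s s' d d' W₁ W₂ : ℝ → ℝ}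

/-- Exponential decay of the internal mode: the sources decay at rate `2σ > 2α`, so that the Green
potentials inherit the decay of their kernels. -/
theorem IsModePair.exists_decay (hσ : 1 < σ) (hε : 0 < ε) (h : IsProfile σ ε R)
    (hm : IsModePair σ ε R α s s' d d') : ∃ C, ∀ y,
    |s y| ≤ C * Real.exp (-α * |y|) ∧ |s' y| ≤ C * Real.exp (-α * |y|) ∧
    |d y| ≤ C * Real.exp (-α * |y|) ∧ |d' y| ≤ C * Real.exp (-α * |y|) := by
  have hα := hm.alpha_pos
  have hα1 := hm.alpha_lt_one
  obtain ⟨B, hB⟩ := hm.bounded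
  have hcs := continuous_of_hasDerivAt hm.hs
  have hcd := continuous_of_hasDerivAt hm.hd
  have hB0 : 0 ≤ B := (abs_nonneg _).trans (hB 0).1
  have hK := coefBound_pos hσ
  have bound : ∀ {c₁ c₂ : ℝ}, |c₁| + |c₂| ≤ coefBound σ → ∀ z, |coupling σ ε R c₁ c₂ s d z|
      ≤ coefBound σ * ε * ((2 * √2) ^ (2 * σ) * (B + B)) * Real.exp (-(2 * α) * |z|) := by
    intro c₁ c₂ hc z
    refine (abs_coupling_le hσ hε h hc s d z).trans ?_
    have h1 := Q_rpow_le_exp (t := 2 * σ) (by linarith) z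
    have h2 : Real.exp (-(2 * σ) * |z|) ≤ Real.exp (-(2 * α) * |z|) :=
      Real.exp_le_exp.2 (by nlinarith [abs_nonneg z])
    calc _ ≤ coefBound σ * ε * (((2 * √2) ^ (2 * σ) * Real.exp (-(2 * α) * |z|)) * (B + B)) := by
          refine mul_le_mul_of_nonneg_left (mul_le_mul (h1.trans ?_)
            (by linarith [hB z]) (by positivity) (by positivity)) (by positivity)
          exact mul_le_mul_of_nonneg_left h2 (by positivity)
      _ = _ := by ring
  set N := coefBound σ * ε * ((2 * √2) ^ (2 * σ) * (B + B)) with hN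
  have hN0 : 0 ≤ N := by positivity
  set I := ∫ z, Real.exp (-α * |z|) with hI
  have hI0 : 0 ≤ I := integral_nonneg fun z => (Real.exp_pos _).le
  have le_one : ∀ {n z : ℝ}, 0 ≤ n → n * Real.exp (-(2 * α) * |z|) ≤ n := fun hn =>
    mul_le_of_le_one_right hn (Real.exp_le_one_iff.2 (by
      rw [neg_mul]; exact neg_nonpos.2 (mul_nonneg (by linarith) (abs_nonneg _))))
  have hκ2 : (1 : ℝ) ≤ 2 - α ^ 2 := by nlinarith
  have hκ : 1 ≤ √(2 - α ^ 2) := by simpa using Real.sqrt_le_sqrt hκ2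
  refine ⟨1 / α * (N * I) + N * I + 1 / √(2 - α ^ 2) * (N * I), fun y => ?_⟩
  have es := eq_green hα (continuous_coupling h _ _ hcs hcd)
    (fun z => (bound (coef_le₁ σ) z).trans (le_one hN0)) hm.hs hm.hs' (fun y => (hB y).1) y
  have ed := eq_green (κ := √(2 - α ^ 2)) (by linarith) (continuous_coupling h _ _ hcs hcd)
    (fun z => (bound (coef_le₂ σ) z).trans (le_one hN0)) hm.hd
    (fun y => by rw [Real.sq_sqrt (by linarith)]; exact hm.hd' y) (fun y => (hB y).2) y
  have bs := abs_green_le_exp hα le_rfl (bound (coef_le₁ σ)) y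
  have bd := abs_green_le_exp hα (hα1.le.trans hκ) (bound (coef_le₂ σ)) y
  rw [← es.1, ← es.2] at bs
  rw [← ed.1, ← ed.2] at bd
  have p1 : 0 ≤ 1 / α * (N * I) := by positivity
  have p2 : 0 ≤ N * I := by positivity
  have p3 : 0 ≤ 1 / √(2 - α ^ 2) * (N * I) := by positivity
  have hexp := (Real.exp_pos (-α * |y|)).le
  refine ⟨bs.1.trans ?_, bs.2.trans ?_, bd.1.trans ?_, bd.2.trans ?_⟩ <;>
    exact mul_le_mul_of_nonneg_right (by linarith) hexp

theorem IsInternalMode.isCoupled (hσ : 1 < σ) (hω : 0 < ω) (hR : ∀ y, 0 < R y)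
    (h : IsInternalMode (powerNL a σ) ω R α W₁ W₂) :
    IsCoupled σ (a * ω ^ (σ - 1)) R (1 - α ^ 2) W₁ W₂ :=
  isCoupled_of_eq hσ hω hR h.smooth₁.contDiff h.smooth₂.contDiff h.eq₁ h.eq₂

theorem half_potential_eq (hσ : 1 < σ) (hω : 0 < ω) (hR : ∀ y, 0 < R y) (W₁ W₂ : ℝ → ℝ) (y : ℝ) :
    (1 / 2) * (aPlus (powerNL a σ) ω R y * W₁ y + aMinus (powerNL a σ) ω R y * W₂ y)
      = coupling σ (a * ω ^ (σ - 1)) R (coef1 σ) (coef2 σ) (fun y => (W₁ y + W₂ y) / 2)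
        (fun y => (W₁ y - W₂ y) / 2) y := by
  have : σ + 1 ≠ 0 := by linarith
  rw [aPlus_eq hσ hω hR, aMinus_eq hσ hω hR, coupling, coef1, coef2]
  field_simp
  ring

theorem IsInternalMode.isModePair (hσ : 1 < σ) (hω : 0 < ω) (hR : ∀ y, 0 < R y)
    (h : IsInternalMode (powerNL a σ) ω R α W₁ W₂) :
    IsModePair σ (a * ω ^ (σ - 1)) R α (fun y => (W₁ y + W₂ y) / 2)
      (fun y => (deriv W₁ y + deriv W₂ y) / 2) (fun y => (W₁ y - W₂ y) / 2)
      (fun y => (deriv W₁ y - deriv W₂ y) / 2) := by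
  have hc := h.isCoupled hσ hω hR
  obtain ⟨B₁, hB₁⟩ := exists_bound_of_memLp hc.hd₁ (continuous_of_hasDerivAt hc.hdd₁)
    h.smooth₁.memLp h.smooth₁.memLp_deriv
  obtain ⟨B₂, hB₂⟩ := exists_bound_of_memLp hc.hd₂ (continuous_of_hasDerivAt hc.hdd₂)
    h.smooth₂.memLp h.smooth₂.memLp_deriv
  refine ⟨h.alpha_pos, h.alpha_lt_one, fun y => (hc.half_sum hσ y).1, fun y => ?_,
    fun y => (hc.half_diff hσ y).1, fun y => ?_, ⟨B₁ + B₂, fun y => ?_⟩, ?_⟩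
  · exact ((hc.half_sum hσ y).2).congr_deriv (by ring)
  · exact ((hc.half_diff hσ y).2).congr_deriv (by ring)
  · have h1 := abs_le.1 (hB₁ y)
    have h2 := abs_le.1 (hB₂ y)
    constructor <;> rw [abs_le] <;> constructor <;> linarith
  · rw [← h.normalization, ← integral_const_mul]
    simp only [half_potential_eq hσ hω hR]

end

/-- The contraction principle (with constant `1/2`) for pairs of bounded continuous functions,
stated pointwise. -/
theorem exists_fixedPoint_pair (Φ Ψ : (ℝ → ℝ) → (ℝ → ℝ) → ℝ → ℝ)
    (hc : ∀ f g, Continuous f → Continuous g → (∃ M, ∀ y, |f y| ≤ M ∧ |g y| ≤ M) →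
      Continuous (Φ f g) ∧ Continuous (Ψ f g) ∧ ∃ M, ∀ y, |Φ f g y| ≤ M ∧ |Ψ f g y| ≤ M)
    (hl : ∀ f₁ g₁ f₂ g₂, Continuous f₁ → Continuous g₁ → Continuous f₂ → Continuous g₂ →
      (∃ M, ∀ y, |f₁ y| ≤ M ∧ |g₁ y| ≤ M) → (∃ M, ∀ y, |f₂ y| ≤ M ∧ |g₂ y| ≤ M) → ∀ δ,
      (∀ y, |f₁ y - f₂ y| ≤ δ ∧ |g₁ y - g₂ y| ≤ δ) →
      ∀ y, |Φ f₁ g₁ y - Φ f₂ g₂ y| ≤ δ / 2 ∧ |Ψ f₁ g₁ y - Ψ f₂ g₂ y| ≤ δ / 2) :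
    ∃ f g, Continuous f ∧ Continuous g ∧ (∃ M, ∀ y, |f y| ≤ M ∧ |g y| ≤ M) ∧
      (∀ y, f y = Φ f g y) ∧ ∀ y, g y = Ψ f g y := by
  have hb : ∀ p : BoundedContinuousFunction ℝ ℝ × BoundedContinuousFunction ℝ ℝ,
      ∃ M, ∀ y, |p.1 y| ≤ M ∧ |p.2 y| ≤ M := fun p =>
    ⟨max ‖p.1‖ ‖p.2‖, fun y => ⟨(p.1.norm_coe_le_norm y).trans (le_max_left _ _),
      (p.2.norm_coe_le_norm y).trans (le_max_right _ _)⟩⟩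
  have h0 := fun p : BoundedContinuousFunction ℝ ℝ × BoundedContinuousFunction ℝ ℝ =>
    hc p.1 p.2 p.1.continuous p.2.continuous (hb p)
  let T : BoundedContinuousFunction ℝ ℝ × BoundedContinuousFunction ℝ ℝ →
      BoundedContinuousFunction ℝ ℝ × BoundedContinuousFunction ℝ ℝ := fun p =>
    (BoundedContinuousFunction.ofNormedAddCommGroup (Φ p.1 p.2) (h0 p).1 (h0 p).2.2.choose
      (fun y => ((h0 p).2.2.choose_spec y).1),
     BoundedContinuousFunction.ofNormedAddCommGroup (Ψ p.1 p.2) (h0 p).2.1 (h0 p).2.2.choose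
      (fun y => ((h0 p).2.2.choose_spec y).2))
  have hT : ContractingWith (1 / 2) T := by
    refine ⟨by norm_num, LipschitzWith.of_dist_le_mul fun p q => ?_⟩
    have hδ : ∀ y, |p.1 y - q.1 y| ≤ dist p q ∧ |p.2 y - q.2 y| ≤ dist p q := fun y =>
      ⟨(BoundedContinuousFunction.dist_coe_le_dist (f := p.1) (g := q.1) y).trans
        (le_max_left _ _),
       (BoundedContinuousFunction.dist_coe_le_dist (f := p.2) (g := q.2) y).trans
        (le_max_right _ _)⟩
    have h1 := hl p.1 p.2 q.1 q.2 p.1.continuous p.2.continuous q.1.continuous q.2.continuous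
      (hb p) (hb q) _ hδ
    have e : ((1 / 2 : NNReal) : ℝ) * dist p q = dist p q / 2 := by push_cast; ring
    have hpos : 0 ≤ dist p q / 2 := by positivity
    rw [e]
    exact max_le ((BoundedContinuousFunction.dist_le hpos).2 fun y => (h1 y).1)
      ((BoundedContinuousFunction.dist_le hpos).2 fun y => (h1 y).2)
  have hfix : T (hT.fixedPoint T) = hT.fixedPoint T := hT.fixedPoint_isFixedPt
  set p := hT.fixedPoint T
  refine ⟨p.1, p.2, p.1.continuous, p.2.continuous, hb p, fun y => ?_, fun y => ?_⟩
  · exact (DFunLike.congr_fun (congrArg Prod.fst hfix) y).symm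
  · exact (DFunLike.congr_fun (congrArg Prod.snd hfix) y).symm

/-! ### The internal mode: existence -/

/-- Truncation to `[-2, 2]`. It makes the sources of the fixed point problem globally bounded and
Lipschitz; the solution found satisfies bounds that make it inactive. -/
noncomputable def clip (x : ℝ) : ℝ := max (-2) (min x 2)

theorem abs_clip_le (x : ℝ) : |clip x| ≤ 2 := by
  rw [clip, abs_le]
  exact ⟨le_max_left _ _, max_le (by norm_num) (min_le_right _ _)⟩

theorem abs_clip_sub_le (x y : ℝ) : |clip x - clip y| ≤ |x - y| := by
  have h1 := abs_max_sub_max_le_max (-2 : ℝ) (min x 2) (-2) (min y 2)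
  have h2 := abs_min_sub_min_le_max x 2 y 2
  rw [sub_self, abs_zero, max_eq_right (abs_nonneg (min x 2 - min y 2))] at h1
  rw [sub_self, abs_zero, max_eq_left (abs_nonneg (x - y))] at h2
  exact h1.trans h2

theorem clip_eq {x : ℝ} (h : |x| ≤ 2) : clip x = x := by
  rw [abs_le] at h
  rw [clip, min_eq_left h.2, max_eq_right h.1]

@[fun_prop]
theorem continuous_clip : Continuous clip := by unfold clip; fun_prop

theorem abs_exp_neg_sub_exp_neg_le {a b : ℝ} (ha : 0 ≤ a) (hb : 0 ≤ b) :
    |Real.exp (-a) - Real.exp (-b)| ≤ |a - b| := by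
  wlog hab : a ≤ b generalizing a b
  · rw [abs_sub_comm, abs_sub_comm a]
    exact this hb ha (le_of_not_ge hab)
  have e : Real.exp (-b) = Real.exp (-a) * Real.exp (-(b - a)) := by
    rw [← Real.exp_add]; ring_nf
  obtain ⟨h1, h2, -⟩ := one_sub_exp_bounds (sub_nonneg.2 hab)
  have e2 : Real.exp (-a) - Real.exp (-b) = Real.exp (-a) * (1 - Real.exp (-(b - a))) := by
    rw [e]; ring
  rw [e2, abs_sub_comm a, abs_of_nonneg (sub_nonneg.2 hab), abs_of_nonneg (by positivity)]
  have h3 : Real.exp (-a) ≤ 1 := Real.exp_le_one_iff.2 (by linarith)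
  exact (mul_le_of_le_one_left h1 h3).trans h2

/-- The kernel `(1 - e^{-αr})/(2α)` is Lipschitz in `α`. -/
theorem abs_smallKernel_sub_le {α β r : ℝ} (hα : 0 < α) (hβ : 0 < β) (hr : 0 ≤ r) :
    |(1 - Real.exp (-α * r)) / (2 * α) - (1 - Real.exp (-β * r)) / (2 * β)|
      ≤ |α - β| * r ^ 2 / 4 := by
  have hd : ∀ γ : ℝ, 0 < γ → ∀ t, HasDerivAt (fun t => (1 - Real.exp (-γ * t)) / (2 * γ))
      (Real.exp (-(γ * t)) / 2) t := fun γ hγ t => by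
    refine (((((hasDerivAt_id' t).const_mul (-γ)).exp).const_sub 1).div_const (2 * γ)).congr_deriv ?_
    rw [neg_mul]; field_simp
  have h := intervalIntegral.integral_eq_sub_of_hasDerivAt (a := 0) (b := r)
    (fun t _ => (hd α hα t).fun_sub (hd β hβ t))
    ((by fun_prop : Continuous fun t => Real.exp (-(α * t)) / 2
      - Real.exp (-(β * t)) / 2).intervalIntegrable _ _)
  simp only [mul_zero, Real.exp_zero, sub_self, zero_div, sub_zero] at h
  rw [← h]
  have e : |α - β| * r ^ 2 / 4 = ∫ t in (0 : ℝ)..r, |α - β| / 2 * t := by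
    rw [intervalIntegral.integral_const_mul, integral_id]; ring
  rw [e]
  refine intervalIntegral.norm_integral_le_of_norm_le (μ := volume)
    (f := fun t => Real.exp (-(α * t)) / 2 - Real.exp (-(β * t)) / 2) hr (ae_of_all _ fun t ht => ?_)
    ((by fun_prop : Continuous fun t : ℝ => |α - β| / 2 * t).intervalIntegrable _ _)
  have ht0 : 0 ≤ t := ht.1.le
  have h1 := abs_exp_neg_sub_exp_neg_le (mul_nonneg hα.le ht0) (mul_nonneg hβ.le ht0)
  rw [← sub_mul, abs_mul, abs_of_nonneg ht0] at h1
  rw [Real.norm_eq_abs, ← sub_div, abs_div, abs_two]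
  linarith

section
variable {σ ε : ℝ} {R : ℝ → ℝ}

theorem abs_shiftedGreen_sub_one_le {α : ℝ} (hα : 0 < α) {F : ℝ → ℝ} (hF : Integrable F)
    (h1 : Integrable fun z => (1 + |z|) * |F z|) (y : ℝ) :
    |shiftedGreen α F y - 1| ≤ 1 / 2 * (1 + |y|) * ∫ z, (1 + |z|) * |F z| := by
  rw [(shiftedGreen_eq hα hF y).2, add_sub_cancel_left, ← integral_const_mul]
  refine norm_integral_le_of_norm_le (μ := volume)
    (f := fun z => (1 - Real.exp (-α * |y - z|)) / (2 * α) * F z) (h1.const_mul _)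
    (ae_of_all _ fun z => ?_)
  rw [Real.norm_eq_abs, abs_mul]
  calc _ ≤ ((1 + |y|) * (1 + |z|) / 2) * |F z| := by
        refine mul_le_mul_of_nonneg_right ?_ (abs_nonneg _)
        exact (smallKernel_bounds hα (abs_nonneg _)).1.trans
          (by have := abs_sub_le_weight y z; linarith)
    _ = _ := by ring

theorem abs_shiftedGreen_sub_le {α β : ℝ} (hα : 0 < α) (hβ : 0 < β) {F G : ℝ → ℝ}
    (hF : Integrable F) (hG : Integrable G) (h2 : Integrable fun z => (1 + |z|) ^ 2 * |F z|)
    (h1 : Integrable fun z => (1 + |z|) * |F z - G z|) (y : ℝ) :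
    |shiftedGreen α F y - shiftedGreen β G y| ≤ (1 + |y|) ^ 2 *
      (|α - β| / 4 * (∫ z, (1 + |z|) ^ 2 * |F z|) + 1 / 2 * ∫ z, (1 + |z|) * |F z - G z|) := by
  obtain ⟨i1, e1⟩ := shiftedGreen_eq hα hF y
  obtain ⟨i2, e2⟩ := shiftedGreen_eq hβ hG y
  rw [e1, e2, add_sub_add_left_eq_sub, ← integral_sub i1 i2, ← integral_const_mul,
    ← integral_const_mul, ← integral_add (h2.const_mul _) (h1.const_mul _), ← integral_const_mul]
  refine norm_integral_le_of_norm_le (μ := volume)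
    (f := fun z => (1 - Real.exp (-α * |y - z|)) / (2 * α) * F z
      - (1 - Real.exp (-β * |y - z|)) / (2 * β) * G z)
    (((h2.const_mul _).add (h1.const_mul _)).const_mul _) (ae_of_all _ fun z => ?_)
  have e4 : (1 - Real.exp (-α * |y - z|)) / (2 * α) * F z
      - (1 - Real.exp (-β * |y - z|)) / (2 * β) * G z
      = ((1 - Real.exp (-α * |y - z|)) / (2 * α) - (1 - Real.exp (-β * |y - z|)) / (2 * β)) * F z
        + (1 - Real.exp (-β * |y - z|)) / (2 * β) * (F z - G z) := by ring
  rw [Real.norm_eq_abs, e4]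
  have hr := abs_sub_le_weight y z
  have hr0 := abs_nonneg (y - z)
  have hr2 : |y - z| ^ 2 ≤ (1 + |y|) ^ 2 * (1 + |z|) ^ 2 := by
    rw [← mul_pow]; exact pow_le_pow_left₀ hr0 hr 2
  have hr3 : |y - z| ≤ (1 + |y|) ^ 2 * (1 + |z|) := hr.trans
    (mul_le_mul_of_nonneg_right (by nlinarith [abs_nonneg y]) (by positivity))
  refine (abs_add_le _ _).trans ?_
  rw [abs_mul, abs_mul ((1 - Real.exp (-β * |y - z|)) / (2 * β))]
  have t1 := mul_le_mul_of_nonneg_right (abs_smallKernel_sub_le hα hβ hr0) (abs_nonneg (F z))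
  have t2 : |α - β| * |y - z| ^ 2 / 4 * |F z|
      ≤ |α - β| * ((1 + |y|) ^ 2 * (1 + |z|) ^ 2) / 4 * |F z| := by
    gcongr
  have t3 : |(1 - Real.exp (-β * |y - z|)) / (2 * β)| * |F z - G z|
      ≤ (1 + |y|) ^ 2 * (1 + |z|) / 2 * |F z - G z| :=
    mul_le_mul_of_nonneg_right ((smallKernel_bounds hβ hr0).1.trans (by linarith)) (abs_nonneg _)
  refine (add_le_add (t1.trans t2) t3).trans (le_of_eq (by ring))

theorem coupling_sub (c₁ c₂ : ℝ) (s d s₂ d₂ : ℝ → ℝ) (y : ℝ) :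
    coupling σ ε R c₁ c₂ s d y - coupling σ ε R c₁ c₂ s₂ d₂ y
      = coupling σ ε R c₁ c₂ (fun y => s y - s₂ y) (fun y => d y - d₂ y) y := by
  simp only [coupling]; ring

theorem abs_coupling_le_weight (hσ : 1 < σ) (hε : 0 < ε) (h : IsProfile σ ε R) {c₁ c₂ : ℝ}
    (hc : |c₁| + |c₂| ≤ coefBound σ) {s d : ℝ → ℝ} {b : ℝ} {k : ℕ}
    (hb : ∀ z, |s z| + |d z| ≤ b * (1 + |z|) ^ k) (z : ℝ) :
    |coupling σ ε R c₁ c₂ s d z| ≤ coefBound σ * ε * b * ((1 + |z|) ^ k * Q z ^ (2 * σ)) := by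
  refine (abs_coupling_le hσ hε h hc s d z).trans ?_
  have hK := coefBound_pos hσ
  calc _ ≤ coefBound σ * ε * (Q z ^ (2 * σ) * (b * (1 + |z|) ^ k)) :=
        mul_le_mul_of_nonneg_left (mul_le_mul_of_nonneg_left (hb z) (Q_rpow_pos _ z).le)
          (by positivity)
    _ = _ := by ring

theorem exists_weight_mul_Q_rpow_le (hσ : 1 < σ) (k : ℕ) :
    ∃ P, 0 < P ∧ ∀ z, (1 + |z|) ^ k * Q z ^ (2 * σ) ≤ P := by
  obtain ⟨q, hq, hqb⟩ := exists_weight_mul_exp_le (c := 2 * σ) (by linarith) k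
  refine ⟨(2 * √2) ^ (2 * σ) * q, by positivity, fun z => ?_⟩
  have h3 := Q_rpow_le_exp (t := 2 * σ) (by linarith) z
  have h5 : Real.exp (-(2 * σ / 2) * |z|) ≤ 1 :=
    Real.exp_le_one_iff.2 (by nlinarith [abs_nonneg z])
  calc (1 + |z|) ^ k * Q z ^ (2 * σ)
      ≤ (1 + |z|) ^ k * ((2 * √2) ^ (2 * σ) * Real.exp (-(2 * σ) * |z|)) :=
        mul_le_mul_of_nonneg_left h3 (by positivity)
    _ = (2 * √2) ^ (2 * σ) * ((1 + |z|) ^ k * Real.exp (-(2 * σ) * |z|)) := by ring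
    _ ≤ _ := mul_le_mul_of_nonneg_left ((hqb z).trans (mul_le_of_le_one_right hq.le h5))
        (by positivity)

/-- The source of the `s` equation, for truncated unknowns `s = (1+|y|)² clip φ`, `d = clip δ`. -/
noncomputable def clippedSource (σ ε : ℝ) (R : ℝ → ℝ) (c₁ c₂ : ℝ) (φ d : ℝ → ℝ) : ℝ → ℝ :=
  coupling σ ε R c₁ c₂ (fun y => (1 + |y|) ^ 2 * clip (φ y)) (fun y => clip (d y))

theorem continuous_clippedSource (h : IsProfile σ ε R) (c₁ c₂ : ℝ) {φ d : ℝ → ℝ}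
    (hφ : Continuous φ) (hd : Continuous d) : Continuous (clippedSource σ ε R c₁ c₂ φ d) :=
  continuous_coupling h _ _ (by fun_prop) (by fun_prop)

theorem abs_clippedSource_le (hσ : 1 < σ) (hε : 0 < ε) (h : IsProfile σ ε R) {c₁ c₂ : ℝ}
    (hc : |c₁| + |c₂| ≤ coefBound σ) (φ d : ℝ → ℝ) (z : ℝ) :
    |clippedSource σ ε R c₁ c₂ φ d z|
      ≤ coefBound σ * ε * 4 * ((1 + |z|) ^ 2 * Q z ^ (2 * σ)) := by
  refine abs_coupling_le_weight hσ hε h hc (fun z => ?_) z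
  rw [abs_mul, abs_of_nonneg (by positivity : (0 : ℝ) ≤ (1 + |z|) ^ 2)]
  have h1 := abs_clip_le (φ z)
  have h2 := abs_clip_le (d z)
  have h3 := one_le_weight 2 z
  nlinarith

theorem abs_clippedSource_sub_le (hσ : 1 < σ) (hε : 0 < ε) (h : IsProfile σ ε R) {c₁ c₂ : ℝ}
    (hc : |c₁| + |c₂| ≤ coefBound σ) {φ₁ d₁ φ₂ d₂ : ℝ → ℝ} {δ : ℝ}
    (hδ : ∀ y, |φ₁ y - φ₂ y| ≤ δ ∧ |d₁ y - d₂ y| ≤ δ) (z : ℝ) :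
    |clippedSource σ ε R c₁ c₂ φ₁ d₁ z - clippedSource σ ε R c₁ c₂ φ₂ d₂ z|
      ≤ coefBound σ * ε * (2 * δ) * ((1 + |z|) ^ 2 * Q z ^ (2 * σ)) := by
  rw [clippedSource, clippedSource, coupling_sub]
  refine abs_coupling_le_weight hσ hε h hc (fun z => ?_) z
  rw [← mul_sub, abs_mul, abs_of_nonneg (by positivity : (0 : ℝ) ≤ (1 + |z|) ^ 2)]
  have h1 := (abs_clip_sub_le (φ₁ z) (φ₂ z)).trans (hδ z).1
  have h2 := (abs_clip_sub_le (d₁ z) (d₂ z)).trans (hδ z).2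
  have h3 := one_le_weight 2 z
  have h4 : 0 ≤ δ := (abs_nonneg _).trans (hδ z).1
  nlinarith [mul_le_mul_of_nonneg_left h1 (by positivity : (0 : ℝ) ≤ (1 + |z|) ^ 2)]

theorem integral_weight_clippedSource (hσ : 1 < σ) (hε : 0 < ε) (h : IsProfile σ ε R) {c₁ c₂ : ℝ}
    (hc : |c₁| + |c₂| ≤ coefBound σ) {φ d : ℝ → ℝ} (hφ : Continuous φ) (hd : Continuous d)
    (l : ℕ) : Integrable (fun z => (1 + |z|) ^ l * |clippedSource σ ε R c₁ c₂ φ d z|) ∧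
      ∫ z, (1 + |z|) ^ l * |clippedSource σ ε R c₁ c₂ φ d z|
        ≤ coefBound σ * ε * 4 * moment σ (l + 2) :=
  integrable_of_abs_le_weight_Q hσ (continuous_clippedSource h _ _ hφ hd)
    (abs_clippedSource_le hσ hε h hc φ d) l

theorem integral_weight_clippedSource_sub (hσ : 1 < σ) (hε : 0 < ε) (h : IsProfile σ ε R)
    {c₁ c₂ : ℝ} (hc : |c₁| + |c₂| ≤ coefBound σ) {φ₁ d₁ φ₂ d₂ : ℝ → ℝ} (hφ₁ : Continuous φ₁)
    (hd₁ : Continuous d₁) (hφ₂ : Continuous φ₂) (hd₂ : Continuous d₂) {δ : ℝ}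
    (hδ : ∀ y, |φ₁ y - φ₂ y| ≤ δ ∧ |d₁ y - d₂ y| ≤ δ) (l : ℕ) :
    Integrable (fun z => (1 + |z|) ^ l * |clippedSource σ ε R c₁ c₂ φ₁ d₁ z
      - clippedSource σ ε R c₁ c₂ φ₂ d₂ z|) ∧
      ∫ z, (1 + |z|) ^ l * |clippedSource σ ε R c₁ c₂ φ₁ d₁ z
        - clippedSource σ ε R c₁ c₂ φ₂ d₂ z| ≤ coefBound σ * ε * (2 * δ) * moment σ (l + 2) :=
  integrable_of_abs_le_weight_Q hσ ((continuous_clippedSource h _ _ hφ₁ hd₁).sub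
    (continuous_clippedSource h _ _ hφ₂ hd₂)) (abs_clippedSource_sub_le hσ hε h hc hδ) l

end

section
variable {σ ε : ℝ} {R : ℝ → ℝ}

/-- The rate `α = -½ ∫ F` prescribed by the normalization, bounded below by `c ε` so that it is
positive for arbitrary unknowns. -/
noncomputable def clippedRate (σ ε c : ℝ) (R φ d : ℝ → ℝ) : ℝ :=
  max (c * ε) (-(1 / 2) * ∫ z, clippedSource σ ε R (coef1 σ) (coef2 σ) φ d z)

theorem clippedRate_pos {c : ℝ} (hc : 0 < c) (hε : 0 < ε) (φ d : ℝ → ℝ) :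
    0 < clippedRate σ ε c R φ d := lt_max_of_lt_left (by positivity)

theorem clippedRate_le (hσ : 1 < σ) (hε : 0 < ε) (h : IsProfile σ ε R) {c : ℝ} (hc : 0 < c)
    {φ d : ℝ → ℝ} (hφ : Continuous φ) (hd : Continuous d) :
    clippedRate σ ε c R φ d ≤ (c + 2 * coefBound σ * moment σ 2) * ε := by
  have hK := coefBound_pos hσ
  have hJ := moment_nonneg σ 2
  have h1 := (integral_weight_clippedSource hσ hε h (coef_le₁ σ) hφ hd 0).2
  simp only [pow_zero, one_mul, zero_add] at h1
  have h2 : |∫ z, clippedSource σ ε R (coef1 σ) (coef2 σ) φ d z|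
      ≤ ∫ z, |clippedSource σ ε R (coef1 σ) (coef2 σ) φ d z| := abs_integral_le_integral_abs
  have h3 := neg_abs_le (∫ z, clippedSource σ ε R (coef1 σ) (coef2 σ) φ d z)
  have h4 : 0 ≤ coefBound σ * moment σ 2 * ε := by positivity
  have h5 : 0 < c * ε := by positivity
  refine max_le ?_ ?_
  · linarith
  · linarith

theorem abs_clippedRate_sub_le (hσ : 1 < σ) (hε : 0 < ε) (h : IsProfile σ ε R) (c : ℝ)
    {φ₁ d₁ φ₂ d₂ : ℝ → ℝ} (hφ₁ : Continuous φ₁) (hd₁ : Continuous d₁) (hφ₂ : Continuous φ₂)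
    (hd₂ : Continuous d₂) {δ : ℝ} (hδ : ∀ y, |φ₁ y - φ₂ y| ≤ δ ∧ |d₁ y - d₂ y| ≤ δ) :
    |clippedRate σ ε c R φ₁ d₁ - clippedRate σ ε c R φ₂ d₂|
      ≤ coefBound σ * moment σ 2 * ε * δ := by
  have i1 := (integral_weight_clippedSource hσ hε h (coef_le₁ σ) hφ₁ hd₁ 0).1
  have i2 := (integral_weight_clippedSource hσ hε h (coef_le₁ σ) hφ₂ hd₂ 0).1
  have h1 := (integral_weight_clippedSource_sub hσ hε h (coef_le₁ σ) hφ₁ hd₁ hφ₂ hd₂ hδ 0).2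
  simp only [pow_zero, one_mul, zero_add] at h1 i1 i2
  set F₁ := clippedSource σ ε R (coef1 σ) (coef2 σ) φ₁ d₁
  set F₂ := clippedSource σ ε R (coef1 σ) (coef2 σ) φ₂ d₂
  have c1 : Continuous F₁ := continuous_clippedSource h _ _ hφ₁ hd₁
  have c2 : Continuous F₂ := continuous_clippedSource h _ _ hφ₂ hd₂
  have i1' : Integrable F₁ := (integrable_norm_iff c1.aestronglyMeasurable).1 i1
  have i2' : Integrable F₂ := (integrable_norm_iff c2.aestronglyMeasurable).1 i2
  have h2 : |∫ z, (F₁ z - F₂ z)| ≤ ∫ z, |F₁ z - F₂ z| := abs_integral_le_integral_abs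
  rw [integral_sub i1' i2'] at h2
  have h3 := abs_max_sub_max_le_max (c * ε) (-(1 / 2) * ∫ z, F₁ z) (c * ε) (-(1 / 2) * ∫ z, F₂ z)
  rw [sub_self, abs_zero, ← mul_sub, abs_mul, abs_neg,
    abs_of_pos (by norm_num : (0 : ℝ) < 1 / 2)] at h3
  refine h3.trans (max_le ?_ ?_)
  · have h4 : 0 ≤ δ := (abs_nonneg _).trans (hδ 0).1
    have hK := coefBound_pos hσ
    have hJ := moment_nonneg σ 2
    positivity
  · linarith

theorem green_sub {κ : ℝ} (hκ : 0 < κ) {f g : ℝ → ℝ} (hf : Continuous f)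
    (hg : Continuous g) {M N : ℝ} (hM : ∀ z, |f z| ≤ M) (hN : ∀ z, |g z| ≤ N) (y : ℝ) :
    green κ (fun z => f z - g z) y = green κ f y - green κ g y :=
  (eq_green (u := fun y => green κ f y - green κ g y)
    (u' := fun y => greenDeriv κ f y - greenDeriv κ g y) (f := fun z => f z - g z) hκ
    (by fun_prop) (fun z => (abs_sub _ _).trans (add_le_add (hM z) (hN z)))
    (fun y => (hasDerivAt_green hκ hf hM y).fun_sub (hasDerivAt_green hκ hg hN y))
    (fun y => ((hasDerivAt_greenDeriv hκ hf hM y).fun_sub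
      (hasDerivAt_greenDeriv hκ hg hN y)).congr_deriv (by ring))
    (M := M / κ ^ 2 + N / κ ^ 2)
    (fun y => (abs_sub _ _).trans (add_le_add (abs_green_le hκ hM y)
      (abs_green_le hκ hN y))) y).1.symm

theorem abs_green_sub_le {κ : ℝ} (hκ : 0 < κ) {f g : ℝ → ℝ} (hf : Continuous f)
    (hg : Continuous g) {M N B : ℝ} (hM : ∀ z, |f z| ≤ M) (hN : ∀ z, |g z| ≤ N)
    (hB : ∀ z, |f z - g z| ≤ B) (y : ℝ) : |green κ f y - green κ g y| ≤ B / κ ^ 2 := by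
  rw [← green_sub hκ hf hg hM hN]
  exact abs_green_le hκ hB y

/-- The source of the `d` equation `d'' = 2 d + (G - α² d)`, for truncated unknowns. -/
noncomputable def clippedSource₂ (σ ε c : ℝ) (R φ d : ℝ → ℝ) (y : ℝ) : ℝ :=
  clippedSource σ ε R (coef2 σ) (coef1 σ) φ d y - clippedRate σ ε c R φ d ^ 2 * clip (d y)

theorem integrable_clippedSource (hσ : 1 < σ) (hε : 0 < ε) (h : IsProfile σ ε R) {c₁ c₂ : ℝ}
    (hc : |c₁| + |c₂| ≤ coefBound σ) {φ d : ℝ → ℝ} (hφ : Continuous φ) (hd : Continuous d) :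
    Integrable (clippedSource σ ε R c₁ c₂ φ d) := by
  have i1 := (integral_weight_clippedSource hσ hε h hc hφ hd 0).1
  simp only [pow_zero, one_mul] at i1
  exact (integrable_norm_iff (continuous_clippedSource h _ _ hφ hd).aestronglyMeasurable).1 i1

/-- The Lipschitz estimate for the first component of the fixed point map. -/
theorem abs_shiftedGreen_clipped_sub_le (hσ : 1 < σ) (hε : 0 < ε) (h : IsProfile σ ε R) {c : ℝ}
    (hc : 0 < c) {φ₁ d₁ φ₂ d₂ : ℝ → ℝ} (hφ₁ : Continuous φ₁) (hd₁ : Continuous d₁)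
    (hφ₂ : Continuous φ₂) (hd₂ : Continuous d₂) {δ : ℝ}
    (hδ : ∀ y, |φ₁ y - φ₂ y| ≤ δ ∧ |d₁ y - d₂ y| ≤ δ) (y : ℝ) :
    |shiftedGreen (clippedRate σ ε c R φ₁ d₁) (clippedSource σ ε R (coef1 σ) (coef2 σ) φ₁ d₁) y
      - shiftedGreen (clippedRate σ ε c R φ₂ d₂) (clippedSource σ ε R (coef1 σ) (coef2 σ) φ₂ d₂) y|
    ≤ (1 + |y|) ^ 2 * ((coefBound σ ^ 2 * moment σ 2 * moment σ 4 * ε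
      + coefBound σ * moment σ 3) * ε * δ) := by
  have hK := coefBound_pos hσ
  obtain ⟨i1, b1⟩ := integral_weight_clippedSource hσ hε h (coef_le₁ σ) hφ₁ hd₁ 2
  obtain ⟨i2, b2⟩ :=
    integral_weight_clippedSource_sub hσ hε h (coef_le₁ σ) hφ₁ hd₁ hφ₂ hd₂ hδ 1
  simp only [pow_one] at i2 b2
  refine (abs_shiftedGreen_sub_le (clippedRate_pos hc hε _ _) (clippedRate_pos hc hε _ _)
    (integrable_clippedSource hσ hε h (coef_le₁ σ) hφ₁ hd₁)
    (integrable_clippedSource hσ hε h (coef_le₁ σ) hφ₂ hd₂) i1 i2 y).trans ?_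
  refine mul_le_mul_of_nonneg_left ?_ (by positivity)
  have h1 := abs_clippedRate_sub_le hσ hε h c hφ₁ hd₁ hφ₂ hd₂ hδ
  have h2 := mul_le_mul h1 b1 (integral_nonneg fun _ => by positivity)
    ((abs_nonneg _).trans h1)
  norm_num at b2 h2
  linarith

theorem abs_clippedSource₂_sub_le (hσ : 1 < σ) (hε : 0 < ε) (h : IsProfile σ ε R) {c P : ℝ}
    (hc : 0 < c) (hP : ∀ z, (1 + |z|) ^ 2 * Q z ^ (2 * σ) ≤ P)
    {φ₁ d₁ φ₂ d₂ : ℝ → ℝ} (hφ₁ : Continuous φ₁) (hd₁ : Continuous d₁)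
    (hφ₂ : Continuous φ₂) (hd₂ : Continuous d₂) {δ : ℝ}
    (hδ : ∀ y, |φ₁ y - φ₂ y| ≤ δ ∧ |d₁ y - d₂ y| ≤ δ) (y : ℝ) :
    |clippedSource₂ σ ε c R φ₁ d₁ y - clippedSource₂ σ ε c R φ₂ d₂ y|
      ≤ (2 * coefBound σ * P + 4 * ((c + 2 * coefBound σ * moment σ 2) * ε) * (coefBound σ *
        moment σ 2) + (c + 2 * coefBound σ * moment σ 2) ^ 2 * ε) * ε * δ := by
  have hK := coefBound_pos hσ
  have hJ := moment_nonneg σ 2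
  have hδ0 : 0 ≤ δ := (abs_nonneg _).trans (hδ 0).1
  set Λ := c + 2 * coefBound σ * moment σ 2 with hΛ
  have hΛ0 : 0 < Λ := by positivity
  set α₁ := clippedRate σ ε c R φ₁ d₁ with hα₁
  set α₂ := clippedRate σ ε c R φ₂ d₂ with hα₂
  have p1 : 0 < α₁ := clippedRate_pos hc hε _ _
  have p2 : 0 < α₂ := clippedRate_pos hc hε _ _
  have l1 : α₁ ≤ Λ * ε := clippedRate_le hσ hε h hc hφ₁ hd₁
  have l2 : α₂ ≤ Λ * ε := clippedRate_le hσ hε h hc hφ₂ hd₂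
  have h1 := abs_clippedRate_sub_le hσ hε h c hφ₁ hd₁ hφ₂ hd₂ hδ
  have h2 : |α₁ ^ 2 - α₂ ^ 2| ≤ (2 * (Λ * ε)) * (coefBound σ * moment σ 2 * ε * δ) := by
    rw [show α₁ ^ 2 - α₂ ^ 2 = (α₁ + α₂) * (α₁ - α₂) by ring, abs_mul]
    exact mul_le_mul (by rw [abs_of_pos (by linarith)]; linarith) h1 (abs_nonneg _) (by positivity)
  have h3 := (abs_clippedSource_sub_le hσ hε h (coef_le₂ σ) hδ y).trans
    (mul_le_mul_of_nonneg_left (hP y) (by positivity))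
  have e : clippedSource₂ σ ε c R φ₁ d₁ y - clippedSource₂ σ ε c R φ₂ d₂ y
      = (clippedSource σ ε R (coef2 σ) (coef1 σ) φ₁ d₁ y
        - clippedSource σ ε R (coef2 σ) (coef1 σ) φ₂ d₂ y)
        - ((α₁ ^ 2 - α₂ ^ 2) * clip (d₁ y) + α₂ ^ 2 * (clip (d₁ y) - clip (d₂ y))) := by
    simp only [clippedSource₂, ← hα₁, ← hα₂]; ring
  have h4 : |(α₁ ^ 2 - α₂ ^ 2) * clip (d₁ y)|
      ≤ (2 * (Λ * ε)) * (coefBound σ * moment σ 2 * ε * δ) * 2 := by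
    rw [abs_mul]
    exact mul_le_mul h2 (abs_clip_le _) (abs_nonneg _) (by positivity)
  have h5 : |α₂ ^ 2 * (clip (d₁ y) - clip (d₂ y))| ≤ (Λ * ε) ^ 2 * δ := by
    rw [abs_mul, abs_of_nonneg (sq_nonneg _)]
    exact mul_le_mul (pow_le_pow_left₀ p2.le l2 2) ((abs_clip_sub_le _ _).trans (hδ y).2)
      (abs_nonneg _) (by positivity)
  rw [e]
  refine (abs_sub _ _).trans ((add_le_add h3 ((abs_add_le _ _).trans (add_le_add h4 h5))).trans ?_)
  exact le_of_eq (by ring)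

theorem abs_clippedSource₂_le (hσ : 1 < σ) (hε : 0 < ε) (h : IsProfile σ ε R) {c P : ℝ}
    (hc : 0 < c) (hP : ∀ z, (1 + |z|) ^ 2 * Q z ^ (2 * σ) ≤ P)
    {φ d : ℝ → ℝ} (hφ : Continuous φ) (hd : Continuous d) (y : ℝ) :
    |clippedSource₂ σ ε c R φ d y|
      ≤ (4 * coefBound σ * P + 2 * (c + 2 * coefBound σ * moment σ 2) ^ 2 * ε) * ε := by
  have hK := coefBound_pos hσ
  have h1 := (abs_clippedSource_le hσ hε h (coef_le₂ σ) φ d y).trans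
    (mul_le_mul_of_nonneg_left (hP y) (by positivity))
  have h2 : |clippedRate σ ε c R φ d ^ 2 * clip (d y)|
      ≤ ((c + 2 * coefBound σ * moment σ 2) * ε) ^ 2 * 2 := by
    rw [abs_mul, abs_of_nonneg (sq_nonneg _)]
    exact mul_le_mul (pow_le_pow_left₀ (clippedRate_pos hc hε _ _).le
      (clippedRate_le hσ hε h hc hφ hd) 2) (abs_clip_le _) (abs_nonneg _) (by positivity)
  refine (abs_sub _ _).trans ((add_le_add h1 h2).trans (le_of_eq (by ring)))

theorem continuous_clippedSource₂ (h : IsProfile σ ε R) (c : ℝ) {φ d : ℝ → ℝ}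
    (hφ : Continuous φ) (hd : Continuous d) : Continuous (clippedSource₂ σ ε c R φ d) :=
  (continuous_clippedSource h _ _ hφ hd).sub ((continuous_clip.comp hd).const_mul _)

/-- Existence for the truncated problem, by contraction for `φ = s / (1 + |y|)²` and `d`: the
weight compensates the quadratic growth of the dependence of the Green potential on the rate. -/
theorem exists_clipped (hσ : 1 < σ) {c : ℝ} (hc : 0 < c) : ∃ ε₀, 0 < ε₀ ∧ ∃ E, 0 < E ∧ ∀ ε R,
    0 < ε → ε ≤ ε₀ → IsProfile σ ε R → ∃ φ d, Continuous φ ∧ Continuous d ∧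
      (∀ y, (1 + |y|) ^ 2 * φ y = shiftedGreen (clippedRate σ ε c R φ d)
        (clippedSource σ ε R (coef1 σ) (coef2 σ) φ d) y) ∧
      (∀ y, d y = green √2 (clippedSource₂ σ ε c R φ d) y) ∧
      (∀ y, |φ y| ≤ 2 ∧ |d y| ≤ 2) ∧
      (∀ y, |(1 + |y|) ^ 2 * φ y - 1| ≤ E * ε * (1 + |y|) ∧ |d y| ≤ E * ε) ∧
      clippedRate σ ε c R φ d < 1 := by
  have hK := coefBound_pos hσ
  have hJ2 := moment_nonneg σ 2
  have hJ3 := moment_nonneg σ 3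
  have hJ4 := moment_nonneg σ 4
  obtain ⟨P, hP0, hP⟩ := exists_weight_mul_Q_rpow_le hσ 2
  set K := coefBound σ
  set Λ := c + 2 * K * moment σ 2 with hΛ
  have hΛ0 : 0 < Λ := by positivity
  set L₁ := K ^ 2 * moment σ 2 * moment σ 4 + K * moment σ 3 with hL₁
  set L₂ := 2 * K * P + 4 * Λ * (K * moment σ 2) + Λ ^ 2 with hL₂
  set E := 2 * K * moment σ 3 + (4 * K * P + 2 * Λ ^ 2) with hE
  have hL₁0 : 0 ≤ L₁ := by positivity
  have hL₂0 : 0 ≤ L₂ := by positivity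
  have hE0 : 0 < E := by positivity
  set N := 1 + L₁ + L₂ + E + Λ with hN
  have hN0 : 0 < N := by positivity
  refine ⟨1 / (2 * N), by positivity, E, hE0, fun ε R hε hle h => ?_⟩
  rw [le_div_iff₀ (by positivity)] at hle
  have key : ∀ {x : ℝ}, x ≤ N → x * ε ≤ 1 / 2 := fun hx => by
    have := mul_le_mul_of_nonneg_right hx hε.le
    linarith
  have k0 : 1 * ε ≤ 1 / 2 := key (by linarith)
  have k1 : L₁ * ε ≤ 1 / 2 := key (by linarith)
  have k2 : L₂ * ε ≤ 1 / 2 := key (by linarith)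
  have k3 : E * ε ≤ 1 / 2 := key (by linarith)
  have k4 : Λ * ε ≤ 1 / 2 := key (by linarith)
  have hε1 : ε ≤ 1 := by linarith
  have hw : ∀ y : ℝ, 1 ≤ (1 + |y|) ^ 2 := one_le_weight 2
  have hsq : (√2 : ℝ) ^ 2 = 2 := sqrt_two_sq
  -- bounds for the values of the map
  have val1 : ∀ {φ d : ℝ → ℝ}, Continuous φ → Continuous d → ∀ y,
      |shiftedGreen (clippedRate σ ε c R φ d) (clippedSource σ ε R (coef1 σ) (coef2 σ) φ d) y - 1|
        ≤ E * ε * (1 + |y|) := fun {φ d} hφ hd y => by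
    obtain ⟨i1, b1⟩ := integral_weight_clippedSource hσ hε h (coef_le₁ σ) hφ hd 1
    simp only [pow_one] at i1 b1
    norm_num at b1
    refine (abs_shiftedGreen_sub_one_le (clippedRate_pos hc hε _ _)
      (integrable_clippedSource hσ hε h (coef_le₁ σ) hφ hd) i1 y).trans ?_
    calc _ ≤ 1 / 2 * (1 + |y|) * (K * ε * 4 * moment σ 3) :=
          mul_le_mul_of_nonneg_left b1 (by positivity)
      _ = (2 * K * moment σ 3) * ε * (1 + |y|) := by ring
      _ ≤ _ := by
          refine mul_le_mul_of_nonneg_right (mul_le_mul_of_nonneg_right ?_ hε.le) (by positivity)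
          have : 0 ≤ 4 * K * P + 2 * Λ ^ 2 := by positivity
          linarith
  have src2 : ∀ {φ d : ℝ → ℝ}, Continuous φ → Continuous d → ∀ y,
      |clippedSource₂ σ ε c R φ d y| ≤ E * ε := fun {φ d} hφ hd y => by
    refine (abs_clippedSource₂_le hσ hε h hc hP hφ hd y).trans
      (mul_le_mul_of_nonneg_right ?_ hε.le)
    have : 2 * Λ ^ 2 * ε ≤ 2 * Λ ^ 2 := mul_le_of_le_one_right (by positivity) hε1
    have : 0 ≤ 2 * K * moment σ 3 := by positivity
    linarith
  have val2 : ∀ {φ d : ℝ → ℝ}, Continuous φ → Continuous d → ∀ y,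
      |green √2 (clippedSource₂ σ ε c R φ d) y| ≤ E * ε := fun {φ d} hφ hd y => by
    refine (abs_green_le (by positivity) (src2 hφ hd) y).trans ?_
    exact div_le_self (by positivity) (by rw [hsq]; norm_num)
  have val1' : ∀ {φ d : ℝ → ℝ}, Continuous φ → Continuous d → ∀ y,
      |shiftedGreen (clippedRate σ ε c R φ d) (clippedSource σ ε R (coef1 σ) (coef2 σ) φ d) y
        / (1 + |y|) ^ 2| ≤ 2 := fun {φ d} hφ hd y => by
    rw [abs_div, abs_of_nonneg (by positivity : (0 : ℝ) ≤ (1 + |y|) ^ 2),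
      div_le_iff₀ (by positivity)]
    have h1 := val1 hφ hd y
    have h2 := abs_add_le (shiftedGreen (clippedRate σ ε c R φ d)
      (clippedSource σ ε R (coef1 σ) (coef2 σ) φ d) y - 1) 1
    rw [sub_add_cancel, abs_one] at h2
    have h3 : E * ε * (1 + |y|) ≤ 1 / 2 * (1 + |y|) :=
      mul_le_mul_of_nonneg_right k3 (by positivity)
    nlinarith [abs_nonneg y]
  obtain ⟨φ, d, hφ, hd, -, e1, e2⟩ := exists_fixedPoint_pair
    (fun φ d y => shiftedGreen (clippedRate σ ε c R φ d)
      (clippedSource σ ε R (coef1 σ) (coef2 σ) φ d) y / (1 + |y|) ^ 2)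
    (fun φ d => green √2 (clippedSource₂ σ ε c R φ d))
    (fun φ d hφ hd _ => by
      refine ⟨?_, ?_, 2, fun y => ⟨val1' hφ hd y, (val2 hφ hd y).trans (by linarith)⟩⟩
      · have hcg : Continuous (green (clippedRate σ ε c R φ d)
            (clippedSource σ ε R (coef1 σ) (coef2 σ) φ d)) :=
          continuous_of_hasDerivAt (hasDerivAt_green (clippedRate_pos hc hε _ _)
            (continuous_clippedSource h _ _ hφ hd) fun z =>
            (abs_clippedSource_le hσ hε h (coef_le₁ σ) φ d z).trans
              (mul_le_mul_of_nonneg_left (hP z) (by positivity)))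
        exact (hcg.const_add _).div (by fun_prop) fun y => by positivity
      · exact continuous_of_hasDerivAt (hasDerivAt_green (by positivity)
          (continuous_clippedSource₂ h c hφ hd) (src2 hφ hd)))
    (fun φ₁ d₁ φ₂ d₂ hφ₁ hd₁ hφ₂ hd₂ _ _ δ hδ y => by
      have hδ0 : 0 ≤ δ := (abs_nonneg _).trans (hδ 0).1
      constructor
      · rw [← sub_div, abs_div, abs_of_nonneg (by positivity : (0 : ℝ) ≤ (1 + |y|) ^ 2),
          div_le_iff₀ (by positivity)]
        refine (abs_shiftedGreen_clipped_sub_le hσ hε h hc hφ₁ hd₁ hφ₂ hd₂ hδ y).trans ?_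
        rw [mul_comm (δ / 2)]
        refine mul_le_mul_of_nonneg_left ?_ (by positivity)
        have : (K ^ 2 * moment σ 2 * moment σ 4 * ε + K * moment σ 3) * ε ≤ L₁ * ε := by
          refine mul_le_mul_of_nonneg_right ?_ hε.le
          have : K ^ 2 * moment σ 2 * moment σ 4 * ε ≤ K ^ 2 * moment σ 2 * moment σ 4 :=
            mul_le_of_le_one_right (by positivity) hε1
          linarith
        have := mul_le_mul_of_nonneg_right (this.trans k1) hδ0
        linarith
      · have hb := abs_clippedSource₂_sub_le hσ hε h hc hP hφ₁ hd₁ hφ₂ hd₂ hδ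
        refine (abs_green_sub_le (by positivity) (continuous_clippedSource₂ h c hφ₁ hd₁)
          (continuous_clippedSource₂ h c hφ₂ hd₂) (src2 hφ₁ hd₁) (src2 hφ₂ hd₂) hb y).trans ?_
        rw [hsq]
        refine div_le_div_of_nonneg_right ?_ (by norm_num)
        have : (2 * K * P + 4 * (Λ * ε) * (K * moment σ 2) + Λ ^ 2 * ε) * ε ≤ L₂ * ε := by
          refine mul_le_mul_of_nonneg_right ?_ hε.le
          have h1 : Λ ^ 2 * ε ≤ Λ ^ 2 := mul_le_of_le_one_right (by positivity) hε1
          have h2 : 4 * Λ * (K * moment σ 2) * ε ≤ 4 * Λ * (K * moment σ 2) :=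
            mul_le_of_le_one_right (by positivity) hε1
          linarith
        have := mul_le_mul_of_nonneg_right (this.trans k2) hδ0
        linarith)
  have e1' : ∀ y, (1 + |y|) ^ 2 * φ y = shiftedGreen (clippedRate σ ε c R φ d)
      (clippedSource σ ε R (coef1 σ) (coef2 σ) φ d) y := fun y => by
    have : (1 + |y|) ^ 2 ≠ 0 := by positivity
    rw [e1 y]; field_simp
  refine ⟨φ, d, hφ, hd, e1', e2, fun y => ⟨?_, ?_⟩, fun y => ⟨?_, ?_⟩,
    (clippedRate_le hσ hε h hc hφ hd).trans_lt (by linarith)⟩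
  · rw [e1]; exact val1' hφ hd y
  · rw [e2]; exact (val2 hφ hd y).trans (by linarith)
  · rw [e1']; exact val1 hφ hd y
  · rw [e2]; exact val2 hφ hd y

theorem moment_pos (hσ : 1 < σ) (k : ℕ) : 0 < moment σ k := by
  have hpos : ∀ z : ℝ, 0 < (1 + |z|) ^ k * Q z ^ (2 * σ) := fun z =>
    mul_pos (by positivity) (Q_rpow_pos _ z)
  rw [moment, integral_pos_iff_support_of_nonneg (fun z => (hpos z).le)
    (integrable_weight_mul_Q_rpow (by linarith) k),
    show Function.support (fun z : ℝ => (1 + |z|) ^ k * Q z ^ (2 * σ)) = univ from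
      eq_univ_of_forall fun z => (hpos z).ne']
  simp

/-- Existence of the internal mode. Since `s = 1 + O(ε)` and `d = O(ε)` for the solution of the
truncated problem, `-½ ∫ F` is close to `ε (σ-1)²/(2(σ+1)) ∫ Q^(2σ)`, which exceeds the lower
truncation `c ε` of the rate for the `c` chosen here. -/
theorem exists_modePair (hσ : 1 < σ) : ∃ ε₀, 0 < ε₀ ∧ ∀ ε R, 0 < ε → ε ≤ ε₀ → IsProfile σ ε R →
    ∃ α s s' d d', IsModePair σ ε R α s s' d d' := by
  have hK := coefBound_pos hσ
  have hJ0 := moment_pos hσ 0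
  have hJ1 := moment_nonneg σ 1
  have hσ2 : 0 < (σ - 1) ^ 2 / (σ + 1) :=
    div_pos (pow_pos (by linarith) 2) (by linarith)
  set q := (σ - 1) ^ 2 / (σ + 1) with hq
  have hc1 : coef1 σ = -q := rfl
  set c := q * moment σ 0 / 8 with hc
  have hc0 : 0 < c := by positivity
  obtain ⟨ε₁, hε₁, E, hE, hex⟩ := exists_clipped hσ hc0
  obtain ⟨ε₂, hε₂, hpow⟩ := exists_rpow_bound hσ
  obtain ⟨P, hP, hpow⟩ := hpow (2 * σ)
  set K := coefBound σ
  set X := K * (2 * E) * moment σ 1 with hX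
  have hX0 : 0 ≤ X := by positivity
  refine ⟨min ε₁ (min ε₂ (min (1 / (2 * P)) (c / (X + 1)))), by positivity, fun ε R hε hle h => ?_⟩
  have hle1 := hle.trans (min_le_left _ _)
  have hle' := hle.trans (min_le_right _ _)
  have hle2 := hle'.trans (min_le_left _ _)
  have hle'' := hle'.trans (min_le_right _ _)
  have hle3 := hle''.trans (min_le_left _ _)
  have hle4 := hle''.trans (min_le_right _ _)
  rw [le_div_iff₀ (by positivity)] at hle3 hle4
  obtain ⟨φ, d, hφ, hd, e1, e2, hcl, hval, hlt⟩ := hex ε R hε hle1 h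
  set α := clippedRate σ ε c R φ d with hα
  have hα0 : 0 < α := clippedRate_pos hc0 hε _ _
  set s : ℝ → ℝ := fun y => (1 + |y|) ^ 2 * φ y with hs
  have hF : clippedSource σ ε R (coef1 σ) (coef2 σ) φ d
      = coupling σ ε R (coef1 σ) (coef2 σ) s d := by
    funext y
    simp only [clippedSource, coupling, hs, clip_eq (hcl y).1, clip_eq (hcl y).2]
  have hG : clippedSource σ ε R (coef2 σ) (coef1 σ) φ d
      = coupling σ ε R (coef2 σ) (coef1 σ) s d := by
    funext y
    simp only [clippedSource, coupling, hs, clip_eq (hcl y).1, clip_eq (hcl y).2]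
  have hiF := integrable_clippedSource hσ hε h (coef_le₁ σ) hφ hd
  rw [hF] at hiF e1
  set F := coupling σ ε R (coef1 σ) (coef2 σ) s d with hFdef
  have hcs : Continuous s := by fun_prop
  have hcF : Continuous F := continuous_coupling h _ _ hcs hd
  have hcG : Continuous (coupling σ ε R (coef2 σ) (coef1 σ) s d) := continuous_coupling h _ _ hcs hd
  -- the lower truncation of the rate is not active
  have hint : ∫ z, F z = -2 * α := by
    have hb : ∀ z, |s z - 1| + |d z| ≤ 2 * E * ε * (1 + |z|) ^ 1 := fun z => by
      have h1 := (hval z).1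
      have h2 := (hval z).2
      have h3 : E * ε ≤ E * ε * (1 + |z|) :=
        le_mul_of_one_le_right (by positivity) (by linarith [abs_nonneg z])
      rw [pow_one]
      linarith
    have hcs1 : Continuous fun z => s z - 1 := by fun_prop
    have hr := abs_coupling_le_weight hσ hε h (coef_le₁ σ) (s := fun z => s z - 1) hb
    obtain ⟨i1, b1⟩ := integrable_of_abs_le_weight_Q hσ
      (continuous_coupling h _ _ hcs1 hd) hr 0
    simp only [pow_zero, one_mul, zero_add] at i1 b1
    have i1' := (integrable_norm_iff (continuous_coupling h _ _
      hcs1 hd).aestronglyMeasurable).1 i1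
    have e : F = fun z => -q * pot σ ε R z
        + coupling σ ε R (coef1 σ) (coef2 σ) (fun z => s z - 1) d z := by
      funext z; simp only [hFdef, coupling, hc1]; ring
    have i0 := (integrable_weight_mul_Q_rpow (t := 2 * σ) (by linarith) 0)
    simp only [pow_zero, one_mul] at i0
    have hipot : Integrable (pot σ ε R) := (i0.const_mul ε).mono'
      (continuous_pot h).aestronglyMeasurable (ae_of_all _ fun z => by
        rw [Real.norm_eq_abs, abs_of_pos (pot_pos hε h z)]; exact pot_le hσ hε h z)
    have hlow : 1 / 2 * ε * moment σ 0 ≤ ∫ z, pot σ ε R z := by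
      simp only [moment, pow_zero, one_mul]
      rw [← integral_const_mul]
      refine integral_mono (i0.const_mul _) hipot fun z => ?_
      have hz := (abs_le.1 (hpow ε R hε hle2 h z)).1
      have hQ := Q_rpow_pos (2 * σ) z
      have h5 : P * ε * Q z ^ (2 * σ) ≤ 1 / 2 * Q z ^ (2 * σ) :=
        mul_le_mul_of_nonneg_right (by linarith) hQ.le
      calc 1 / 2 * ε * Q z ^ (2 * σ) = ε * (1 / 2 * Q z ^ (2 * σ)) := by ring
        _ ≤ ε * R z ^ (2 * σ) := mul_le_mul_of_nonneg_left (by linarith) hε.le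
    have hsum : ∫ z, F z = -q * (∫ z, pot σ ε R z)
        + ∫ z, coupling σ ε R (coef1 σ) (coef2 σ) (fun z => s z - 1) d z := by
      simp only [e]
      rw [integral_add (hipot.const_mul _) i1', integral_const_mul]
    have habs := le_abs_self (∫ z, coupling σ ε R (coef1 σ) (coef2 σ) (fun z => s z - 1) d z)
    have habs2 := habs.trans (abs_integral_le_integral_abs.trans b1)
    have h6 : K * ε * (2 * E * ε) * moment σ 1 ≤ c * ε := by
      calc K * ε * (2 * E * ε) * moment σ 1 = (ε * X) * ε := by rw [hX]; ring
        _ ≤ c * ε := mul_le_mul_of_nonneg_right (by linarith) hε.le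
    have h7 := mul_le_mul_of_nonneg_left hlow hσ2.le
    have h8 : c * ε ≤ -(1 / 2) * ∫ z, F z := by
      rw [hsum]
      have : 8 * c = q * moment σ 0 := by rw [hc]; ring
      nlinarith
    have h9 : α = -(1 / 2) * ∫ z, F z := by
      rw [hα, clippedRate, hF]
      exact max_eq_right h8
    linarith
  obtain ⟨P₂, hP₂, hP₂b⟩ := exists_weight_mul_Q_rpow_le hσ 2
  have hFb : ∀ z, |F z| ≤ K * ε * 4 * P₂ := fun z => by
    have := abs_clippedSource_le hσ hε h (coef_le₁ σ) φ d z
    rw [hF] at this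
    exact this.trans (mul_le_mul_of_nonneg_left (hP₂b z) (by positivity))
  have hsg : ∀ y, s y = green α F y := fun y => by
    have := e1 y
    rw [shiftedGreen, hint] at this
    rw [show s y = (1 + |y|) ^ 2 * φ y from rfl, this]
    field_simp
    ring
  have hsfun : s = green α F := funext hsg
  set G₂ := clippedSource₂ σ ε c R φ d with hG₂
  have hcG₂ : Continuous G₂ := continuous_clippedSource₂ h c hφ hd
  have hG₂b := abs_clippedSource₂_le hσ hε h hc0 hP₂b hφ hd
  have hdfun : d = green √2 G₂ := funext e2
  have hG₂eq : ∀ y, G₂ y = coupling σ ε R (coef2 σ) (coef1 σ) s d y - α ^ 2 * d y := fun y => by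
    rw [hG₂, clippedSource₂, hG, clip_eq (hcl y).2]
  refine ⟨α, s, greenDeriv α F, d, greenDeriv √2 G₂, hα0, hlt, fun y => ?_, fun y => ?_,
    fun y => ?_, fun y => ?_, ⟨K * ε * 4 * P₂ / α ^ 2 + 2, fun y => ⟨?_, ?_⟩⟩, hint⟩
  · rw [hsfun]; exact hasDerivAt_green hα0 hcF hFb y
  · rw [hsg]; exact hasDerivAt_greenDeriv hα0 hcF hFb y
  · have := hasDerivAt_green (κ := √2) (by positivity) hcG₂ hG₂b y
    rwa [← hdfun] at this
  · refine (hasDerivAt_greenDeriv (κ := √2) (by positivity) hcG₂ hG₂b y).congr_deriv ?_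
    rw [sqrt_two_sq, ← e2, hG₂eq]
    ring
  · rw [hsg]
    exact (abs_green_le hα0 hFb y).trans (by linarith)
  · have : 0 ≤ K * ε * 4 * P₂ / α ^ 2 := by positivity
    linarith [(hcl y).2]

end

/-! ### The soliton: existence -/

/-- The solution `∫₀^y S(y-z) F(z) dz` of `u'' = m u + F` with zero data at the origin, written
with separated variables; `C`, `S` are the fundamental solutions of `u'' = m u`. -/
noncomputable def volterra (C S F : ℝ → ℝ) (y : ℝ) : ℝ :=
  S y * (∫ z in (0 : ℝ)..y, C z * F z) - C y * ∫ z in (0 : ℝ)..y, S z * F z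

/-- The derivative of `volterra C S F`. -/
noncomputable def volterraDeriv (m : ℝ) (C S F : ℝ → ℝ) (y : ℝ) : ℝ :=
  C y * (∫ z in (0 : ℝ)..y, C z * F z) - m * S y * ∫ z in (0 : ℝ)..y, S z * F z

section Volterra
variable {m : ℝ} {C S F : ℝ → ℝ}

theorem hasDerivAt_integral_zero (hF : Continuous F) (y : ℝ) :
    HasDerivAt (fun y => ∫ z in (0 : ℝ)..y, F z) (F y) y :=
  intervalIntegral.integral_hasDerivAt_right (hF.intervalIntegrable _ _)
    hF.aestronglyMeasurable.stronglyMeasurableAtFilter hF.continuousAt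

theorem hasDerivAt_volterra (hC : ∀ t, HasDerivAt C (m * S t) t)
    (hS : ∀ t, HasDerivAt S (C t) t) (hF : Continuous F) (y : ℝ) :
    HasDerivAt (volterra C S F) (volterraDeriv m C S F y) y := by
  have cC := continuous_of_hasDerivAt hC
  have cS := continuous_of_hasDerivAt hS
  refine (((hS y).fun_mul (hasDerivAt_integral_zero (cC.mul hF) y)).fun_sub
    ((hC y).fun_mul (hasDerivAt_integral_zero (cS.mul hF) y))).congr_deriv ?_
  simp only [volterraDeriv, Pi.mul_apply]; ring

theorem hasDerivAt_volterraDeriv (hC : ∀ t, HasDerivAt C (m * S t) t)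
    (hS : ∀ t, HasDerivAt S (C t) t) (h1 : ∀ t, C t ^ 2 - m * S t ^ 2 = 1) (hF : Continuous F)
    (y : ℝ) : HasDerivAt (volterraDeriv m C S F) (m * volterra C S F y + F y) y := by
  have cC := continuous_of_hasDerivAt hC
  have cS := continuous_of_hasDerivAt hS
  refine (((hC y).fun_mul (hasDerivAt_integral_zero (cC.mul hF) y)).fun_sub
    (((hS y).const_mul m).fun_mul (hasDerivAt_integral_zero (cS.mul hF) y))).congr_deriv ?_
  simp only [volterra, Pi.mul_apply]
  linear_combination F y * h1 y

theorem volterra_eq (hC : Continuous C) (hS : Continuous S) (hF : Continuous F)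
    (hadd : ∀ y z, S (y - z) = S y * C z - C y * S z) (y : ℝ) :
    volterra C S F y = ∫ z in (0 : ℝ)..y, S (y - z) * F z := by
  simp only [volterra, hadd]
  rw [← intervalIntegral.integral_const_mul, ← intervalIntegral.integral_const_mul,
    ← intervalIntegral.integral_sub ((by fun_prop : Continuous _).intervalIntegrable _ _)
      ((by fun_prop : Continuous _).intervalIntegrable _ _)]
  congr 1; funext z; ring

theorem volterra_zero : volterra C S F 0 = 0 := by simp [volterra]

theorem volterraDeriv_zero : volterraDeriv m C S F 0 = 0 := by simp [volterraDeriv]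

end Volterra

theorem volterra_cosh_eq {F : ℝ → ℝ} (hF : Continuous F) (y : ℝ) :
    volterra Real.cosh Real.sinh F y = ∫ z in (0 : ℝ)..y, Real.sinh (y - z) * F z :=
  volterra_eq Real.continuous_cosh Real.continuous_sinh hF (fun y z => Real.sinh_sub y z) y

theorem contDiff_of_hasDerivAt_hasDerivAt {n : ℕ} {u u' u'' : ℝ → ℝ}
    (h : ∀ y, HasDerivAt u (u' y) y) (h' : ∀ y, HasDerivAt u' (u'' y) y)
    (hc : ContDiff ℝ n u'') : ContDiff ℝ (n + 2 : ℕ) u := by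
  have e1 : deriv u = u' := funext fun y => (h y).deriv
  have e2 : deriv u' = u'' := funext fun y => (h' y).deriv
  have c1 : ContDiff ℝ ((n : WithTop ℕ∞) + 1) u' :=
    contDiff_succ_iff_deriv.2 ⟨fun y => (h' y).differentiableAt, by simp, by rwa [e2]⟩
  have c2 : ContDiff ℝ ((n : WithTop ℕ∞) + 1 + 1) u :=
    contDiff_succ_iff_deriv.2 ⟨fun y => (h y).differentiableAt, by simp, by rwa [e1]⟩
  refine c2.of_le (le_of_eq ?_)
  push_cast
  rw [add_assoc, one_add_one_eq_two]

theorem memLp_of_abs_le_exp {f : ℝ → ℝ} (hf : Continuous f) {C c : ℝ} (hc : 0 < c)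
    (h : ∀ y, |f y| ≤ C * Real.exp (-c * |y|)) : MemLp f 2 volume := by
  rw [memLp_two_iff_integrable_sq hf.aestronglyMeasurable]
  refine ((integrable_exp_neg_mul_abs (mul_pos two_pos hc)).const_mul (C ^ 2)).mono'
    (by fun_prop) (ae_of_all _ fun y => ?_)
  rw [Real.norm_eq_abs, abs_of_nonneg (sq_nonneg _), ← sq_abs]
  calc |f y| ^ 2 ≤ (C * Real.exp (-c * |y|)) ^ 2 := pow_le_pow_left₀ (abs_nonneg _) (h y) 2
    _ = C ^ 2 * Real.exp (-(2 * c) * |y|) := by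
      rw [mul_pow, ← Real.exp_nat_mul]; ring_nf

/-- The value `1/R(0)` prescribed by the first integral, as `R'(0) = 0`. -/
theorem exists_center {σ ε : ℝ} (hσ : 1 < σ) (hε : 0 < ε) :
    ∃ x, 1 / √2 ≤ x ∧ x ^ 2 = 1 / 2 + ε / (σ + 1) * x ^ (2 - 2 * σ) := by
  have hτ : 0 < ε / (σ + 1) := div_pos hε (by linarith)
  have h0 : (0 : ℝ) < 1 / √2 := by positivity
  have hs : (1 / √2 : ℝ) ^ 2 = 1 / 2 := by rw [div_pow, sqrt_two_sq]; norm_num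
  have hle : 1 / √2 ≤ 1 + ε / (σ + 1) := by
    have : (1 / √2 : ℝ) ≤ 1 := by
      rw [div_le_one (by positivity)]
      exact Real.one_le_sqrt.2 (by norm_num)
    linarith
  set f : ℝ → ℝ := fun x => x ^ 2 - (1 / 2 + ε / (σ + 1) * x ^ (2 - 2 * σ)) with hf
  have hcont : ContinuousOn f (Icc (1 / √2) (1 + ε / (σ + 1))) := by
    intro x hx
    have hx0 : x ≠ 0 := (h0.trans_le hx.1).ne'
    have : ContinuousAt (fun x : ℝ => x ^ (2 - 2 * σ)) x :=
      Real.continuousAt_rpow_const _ _ (Or.inl hx0)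
    exact ((continuousAt_id.pow 2).sub (continuousAt_const.add
      (continuousAt_const.mul this))).continuousWithinAt
  have h1 : f (1 / √2) ≤ 0 := by
    have : 0 < (1 / √2 : ℝ) ^ (2 - 2 * σ) := Real.rpow_pos_of_pos h0 _
    simp only [hf, hs]; nlinarith
  have h2 : 0 ≤ f (1 + ε / (σ + 1)) := by
    have : (1 + ε / (σ + 1)) ^ (2 - 2 * σ) ≤ 1 :=
      Real.rpow_le_one_of_one_le_of_nonpos (by linarith) (by linarith)
    simp only [hf]; nlinarith
  obtain ⟨x, hx, hfx⟩ := intermediate_value_Icc hle hcont ⟨h1, h2⟩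
  exact ⟨x, hx.1, by simp only [hf] at hfx; linarith⟩

theorem abs_rpow_max_sub_le {t x y : ℝ} (ht : t ≤ 0) :
    |max x (1 / 2) ^ t - max y (1 / 2) ^ t| ≤ -t * (1 / 2) ^ (t - 1) * |x - y| := by
  have hd : ∀ z ∈ Ici (1 / 2 : ℝ),
      HasDerivWithinAt (fun z : ℝ => z ^ t) (t * z ^ (t - 1)) (Ici (1 / 2)) z := fun z hz =>
    (Real.hasDerivAt_rpow_const (Or.inl (by
      have : (1 / 2 : ℝ) ≤ z := hz
      linarith))).hasDerivWithinAt
  have h := (convex_Ici (1 / 2 : ℝ)).norm_image_sub_le_of_norm_hasDerivWithin_le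
    (C := -t * (1 / 2) ^ (t - 1)) hd (fun z hz => by
      have hz' : (1 / 2 : ℝ) ≤ z := hz
      have hz0 : 0 < z := by linarith
      rw [Real.norm_eq_abs, abs_mul, abs_of_nonpos ht, abs_of_pos (Real.rpow_pos_of_pos hz0 _)]
      exact mul_le_mul_of_nonneg_left
        (Real.rpow_le_rpow_of_nonpos (by norm_num) hz' (by linarith)) (by linarith))
    (show max y (1 / 2) ∈ Ici (1 / 2 : ℝ) from mem_Ici.2 (le_max_right _ _))
    (show max x (1 / 2) ∈ Ici (1 / 2 : ℝ) from mem_Ici.2 (le_max_right _ _))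
  refine h.trans (mul_le_mul_of_nonneg_left ?_
    (mul_nonneg (by linarith) (Real.rpow_nonneg (by norm_num) _)))
  have h2 := abs_max_sub_max_le_max x (1 / 2) y (1 / 2)
  rwa [sub_self, abs_zero, max_eq_left (abs_nonneg (x - y))] at h2

section
variable {σ : ℝ}

/-- The truncated source `(cosh · max ξ ½)^(1-2σ)` of the equation for `v = ξ cosh`. -/
noncomputable def profileSource (σ : ℝ) (ξ : ℝ → ℝ) (z : ℝ) : ℝ :=
  (Real.cosh z * max (ξ z) (1 / 2)) ^ (1 - 2 * σ)

theorem profileSource_eq (σ : ℝ) (ξ : ℝ → ℝ) (z : ℝ) : profileSource σ ξ z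
    = Real.cosh z ^ (1 - 2 * σ) * max (ξ z) (1 / 2) ^ (1 - 2 * σ) :=
  Real.mul_rpow (Real.cosh_pos z).le (le_max_of_le_right (by norm_num))

theorem continuous_profileSource {ξ : ℝ → ℝ} (hξ : Continuous ξ) :
    Continuous (profileSource σ ξ) := by
  refine Continuous.rpow_const (by fun_prop) fun z => Or.inl ?_
  have : (0 : ℝ) < max (ξ z) (1 / 2) := lt_max_of_lt_right (by norm_num)
  have := Real.cosh_pos z
  positivity

theorem profileSource_pos (σ : ℝ) (ξ : ℝ → ℝ) (z : ℝ) : 0 < profileSource σ ξ z :=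
  Real.rpow_pos_of_pos (mul_pos (Real.cosh_pos z) (lt_max_of_lt_right (by norm_num))) _

theorem abs_profileSource_le (hσ : 1 < σ) (ξ : ℝ → ℝ) (z : ℝ) :
    |profileSource σ ξ z| ≤ (1 / 2) ^ (1 - 2 * σ) := by
  rw [abs_of_pos (profileSource_pos σ ξ z)]
  refine Real.rpow_le_rpow_of_nonpos (by norm_num) ?_ (by linarith)
  have h1 := Real.one_le_cosh z
  have h2 : (1 / 2 : ℝ) ≤ max (ξ z) (1 / 2) := le_max_right _ _
  nlinarith

theorem abs_profileSource_sub_le (hσ : 1 < σ) (ξ η : ℝ → ℝ) (z : ℝ) :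
    |profileSource σ ξ z - profileSource σ η z|
      ≤ (2 * σ - 1) * (1 / 2) ^ (-(2 * σ)) * |ξ z - η z| := by
  rw [profileSource_eq, profileSource_eq, ← mul_sub, abs_mul,
    abs_of_pos (Real.rpow_pos_of_pos (Real.cosh_pos z) _)]
  have h1 : Real.cosh z ^ (1 - 2 * σ) ≤ 1 :=
    Real.rpow_le_one_of_one_le_of_nonpos (Real.one_le_cosh z) (by linarith)
  have h2 := abs_rpow_max_sub_le (t := 1 - 2 * σ) (x := ξ z) (y := η z) (by linarith)
  rw [show -(1 - 2 * σ) = 2 * σ - 1 by ring, show 1 - 2 * σ - 1 = -(2 * σ) by ring] at h2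
  exact (mul_le_of_le_one_left (abs_nonneg _) h1).trans h2

theorem volterra_even {C S F : ℝ → ℝ} (hC : ∀ t, C (-t) = C t) (hS : ∀ t, S (-t) = -S t)
    (hF : ∀ t, F (-t) = F t) (y : ℝ) : volterra C S F (-y) = volterra C S F y := by
  have h1 := intervalIntegral.integral_comp_neg (a := 0) (b := y) (fun z => C z * F z)
  have h2 := intervalIntegral.integral_comp_neg (a := 0) (b := y) (fun z => S z * F z)
  simp only [hC, hS, hF, neg_mul, intervalIntegral.integral_neg, neg_zero] at h1 h2
  rw [volterra, intervalIntegral.integral_symm (-y) 0, intervalIntegral.integral_symm (-y) 0,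
    ← h1, ← h2, hC, hS, volterra]
  ring

theorem volterra_nonneg {F : ℝ → ℝ} (hF : Continuous F) (hev : ∀ z, F (-z) = F z)
    (hpos : ∀ z, 0 < F z) (y : ℝ) : 0 ≤ volterra Real.cosh Real.sinh F y := by
  wlog hy : 0 ≤ y generalizing y
  · rw [← volterra_even Real.cosh_neg Real.sinh_neg hev]
    exact this (-y) (by linarith)
  rw [volterra_cosh_eq hF]
  exact intervalIntegral.integral_nonneg hy fun z hz =>
    mul_nonneg (Real.sinh_nonneg_iff.2 (by linarith [hz.2])) (hpos z).le

/-- Existence of the reciprocal `v = 1/R`, as a solution of `v'' = v + ε c v^(1-2σ)`: contraction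
for `ξ = v / cosh` in Duhamel's formula. The source is nonnegative, which gives `v ≥ cosh / √2` and
makes the truncation inactive. -/
theorem exists_recip_profile (hσ : 1 < σ) : ∃ ε₀, 0 < ε₀ ∧ ∀ ε, 0 < ε → ε ≤ ε₀ →
    ∃ v v' : ℝ → ℝ, (∀ y, HasDerivAt v (v' y) y) ∧
      (∀ y, HasDerivAt v' (v y + ε * ((σ - 1) / (σ + 1)) * v y ^ (1 - 2 * σ)) y) ∧
      (∀ y, v (-y) = v y) ∧ (∀ y, 1 / √2 * Real.cosh y ≤ v y) ∧ v' 0 = 0 ∧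
      v 0 ^ 2 = 1 / 2 + ε / (σ + 1) * v 0 ^ (2 - 2 * σ) := by
  set c := (σ - 1) / (σ + 1) with hc
  have hc0 : 0 < c := div_pos (by linarith) (by linarith)
  set L := (2 * σ - 1) * (1 / 2 : ℝ) ^ (-(2 * σ)) with hL
  have hL0 : 0 < L := mul_pos (by linarith) (Real.rpow_pos_of_pos (by norm_num) _)
  set B := (1 / 2 : ℝ) ^ (1 - 2 * σ) with hB
  have hB0 : 0 < B := Real.rpow_pos_of_pos (by norm_num) _
  refine ⟨1 / (2 * c * L), by positivity, fun ε hε hle => ?_⟩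
  rw [le_div_iff₀ (by positivity)] at hle
  obtain ⟨x, hx, hx2⟩ := exists_center hσ hε
  -- using `|y|` in the upper limit makes the solution even
  obtain ⟨ξ, -, hξ, -, -, e1, -⟩ := exists_fixedPoint_pair
    (fun ξ _ y => x + ε * c * (volterra Real.cosh Real.sinh (profileSource σ ξ) |y| / Real.cosh y))
    (fun _ _ _ => 0)
    (fun ξ _ hξ _ _ => by
      have hF := continuous_profileSource (σ := σ) hξ
      have hv : Continuous (volterra Real.cosh Real.sinh (profileSource σ ξ)) :=
        continuous_of_hasDerivAt (hasDerivAt_volterra (m := 1)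
          (fun t => by simpa using Real.hasDerivAt_cosh t) Real.hasDerivAt_sinh hF)
      refine ⟨continuous_const.add (continuous_const.mul ((hv.comp continuous_abs).div
        Real.continuous_cosh fun y => (Real.cosh_pos y).ne')), continuous_const,
        |x| + ε * c * B, fun y => ⟨?_, by rw [abs_zero]; positivity⟩⟩
      refine (abs_add_le _ _).trans ?_
      rw [abs_mul (ε * c), abs_of_pos (by positivity : 0 < ε * c), abs_div,
        abs_of_pos (Real.cosh_pos y)]
      gcongr
      rw [div_le_iff₀ (Real.cosh_pos y), volterra_cosh_eq hF]
      have := abs_integral_kernel_le (K := Real.sinh) abs_sinh_le_cosh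
        (abs_profileSource_le hσ ξ) |y|
      rwa [Real.cosh_abs] at this)
    (fun ξ _ η _ hξ _ hη _ _ _ δ hδ y => by
      have hF := continuous_profileSource (σ := σ) hξ
      have hG := continuous_profileSource (σ := σ) hη
      have hδ0 : 0 ≤ δ := (abs_nonneg _).trans (hδ 0).1
      refine ⟨?_, by simp only [sub_self, abs_zero]; positivity⟩
      have h1 := abs_integral_kernel_le (K := Real.sinh) abs_sinh_le_cosh
        (F := fun z => profileSource σ ξ z - profileSource σ η z) (B := L * δ)
        (fun z => (abs_profileSource_sub_le hσ ξ η z).trans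
          (mul_le_mul_of_nonneg_left (hδ z).1 hL0.le)) |y|
      rw [← integral_kernel_sub Real.continuous_sinh hF hG, Real.cosh_abs] at h1
      rw [volterra_cosh_eq hF, volterra_cosh_eq hG, add_sub_add_left_eq_sub, ← mul_sub, ← sub_div,
        abs_mul, abs_of_pos (by positivity : 0 < ε * c), abs_div, abs_of_pos (Real.cosh_pos y)]
      have h2 := (div_le_iff₀ (Real.cosh_pos y)).2 h1
      calc _ ≤ ε * c * (L * δ) := mul_le_mul_of_nonneg_left h2 (by positivity)
        _ ≤ δ / 2 := by nlinarith)
  set F := profileSource σ ξ with hF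
  have hcF : Continuous F := continuous_profileSource hξ
  have hξev : ∀ y, ξ (-y) = ξ y := fun y => by rw [e1, e1 y, abs_neg, Real.cosh_neg]
  have hFev : ∀ y, F (-y) = F y := fun y => by
    simp only [hF, profileSource, hξev, Real.cosh_neg]
  have habs : ∀ y, volterra Real.cosh Real.sinh F |y| = volterra Real.cosh Real.sinh F y :=
    fun y => by
      rcases abs_choice y with h | h <;> rw [h]
      exact volterra_even Real.cosh_neg Real.sinh_neg hFev y
  have hξx : ∀ y, x ≤ ξ y := fun y => by
    have h1 := volterra_nonneg hcF hFev (profileSource_pos σ ξ) |y|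
    rw [e1]
    have := Real.cosh_pos y
    have : 0 ≤ ε * c * (volterra Real.cosh Real.sinh F |y| / Real.cosh y) := by positivity
    linarith
  have hhalf : (1 / 2 : ℝ) ≤ 1 / √2 := by
    apply one_div_le_one_div_of_le (by positivity)
    rw [Real.sqrt_le_left (by norm_num)]; norm_num
  set v : ℝ → ℝ := fun y => x * Real.cosh y + ε * c * volterra Real.cosh Real.sinh F y with hv
  have hvξ : ∀ y, v y = Real.cosh y * ξ y := fun y => by
    have := (Real.cosh_pos y).ne'
    rw [e1, habs]; simp only [hv]; field_simp
  have hvF : ∀ y, F y = v y ^ (1 - 2 * σ) := fun y => by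
    rw [hvξ, hF, profileSource, max_eq_left (hhalf.trans (hx.trans (hξx y)))]
  have hcosh : ∀ t, HasDerivAt Real.cosh (1 * Real.sinh t) t := fun t => by
    simpa using Real.hasDerivAt_cosh t
  have hv0 : v 0 = x := by simp [hv, volterra_zero]
  refine ⟨v, fun y => x * Real.sinh y + ε * c * volterraDeriv 1 Real.cosh Real.sinh F y,
    fun y => ?_, fun y => ?_, fun y => ?_, fun y => ?_, ?_, ?_⟩
  · exact ((Real.hasDerivAt_cosh y).const_mul x).fun_add
      ((hasDerivAt_volterra hcosh Real.hasDerivAt_sinh hcF y).const_mul _)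
  · refine (((Real.hasDerivAt_sinh y).const_mul x).fun_add
      ((hasDerivAt_volterraDeriv hcosh Real.hasDerivAt_sinh
        (fun t => by rw [one_mul]; exact Real.cosh_sq_sub_sinh_sq t) hcF y).const_mul
          (ε * c))).congr_deriv ?_
    rw [← hvF]; simp only [hv]; ring
  · rw [hvξ, hvξ, hξev, Real.cosh_neg]
  · rw [hvξ, mul_comm]
    exact mul_le_mul_of_nonneg_left (hx.trans (hξx y)) (Real.cosh_pos y).le
  · simp [volterraDeriv_zero]
  · rw [hv0]; exact hx2

/-- Existence of a smooth soliton, as the reciprocal of `v`. -/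
theorem exists_soliton (hσ : 1 < σ) : ∃ ε₀, 0 < ε₀ ∧ ∀ ε, 0 < ε → ε ≤ ε₀ → ∃ R : ℝ → ℝ,
    IsProfile σ ε R ∧ ContDiff ℝ (⊤ : ℕ∞) R ∧ MemLp R 2 volume ∧ MemLp (deriv R) 2 volume ∧
      ∀ y, deriv (deriv R) y = R y - R y ^ 3 - ε * R y ^ (2 * σ) * R y := by
  obtain ⟨ε₀, hε₀, hex⟩ := exists_recip_profile hσ
  refine ⟨ε₀, hε₀, fun ε hε hle => ?_⟩
  obtain ⟨v, v', hv, hv', hev, hlow, hv0', hv0⟩ := hex ε hε hle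
  have hσ1 : σ + 1 ≠ 0 := by linarith
  have hpos : ∀ y, 0 < v y := fun y =>
    lt_of_lt_of_le (mul_pos (by positivity) (Real.cosh_pos y)) (hlow y)
  have hne : ∀ y, v y ≠ 0 := fun y => (hpos y).ne'
  -- the first integral of the equation, with the constant fixed by the value at the origin
  have henergy : ∀ y, v' y ^ 2 = v y ^ 2 - 1 / 2 - ε / (σ + 1) * v y ^ (2 - 2 * σ) := by
    have hE : ∀ y, HasDerivAt (fun y => v' y ^ 2 - v y ^ 2
        + ε / (σ + 1) * v y ^ (2 - 2 * σ)) 0 y := fun y => by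
      refine ((((hv' y).fun_pow 2).fun_sub ((hv y).fun_pow 2)).fun_add
        ((hasDerivAt_comp_rpow (t := 2 - 2 * σ) (hv y) (hpos y)).const_mul
          (ε / (σ + 1)))).congr_deriv ?_
      have e : v y ^ (2 - 2 * σ) = v y ^ (1 - 2 * σ) * v y := by
        rw [← Real.rpow_add_one (hne y)]; ring_nf
      rw [e]
      have := hne y
      simp only [Nat.cast_ofNat, Nat.add_one_sub_one, pow_one]
      field_simp
      ring
    have hconst := is_const_of_deriv_eq_zero (fun y => (hE y).differentiableAt)
      (fun y => (hE y).deriv)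
    intro y
    have h1 := hconst y 0
    simp only [hv0'] at h1
    have h2 := hv0
    linarith
  have hsmooth : ∀ n : ℕ, ContDiff ℝ n v := by
    intro n
    induction n using Nat.strong_induction_on with
    | _ n ih =>
      have base : ContDiff ℝ (0 + 2 : ℕ) v := by
        refine contDiff_of_hasDerivAt_hasDerivAt hv hv' ?_
        have hcv := continuous_of_hasDerivAt hv
        have : Continuous fun y => v y ^ (1 - 2 * σ) :=
          hcv.rpow_const fun y => Or.inl (hne y)
        exact contDiff_zero.2 (by fun_prop)
      rcases Nat.lt_or_ge n 3 with hn | hn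
      · exact base.of_le (by exact_mod_cast (by omega : n ≤ 0 + 2))
      · obtain ⟨k, rfl⟩ : ∃ k, n = k + 2 := ⟨n - 2, by omega⟩
        refine contDiff_of_hasDerivAt_hasDerivAt hv hv' ?_
        have hk := ih k (by omega)
        exact hk.add (contDiff_const.mul (hk.rpow_const_of_ne hne))
  set R : ℝ → ℝ := fun y => (v y)⁻¹ with hR
  have hRsmooth : ContDiff ℝ (⊤ : ℕ∞) R := by
    have : ContDiff ℝ (⊤ : ℕ∞) v := contDiff_infty.2 hsmooth
    exact this.inv hne
  have hRd : ∀ y, HasDerivAt R (-v' y / v y ^ 2) y := fun y => (hv y).fun_inv (hne y)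
  have hderiv : deriv R = fun y => -v' y / v y ^ 2 := funext fun y => (hRd y).deriv
  have hpow : ∀ y, R y ^ (2 * σ) = v y ^ (1 - 2 * σ) / v y := fun y => by
    rw [hR]
    simp only
    rw [Real.inv_rpow (hpos y).le, ← Real.rpow_neg (hpos y).le, ← Real.rpow_sub_one (hne y)]
    ring_nf
  have hRdd : ∀ y, HasDerivAt (deriv R) (R y - R y ^ 3 - ε * R y ^ (2 * σ) * R y) y := fun y => by
    rw [hderiv]
    refine ((hv' y).fun_neg.fun_div ((hv y).fun_pow 2) (pow_ne_zero 2 (hne y))).congr_deriv ?_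
    have e2 : v' y ^ 2 = v y ^ 2 - 1 / 2 - ε / (σ + 1) * (v y ^ (1 - 2 * σ) * v y) := by
      rw [henergy, ← Real.rpow_add_one (hne y)]; ring_nf
    rw [hpow]
    simp only [hR]
    have := hne y
    simp only [Nat.cast_ofNat, Nat.add_one_sub_one, pow_one]
    generalize v y ^ (1 - 2 * σ) = p at e2 ⊢
    field_simp
    field_simp at e2
    linear_combination e2
  have hRenergy : ∀ y, deriv R y ^ 2
      = R y ^ 2 - R y ^ 4 / 2 - ε / (σ + 1) * R y ^ (2 * σ) * R y ^ 2 := fun y => by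
    have e2 : v' y ^ 2 = v y ^ 2 - 1 / 2 - ε / (σ + 1) * (v y ^ (1 - 2 * σ) * v y) := by
      rw [henergy, ← Real.rpow_add_one (hne y)]; ring_nf
    rw [hderiv, hpow]
    simp only [hR]
    have := hne y
    rw [div_pow, neg_sq, e2]
    field_simp
  have hprof : IsProfile σ ε R :=
    ⟨fun y => inv_pos.2 (hpos y), fun y => by simp only [hR, hev],
      fun y => by rw [(hRd y).deriv]; exact hRd y, hRdd, hRenergy⟩
  have hRexp : ∀ y, |R y| ≤ 2 * √2 * Real.exp (-1 * |y|) := fun y => by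
    rw [abs_of_pos (hprof.pos y), neg_one_mul]
    exact (hprof.le_Q hσ hε y).trans (Q_le_exp y)
  refine ⟨R, hprof, hRsmooth, memLp_of_abs_le_exp hRsmooth.continuous one_pos hRexp,
    memLp_of_abs_le_exp (C := 2 * √2) (continuous_of_hasDerivAt hRdd) one_pos fun y => ?_,
    fun y => (hRdd y).deriv⟩
  refine le_trans (sq_le_sq.1 ?_) (hRexp y)
  rw [hRenergy]
  have := hprof.pos y
  have h1 : 0 < R y ^ (2 * σ) := Real.rpow_pos_of_pos this _
  have h2 : 0 < ε / (σ + 1) := div_pos hε (by linarith)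
  have : 0 < ε / (σ + 1) * R y ^ (2 * σ) * R y ^ 2 := by positivity
  have : 0 < R y ^ 4 / 2 := by positivity
  linarith

end

section
variable {σ ε a ω α μ : ℝ} {R s s' d d' : ℝ → ℝ}

theorem contDiff_pot (h : IsProfile σ ε R) (hR : ContDiff ℝ (⊤ : ℕ∞) R) :
    ContDiff ℝ (⊤ : ℕ∞) (pot σ ε R) :=
  contDiff_const.mul (hR.rpow_const_of_ne fun y => (h.pos y).ne')

/-- Smoothness of the solutions of `s'' = m₁ s + F`, `d'' = m₂ d + G`. -/
theorem contDiff_of_system (h : IsProfile σ ε R) (hR : ContDiff ℝ (⊤ : ℕ∞) R) {m₁ m₂ : ℝ}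
    (hs : ∀ y, HasDerivAt s (s' y) y)
    (hs' : ∀ y, HasDerivAt s' (m₁ * s y + coupling σ ε R (coef1 σ) (coef2 σ) s d y) y)
    (hd : ∀ y, HasDerivAt d (d' y) y)
    (hd' : ∀ y, HasDerivAt d' (m₂ * d y + coupling σ ε R (coef2 σ) (coef1 σ) s d y) y) :
    ContDiff ℝ (⊤ : ℕ∞) s ∧ ContDiff ℝ (⊤ : ℕ∞) d := by
  have hp := contDiff_infty.1 (contDiff_pot h hR)
  have step : ∀ n : ℕ, ContDiff ℝ n s → ContDiff ℝ n d →
      ContDiff ℝ (n + 2 : ℕ) s ∧ ContDiff ℝ (n + 2 : ℕ) d := fun n cs cd =>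
    ⟨contDiff_of_hasDerivAt_hasDerivAt hs hs' ((contDiff_const.mul cs).add
      ((hp n).mul ((contDiff_const.mul cs).add (contDiff_const.mul cd)))),
     contDiff_of_hasDerivAt_hasDerivAt hd hd' ((contDiff_const.mul cd).add
      ((hp n).mul ((contDiff_const.mul cs).add (contDiff_const.mul cd))))⟩
  have all : ∀ n : ℕ, ContDiff ℝ n s ∧ ContDiff ℝ n d := by
    intro n
    induction n with
    | zero => exact ⟨contDiff_zero.2 (continuous_of_hasDerivAt hs),
        contDiff_zero.2 (continuous_of_hasDerivAt hd)⟩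
    | succ n ih =>
      obtain ⟨h1, h2⟩ := step n ih.1 ih.2
      exact ⟨h1.of_le (by exact_mod_cast (by omega : n + 1 ≤ n + 2)),
        h2.of_le (by exact_mod_cast (by omega : n + 1 ≤ n + 2))⟩
  exact ⟨contDiff_infty.2 fun n => (all n).1, contDiff_infty.2 fun n => (all n).2⟩

theorem isSmoothH2_of_decay {u u' u'' : ℝ → ℝ} (hu : ∀ y, HasDerivAt u (u' y) y)
    (hu' : ∀ y, HasDerivAt u' (u'' y) y) (hc : ContDiff ℝ (⊤ : ℕ∞) u) {C c : ℝ} (hc0 : 0 < c)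
    (hb : ∀ y, |u y| ≤ C * Real.exp (-c * |y|) ∧ |u' y| ≤ C * Real.exp (-c * |y|) ∧
      |u'' y| ≤ C * Real.exp (-c * |y|)) : IsSmoothH2 u := by
  have e1 : deriv u = u' := funext fun y => (hu y).deriv
  have e2 : deriv u' = u'' := funext fun y => (hu' y).deriv
  have c1 := contDiff_infty_iff_deriv.1 hc
  rw [e1] at c1
  have c2 := contDiff_infty_iff_deriv.1 c1.2
  rw [e2] at c2
  refine ⟨hc, memLp_of_abs_le_exp hc.continuous hc0 fun y => (hb y).1, ?_, ?_⟩
  · rw [e1]; exact memLp_of_abs_le_exp c1.2.continuous hc0 fun y => (hb y).2.1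
  · rw [e1, e2]; exact memLp_of_abs_le_exp c2.2.continuous hc0 fun y => (hb y).2.2

/-- The equations `M₊ f₁ = μ f₂`, `M₋ f₂ = μ f₁` for `f₁ = s + d`, `f₂ = s - d`. -/
theorem Mplus_Mminus_of_system (hσ : 1 < σ) (hω : 0 < ω) (hpos : ∀ y, 0 < R y)
    (hs : ∀ y, HasDerivAt s (s' y) y)
    (hs' : ∀ y, HasDerivAt s' ((1 - μ) * s y
      + coupling σ (a * ω ^ (σ - 1)) R (coef1 σ) (coef2 σ) s d y) y)
    (hd : ∀ y, HasDerivAt d (d' y) y)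
    (hd' : ∀ y, HasDerivAt d' ((1 + μ) * d y
      + coupling σ (a * ω ^ (σ - 1)) R (coef2 σ) (coef1 σ) s d y) y) (y : ℝ) :
    Mplus (powerNL a σ) ω R (fun y => s y + d y) y = μ * (s y - d y) ∧
    Mminus (powerNL a σ) ω R (fun y => s y - d y) y = μ * (s y + d y) := by
  have hσ1 : σ + 1 ≠ 0 := by linarith
  constructor
  · rw [Mplus, deriv_deriv_eq (fun y => (hs y).fun_add (hd y))
      (fun y => (hs' y).fun_add (hd' y)), aPlus_eq hσ hω hpos, coupling, coupling, coef1, coef2]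
    field_simp
    ring
  · rw [Mminus, deriv_deriv_eq (fun y => (hs y).fun_sub (hd y))
      (fun y => (hs' y).fun_sub (hd' y)), aMinus_eq hσ hω hpos, coupling, coupling, coef1, coef2]
    field_simp
    ring

theorem IsModePair.isInternalMode (hσ : 1 < σ) (hω : 0 < ω) (ha : 0 < a)
    (h : IsProfile σ (a * ω ^ (σ - 1)) R) (hR : ContDiff ℝ (⊤ : ℕ∞) R)
    (hm : IsModePair σ (a * ω ^ (σ - 1)) R α s s' d d') :
    IsInternalMode (powerNL a σ) ω R α (fun y => s y + d y) (fun y => s y - d y) := by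
  have hε : 0 < a * ω ^ (σ - 1) := mul_pos ha (Real.rpow_pos_of_pos hω _)
  obtain ⟨cs, cd⟩ := contDiff_of_system h hR hm.hs hm.hs' hm.hd hm.hd'
  obtain ⟨C, hC⟩ := hm.exists_decay hσ hε h
  have hα := hm.alpha_pos
  have hα1 := hm.alpha_lt_one
  have heq := Mplus_Mminus_of_system (μ := 1 - α ^ 2) hσ hω h.pos hm.hs
    (fun y => (hm.hs' y).congr_deriv (by ring)) hm.hd
    (fun y => (hm.hd' y).congr_deriv (by ring))
  have hC0 : 0 ≤ C := by have := (abs_nonneg _).trans (hC 0).1; simpa using this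
  have hK := coefBound_pos hσ
  set ε := a * ω ^ (σ - 1)
  set N := coefBound σ * ε * (√2 ^ (2 * σ) * (C + C)) with hN
  have hN0 : 0 ≤ N := by positivity
  have hcoup : ∀ {c₁ c₂ : ℝ}, |c₁| + |c₂| ≤ coefBound σ → ∀ z,
      |coupling σ ε R c₁ c₂ s d z| ≤ N * Real.exp (-α * |z|) := fun hc z => by
    refine (abs_coupling_le hσ hε h hc s d z).trans ?_
    have h1 := Q_rpow_le (t := 2 * σ) (by linarith) z
    calc _ ≤ coefBound σ * ε * (√2 ^ (2 * σ) * ((C + C) * Real.exp (-α * |z|))) := by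
          refine mul_le_mul_of_nonneg_left (mul_le_mul h1 ?_ (by positivity) (by positivity))
            (by positivity)
          linarith [(hC z).1, (hC z).2.2.1]
      _ = _ := by rw [hN]; ring
  have hs2 : ∀ y, |α ^ 2 * s y + coupling σ ε R (coef1 σ) (coef2 σ) s d y|
      ≤ (2 * C + N) * Real.exp (-α * |y|) := fun y => by
    refine (abs_add_le _ _).trans ?_
    rw [abs_mul, abs_of_nonneg (sq_nonneg α)]
    have h1 := (hC y).1
    have h2 := hcoup (coef_le₁ σ) y
    have h3 : α ^ 2 * |s y| ≤ 2 * (C * Real.exp (-α * |y|)) :=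
      mul_le_mul (by nlinarith) h1 (abs_nonneg _) (by norm_num)
    linarith
  have hd2 : ∀ y, |(2 - α ^ 2) * d y + coupling σ ε R (coef2 σ) (coef1 σ) s d y|
      ≤ (2 * C + N) * Real.exp (-α * |y|) := fun y => by
    refine (abs_add_le _ _).trans ?_
    rw [abs_mul, abs_of_nonneg (by nlinarith : 0 ≤ 2 - α ^ 2)]
    have h1 := (hC y).2.2.1
    have h2 := hcoup (coef_le₂ σ) y
    have h3 : (2 - α ^ 2) * |d y| ≤ 2 * (C * Real.exp (-α * |y|)) :=
      mul_le_mul (by nlinarith) h1 (abs_nonneg _) (by norm_num)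
    linarith
  have lift : ∀ y, 0 ≤ C * Real.exp (-α * |y|) ∧ 0 ≤ N * Real.exp (-α * |y|) := fun y =>
    ⟨by positivity, by positivity⟩
  refine ⟨hα, hα1, ?_, ?_, fun y => (heq y).1, fun y => (heq y).2, ?_⟩
  · refine isSmoothH2_of_decay (C := 2 * (2 * C + N)) (fun y => (hm.hs y).fun_add (hm.hd y))
      (fun y => (hm.hs' y).fun_add (hm.hd' y)) (cs.add cd) hα fun y => ?_
    obtain ⟨h1, h2, h3, h4⟩ := hC y
    obtain ⟨h5, h6⟩ := lift y
    refine ⟨(abs_add_le _ _).trans ?_, (abs_add_le _ _).trans ?_, (abs_add_le _ _).trans ?_⟩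
    · linarith
    · linarith
    · linarith [hs2 y, hd2 y]
  · refine isSmoothH2_of_decay (C := 2 * (2 * C + N)) (fun y => (hm.hs y).fun_sub (hm.hd y))
      (fun y => (hm.hs' y).fun_sub (hm.hd' y)) (cs.sub cd) hα fun y => ?_
    obtain ⟨h1, h2, h3, h4⟩ := hC y
    obtain ⟨h5, h6⟩ := lift y
    refine ⟨(abs_sub _ _).trans ?_, (abs_sub _ _).trans ?_, (abs_sub _ _).trans ?_⟩
    · linarith
    · linarith
    · linarith [hs2 y, hd2 y]
  · rw [← hm.normalization, ← integral_const_mul]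
    refine integral_congr_ae (ae_of_all _ fun y => ?_)
    refine (half_potential_eq hσ hω h.pos (fun y => s y + d y) (fun y => s y - d y) y).trans ?_
    simp only [coupling]
    ring

end

/-! ### The radiation mode -/

/-- The radiation mode in the variables `s = (h₁ + h₂)/2`, `d = (h₁ - h₂)/2`; here
`2λ = 1 + k²`. -/
structure IsRadiationPair (σ ε : ℝ) (R : ℝ → ℝ) (k : ℝ) (s s' d d' : ℝ → ℝ) : Prop where
  hs : ∀ y, HasDerivAt s (s' y) y
  hs' : ∀ y, HasDerivAt s' (-k ^ 2 * s y + coupling σ ε R (coef1 σ) (coef2 σ) s d y) y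
  hd : ∀ y, HasDerivAt d (d' y) y
  hd' : ∀ y, HasDerivAt d' ((2 + k ^ 2) * d y + coupling σ ε R (coef2 σ) (coef1 σ) s d y) y
  even : ∀ y, s (-y) = s y ∧ d (-y) = d y
  bounded : ∃ B, ∀ y, |s y| ≤ B ∧ |d y| ≤ B
  normalization : s 0 = -1

section
variable {σ ε a ω k α : ℝ} {R s s' d d' h₁ h₂ : ℝ → ℝ}

theorem abs_intervalIntegral_le_integral {K F : ℝ → ℝ} (hF : Integrable F) {B : ℝ}
    (hK : ∀ z, |K z| ≤ B) (y : ℝ) : |∫ z in (0 : ℝ)..y, K z * F z| ≤ B * ∫ z, |F z| := by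
  have hB0 : 0 ≤ B := (abs_nonneg _).trans (hK 0)
  have h1 := intervalIntegral.norm_integral_le_integral_norm_uIoc (a := 0) (b := y)
    (f := fun z => K z * F z) (μ := volume)
  have h2 : ∫ z in uIoc 0 y, ‖K z * F z‖ ≤ ∫ z in uIoc 0 y, B * |F z| := by
    by_cases hi : IntegrableOn (fun z => ‖K z * F z‖) (uIoc 0 y)
    · refine integral_mono hi (hF.abs.const_mul B).integrableOn fun z => ?_
      simp only [Real.norm_eq_abs, abs_mul]
      exact mul_le_mul_of_nonneg_right (hK z) (abs_nonneg _)
    · rw [integral_undef hi]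
      exact integral_nonneg fun z => by positivity
  have h3 : ∫ z in uIoc 0 y, B * |F z| ≤ ∫ z, B * |F z| :=
    setIntegral_le_integral (hF.abs.const_mul B) (ae_of_all _ fun z => by positivity)
  exact h1.trans (h2.trans (h3.trans_eq (integral_const_mul _ _)))

/-- The zeroth order description of the radiation mode: `s = -cos y`, `d = 0`. By evenness `s` is
given by Duhamel's formula from the origin and `d` is the bounded solution of its equation; the
bound is closed on the number `∫ Q^(2σ) (|s| + |d|)`. -/
theorem exists_radiation_bound (hσ : 1 < σ) : ∃ ε₀, 0 < ε₀ ∧ ∃ C, 0 < C ∧ ∀ ε R k s s' d d',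
    0 < ε → ε ≤ ε₀ → IsProfile σ ε R → 1 / 2 ≤ k → k ≤ 1 →
    IsRadiationPair σ ε R k s s' d d' → ∀ y,
    |s y + Real.cos y| ≤ C * (ε + (1 - k)) * (1 + |y|) ∧
    |s' y - Real.sin y| ≤ C * (ε + (1 - k)) * (1 + |y|) ∧
    |d y| ≤ C * (ε + (1 - k)) * (1 + |y|) ∧ |d' y| ≤ C * (ε + (1 - k)) * (1 + |y|) := by
  have hK := coefBound_pos hσ
  have hJ := moment_nonneg σ 0
  set K := coefBound σ with hKdef
  set J := moment σ 0 with hJdef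
  refine ⟨1 / (6 * (K * J + 1)), by positivity, 4 * (K * J) + 1, by positivity,
    fun ε R k s s' d d' hε hle h hk hk1 hm => ?_⟩
  rw [le_div_iff₀ (by positivity)] at hle
  obtain ⟨B, hB⟩ := hm.bounded
  have hk0 : 0 < k := by linarith
  have hcs := continuous_of_hasDerivAt hm.hs
  have hcd := continuous_of_hasDerivAt hm.hd
  set F := coupling σ ε R (coef1 σ) (coef2 σ) s d with hF
  set G := coupling σ ε R (coef2 σ) (coef1 σ) s d with hG
  have hcF : Continuous F := continuous_coupling h _ _ hcs hcd
  have hcG : Continuous G := continuous_coupling h _ _ hcs hcd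
  have hFb : ∀ z, |F z| ≤ K * ε * (Q z ^ (2 * σ) * (|s z| + |d z|)) :=
    abs_coupling_le hσ hε h (coef_le₁ σ) s d
  have hGb : ∀ z, |G z| ≤ K * ε * (Q z ^ (2 * σ) * (|s z| + |d z|)) :=
    abs_coupling_le hσ hε h (coef_le₂ σ) s d
  have i0 := (integrable_weight_mul_Q_rpow (t := 2 * σ) (by linarith) 0)
  simp only [pow_zero, one_mul] at i0
  set m : ℝ → ℝ := fun z => Q z ^ (2 * σ) * (|s z| + |d z|) with hmdef
  have hm0 : ∀ z, 0 ≤ m z := fun z => by have := Q_rpow_pos (2 * σ) z; positivity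
  have him : Integrable m := by
    refine (i0.mul_const (B + B)).mono' (by fun_prop) (ae_of_all _ fun z => ?_)
    rw [Real.norm_eq_abs, abs_of_nonneg (hm0 z)]
    exact mul_le_mul_of_nonneg_left (by linarith [hB z]) (Q_rpow_pos _ z).le
  set M := ∫ z, m z with hM
  have hM0 : 0 ≤ M := integral_nonneg hm0
  have absint : ∀ {H : ℝ → ℝ}, Continuous H → (∀ z, |H z| ≤ K * ε * m z) →
      Integrable H ∧ ∫ z, |H z| ≤ K * ε * M := by
    intro H hc hb
    have hi : Integrable H := (him.const_mul (K * ε)).mono' hc.aestronglyMeasurable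
      (ae_of_all _ fun z => by rw [Real.norm_eq_abs]; exact hb z)
    refine ⟨hi, ?_⟩
    rw [hM, ← integral_const_mul]
    exact integral_mono hi.abs (him.const_mul _) hb
  obtain ⟨hiF, hFM⟩ := absint hcF hFb
  obtain ⟨hiG, hGM⟩ := absint hcG hGb
  have hGbdd : ∀ z, |G z| ≤ K * ε * (√2 ^ (2 * σ) * (B + B)) := fun z => by
    have := Q_rpow_pos (2 * σ) z
    have h2 := Q_rpow_le (t := 2 * σ) (by linarith) z
    refine (hGb z).trans (mul_le_mul_of_nonneg_left ?_ (by positivity))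
    exact mul_le_mul h2 (by linarith [hB z]) (by positivity) (by positivity)
  have hs'0 : s' 0 = 0 := by
    have e : s' = deriv s := funext fun y => (hm.hs y).deriv.symm
    rw [e]
    exact deriv_even_zero (fun y => (hm.even y).1) fun y => by rw [← e]; exact hm.hs y
  have hκ : 1 ≤ √(2 + k ^ 2) := Real.one_le_sqrt.2 (by nlinarith)
  have ed := eq_green (κ := √(2 + k ^ 2)) (by linarith) hcG hGbdd hm.hd
    (fun y => by rw [Real.sq_sqrt (by positivity)]; exact hm.hd' y) (fun y => (hB y).2)
  have bs : ∀ y, |s y + Real.cos (k * y)| ≤ 2 * (K * ε * M) := fun y => by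
    have e1 := (duhamel_trig hk0.ne' hm.hs hm.hs' hcF y).1
    rw [e1, hm.normalization, hs'0]
    have := abs_intervalIntegral_le_integral (K := fun z => Real.sin (k * (y - z)) / k) (B := 2)
      hiF (fun z => by
        rw [abs_div, abs_of_pos hk0, div_le_iff₀ hk0]
        exact (Real.abs_sin_le_one _).trans (by linarith)) y
    refine le_trans (le_of_eq ?_) (this.trans (mul_le_mul_of_nonneg_left hFM (by norm_num)))
    congr 1; ring
  have bs' : ∀ y, |s' y - k * Real.sin (k * y)| ≤ K * ε * M := fun y => by
    have e1 := (duhamel_trig hk0.ne' hm.hs hm.hs' hcF y).2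
    rw [e1, hm.normalization, hs'0]
    have := abs_intervalIntegral_le_integral (K := fun z => Real.cos (k * (y - z))) (B := 1)
      hiF (fun z => Real.abs_cos_le_one _) y
    refine le_trans (le_of_eq ?_) (this.trans (by rw [one_mul]; exact hFM))
    congr 1; field_simp; ring
  have bd : ∀ y, |d y| ≤ K * ε * M := fun y => by
    rw [(ed y).1]
    refine (abs_green_le_integral (by linarith) hiG y).trans ?_
    refine (mul_le_of_le_one_left (integral_nonneg fun _ => abs_nonneg _) ?_).trans hGM
    rw [div_le_one (by linarith)]; linarith
  have bd' : ∀ y, |d' y| ≤ K * ε * M := fun y => by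
    rw [(ed y).2]
    refine (abs_greenDeriv_le_integral (by linarith) hiG y).trans ?_
    have : 0 ≤ ∫ z, |G z| := integral_nonneg fun _ => abs_nonneg _
    linarith
  have hMJ : M ≤ (1 + 3 * (K * ε * M)) * J := by
    have hi := i0.const_mul (1 + 3 * (K * ε * M))
    have e : J = ∫ z, Q z ^ (2 * σ) := by simp [hJdef, moment]
    rw [e, ← integral_const_mul]
    refine integral_mono him hi fun z => ?_
    have hn : |s z| + |d z| ≤ 1 + 3 * (K * ε * M) := by
      have h1 := abs_sub (s z + Real.cos (k * z)) (Real.cos (k * z))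
      rw [add_sub_cancel_right] at h1
      have := Real.abs_cos_le_one (k * z)
      linarith [bs z, bd z]
    simp only [hmdef]
    rw [mul_comm (1 + 3 * (K * ε * M))]
    exact mul_le_mul_of_nonneg_left hn (Q_rpow_pos _ z).le
  have hM2 : M ≤ 2 * J := by
    have h1 : 3 * (K * J * ε) ≤ 1 / 2 := by nlinarith
    nlinarith [mul_le_mul_of_nonneg_right h1 hM0]
  have hKM : K * ε * M ≤ 2 * (K * J) * ε := by
    have := mul_le_mul_of_nonneg_left hM2 (by positivity : 0 ≤ K * ε)
    linarith
  intro y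
  have hy := abs_nonneg y
  have hk1' : 0 ≤ 1 - k := by linarith
  have hX : 0 ≤ K * J := by positivity
  have hang : |k * y - y| = (1 - k) * |y| := by
    rw [show k * y - y = -((1 - k) * y) by ring, abs_neg, abs_mul, abs_of_nonneg hk1']
  have hcos : |Real.cos (k * y) - Real.cos y| ≤ (1 - k) * |y| := by
    rw [← hang]; exact Real.abs_cos_sub_cos_le _ _
  have hsin : |Real.sin (k * y) - Real.sin y| ≤ (1 - k) * |y| := by
    rw [← hang]; exact Real.abs_sin_sub_sin_le _ _
  have fin : ∀ {A Y : ℝ}, 0 ≤ A → A ≤ 4 * (K * J) * ε → 0 ≤ Y → Y ≤ 1 + |y| →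
      A + (1 - k) * Y ≤ (4 * (K * J) + 1) * (ε + (1 - k)) * (1 + |y|) := by
    intro A Y _ hA hY hY1
    have h1 : (1 - k) * Y ≤ (1 - k) * (1 + |y|) := mul_le_mul_of_nonneg_left hY1 hk1'
    have h2 : 4 * (K * J) * ε ≤ 4 * (K * J) * ε * (1 + |y|) :=
      le_mul_of_one_le_right (by positivity) (by linarith)
    have h3 : 0 ≤ 4 * (K * J) * (1 - k) * (1 + |y|) := by positivity
    have h4 : 0 ≤ ε * (1 + |y|) := by positivity
    nlinarith
  have hKM0 : 0 ≤ K * ε * M := by positivity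
  refine ⟨?_, ?_, ?_, ?_⟩
  · have e : s y + Real.cos y = (s y + Real.cos (k * y)) - (Real.cos (k * y) - Real.cos y) := by
      ring
    rw [e]
    refine (abs_sub _ _).trans ((add_le_add (bs y) hcos).trans
      (fin (by positivity) (by linarith) hy (by linarith)))
  · have e : s' y - Real.sin y = (s' y - k * Real.sin (k * y))
        + ((Real.sin (k * y) - Real.sin y) - (1 - k) * Real.sin (k * y)) := by ring
    rw [e]
    have h1 : |(1 - k) * Real.sin (k * y)| ≤ (1 - k) * 1 := by
      rw [abs_mul, abs_of_nonneg hk1']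
      exact mul_le_mul_of_nonneg_left (Real.abs_sin_le_one _) hk1'
    have h2 := (abs_add_le (s' y - k * Real.sin (k * y))
      ((Real.sin (k * y) - Real.sin y) - (1 - k) * Real.sin (k * y))).trans
      (add_le_add (bs' y) ((abs_sub _ _).trans (add_le_add hsin h1)))
    refine h2.trans (le_trans (le_of_eq ?_) (fin hKM0 (by linarith [mul_nonneg hX hε.le])
      (by positivity : 0 ≤ 1 + |y|) le_rfl))
    ring
  · have := fin hKM0 (by linarith [mul_nonneg hX hε.le]) le_rfl (by positivity : 0 ≤ 1 + |y|)
    linarith [bd y]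
  · have := fin hKM0 (by linarith [mul_nonneg hX hε.le]) le_rfl (by positivity : 0 ≤ 1 + |y|)
    linarith [bd' y]

end

section
variable {σ ε a ω k α : ℝ} {R s s' d d' h₁ h₂ : ℝ → ℝ}

theorem green_even {κ : ℝ} {F : ℝ → ℝ} (hF : ∀ z, F (-z) = F z) (y : ℝ) :
    green κ F (-y) = green κ F y := by
  have h1 : leftConv κ F (-y) = rightConv κ F y := by
    rw [leftConv, rightConv, ← integral_comp_neg_Ioi]
    congr 1; funext z; rw [hF]; ring_nf
  have h2 : rightConv κ F (-y) = leftConv κ F y := by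
    rw [leftConv, rightConv, ← integral_comp_neg_Iic]
    congr 1; funext z; rw [hF]; ring_nf
  rw [green, green, h1, h2]; ring

theorem coupling_even (h : IsProfile σ ε R) (c₁ c₂ : ℝ) (hs : ∀ y, s (-y) = s y)
    (hd : ∀ y, d (-y) = d y) (y : ℝ) :
    coupling σ ε R c₁ c₂ s d (-y) = coupling σ ε R c₁ c₂ s d y := by
  simp only [coupling, pot, h.even, hs, hd]

/-- Existence of the radiation mode, by contraction in Duhamel's formula for `s` and in Green's
formula for `d`, evaluated at `|y|` so that the fixed point is even. -/
theorem exists_radiationPair (hσ : 1 < σ) : ∃ ε₀, 0 < ε₀ ∧ ∀ ε R k, 0 < ε → ε ≤ ε₀ →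
    IsProfile σ ε R → 1 / 2 ≤ k → ∃ s s' d d', IsRadiationPair σ ε R k s s' d d' := by
  have hK := coefBound_pos hσ
  have hJ := moment_nonneg σ 0
  set K := coefBound σ with hKdef
  refine ⟨1 / (8 * (K * moment σ 0 + 1)), by positivity, fun ε R k hε hle h hk => ?_⟩
  rw [le_div_iff₀ (by positivity)] at hle
  have hk0 : 0 < k := by linarith
  have hKJ : 0 ≤ K * moment σ 0 := by positivity
  have hκ : 1 ≤ √(2 + k ^ 2) := Real.one_le_sqrt.2 (by nlinarith)
  set C : ℝ → ℝ := fun t => Real.cos (k * t) with hC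
  set S : ℝ → ℝ := fun t => Real.sin (k * t) / k with hS
  have hmul : ∀ t, HasDerivAt (fun t => k * t) k t := fun t => by
    simpa using (hasDerivAt_id t).const_mul k
  have dC : ∀ t, HasDerivAt C (-k ^ 2 * S t) t := fun t =>
    ((hmul t).cos).congr_deriv (by simp only [hS]; field_simp)
  have dS : ∀ t, HasDerivAt S (C t) t := fun t =>
    ((hmul t).sin.div_const k).congr_deriv (by simp only [hC]; field_simp)
  have cC := continuous_of_hasDerivAt dC
  have cS := continuous_of_hasDerivAt dS
  have hsq : ∀ t, C t ^ 2 - -k ^ 2 * S t ^ 2 = 1 := fun t => by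
    have := Real.cos_sq_add_sin_sq (k * t)
    simp only [hC, hS]; field_simp; linarith
  have hSb : ∀ t, |S t| ≤ 2 := fun t => by
    rw [abs_div, abs_of_pos hk0, div_le_iff₀ hk0]
    exact (Real.abs_sin_le_one _).trans (by linarith)
  have veq : ∀ {F : ℝ → ℝ}, Continuous F → ∀ y, volterra C S F y
      = ∫ z in (0 : ℝ)..y, S (y - z) * F z := fun hF y =>
    volterra_eq cC cS hF (fun y z => by
      simp only [hC, hS, mul_sub, Real.sin_sub]; field_simp) y
  have vbound : ∀ {F : ℝ → ℝ}, Continuous F → Integrable F → ∀ y,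
      |volterra C S F y| ≤ 2 * ∫ z, |F z| := fun {F} hF hi y => by
    rw [veq hF]
    exact abs_intervalIntegral_le_integral (K := fun z => S (y - z)) hi (fun z => hSb _) y
  have gbound : ∀ {F : ℝ → ℝ}, Integrable F → ∀ y,
      |green √(2 + k ^ 2) F y| ≤ ∫ z, |F z| := fun {F} hi y => by
    refine (abs_green_le_integral (by linarith) hi y).trans
      (mul_le_of_le_one_left (integral_nonneg fun _ => abs_nonneg _) ?_)
    rw [div_le_one (by linarith)]; linarith
  -- integrals of the coupling terms of bounded functions
  have hint : ∀ {c₁ c₂ : ℝ}, |c₁| + |c₂| ≤ K → ∀ {f g : ℝ → ℝ} {b : ℝ}, Continuous f →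
      Continuous g → (∀ y, |f y| ≤ b ∧ |g y| ≤ b) →
      Integrable (coupling σ ε R c₁ c₂ f g) ∧
        ∫ z, |coupling σ ε R c₁ c₂ f g z| ≤ K * ε * (2 * b) * moment σ 0 := by
    intro c₁ c₂ hc f g b hf hg hb
    have hcc := continuous_coupling h c₁ c₂ hf hg
    obtain ⟨i1, b1⟩ := integrable_of_abs_le_weight_Q hσ hcc
      (abs_coupling_le_weight hσ hε h hc (b := 2 * b) (k := 0) (fun z => by
        rw [pow_zero]; linarith [(hb z).1, (hb z).2])) 0
    simp only [pow_zero, one_mul, zero_add] at i1 b1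
    exact ⟨(integrable_norm_iff hcc.aestronglyMeasurable).1 i1, b1⟩
  have hpt : ∀ {c₁ c₂ : ℝ}, |c₁| + |c₂| ≤ K → ∀ {f g : ℝ → ℝ} {b : ℝ},
      (∀ y, |f y| ≤ b ∧ |g y| ≤ b) →
      ∀ z, |coupling σ ε R c₁ c₂ f g z| ≤ K * ε * (√2 ^ (2 * σ) * (b + b)) := by
    intro c₁ c₂ hc f g b hb z
    have := Q_rpow_pos (2 * σ) z
    refine (abs_coupling_le hσ hε h hc f g z).trans (mul_le_mul_of_nonneg_left ?_ (by positivity))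
    exact mul_le_mul (Q_rpow_le (by linarith) z) (by linarith [(hb z).1, (hb z).2])
      (by positivity) (by positivity)
  have cgreen : ∀ {f g : ℝ → ℝ}, Continuous f → Continuous g → (∃ M, ∀ y, |f y| ≤ M ∧ |g y| ≤ M) →
      Continuous (green √(2 + k ^ 2) (coupling σ ε R (coef2 σ) (coef1 σ) f g)) :=
    fun hf hg ⟨M, hM⟩ => continuous_of_hasDerivAt (hasDerivAt_green (by linarith)
      (continuous_coupling h _ _ hf hg) (hpt (coef_le₂ σ) hM))
  obtain ⟨s, d, hs, hd, ⟨M, hM⟩, e1, e2⟩ := exists_fixedPoint_pair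
    (fun f g y => -C y + volterra C S (coupling σ ε R (coef1 σ) (coef2 σ) f g) |y|)
    (fun f g y => green √(2 + k ^ 2) (coupling σ ε R (coef2 σ) (coef1 σ) f g) |y|)
    (fun f g hf hg hb => by
      have cv : Continuous (volterra C S (coupling σ ε R (coef1 σ) (coef2 σ) f g)) :=
        continuous_of_hasDerivAt (hasDerivAt_volterra dC dS (continuous_coupling h _ _ hf hg))
      refine ⟨cC.neg.add (cv.comp continuous_abs), (cgreen hf hg hb).comp continuous_abs, ?_⟩
      obtain ⟨M, hM⟩ := hb
      have hM0 : 0 ≤ M := (abs_nonneg _).trans (hM 0).1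
      obtain ⟨i1, b1⟩ := hint (coef_le₁ σ) hf hg hM
      obtain ⟨i2, b2⟩ := hint (coef_le₂ σ) hf hg hM
      refine ⟨1 + 2 * (K * ε * (2 * M) * moment σ 0), fun y => ⟨?_, ?_⟩⟩
      · refine (abs_add_le _ _).trans (add_le_add ?_ ((vbound (continuous_coupling h _ _ hf hg)
          i1 _).trans (mul_le_mul_of_nonneg_left b1 (by norm_num))))
        rw [abs_neg]; exact Real.abs_cos_le_one _
      · have : 0 ≤ K * ε * (2 * M) * moment σ 0 := by positivity
        exact (gbound i2 _).trans (by linarith))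
    (fun f₁ g₁ f₂ g₂ hf₁ hg₁ hf₂ hg₂ hb₁ hb₂ δ hδ y => by
      have hδ0 : 0 ≤ δ := (abs_nonneg _).trans (hδ 0).1
      have hsm : K * ε * (2 * δ) * moment σ 0 ≤ δ / 4 := by
        have := mul_le_mul_of_nonneg_right hle hδ0
        nlinarith [mul_nonneg hε.le hδ0]
      obtain ⟨i1, b1⟩ := hint (coef_le₁ σ) (hf₁.sub hf₂) (hg₁.sub hg₂) hδ
      obtain ⟨i2, b2⟩ := hint (coef_le₂ σ) (hf₁.sub hf₂) (hg₁.sub hg₂) hδ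
      constructor
      · have cF := continuous_coupling h (coef1 σ) (coef2 σ) hf₁ hg₁
        have cG := continuous_coupling h (coef1 σ) (coef2 σ) hf₂ hg₂
        rw [add_sub_add_left_eq_sub, veq cF, veq cG, integral_kernel_sub cS cF cG]
        have := abs_intervalIntegral_le_integral (K := fun z => S (|y| - z)) i1
          (fun z => hSb _) |y|
        simp only [coupling_sub]
        refine this.trans ?_
        linarith
      · obtain ⟨M₁, hM₁⟩ := hb₁
        obtain ⟨M₂, hM₂⟩ := hb₂
        have cF := continuous_coupling h (coef2 σ) (coef1 σ) hf₁ hg₁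
        have cG := continuous_coupling h (coef2 σ) (coef1 σ) hf₂ hg₂
        have p1 := hpt (coef_le₂ σ) hM₁
        have p2 := hpt (coef_le₂ σ) hM₂
        rw [← green_sub (by linarith) cF cG p1 p2]
        simp only [coupling_sub]
        refine (gbound i2 _).trans ?_
        linarith)
  have hCe : ∀ t, C (-t) = C t := fun t => by simp [hC]
  have hSo : ∀ t, S (-t) = -S t := fun t => by simp [hS, neg_div]
  have hse : ∀ y, s (-y) = s y := fun y => by rw [e1, e1 y, abs_neg, hCe]
  have hde : ∀ y, d (-y) = d y := fun y => by rw [e2, e2 y, abs_neg]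
  set F := coupling σ ε R (coef1 σ) (coef2 σ) s d with hF
  set G := coupling σ ε R (coef2 σ) (coef1 σ) s d with hG
  have hcF : Continuous F := continuous_coupling h _ _ hs hd
  have hcG : Continuous G := continuous_coupling h _ _ hs hd
  have hFe : ∀ y, F (-y) = F y := coupling_even h _ _ hse hde
  have hGe : ∀ y, G (-y) = G y := coupling_even h _ _ hse hde
  have es : s = fun y => -C y + volterra C S F y := funext fun y => by
    rw [e1]
    rcases abs_choice y with hy | hy <;> rw [hy]
    rw [volterra_even hCe hSo hFe]
  have edd : d = green √(2 + k ^ 2) G := funext fun y => by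
    rw [e2]
    rcases abs_choice y with hy | hy <;> rw [hy]
    rw [green_even hGe]
  have hGb := hpt (coef_le₂ σ) hM
  refine ⟨s, fun y => -(-k ^ 2 * S y) + volterraDeriv (-k ^ 2) C S F y, d,
    greenDeriv √(2 + k ^ 2) G, fun y => ?_, fun y => ?_, fun y => ?_, fun y => ?_,
    fun y => ⟨hse y, hde y⟩, ⟨M, hM⟩, ?_⟩
  · have := (dC y).fun_neg.fun_add (hasDerivAt_volterra dC dS hcF y)
    rwa [← es] at this
  · refine (((dS y).const_mul (-k ^ 2)).fun_neg.fun_add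
      (hasDerivAt_volterraDeriv dC dS hsq hcF y)).congr_deriv ?_
    have : s y = -C y + volterra C S F y := congrFun es y
    rw [this]; ring
  · have := hasDerivAt_green (κ := √(2 + k ^ 2)) (by linarith) hcG hGb y
    rwa [← edd] at this
  · refine (hasDerivAt_greenDeriv (κ := √(2 + k ^ 2)) (by linarith) hcG hGb y).congr_deriv ?_
    rw [Real.sq_sqrt (by positivity), ← edd]
  · rw [e1, abs_zero, volterra_zero]; simp [hC]

theorem IsRadiationPair.isRadiationMode (hσ : 1 < σ) (hω : 0 < ω)
    (h : IsProfile σ (a * ω ^ (σ - 1)) R) (hR : ContDiff ℝ (⊤ : ℕ∞) R)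
    (hk : k ^ 2 = 1 - 2 * α ^ 2) (hm : IsRadiationPair σ (a * ω ^ (σ - 1)) R k s s' d d') :
    IsRadiationMode (powerNL a σ) ω R (1 - α ^ 2) (fun y => s y + d y) (fun y => s y - d y) := by
  obtain ⟨cs, cd⟩ := contDiff_of_system h hR hm.hs hm.hs' hm.hd hm.hd'
  have heq := Mplus_Mminus_of_system (μ := 2 * (1 - α ^ 2)) hσ hω h.pos hm.hs
    (fun y => (hm.hs' y).congr_deriv (by rw [hk]; ring)) hm.hd
    (fun y => (hm.hd' y).congr_deriv (by rw [hk]; ring))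
  obtain ⟨B, hB⟩ := hm.bounded
  refine ⟨cs.add cd, cs.sub cd, fun y => ?_, fun y => ?_, ⟨B + B, fun y => ⟨?_, ?_⟩⟩,
    fun y => (heq y).1, fun y => (heq y).2, ?_⟩
  · simp only [(hm.even y).1, (hm.even y).2]
  · simp only [(hm.even y).1, (hm.even y).2]
  · exact (abs_add_le _ _).trans (add_le_add (hB y).1 (hB y).2)
  · exact (abs_sub _ _).trans (add_le_add (hB y).1 (hB y).2)
  · simp only [hm.normalization]; ring

theorem IsRadiationMode.isCoupled (hσ : 1 < σ) (hω : 0 < ω) (hR : ∀ y, 0 < R y)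
    (h : IsRadiationMode (powerNL a σ) ω R (1 - α ^ 2) h₁ h₂) :
    IsCoupled σ (a * ω ^ (σ - 1)) R (2 * (1 - α ^ 2)) h₁ h₂ :=
  isCoupled_of_eq hσ hω hR h.contDiff₁ h.contDiff₂ h.eq₁ h.eq₂

theorem IsRadiationMode.isRadiationPair (hσ : 1 < σ) (hω : 0 < ω) (hR : ∀ y, 0 < R y)
    (hk : k ^ 2 = 1 - 2 * α ^ 2) (h : IsRadiationMode (powerNL a σ) ω R (1 - α ^ 2) h₁ h₂) :
    IsRadiationPair σ (a * ω ^ (σ - 1)) R k (fun y => (h₁ y + h₂ y) / 2)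
      (fun y => (deriv h₁ y + deriv h₂ y) / 2) (fun y => (h₁ y - h₂ y) / 2)
      (fun y => (deriv h₁ y - deriv h₂ y) / 2) := by
  have hc := h.isCoupled hσ hω hR
  obtain ⟨B, hB⟩ := h.bounded
  refine ⟨fun y => (hc.half_sum hσ y).1, fun y => ?_, fun y => (hc.half_diff hσ y).1, fun y => ?_,
    fun y => ⟨by rw [h.even₁, h.even₂], by rw [h.even₁, h.even₂]⟩, ⟨B, fun y => ?_⟩,
    h.normalization⟩
  · exact ((hc.half_sum hσ y).2).congr_deriv (by rw [hk]; ring)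
  · exact ((hc.half_diff hσ y).2).congr_deriv (by rw [hk]; ring)
  · have h1 := abs_le.1 (hB y).1
    have h2 := abs_le.1 (hB y).2
    constructor <;> rw [abs_le] <;> constructor <;> linarith

/-- Existence of all the objects entering `Γ(ω)`. -/
theorem exists_fermiTuple (hσ : 1 < σ) : ∃ ε₀, 0 < ε₀ ∧ ∀ a ω : ℝ, 0 < a → 0 < ω →
    a * ω ^ (σ - 1) ≤ ε₀ → ∃ (R : ℝ → ℝ) (α : ℝ) (W₁ W₂ h₁ h₂ : ℝ → ℝ),
      IsFermiTuple (powerNL a σ) ω R α W₁ W₂ h₁ h₂ := by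
  obtain ⟨ε₁, hε₁, e1⟩ := exists_soliton hσ
  obtain ⟨ε₂, hε₂, e2⟩ := exists_modePair hσ
  obtain ⟨ε₃, hε₃, e3⟩ := exists_radiationPair hσ
  obtain ⟨ε₄, hε₄, C, hC, e4⟩ := exists_mode_expansion hσ
  refine ⟨min ε₁ (min ε₂ (min ε₃ (min ε₄ (1 / (2 * C))))), by positivity,
    fun a ω ha hω hle => ?_⟩
  simp only [le_min_iff] at hle
  obtain ⟨l1, l2, l3, l4, l5⟩ := hle
  rw [le_div_iff₀ (by positivity)] at l5
  have hε : 0 < a * ω ^ (σ - 1) := mul_pos ha (Real.rpow_pos_of_pos hω _)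
  obtain ⟨R, hR, cR, m1, m2, eq⟩ := e1 _ hε l1
  obtain ⟨α, s, s', d, d', hm⟩ := e2 _ R hε l2 hR
  have hα : α ≤ 1 / 2 := ((e4 _ R α s s' d d' hε l4 hR hm).1).trans (by linarith)
  have hα0 := hm.alpha_pos
  have hk2 : 1 / 4 ≤ 1 - 2 * α ^ 2 := by nlinarith
  have hk : 1 / 2 ≤ √(1 - 2 * α ^ 2) := Real.le_sqrt_of_sq_le (by linarith)
  obtain ⟨t, t', u, u', hr⟩ := e3 _ R √(1 - 2 * α ^ 2) hε l3 hR hk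
  refine ⟨R, α, _, _, _, _, ⟨⟨contDiff_infty.1 cR 2, hR.pos, hR.even, m1, m2,
    fun y => ?_⟩, hm.isInternalMode hσ hω ha hR cR,
    hr.isRadiationMode hσ hω hR cR (Real.sq_sqrt (by linarith))⟩⟩
  rw [eq, powerNL_soliton hω (hR.pos y)]

end

/-! ### Exact reduction of `Γ` -/

/-- Continuous functions of at most polynomial growth. -/
def PolyGrowth (F : ℝ → ℝ) : Prop := Continuous F ∧ ∃ (C : ℝ) (k : ℕ), ∀ y, |F y| ≤ C * (1 + |y|) ^ k

/-- Continuous functions decaying exponentially, up to a polynomial factor. -/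
def ExpDecay (F : ℝ → ℝ) : Prop := Continuous F ∧ ∃ (C : ℝ) (k : ℕ) (c : ℝ), 0 < c ∧
  ∀ y, |F y| ≤ C * ((1 + |y|) ^ k * Real.exp (-c * |y|))

section Growth
variable {F G : ℝ → ℝ}

theorem PolyGrowth.const (c : ℝ) : PolyGrowth fun _ => c :=
  ⟨continuous_const, |c|, 0, fun y => by simp⟩

theorem PolyGrowth.of_bounded (hc : Continuous F) {C : ℝ} (h : ∀ y, |F y| ≤ C) : PolyGrowth F :=
  ⟨hc, C, 0, fun y => by simpa using h y⟩

theorem PolyGrowth.add (hF : PolyGrowth F) (hG : PolyGrowth G) : PolyGrowth fun y => F y + G y := by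
  obtain ⟨cF, C, k, h⟩ := hF
  obtain ⟨cG, D, l, h'⟩ := hG
  refine ⟨cF.add cG, |C| + |D|, max k l, fun y => ?_⟩
  have h1 : C * (1 + |y|) ^ k ≤ |C| * (1 + |y|) ^ max k l :=
    mul_le_mul (le_abs_self C) (weight_mono (le_max_left _ _) y) (by positivity) (abs_nonneg _)
  have h2 : D * (1 + |y|) ^ l ≤ |D| * (1 + |y|) ^ max k l :=
    mul_le_mul (le_abs_self D) (weight_mono (le_max_right _ _) y) (by positivity) (abs_nonneg _)
  refine (abs_add_le _ _).trans ?_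
  rw [add_mul]
  exact add_le_add ((h y).trans h1) ((h' y).trans h2)

theorem PolyGrowth.mul (hF : PolyGrowth F) (hG : PolyGrowth G) : PolyGrowth fun y => F y * G y := by
  obtain ⟨cF, C, k, h⟩ := hF
  obtain ⟨cG, D, l, h'⟩ := hG
  refine ⟨cF.mul cG, C * D, k + l, fun y => ?_⟩
  rw [abs_mul]
  calc |F y| * |G y| ≤ (C * (1 + |y|) ^ k) * (D * (1 + |y|) ^ l) :=
        mul_le_mul (h y) (h' y) (abs_nonneg _) ((abs_nonneg _).trans (h y))
    _ = _ := by ring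

theorem PolyGrowth.neg (hF : PolyGrowth F) : PolyGrowth fun y => -F y := by
  obtain ⟨cF, C, k, h⟩ := hF
  exact ⟨cF.neg, C, k, fun y => by rw [abs_neg]; exact h y⟩

theorem PolyGrowth.sub (hF : PolyGrowth F) (hG : PolyGrowth G) :
    PolyGrowth fun y => F y - G y := by
  simpa only [sub_eq_add_neg] using hF.add hG.neg

theorem PolyGrowth.pow (hF : PolyGrowth F) (n : ℕ) : PolyGrowth fun y => F y ^ n := by
  induction n with
  | zero => simpa using PolyGrowth.const 1
  | succ n ih => simpa only [pow_succ] using ih.mul hF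

theorem ExpDecay.mul (hF : ExpDecay F) (hG : PolyGrowth G) : ExpDecay fun y => F y * G y := by
  obtain ⟨cF, C, k, c, hc, h⟩ := hF
  obtain ⟨cG, D, l, h'⟩ := hG
  refine ⟨cF.mul cG, C * D, k + l, c, hc, fun y => ?_⟩
  rw [abs_mul]
  calc |F y| * |G y| ≤ (C * ((1 + |y|) ^ k * Real.exp (-c * |y|))) * (D * (1 + |y|) ^ l) :=
        mul_le_mul (h y) (h' y) (abs_nonneg _) ((abs_nonneg _).trans (h y))
    _ = _ := by ring

theorem ExpDecay.mul' (hF : PolyGrowth F) (hG : ExpDecay G) : ExpDecay fun y => F y * G y := by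
  simpa only [mul_comm] using hG.mul hF

theorem ExpDecay.add (hF : ExpDecay F) (hG : ExpDecay G) : ExpDecay fun y => F y + G y := by
  obtain ⟨cF, C, k, c, hc, h⟩ := hF
  obtain ⟨cG, D, l, d, hd, h'⟩ := hG
  refine ⟨cF.add cG, |C| + |D|, max k l, min c d, lt_min hc hd, fun y => ?_⟩
  have hy := abs_nonneg y
  have h1 : C * ((1 + |y|) ^ k * Real.exp (-c * |y|))
      ≤ |C| * ((1 + |y|) ^ max k l * Real.exp (-min c d * |y|)) := by
    refine mul_le_mul (le_abs_self C) (mul_le_mul (weight_mono (le_max_left _ _) y)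
      (Real.exp_le_exp.2 ?_) (by positivity) (by positivity)) (by positivity) (abs_nonneg _)
    nlinarith [mul_le_mul_of_nonneg_right (min_le_left c d) hy]
  have h2 : D * ((1 + |y|) ^ l * Real.exp (-d * |y|))
      ≤ |D| * ((1 + |y|) ^ max k l * Real.exp (-min c d * |y|)) := by
    refine mul_le_mul (le_abs_self D) (mul_le_mul (weight_mono (le_max_right _ _) y)
      (Real.exp_le_exp.2 ?_) (by positivity) (by positivity)) (by positivity) (abs_nonneg _)
    nlinarith [mul_le_mul_of_nonneg_right (min_le_right c d) hy]
  refine (abs_add_le _ _).trans ?_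
  rw [add_mul]
  exact add_le_add ((h y).trans h1) ((h' y).trans h2)

theorem ExpDecay.neg (hF : ExpDecay F) : ExpDecay fun y => -F y := by
  obtain ⟨cF, C, k, c, hc, h⟩ := hF
  exact ⟨cF.neg, C, k, c, hc, fun y => by rw [abs_neg]; exact h y⟩

theorem ExpDecay.sub (hF : ExpDecay F) (hG : ExpDecay G) : ExpDecay fun y => F y - G y := by
  simpa only [sub_eq_add_neg] using hF.add hG.neg

theorem ExpDecay.polyGrowth (hF : ExpDecay F) : PolyGrowth F := by
  obtain ⟨cF, C, k, c, hc, h⟩ := hF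
  refine ⟨cF, |C|, k, fun y => (h y).trans ?_⟩
  refine mul_le_mul (le_abs_self C) (mul_le_of_le_one_right (by positivity) ?_) (by positivity)
    (abs_nonneg _)
  exact Real.exp_le_one_iff.2 (by nlinarith [abs_nonneg y])

theorem ExpDecay.integrable (hF : ExpDecay F) : Integrable F := by
  obtain ⟨cF, C, k, c, hc, h⟩ := hF
  exact ((integrable_weight_mul_exp hc k).const_mul C).mono' cF.aestronglyMeasurable
    (ae_of_all _ fun y => by rw [Real.norm_eq_abs]; exact h y)

/-- The integral of the derivative of a decaying function vanishes. -/
theorem ExpDecay.integral_deriv_eq_zero (hF : ExpDecay F) (hG : Integrable G)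
    (hd : ∀ y, HasDerivAt F (G y) y) : ∫ y, G y = 0 := by
  obtain ⟨cF, C, k, c, hc, h⟩ := hF
  have h1 := integral_of_hasDerivAt_of_tendsto hd hG
    (tendsto_zero_of_le_weight hc h tendsto_abs_atBot_atTop)
    (tendsto_zero_of_le_weight hc h tendsto_abs_atTop_atTop)
  simpa using h1

end Growth

/-- `ε R^(2σ-2)`. -/
noncomputable def rpot (σ ε : ℝ) (R : ℝ → ℝ) (y : ℝ) : ℝ := ε * R y ^ (2 * σ - 2)

/-- The function `ψ` with `∫ (G₁ g₁ + G₂ g₂) = ∫ R ψ g₁`, in terms of the values of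
`u = R²`, `w = ε R^(2σ)`, `x = ε R^(2σ-2)`, `p = R'/R` and of `V₁`, `V₂` and their derivatives.
The bracket is `(1 + σ x)` times second order terms, `R` being factored out of
`ρ = R (1 + σ x)`, `ρ'` and `ρ''`. -/
noncomputable def psiForm (σ lam u w x p V₁ V₁' V₂ V₂' : ℝ) : ℝ :=
  V₁ ^ 2 * (4 + (2 * σ ^ 2 + 2 * σ) * x) - 2
    - lam⁻¹ * (V₁ * V₂ * ((1 - u - w) * (1 + σ * x)
        + ((1 - u - w) + σ * (2 * σ - 1) * x * ((1 - u - w) + (2 * σ - 2) * p ^ 2)))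
      + 2 * (V₁' * V₂') * (1 + σ * x)
      + 2 * (V₁' * V₂ + V₁ * V₂') * (p * (1 + σ * (2 * σ - 1) * x)))

section
variable {σ ε a ω lam : ℝ} {R f₁ f₂ h₁ h₂ : ℝ → ℝ}

theorem IsProfile.hasDerivAt_rpot (h : IsProfile σ ε R) (y : ℝ) :
    HasDerivAt (rpot σ ε R) ((2 * σ - 2) * logD R y * rpot σ ε R y) y := by
  refine ((hasDerivAt_comp_rpow (t := 2 * σ - 2) (h.hasDerivAt y)
    (h.pos y)).const_mul ε).congr_deriv ?_
  rw [logD, rpot]; ring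

theorem IsProfile.hasDerivAt' (h : IsProfile σ ε R) (y : ℝ) :
    HasDerivAt R (logD R y * R y) y := by
  rw [← h.deriv_eq]; exact h.hasDerivAt y

theorem Gone_eq (hω : 0 < ω) (hR : ∀ y, 0 < R y) (V₁ V₂ : ℝ → ℝ) (y : ℝ) :
    Gone (powerNL a σ) ω R V₁ V₂ y = R y *
      (V₁ y ^ 2 * (3 + (2 * σ ^ 2 + σ) * rpot σ (a * ω ^ (σ - 1)) R y)
        - V₂ y ^ 2 * (1 + σ * rpot σ (a * ω ^ (σ - 1)) R y)) := by
  have h2 := deriv_deriv_powerNL_soliton (a := a) (σ := σ) hω (hR y)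
  have e : 2 * ω * R y ^ 2 * deriv (deriv (powerNL a σ)) (ω * R y ^ 2)
      = 2 * (ω * R y ^ 2 * deriv (deriv (powerNL a σ)) (ω * R y ^ 2)) := by ring
  rw [Gone, e, h2, deriv_powerNL_soliton hω (hR y), rpot]
  ring

theorem Gtwo_eq (hω : 0 < ω) (hR : ∀ y, 0 < R y) (V₁ V₂ : ℝ → ℝ) (y : ℝ) :
    Gtwo (powerNL a σ) ω R V₁ V₂ y
      = 2 * (V₁ y * V₂ y) * (R y * (1 + σ * rpot σ (a * ω ^ (σ - 1)) R y)) := by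
  rw [Gtwo, deriv_powerNL_soliton hω (hR y), rpot]
  ring

/-- `R (S*)² h₁` is a total derivative. -/
theorem hasDerivAt_mul_Sstar (h : IsProfile σ ε R) {μ : ℝ} (hh : IsCoupled σ ε R μ h₁ h₂) (y : ℝ) :
    HasDerivAt (fun y => R y * (deriv h₁ y + logD R y * h₁ y))
      (R y * modeOne σ ε R μ h₁ h₂ y) y := by
  refine ((h.hasDerivAt' y).fun_mul ((hh.hdd₁ y).fun_add
    ((h.hasDerivAt_logD y).fun_mul (hh.hd₁ y)))).congr_deriv ?_
  rw [modeOne]; ring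

/-- The pointwise identity behind `∫ (G₁ g₁ + G₂ g₂) = ∫ R ψ g₁`: `g₂ = (2λ)⁻¹ L₊ g₁`, `L₊` is
symmetric, and `R g₁` is a total derivative. -/
theorem hasDerivAt_reduction (hσ : 1 < σ) (hlam : lam ≠ 0) (h : IsProfile σ ε R)
    (hf : IsCoupled σ ε R lam f₁ f₂) (hh : IsCoupled σ ε R (2 * lam) h₁ h₂)
    {V₁ V₁' V₂ V₂' g₁ g₁' g₂ : ℝ → ℝ} (eV₁ : V₁ = modeOne σ ε R lam f₁ f₂)
    (eV₁' : V₁' = modeOneDeriv σ ε R lam f₁ f₂) (eV₂ : V₂ = modeTwo σ ε R lam f₁ f₂)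
    (eV₂' : V₂' = modeTwoDeriv σ ε R lam f₁ f₂) (eg₁ : g₁ = modeOne σ ε R (2 * lam) h₁ h₂)
    (eg₁' : g₁' = modeOneDeriv σ ε R (2 * lam) h₁ h₂)
    (eg₂ : g₂ = modeTwo σ ε R (2 * lam) h₁ h₂) (y : ℝ) :
    HasDerivAt (fun y => lam⁻¹ * (((V₁' y * V₂ y + V₁ y * V₂' y)
          * (R y * (1 + σ * rpot σ ε R y)) + V₁ y * V₂ y
          * (R y * (logD R y * (1 + σ * (2 * σ - 1) * rpot σ ε R y)))) * g₁ y
        - V₁ y * V₂ y * (R y * (1 + σ * rpot σ ε R y)) * g₁' y)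
        + 2 * (R y * (deriv h₁ y + logD R y * h₁ y)))
      (R y * (V₁ y ^ 2 * (3 + (2 * σ ^ 2 + σ) * rpot σ ε R y)
          - V₂ y ^ 2 * (1 + σ * rpot σ ε R y)) * g₁ y
        + 2 * (V₁ y * V₂ y) * (R y * (1 + σ * rpot σ ε R y)) * g₂ y
        - R y * psiForm σ lam (R y ^ 2) (pot σ ε R y) (rpot σ ε R y) (logD R y) (V₁ y) (V₁' y)
          (V₂ y) (V₂' y) * g₁ y) y := by
  have dV₁ : HasDerivAt V₁ (V₁' y) y := by rw [eV₁, eV₁']; exact hasDerivAt_modeOne hσ h hf y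
  have dV₂ : HasDerivAt V₂ (V₂' y) y := by rw [eV₂, eV₂']; exact hasDerivAt_modeTwo hσ h hf y
  have dV₁' : HasDerivAt V₁' ((1 - 3 * R y ^ 2 - (1 + 2 * σ) * pot σ ε R y) * V₁ y
      - lam * V₂ y) y := by
    rw [eV₁, eV₁', eV₂]; exact hasDerivAt_modeOneDeriv hσ h hf y
  have dV₂' : HasDerivAt V₂' ((1 - R y ^ 2 - pot σ ε R y) * V₂ y - lam * V₁ y) y := by
    rw [eV₁, eV₂', eV₂]; exact hasDerivAt_modeTwoDeriv hσ h hf y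
  have dg₁ : HasDerivAt g₁ (g₁' y) y := by rw [eg₁, eg₁']; exact hasDerivAt_modeOne hσ h hh y
  have dg₁' : HasDerivAt g₁' ((1 - 3 * R y ^ 2 - (1 + 2 * σ) * pot σ ε R y) * g₁ y
      - 2 * lam * g₂ y) y := by
    rw [eg₁, eg₁', eg₂]; exact hasDerivAt_modeOneDeriv hσ h hh y
  have dS : HasDerivAt (fun y => R y * (deriv h₁ y + logD R y * h₁ y)) (R y * g₁ y) y := by
    rw [eg₁]; exact hasDerivAt_mul_Sstar h hh y
  have dR := h.hasDerivAt' y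
  have dx := h.hasDerivAt_rpot y
  have dp := h.hasDerivAt_logD y
  have dρ := dR.fun_mul ((dx.const_mul σ).const_add 1)
  have dρ' := dR.fun_mul (dp.fun_mul ((dx.const_mul (σ * (2 * σ - 1))).const_add 1))
  have dVV := (dV₁'.fun_mul dV₂).fun_add (dV₁.fun_mul dV₂')
  have dG' := (dVV.fun_mul dρ).fun_add ((dV₁.fun_mul dV₂).fun_mul dρ')
  refine ((((dG'.fun_mul dg₁).fun_sub (((dV₁.fun_mul dV₂).fun_mul dρ).fun_mul dg₁')).const_mul
    lam⁻¹).fun_add (dS.const_mul 2)).congr_deriv ?_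
  rw [psiForm]
  field_simp
  ring

/-- The orthogonality `⟨V₂, g₁⟩ = ⟨V₁, g₂⟩ = 0` in differential form. -/
theorem hasDerivAt_orthogonality (hσ : 1 < σ) (hlam : lam ≠ 0) (h : IsProfile σ ε R)
    (hf : IsCoupled σ ε R lam f₁ f₂) (hh : IsCoupled σ ε R (2 * lam) h₁ h₂) (c d y : ℝ) :
    HasDerivAt (fun y => -(1 / (3 * lam)) * ((2 * c + d) * (modeTwo σ ε R lam f₁ f₂ y
          * modeTwoDeriv σ ε R (2 * lam) h₁ h₂ y - modeTwoDeriv σ ε R lam f₁ f₂ y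
          * modeTwo σ ε R (2 * lam) h₁ h₂ y)
        + (c + 2 * d) * (modeOne σ ε R lam f₁ f₂ y * modeOneDeriv σ ε R (2 * lam) h₁ h₂ y
          - modeOneDeriv σ ε R lam f₁ f₂ y * modeOne σ ε R (2 * lam) h₁ h₂ y)))
      (c * (modeTwo σ ε R lam f₁ f₂ y * modeOne σ ε R (2 * lam) h₁ h₂ y)
        + d * (modeOne σ ε R lam f₁ f₂ y * modeTwo σ ε R (2 * lam) h₁ h₂ y)) y := by
  have d1 := ((hasDerivAt_modeTwo hσ h hf y).fun_mul (hasDerivAt_modeTwoDeriv hσ h hh y)).fun_sub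
    ((hasDerivAt_modeTwoDeriv hσ h hf y).fun_mul (hasDerivAt_modeTwo hσ h hh y))
  have d2 := ((hasDerivAt_modeOne hσ h hf y).fun_mul (hasDerivAt_modeOneDeriv hσ h hh y)).fun_sub
    ((hasDerivAt_modeOneDeriv hσ h hf y).fun_mul (hasDerivAt_modeOne hσ h hh y))
  refine (((d1.const_mul (2 * c + d)).fun_add (d2.const_mul (c + 2 * d))).const_mul
    (-(1 / (3 * lam)))).congr_deriv ?_
  field_simp
  ring

end

section
variable {σ ε a ω α : ℝ} {R W₁ W₂ h₁ h₂ : ℝ → ℝ}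

theorem IsProfile.abs_logD_le (hσ : 1 < σ) (hε : 0 < ε) (h : IsProfile σ ε R) (y : ℝ) :
    |logD R y| ≤ 1 := by
  have h1 := h.logD_sq hσ y
  have h2 := pot_pos hε h y
  have h3 : 0 < (σ + 1)⁻¹ := inv_pos.2 (by linarith)
  rw [← sq_le_one_iff_abs_le_one, h1]
  have := sq_nonneg (R y)
  nlinarith [mul_pos h3 h2]

theorem IsProfile.expDecay (hσ : 1 < σ) (hε : 0 < ε) (h : IsProfile σ ε R) : ExpDecay R :=
  ⟨h.continuous, 2 * √2, 0, 1, one_pos, fun y => by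
    rw [abs_of_pos (h.pos y), pow_zero, one_mul, neg_one_mul]
    exact (h.le_Q hσ hε y).trans (Q_le_exp y)⟩

theorem IsProfile.polyGrowth (hσ : 1 < σ) (hε : 0 < ε) (h : IsProfile σ ε R) :
    PolyGrowth (pot σ ε R) ∧ PolyGrowth (rpot σ ε R) ∧ PolyGrowth (logD R) := by
  refine ⟨.of_bounded (continuous_pot h) (C := ε * √2 ^ (2 * σ)) fun y => ?_,
    .of_bounded ((h.continuous_rpow _).const_mul _) (C := ε * √2 ^ (2 * σ - 2)) fun y => ?_,
    .of_bounded (continuous_of_hasDerivAt h.hasDerivAt_logD) (h.abs_logD_le hσ hε)⟩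
  · rw [abs_of_pos (pot_pos hε h y)]
    exact (pot_le hσ hε h y).trans
      (mul_le_mul_of_nonneg_left (Q_rpow_le (by linarith) y) hε.le)
  · rw [rpot, abs_of_pos (mul_pos hε (Real.rpow_pos_of_pos (h.pos y) _))]
    exact mul_le_mul_of_nonneg_left ((h.rpow_le hσ hε (by linarith) y).trans
      (Q_rpow_le (by linarith) y)) hε.le

variable {μ : ℝ} {f₁ f₂ : ℝ → ℝ}

theorem PolyGrowth.modes (hσ : 1 < σ) (hε : 0 < ε) (h : IsProfile σ ε R) (b₁ : PolyGrowth f₁)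
    (b₂ : PolyGrowth f₂) (b₃ : PolyGrowth (deriv f₁)) (b₄ : PolyGrowth (deriv f₂)) :
    PolyGrowth (modeOne σ ε R μ f₁ f₂) ∧ PolyGrowth (modeOneDeriv σ ε R μ f₁ f₂) ∧
    PolyGrowth (modeTwo σ ε R μ f₁ f₂) ∧ PolyGrowth (modeTwoDeriv σ ε R μ f₁ f₂) := by
  obtain ⟨hw, -, hp⟩ := h.polyGrowth hσ hε
  have hR := (h.expDecay hσ hε).polyGrowth.pow 2
  have c := PolyGrowth.const
  exact ⟨((((((c _).add ((c _).mul hw)).sub hR).sub hw).mul b₁).add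
      (((c _).mul hp).mul b₃)).sub ((c _).mul b₂),
    ((((((c _).mul hp).mul (((c _).sub hR).sub hw)).mul b₁).sub
      ((((c _).mul hp).mul (c _)).mul b₂)).add (((c _).mul (((c _).sub hR).sub hw)).mul b₃)).sub
      ((c _).mul b₄),
    (((c _).mul b₁).add (((c _).add ((c _).mul hw)).mul b₂)).add (((c _).mul hp).mul b₄),
    ((((((c _).mul hp).mul (c _)).mul b₁).add ((((c _).add ((c _).mul hw)).mul hp).mul b₂)).sub
      ((c _).mul b₃)).add ((((c _).sub ((c _).mul hw)).sub hR).mul b₄)⟩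

theorem ExpDecay.modes (hσ : 1 < σ) (hε : 0 < ε) (h : IsProfile σ ε R) (b₁ : ExpDecay f₁)
    (b₂ : ExpDecay f₂) (b₃ : ExpDecay (deriv f₁)) (b₄ : ExpDecay (deriv f₂)) :
    ExpDecay (modeOne σ ε R μ f₁ f₂) ∧ ExpDecay (modeOneDeriv σ ε R μ f₁ f₂) ∧
    ExpDecay (modeTwo σ ε R μ f₁ f₂) ∧ ExpDecay (modeTwoDeriv σ ε R μ f₁ f₂) := by
  obtain ⟨hw, -, hp⟩ := h.polyGrowth hσ hε
  have hR := (h.expDecay hσ hε).polyGrowth.pow 2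
  have c := PolyGrowth.const
  exact ⟨((ExpDecay.mul' ((((c _).add ((c _).mul hw)).sub hR).sub hw) b₁).add
      (ExpDecay.mul' ((c _).mul hp) b₃)).sub (ExpDecay.mul' (c _) b₂),
    (((ExpDecay.mul' (((c _).mul hp).mul (((c _).sub hR).sub hw)) b₁).sub
      (ExpDecay.mul' (((c _).mul hp).mul (c _)) b₂)).add
      (ExpDecay.mul' ((c _).mul (((c _).sub hR).sub hw)) b₃)).sub (ExpDecay.mul' (c _) b₄),
    ((ExpDecay.mul' (c _) b₁).add (ExpDecay.mul' ((c _).add ((c _).mul hw)) b₂)).add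
      (ExpDecay.mul' ((c _).mul hp) b₄),
    (((ExpDecay.mul' (((c _).mul hp).mul (c _)) b₁).add
      (ExpDecay.mul' (((c _).add ((c _).mul hw)).mul hp) b₂)).sub
      (ExpDecay.mul' (c _) b₃)).add (ExpDecay.mul' (((c _).sub ((c _).mul hw)).sub hR) b₄)⟩

/-- Exact reduction: `Γ = ∫ R ψ g₁`. -/
theorem integral_fermiIntegrand (hσ : 1 < σ) (hω : 0 < ω) (ha : 0 < a)
    (hε' : ε = a * ω ^ (σ - 1)) (hα1 : 1 - α ^ 2 ≠ 0)
    (h : IsProfile σ ε R) (hf : IsCoupled σ ε R (1 - α ^ 2) W₁ W₂)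
    (hh : IsCoupled σ ε R (2 * (1 - α ^ 2)) h₁ h₂)
    (b₁ : ExpDecay W₁) (b₂ : ExpDecay W₂) (b₃ : ExpDecay (deriv W₁)) (b₄ : ExpDecay (deriv W₂))
    (c₁ : PolyGrowth h₁) (c₂ : PolyGrowth h₂) (c₃ : PolyGrowth (deriv h₁))
    (c₄ : PolyGrowth (deriv h₂)) :
    Integrable (fermiIntegrand (powerNL a σ) ω R α W₁ h₁) ∧
    Integrable (fun y => R y * psiForm σ (1 - α ^ 2) (R y ^ 2)
      (pot σ ε R y) (rpot σ ε R y) (logD R y)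
      (modeOne σ ε R (1 - α ^ 2) W₁ W₂ y) (modeOneDeriv σ ε R (1 - α ^ 2) W₁ W₂ y)
      (modeTwo σ ε R (1 - α ^ 2) W₁ W₂ y) (modeTwoDeriv σ ε R (1 - α ^ 2) W₁ W₂ y)
      * modeOne σ ε R (2 * (1 - α ^ 2)) h₁ h₂ y) ∧
    fermiGamma (powerNL a σ) ω R α W₁ h₁ = ∫ y, R y * psiForm σ (1 - α ^ 2) (R y ^ 2)
      (pot σ ε R y) (rpot σ ε R y) (logD R y)
      (modeOne σ ε R (1 - α ^ 2) W₁ W₂ y) (modeOneDeriv σ ε R (1 - α ^ 2) W₁ W₂ y)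
      (modeTwo σ ε R (1 - α ^ 2) W₁ W₂ y) (modeTwoDeriv σ ε R (1 - α ^ 2) W₁ W₂ y)
      * modeOne σ ε R (2 * (1 - α ^ 2)) h₁ h₂ y := by
  have hε : 0 < ε := by rw [hε']; exact mul_pos ha (Real.rpow_pos_of_pos hω _)
  have hred := hasDerivAt_reduction hσ hα1 h hf hh rfl rfl rfl rfl rfl rfl rfl
  have horth := hasDerivAt_orthogonality hσ hα1 h hf hh
  obtain ⟨v1, v2, v3, v4⟩ := ExpDecay.modes (μ := 1 - α ^ 2) hσ hε h b₁ b₂ b₃ b₄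
  obtain ⟨g1, g2, g3, g4⟩ := PolyGrowth.modes (μ := 2 * (1 - α ^ 2)) hσ hε h c₁ c₂ c₃ c₄
  have e1 := firstComponent_eq h hf
  have e3 := firstComponent_eq h hh
  have e2 : secondComponent (powerNL a σ) ω R (1 - α ^ 2) W₁
      = modeTwo σ ε R (1 - α ^ 2) W₁ W₂ := by
    subst hε'; exact secondComponent_eq hσ hω hα1 h hf
  have e4 : secondComponent (powerNL a σ) ω R (2 * (1 - α ^ 2)) h₁
      = modeTwo σ ε R (2 * (1 - α ^ 2)) h₁ h₂ := by
    subst hε'; exact secondComponent_eq hσ hω (mul_ne_zero two_ne_zero hα1) h hh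
  set V₁ := modeOne σ ε R (1 - α ^ 2) W₁ W₂
  set V₁' := modeOneDeriv σ ε R (1 - α ^ 2) W₁ W₂
  set V₂ := modeTwo σ ε R (1 - α ^ 2) W₁ W₂
  set V₂' := modeTwoDeriv σ ε R (1 - α ^ 2) W₁ W₂
  set G₁ := modeOne σ ε R (2 * (1 - α ^ 2)) h₁ h₂
  set G₂ := modeTwo σ ε R (2 * (1 - α ^ 2)) h₁ h₂
  obtain ⟨hw, hx, hp⟩ := h.polyGrowth hσ hε
  have hRd := h.expDecay hσ hε
  have hR := hRd.polyGrowth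
  have c := PolyGrowth.const
  have V1p := v1.polyGrowth
  have V2p := v3.polyGrowth
  set A₁ : ℝ → ℝ := fun y => R y * (V₁ y ^ 2 * (3 + (2 * σ ^ 2 + σ) * rpot σ ε R y)
      - V₂ y ^ 2 * (1 + σ * rpot σ ε R y)) with hA₁
  set A₂ : ℝ → ℝ := fun y => 2 * (V₁ y * V₂ y) * (R y * (1 + σ * rpot σ ε R y)) with hA₂
  have dA₁ : ExpDecay A₁ := hRd.mul (((V1p.pow 2).mul ((c _).add ((c _).mul hx))).sub
    ((V2p.pow 2).mul ((c _).add ((c _).mul hx))))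
  have dA₂ : ExpDecay A₂ := ExpDecay.mul' ((c _).mul (V1p.mul V2p))
    (hRd.mul ((c _).add ((c _).mul hx)))
  have main : ExpDecay fun y => A₁ y * G₁ y + A₂ y * G₂ y := (dA₁.mul g1).add (dA₂.mul g3)
  set Ψ : ℝ → ℝ := fun y => R y * psiForm σ (1 - α ^ 2) (R y ^ 2) (pot σ ε R y) (rpot σ ε R y)
      (logD R y) (V₁ y) (V₁' y) (V₂ y) (V₂' y) * G₁ y with hΨ
  have iΨ : ExpDecay Ψ := by
    have hk : PolyGrowth fun y => 1 - R y ^ 2 - pot σ ε R y := ((c _).sub (hR.pow 2)).sub hw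
    have hr : PolyGrowth fun y => 1 + σ * rpot σ ε R y := (c _).add ((c _).mul hx)
    refine (hRd.mul ((((V1p.pow 2).mul ((c _).add ((c _).mul hx))).sub (c _)).sub
      ((c _).mul ((((V1p.mul V2p).mul ((hk.mul hr).add (hk.add (((c _).mul hx).mul
        (hk.add ((c _).mul (hp.pow 2))))))).add
        (((c _).mul (v2.polyGrowth.mul v4.polyGrowth)).mul hr)).add
        (((c _).mul ((v2.polyGrowth.mul V2p).add (V1p.mul v4.polyGrowth))).mul
          (hp.mul ((c _).add ((c _).mul hx)))))))).mul g1
  have int1 : ∫ y, (A₁ y * G₁ y + A₂ y * G₂ y) = ∫ y, Ψ y := by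
    have hr : PolyGrowth fun y => 1 + σ * rpot σ ε R y := (c _).add ((c _).mul hx)
    have h0 := ExpDecay.integral_deriv_eq_zero (G := fun y => (A₁ y * G₁ y + A₂ y * G₂ y) - Ψ y)
      ((ExpDecay.mul' (c _) (((((v2.mul V2p).add (v1.mul v4.polyGrowth)).mul
        (hR.mul hr)).add ((v1.mul V2p).mul (hR.mul (hp.mul ((c _).add ((c _).mul hx)))))).mul
        g1 |>.sub (((v1.mul V2p).mul (hR.mul hr)).mul g2))).add
        (ExpDecay.mul' (c _) (hRd.mul (c₃.add (hp.mul c₁)))))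
      (main.integrable.sub iΨ.integrable) hred
    rw [integral_sub main.integrable iΨ.integrable] at h0
    linarith
  have corr : ∀ c d, ExpDecay (fun y => c * (V₂ y * G₁ y) + d * (V₁ y * G₂ y)) ∧
      ∫ y, (c * (V₂ y * G₁ y) + d * (V₁ y * G₂ y)) = 0 := fun k l => by
    have hd : ExpDecay (fun y => k * (V₂ y * G₁ y) + l * (V₁ y * G₂ y)) :=
      (ExpDecay.mul' (c _) (v3.mul g1)).add (ExpDecay.mul' (c _) (v1.mul g3))
    refine ⟨hd, ExpDecay.integral_deriv_eq_zero (ExpDecay.mul' (c _) ((ExpDecay.mul' (c _)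
      ((v3.mul g4).sub (v4.mul g3))).add (ExpDecay.mul' (c _) ((v1.mul g2).sub (v2.mul g1)))))
      hd.integrable (horth k l)⟩
  set k := ip (Gone (powerNL a σ) ω R V₁ V₂) V₁ / ip V₁ V₂ with hk
  set l := ip (Gtwo (powerNL a σ) ω R V₁ V₂) V₂ / ip V₁ V₂ with hl
  have efun : fermiIntegrand (powerNL a σ) ω R α W₁ h₁ = fun y =>
      (A₁ y * G₁ y + A₂ y * G₂ y) - (k * (V₂ y * G₁ y) + l * (V₁ y * G₂ y)) := by
    funext y
    rw [fermiIntegrand, e1, e2, e3, e4, fermiDensity, ← hk, ← hl, Gone_eq hω h.pos,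
      Gtwo_eq hω h.pos, ← hε']
    ring
  rw [fermiGamma, efun]
  refine ⟨main.integrable.sub (corr k l).1.integrable, iΨ.integrable, ?_⟩
  rw [integral_sub main.integrable (corr k l).1.integrable, (corr k l).2, int1, sub_zero]

end

/-! ### First variation of `ψ` and the explicit form of its integral -/

/-- The coefficient of `ε` in `V₁`, in terms of the values of `u = Q²`, `x = Q^(2σ-2)`, `p = Q'/Q`,
`b = D⁰/Q`, `T₁ = T₁⁰`, `T₂ = T₂⁰` and of the derivatives `m₁`, `m₂` of the latter two. -/
noncomputable def varOne (σ u x p b T₁ m₁ T₂ m₂ : ℝ) : ℝ :=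
  ((1 - 2 * (σ + 1)⁻¹) * (x * u) - 2 * u * b - x * u) + (2 - u) * (T₁ + T₂)
    + 2 * p * (m₁ + m₂) - (T₁ - T₂)

/-- The coefficient of `ε` in `V₁'`, where `b' = (D⁰)'/Q`. -/
noncomputable def varOneDeriv (u x p b b' T₁ m₁ T₂ m₂ : ℝ) : ℝ :=
  2 * ((b' - p * b) * (1 - u) - p * (2 * u * b + x * u)) + 2 * p * (1 - u) * (T₁ + T₂)
    - 2 * (b' - p * b) - 2 * p * (T₁ - T₂) + 2 * (1 - u) * (m₁ + m₂) - (m₁ - m₂)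

/-- The coefficient of `ε` in `V₂`. -/
noncomputable def varTwo (σ u x p T₁ m₁ T₂ m₂ : ℝ) : ℝ :=
  -(T₁ + T₂) + 2 * (1 - 2 * (σ + 1)⁻¹) * (x * u) + 2 * (T₁ - T₂) + 2 * p * (m₁ - m₂)

/-- The coefficient of `ε` in `V₂'`. -/
noncomputable def varTwoDeriv (σ u x p T₁ m₁ T₂ m₂ : ℝ) : ℝ :=
  -2 * p * (T₁ + T₂) + 2 * (1 - 2 * (σ + 1)⁻¹) * (x * u) * p + 2 * p * (T₁ - T₂) - (m₁ + m₂)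
    + (2 - u) * (m₁ - m₂)

/-- The coefficient of `ε` in `ψ`. -/
noncomputable def psiOne (σ u x p b b' T₁ m₁ T₂ m₂ : ℝ) : ℝ :=
  8 * (1 - u) * varOne σ u x p b T₁ m₁ T₂ m₂ + (1 - u) ^ 2 * (2 * σ ^ 2 + 2 * σ) * x
    - ((varOne σ u x p b T₁ m₁ T₂ m₂ + (1 - u) * varTwo σ u x p T₁ m₁ T₂ m₂) * (2 * (1 - u))
      + (1 - u) * (-4 * u * b - 2 * (x * u) + σ * x * (1 - u)
        + σ * (2 * σ - 1) * x * ((1 - u) + (2 * σ - 2) * p ^ 2))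
      - 4 * p * u * varTwoDeriv σ u x p T₁ m₁ T₂ m₂
      + 2 * ((varOneDeriv u x p b b' T₁ m₁ T₂ m₂ - 2 * p * u * varTwo σ u x p T₁ m₁ T₂ m₂
          + (1 - u) * varTwoDeriv σ u x p T₁ m₁ T₂ m₂) * p
        - 2 * p * u * (b' - p * b + p * (σ * (2 * σ - 1) * x))))

/-- `P` in the primitive `Q (P cos y + N sin y)` of `Q ψ₁ g₁⁰` minus the integrand of `Γ₀`. -/
noncomputable def primitiveCos (s u x p b b' T₁ m₁ T₂ m₂ : ℝ) : ℝ :=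
  T₁ * p * (4 - 2 * u + 2 * u ^ 2) + T₂ * p * (4 * u - 6 * u ^ 2) + 10 * b'
    + b * p * (6 * u ^ 2 - 8) + m₁ * (8 - 6 * u + 6 * u ^ 2 - 2 * u ^ 3)
    + m₂ * (4 * u - 6 * u ^ 2 + 2 * u ^ 3)
    + p * x * (2 * s + (4 + s - 2 * s ^ 2) * u + (2 * s ^ 2 - s - 2) * u ^ 2 + 4 * u ^ 3
      - (s + 1)⁻¹ * (7 * u - 9 * u ^ 2 + 8 * u ^ 3))

/-- `N` in the primitive `Q (P cos y + N sin y)` of `Q ψ₁ g₁⁰` minus the integrand of `Γ₀`. -/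
noncomputable def primitiveSin (s u x p b T₁ m₁ T₂ m₂ : ℝ) : ℝ :=
  T₁ * (-4 + 10 * u - 2 * u ^ 2) + T₂ * (6 * u ^ 2 - 20 * u) + b * (18 * u - 2 - 6 * u ^ 2)
    + p * m₁ * (16 * u - 12 - 4 * u ^ 2) + p * m₂ * (4 * u ^ 2 - 16 * u)
    + x * (2 * s - 4 * s ^ 2 + (6 * s ^ 2 - s - 4) * u + (s - 2 * s ^ 2 + 14) * u ^ 2 - 4 * u ^ 3
      + (s + 1)⁻¹ * (21 * u - 33 * u ^ 2 + 8 * u ^ 3))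

/-- The coefficient of `cos y` in `Q ψ₁ g₁⁰ - (Q² Δ₄⁰ cos y + 2 (Q'/Q) Δ₅⁰ sin y)`, divided by `Q`,
is `P' + p P + N`, where `P'` is computed from the differential equations satisfied by the
arguments of `primitiveCos`. -/
theorem cos_coefficient {s t u x p b b' T₁ m₁ T₂ m₂ : ℝ} (hp : p ^ 2 = 1 - u / 2)
    (ht : t = (s + 1)⁻¹) (hst : s * t = 1 - t)
    (hb : p * b' = (1 - u) * b - t * u * x / 2) :
    u * psiOne s u x p b b' T₁ m₁ T₂ m₂ - u * ((13 * u - 16) * u * b - 8 * p * u * b'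
      + 2 * (3 * (1 - u) ^ 2 - 1) * T₁ + 6 * (2 - u) ^ 2 * T₂ + 4 * (2 - 3 * u) * p * m₁
      + 4 * (4 - 3 * u) * p * m₂ + 2 * s ^ 2 * x - (4 * (s + 2) * t + (2 * s + 1) ^ 2) * (x * u)
      + (8 * t + (s + 1) * (2 * s + 1)) * (x * u ^ 2))
    = ((m₁ * p + T₁ * (-u / 2)) * (4 - 2 * u + 2 * u ^ 2) + T₁ * p * (-2 + 4 * u) * (2 * p * u)
      + ((m₂ * p + T₂ * (-u / 2)) * (4 * u - 6 * u ^ 2) + T₂ * p * (4 - 12 * u) * (2 * p * u))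
      + 10 * ((1 - 3 * u) * b - x * u - p * b')
      + (((b' - p * b) * p + b * (-u / 2)) * (6 * u ^ 2 - 8) + b * p * (12 * u) * (2 * p * u))
      + (-((s - 1) ^ 2 * t) * (x * u) * (8 - 6 * u + 6 * u ^ 2 - 2 * u ^ 3)
        + m₁ * (-6 + 12 * u - 6 * u ^ 2) * (2 * p * u))
      + ((2 * T₂ + s * (s - 1) * t * (x * u)) * (4 * u - 6 * u ^ 2 + 2 * u ^ 3)
        + m₂ * (4 - 12 * u + 6 * u ^ 2) * (2 * p * u))
      + ((-u / 2) * x + p * ((2 * s - 2) * p * x)) * (2 * s + (4 + s - 2 * s ^ 2) * u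
        + (2 * s ^ 2 - s - 2) * u ^ 2 + 4 * u ^ 3 - t * (7 * u - 9 * u ^ 2 + 8 * u ^ 3))
      + p * x * ((4 + s - 2 * s ^ 2) + (2 * s ^ 2 - s - 2) * (2 * u) + 12 * u ^ 2
        - t * (7 - 18 * u + 24 * u ^ 2)) * (2 * p * u))
      + p * primitiveCos s u x p b b' T₁ m₁ T₂ m₂ + primitiveSin s u x p b T₁ m₁ T₂ m₂ := by
  rw [psiOne, varOne, varTwo, varOneDeriv, varTwoDeriv, primitiveCos, primitiveSin, ← ht]
  clear ht
  grind

/-- The analogous identity for the coefficient of `sin y`, with `N' + p N - P`. -/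
theorem sin_coefficient {s t u x p b b' T₁ m₁ T₂ m₂ : ℝ} (hp : p ^ 2 = 1 - u / 2)
    (ht : t = (s + 1)⁻¹) (hst : s * t = 1 - t)
    (hb : p * b' = (1 - u) * b - t * u * x / 2) :
    2 * p * psiOne s u x p b b' T₁ m₁ T₂ m₂ - 2 * p * ((2 - 30 * u + 29 * u ^ 2 - 8 * u ^ 3) * b
      - 8 * u ^ 2 * p * b' + 2 * (2 - u) * (2 - 3 * u) * T₁ + 2 * (3 * u ^ 2 - 10 * u + 12) * T₂
      + 16 * (1 - u) * p * m₁ + 8 * (2 - u) * p * m₂ + 2 * s * (s + 1) * x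
      - (16 * t + 2 * s + (2 * s + 1) ^ 2) * (x * u)
      + (4 * (4 - s) * t + (s + 1) * (2 * s + 1)) * (x * u ^ 2) - 4 * t * (x * u ^ 3))
    = (m₁ * (-4 + 10 * u - 2 * u ^ 2) + T₁ * (10 - 4 * u) * (2 * p * u)
      + (m₂ * (6 * u ^ 2 - 20 * u) + T₂ * (12 * u - 20) * (2 * p * u))
      + ((b' - p * b) * (18 * u - 2 - 6 * u ^ 2) + b * (18 - 12 * u) * (2 * p * u))
      + (((-u / 2) * m₁ + p * (-((s - 1) ^ 2 * t) * (x * u))) * (16 * u - 12 - 4 * u ^ 2)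
        + p * m₁ * (16 - 8 * u) * (2 * p * u))
      + (((-u / 2) * m₂ + p * (2 * T₂ + s * (s - 1) * t * (x * u))) * (4 * u ^ 2 - 16 * u)
        + p * m₂ * (8 * u - 16) * (2 * p * u))
      + (2 * s - 2) * p * x * (2 * s - 4 * s ^ 2 + (6 * s ^ 2 - s - 4) * u
        + (s - 2 * s ^ 2 + 14) * u ^ 2 - 4 * u ^ 3 + t * (21 * u - 33 * u ^ 2 + 8 * u ^ 3))
      + x * ((6 * s ^ 2 - s - 4) + (s - 2 * s ^ 2 + 14) * (2 * u) - 12 * u ^ 2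
        + t * (21 - 66 * u + 24 * u ^ 2)) * (2 * p * u))
      + p * primitiveSin s u x p b T₁ m₁ T₂ m₂ - primitiveCos s u x p b b' T₁ m₁ T₂ m₂ := by
  rw [psiOne, varOne, varTwo, varOneDeriv, varTwoDeriv, primitiveCos, primitiveSin, ← ht]
  clear ht
  grind

section
variable {σ : ℝ}

/-- The function `ψ₁` with `ψ = ε ψ₁ + O(ε²)`. -/
noncomputable def psiLimit (σ y : ℝ) : ℝ :=
  psiOne σ (Q y ^ 2) (Q y ^ (2 * σ - 2)) (-Real.tanh y) (D0 σ y / Q y) (D0Deriv σ y / Q y)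
    (T1 σ y) (T1Deriv σ y) (T2 σ y) (T2Deriv σ y)

theorem Q_rpow_eq (σ y : ℝ) : Q y ^ (2 * σ) = Q y ^ (2 * σ - 2) * Q y ^ 2 := by
  rw [← Q_rpow_add_two]; congr 1; ring

theorem hasDerivAt_Q_sq (y : ℝ) :
    HasDerivAt (fun y => Q y ^ 2) (2 * -Real.tanh y * Q y ^ 2) y := by
  refine ((hasDerivAt_Q y).fun_pow 2).congr_deriv ?_
  norm_num; ring

theorem hasDerivAt_D0_div_Q (hσ : 1 < σ) (y : ℝ) : HasDerivAt (fun y => D0 σ y / Q y)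
    (D0Deriv σ y / Q y - -Real.tanh y * (D0 σ y / Q y)) y := by
  have hQ := (Q_pos y).ne'
  refine ((hasDerivAt_D0 hσ y).fun_div (hasDerivAt_Q y) hQ).congr_deriv ?_
  field_simp

theorem hasDerivAt_D0Deriv_div_Q (hσ : 1 < σ) (y : ℝ) : HasDerivAt (fun y => D0Deriv σ y / Q y)
    ((1 - 3 * Q y ^ 2) * (D0 σ y / Q y) - Q y ^ (2 * σ - 2) * Q y ^ 2
      - -Real.tanh y * (D0Deriv σ y / Q y)) y := by
  have hQ := (Q_pos y).ne'
  refine ((hasDerivAt_D0Deriv hσ y).fun_div (hasDerivAt_Q y) hQ).congr_deriv ?_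
  rw [Q_rpow_eq]
  generalize Q y ^ (2 * σ - 2) = x
  field_simp

/-- The relation that eliminates `(D⁰)' Q'` from the identities above. -/
theorem D0_div_Q_first_integral (hσ : 1 < σ) (y : ℝ) : -Real.tanh y * (D0Deriv σ y / Q y)
    = (1 - Q y ^ 2) * (D0 σ y / Q y) - (σ + 1)⁻¹ * Q y ^ 2 * Q y ^ (2 * σ - 2) / 2 := by
  have hQ := (Q_pos y).ne'
  have hs : σ + 1 ≠ 0 := by linarith
  have h := D0_first_integral hσ y
  rw [Q_rpow_eq] at h
  generalize Q y ^ (2 * σ - 2) = x at *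
  field_simp at h ⊢
  linear_combination -h

/-- The integrand of `Γ₀` is `Q` times a polynomial in the bounded quantities `u`, `x`, `p`, `b`,
`b'`, in `T₁⁰`, `T₂⁰` and in their derivatives. -/
theorem Gamma0Integrand_eq (hσ : 1 < σ) {y u x p b b' t : ℝ} (hu : u = Q y ^ 2)
    (hx : x = Q y ^ (2 * σ - 2)) (hp : p = -Real.tanh y) (hb : b = D0 σ y / Q y)
    (hb' : b' = D0Deriv σ y / Q y) (ht : t = (σ + 1)⁻¹) :
    Gamma0Integrand σ y = Q y * (u * ((13 * u - 16) * u * b - 8 * p * u * b'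
      + 2 * (3 * (1 - u) ^ 2 - 1) * T1 σ y + 6 * (2 - u) ^ 2 * T2 σ y
      + 4 * (2 - 3 * u) * p * T1Deriv σ y
      + 4 * (4 - 3 * u) * p * T2Deriv σ y + 2 * σ ^ 2 * x
      - (4 * (σ + 2) * t + (2 * σ + 1) ^ 2) * (x * u)
      + (8 * t + (σ + 1) * (2 * σ + 1)) * (x * u ^ 2)) * Real.cos y
      + 2 * p * ((2 - 30 * u + 29 * u ^ 2 - 8 * u ^ 3) * b
      - 8 * u ^ 2 * p * b' + 2 * (2 - u) * (2 - 3 * u) * T1 σ y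
      + 2 * (3 * u ^ 2 - 10 * u + 12) * T2 σ y
      + 16 * (1 - u) * p * T1Deriv σ y + 8 * (2 - u) * p * T2Deriv σ y + 2 * σ * (σ + 1) * x
      - (16 * t + 2 * σ + (2 * σ + 1) ^ 2) * (x * u)
      + (4 * (4 - σ) * t + (σ + 1) * (2 * σ + 1)) * (x * u ^ 2)
      - 4 * t * (x * u ^ 3)) * Real.sin y) := by
  have hQ := (Q_pos y).ne'
  have e1 : Q y ^ (2 * σ - 1) = x * Q y := by
    rw [hx, ← Q_rpow_add_one]; congr 1; ring
  have e2 : Q y ^ (2 * σ + 1) = x * u * Q y := by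
    rw [hx, hu, ← Q_rpow_eq, ← Q_rpow_add_one]
  have e3 : Q y ^ (2 * σ + 3) = x * u ^ 2 * Q y := by
    rw [show 2 * σ + 3 = 2 * σ + 1 + 2 by ring, Q_rpow_add_two, e2, ← hu]; ring
  have e4 : Q y ^ (2 * σ + 5) = x * u ^ 3 * Q y := by
    rw [show 2 * σ + 5 = 2 * σ + 3 + 2 by ring, Q_rpow_add_two, e3, ← hu]; ring
  have e5 : D0 σ y = b * Q y := by rw [hb]; field_simp
  have e6 : D0Deriv σ y = b' * Q y := by rw [hb']; field_simp
  have e7 : deriv Q y = p * Q y := by rw [deriv_Q, hp]; ring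
  have e8 : deriv Q y / Q y = p := by rw [e7]; field_simp
  rw [Gamma0Integrand, mul_div_assoc, e8, Delta4, Delta5, e1, e2, e3, e4,
    (hasDerivAt_D0 hσ y).deriv, (hasDerivAt_T1 hσ y).deriv, (hasDerivAt_T2 hσ y).deriv,
    e5, e6, e7, show Q y ^ 4 = u ^ 2 by rw [hu]; ring, show Q y ^ 6 = u ^ 3 by rw [hu]; ring,
    show Q y ^ 3 = u * Q y by rw [hu]; ring, ← hu, ht]
  simp only [div_eq_mul_inv]
  linear_combination (16 * p ^ 2 * b' * u * Real.sin y * Q y + 8 * p * b' * Q y * u * Real.cos y) * hu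

/-- `Q ψ₁ g₁⁰` and the integrand of `Γ₀` differ by a total derivative. -/
theorem hasDerivAt_primitive (hσ : 1 < σ) (y : ℝ) : HasDerivAt (fun y => Q y *
    (primitiveCos σ (Q y ^ 2) (Q y ^ (2 * σ - 2)) (-Real.tanh y) (D0 σ y / Q y)
        (D0Deriv σ y / Q y) (T1 σ y) (T1Deriv σ y) (T2 σ y) (T2Deriv σ y) * Real.cos y
      + primitiveSin σ (Q y ^ 2) (Q y ^ (2 * σ - 2)) (-Real.tanh y) (D0 σ y / Q y)
        (T1 σ y) (T1Deriv σ y) (T2 σ y) (T2Deriv σ y) * Real.sin y))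
    (Q y * psiLimit σ y * (Q y ^ 2 * Real.cos y + 2 * -Real.tanh y * Real.sin y)
      - Gamma0Integrand σ y) y := by
  have hQ := Q_pos y
  have hs : σ + 1 ≠ 0 := by linarith
  have hp : (-Real.tanh y) ^ 2 = 1 - Q y ^ 2 / 2 := by rw [neg_sq, tanh_sq]
  have hst : σ * (σ + 1)⁻¹ = 1 - (σ + 1)⁻¹ := by field_simp; ring
  have hcos := cos_coefficient (T₁ := T1 σ y) (m₁ := T1Deriv σ y) (T₂ := T2 σ y)
    (m₂ := T2Deriv σ y) hp rfl hst (D0_div_Q_first_integral hσ y)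
  have hsin := sin_coefficient (T₁ := T1 σ y) (m₁ := T1Deriv σ y) (T₂ := T2 σ y)
    (m₂ := T2Deriv σ y) hp rfl hst (D0_div_Q_first_integral hσ y)
  have dQ : HasDerivAt Q (-Real.tanh y * Q y) y := (hasDerivAt_Q y).congr_deriv (by ring)
  have du := hasDerivAt_Q_sq y
  have dx : HasDerivAt (fun y => Q y ^ (2 * σ - 2))
      ((2 * σ - 2) * -Real.tanh y * Q y ^ (2 * σ - 2)) y :=
    (hasDerivAt_Q_rpow _ y).congr_deriv (by ring)
  have dp : HasDerivAt (fun y => -Real.tanh y) (-Q y ^ 2 / 2) y :=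
    (hasDerivAt_tanh y).fun_neg.congr_deriv (by ring)
  have db := hasDerivAt_D0_div_Q hσ y
  have db' := hasDerivAt_D0Deriv_div_Q hσ y
  have d1 := hasDerivAt_T1 hσ y
  have dm1 : HasDerivAt (T1Deriv σ) (-((σ - 1) ^ 2 * (σ + 1)⁻¹)
      * (Q y ^ (2 * σ - 2) * Q y ^ 2)) y := (hasDerivAt_T1Deriv hσ y).congr_deriv (by
    rw [source1, Q_rpow_eq]; ring)
  have d2 := hasDerivAt_T2 hσ y
  have dm2 : HasDerivAt (T2Deriv σ) (2 * T2 σ y + σ * (σ - 1) * (σ + 1)⁻¹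
      * (Q y ^ (2 * σ - 2) * Q y ^ 2)) y := (hasDerivAt_T2Deriv hσ y).congr_deriv (by
    rw [source2, Q_rpow_eq]; ring)
  rw [Gamma0Integrand_eq hσ rfl rfl rfl rfl rfl rfl, psiLimit]
  simp only [primitiveCos, primitiveSin] at hcos hsin ⊢
  have du2 := du.fun_pow 2
  have du3 := du.fun_pow 3
  simp only [Nat.cast_ofNat, Nat.add_one_sub_one, pow_one] at du2 du3
  set t := (σ + 1)⁻¹
  have dcos := (((((((d1.fun_mul dp).fun_mul (((du.const_mul 2).const_sub 4).fun_add
      (du2.const_mul 2))).fun_add ((d2.fun_mul dp).fun_mul ((du.const_mul 4).fun_sub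
      (du2.const_mul 6)))).fun_add (db'.const_mul 10)).fun_add ((db.fun_mul dp).fun_mul
      ((du2.const_mul 6).sub_const 8))).fun_add (dm1.fun_mul ((((du.const_mul 6).const_sub
      8).fun_add (du2.const_mul 6)).fun_sub (du3.const_mul 2)))).fun_add
      (dm2.fun_mul (((du.const_mul 4).fun_sub (du2.const_mul 6)).fun_add
      (du3.const_mul 2)))).fun_add ((dp.fun_mul dx).fun_mul (((((du.const_mul
      (4 + σ - 2 * σ ^ 2)).const_add (2 * σ)).fun_add (du2.const_mul
      (2 * σ ^ 2 - σ - 2))).fun_add (du3.const_mul 4)).fun_sub ((((du.const_mul 7).fun_sub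
      (du2.const_mul 9)).fun_add (du3.const_mul 8)).const_mul t)))
  have dsin := (((((d1.fun_mul (((du.const_mul 10).const_add (-4)).fun_sub
      (du2.const_mul 2))).fun_add (d2.fun_mul ((du2.const_mul 6).fun_sub
      (du.const_mul 20)))).fun_add (db.fun_mul (((du.const_mul 18).sub_const 2).fun_sub
      (du2.const_mul 6)))).fun_add ((dp.fun_mul dm1).fun_mul (((du.const_mul 16).sub_const
      12).fun_sub (du2.const_mul 4)))).fun_add ((dp.fun_mul dm2).fun_mul
      ((du2.const_mul 4).fun_sub (du.const_mul 16)))).fun_add (dx.fun_mul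
      (((((du.const_mul (6 * σ ^ 2 - σ - 4)).const_add (2 * σ - 4 * σ ^ 2)).fun_add
      (du2.const_mul (σ - 2 * σ ^ 2 + 14))).fun_sub (du3.const_mul 4)).fun_add
      ((((du.const_mul 21).fun_sub (du2.const_mul 33)).fun_add (du3.const_mul 8)).const_mul t)))
  refine (dQ.fun_mul ((dcos.fun_mul (Real.hasDerivAt_cos y)).fun_add
    (dsin.fun_mul (Real.hasDerivAt_sin y)))).congr_deriv ?_
  linear_combination (-Q y * Real.cos y) * hcos - Q y * Real.sin y * hsin

end

section
variable {σ : ℝ}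

theorem PolyGrowth.of_unifPoly {F : ℝ → ℝ} (hc : Continuous F)
    (h : UnifPoly fun _ : Unit => F) : PolyGrowth F := by
  obtain ⟨C, k, _, h⟩ := h
  exact ⟨hc, C, k, h ()⟩

theorem expDecay_Q : ExpDecay Q := ⟨continuous_Q, 2 * √2, 0, 1, one_pos, fun y => by
  rw [abs_of_pos (Q_pos y), pow_zero, one_mul, neg_one_mul]; exact Q_le_exp y⟩

theorem polyGrowth_limit (hσ : 1 < σ) : PolyGrowth (fun y => Q y ^ 2) ∧
    PolyGrowth (fun y => Q y ^ (2 * σ - 2)) ∧ PolyGrowth (fun y => -Real.tanh y) ∧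
    PolyGrowth (fun y => D0 σ y / Q y) ∧ PolyGrowth (fun y => D0Deriv σ y / Q y) ∧
    PolyGrowth (T1 σ) ∧ PolyGrowth (T1Deriv σ) ∧ PolyGrowth (T2 σ) ∧ PolyGrowth (T2Deriv σ) := by
  obtain ⟨C, _, hC⟩ := exists_D0_bound hσ
  refine ⟨expDecay_Q.polyGrowth.pow 2, .of_bounded (continuous_Q_rpow _) (C := √2 ^ (2 * σ - 2))
      fun y => ?_, (PolyGrowth.of_bounded continuous_tanh' abs_tanh_le).neg,
    .of_bounded (continuous_of_hasDerivAt (hasDerivAt_D0_div_Q hσ)) fun y => (hC y).1,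
    .of_bounded (continuous_of_hasDerivAt (hasDerivAt_D0Deriv_div_Q hσ)) fun y => (hC y).2,
    .of_unifPoly (continuous_of_hasDerivAt (hasDerivAt_T1 hσ)) (unifPoly_T1 hσ),
    .of_unifPoly (continuous_of_hasDerivAt (hasDerivAt_T1Deriv hσ)) (unifPoly_T1Deriv hσ),
    .of_unifPoly (continuous_of_hasDerivAt (hasDerivAt_T2 hσ)) (unifPoly_T2 hσ),
    .of_unifPoly (continuous_of_hasDerivAt (hasDerivAt_T2Deriv hσ)) (unifPoly_T2Deriv hσ)⟩
  rw [abs_of_pos (Q_rpow_pos _ _)]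
  exact Q_rpow_le (by linarith) y

theorem polyGrowth_cos : PolyGrowth Real.cos :=
  .of_bounded Real.continuous_cos Real.abs_cos_le_one

theorem polyGrowth_sin : PolyGrowth Real.sin :=
  .of_bounded Real.continuous_sin Real.abs_sin_le_one

theorem polyGrowth_psiLimit (hσ : 1 < σ) : PolyGrowth (psiLimit σ) := by
  obtain ⟨h1, h2, h3, h4, h5, h6, h7, h8, h9⟩ := polyGrowth_limit hσ
  unfold psiLimit psiOne varOne varTwo varOneDeriv varTwoDeriv
  repeat' first
    | assumption
    | exact PolyGrowth.const _
    | apply PolyGrowth.sub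
    | apply PolyGrowth.add
    | apply PolyGrowth.neg
    | apply PolyGrowth.pow
    | apply PolyGrowth.mul

theorem expDecay_Gamma0Integrand (hσ : 1 < σ) : ExpDecay (Gamma0Integrand σ) := by
  obtain ⟨h1, h2, h3, h4, h5, h6, h7, h8, h9⟩ := polyGrowth_limit hσ
  have hc := polyGrowth_cos
  have hs := polyGrowth_sin
  rw [show Gamma0Integrand σ = _ from
    funext fun y => Gamma0Integrand_eq hσ (y := y) rfl rfl rfl rfl rfl rfl]
  apply expDecay_Q.mul
  repeat' first
    | assumption
    | exact PolyGrowth.const _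
    | apply PolyGrowth.sub
    | apply PolyGrowth.add
    | apply PolyGrowth.neg
    | apply PolyGrowth.pow
    | apply PolyGrowth.mul

/-- `∫ Q ψ₁ g₁⁰ = Γ₀(σ)`, where `g₁⁰ = Q² cos + 2 (Q'/Q) sin` is the limit of `g₁`. -/
theorem integral_psiLimit (hσ : 1 < σ) :
    ∫ y, Q y * psiLimit σ y * (Q y ^ 2 * Real.cos y + 2 * -Real.tanh y * Real.sin y)
      = Gamma0 σ := by
  obtain ⟨h1, h2, h3, h4, h5, h6, h7, h8, h9⟩ := polyGrowth_limit hσ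
  have hc := polyGrowth_cos
  have hs := polyGrowth_sin
  have hd := expDecay_Gamma0Integrand hσ
  have hl : ExpDecay fun y => Q y * psiLimit σ y
      * (Q y ^ 2 * Real.cos y + 2 * -Real.tanh y * Real.sin y) :=
    (expDecay_Q.mul (polyGrowth_psiLimit hσ)).mul
      ((h1.mul hc).add (((PolyGrowth.const 2).mul h3).mul hs))
  have h0 := ExpDecay.integral_deriv_eq_zero (by
    apply expDecay_Q.mul
    unfold primitiveCos primitiveSin
    repeat' first
      | assumption
      | exact PolyGrowth.const _
      | apply PolyGrowth.sub
      | apply PolyGrowth.add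
      | apply PolyGrowth.neg
      | apply PolyGrowth.pow
      | apply PolyGrowth.mul) (hl.integrable.sub hd.integrable) (hasDerivAt_primitive hσ)
  simp only [Pi.sub_apply] at h0
  rw [integral_sub hl.integrable hd.integrable] at h0
  rw [Gamma0]; linarith

end

/-! ### Expansion of `ψ` and of `Γ` -/

theorem PolyGrowth.unifPoly {ι : Type*} {F : ℝ → ℝ} (h : PolyGrowth F) :
    UnifPoly fun _ : ι => F := by
  obtain ⟨_, C, k, h⟩ := h
  exact ⟨|C|, k, abs_nonneg C, fun _ y =>
    (h y).trans (mul_le_mul_of_nonneg_right (le_abs_self C) (by positivity))⟩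

section
variable {σ : ℝ} {ι : Type} {e : ι → ℝ} {R : ι → ℝ → ℝ}

/-- The expansions of `R/Q`, `R²`, `R'/R` and of the two potentials. -/
theorem exists_soliton_expansion (hσ : 1 < σ) : ∃ ε₀, 0 < ε₀ ∧ ∀ {ι : Type} {e : ι → ℝ}
    {R : ι → ℝ → ℝ}, (∀ i, 0 < e i ∧ e i ≤ 1) → (∀ i, e i ≤ ε₀) →
    (∀ i, IsProfile σ (e i) (R i)) →
    Expands e (fun i y => R i y / Q y) (fun _ => 1) (fun y => D0 σ y / Q y) ∧
    Expands e (fun i y => R i y ^ 2) (fun y => Q y ^ 2) (fun y => 2 * Q y ^ 2 * (D0 σ y / Q y)) ∧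
    Expands e (fun i => logD (R i)) (fun y => -Real.tanh y)
      (fun y => D0Deriv σ y / Q y - -Real.tanh y * (D0 σ y / Q y)) ∧
    Expands e (fun i => pot σ (e i) (R i)) (fun _ => 0) (fun y => Q y ^ (2 * σ - 2) * Q y ^ 2) ∧
    Expands e (fun i => rpot σ (e i) (R i)) (fun _ => 0) (fun y => Q y ^ (2 * σ - 2)) := by
  obtain ⟨ε₁, hε₁, hpow⟩ := exists_rpow_bound hσ
  obtain ⟨ε₂, hε₂, C, hC, hrec⟩ := exists_recip_bound_one hσ
  obtain ⟨K₁, hK₁, hp₁⟩ := hpow (2 * σ)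
  obtain ⟨K₂, hK₂, hp₂⟩ := hpow (2 * σ - 2)
  obtain ⟨h1, h2, h3, h4, h5, -⟩ := polyGrowth_limit hσ
  refine ⟨min ε₁ ε₂, lt_min hε₁ hε₂, fun {ι e R} he hle hR => ?_⟩
  have he0 := fun i => (he i).1
  have hle1 := fun i => (hle i).trans (min_le_left _ _)
  have hle2 := fun i => (hle i).trans (min_le_right _ _)
  have hinv : Expands e (fun i y => Q y / R i y) (fun _ => 1) (fun y => -(D0 σ y / Q y)) := by
    refine .of_bound he0 (.const 1) h4.neg.unifPoly (C := √2 * C) (k := 0) fun i y => ?_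
    have hQ := (Q_pos y).ne'
    have hRy := ((hR i).pos y).ne'
    have hb := (hrec (e i) (R i) (he0 i) (hle2 i) (hR i) y).1
    have := abs_Q_mul_le hb
    have e1 : Q y * ((R i y)⁻¹ - (Q y)⁻¹ - e i * recipVar σ y)
        = Q y / R i y - 1 - e i * -(D0 σ y / Q y) := by
      rw [recipVar]; field_simp
    rw [e1] at this
    calc _ ≤ _ := this
      _ = _ := by ring
  have hratio : Expands e (fun i y => R i y / Q y) (fun _ => 1) (fun y => D0 σ y / Q y) := by
    have := hinv.inv he one_pos fun i y => by
      rw [le_div_iff₀ ((hR i).pos y), one_mul]; exact (hR i).le_Q hσ (he0 i) y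
    simpa only [inv_div, neg_neg] using this
  have hQ2 : Expands e (fun _ y => Q y ^ 2) (fun y => Q y ^ 2) (fun _ => 0) :=
    .of_bound he0 h1.unifPoly (.const 0) (C := 0) (k := 0) fun i y => by simp
  have hq : Expands e (fun i y => Q y * recipDeriv (R i) y) (fun y => Real.tanh y)
      (fun y => -(D0Deriv σ y / Q y) - 2 * Real.tanh y * (D0 σ y / Q y)) := by
    have hth : PolyGrowth Real.tanh := .of_bounded continuous_tanh' abs_tanh_le
    refine .of_bound he0 hth.unifPoly
      (h5.neg.sub (((PolyGrowth.const 2).mul hth).mul h4)).unifPoly (C := √2 * C) (k := 0)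
      fun i y => ?_
    have hQ := (Q_pos y).ne'
    have hb := (hrec (e i) (R i) (he0 i) (hle2 i) (hR i) y).2
    have := abs_Q_mul_le hb
    have e1 : Q y * (recipDeriv (R i) y - Real.sinh y * (1 / √2) - e i * recipVarDeriv σ y)
        = Q y * recipDeriv (R i) y - Real.tanh y
          - e i * (-(D0Deriv σ y / Q y) - 2 * Real.tanh y * (D0 σ y / Q y)) := by
      have e2 : Q y * (Real.sinh y * (1 / √2)) = Real.tanh y := by
        rw [Real.tanh_eq_sinh_div_cosh, Q]
        have := (Real.cosh_pos y).ne'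
        field_simp
      have e3 : Q y * recipVarDeriv σ y
          = -(D0Deriv σ y / Q y) - 2 * Real.tanh y * (D0 σ y / Q y) := by
        rw [recipVarDeriv]; field_simp; ring
      linear_combination -e2 - e i * e3
    rw [e1] at this
    calc _ ≤ _ := this
      _ = _ := by ring
  have hpot : ∀ {t K : ℝ}, 0 ≤ t → (∀ ε R, 0 < ε → ε ≤ ε₁ → IsProfile σ ε R → ∀ y,
      |R y ^ t - Q y ^ t| ≤ K * ε * Q y ^ t) → 0 < K →
      Expands e (fun i y => e i * R i y ^ t) (fun _ => 0) (fun y => Q y ^ t) := by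
    intro t K ht hb hK
    refine Approx.expands_mul (.of_bound he0 (UnifPoly.of_bound (C := √2 ^ t) fun i y => ?_)
      (C := K * √2 ^ t) (k := 0) fun i y => ?_)
    · rw [abs_of_pos (Q_rpow_pos _ _)]; exact Q_rpow_le ht y
    · have := he0 i
      calc _ ≤ K * e i * Q y ^ t := hb _ _ (he0 i) (hle1 i) (hR i) y
        _ ≤ K * e i * √2 ^ t :=
            mul_le_mul_of_nonneg_left (Q_rpow_le ht y) (by positivity)
        _ = _ := by ring
  refine ⟨hratio, ?_, ?_, ?_, hpot (by linarith) hp₂ hK₂⟩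
  · have := (hQ2.mul he (hratio.mul he hratio)).congr (G₀ := fun y => Q y ^ 2)
      (G₁ := fun y => 2 * Q y ^ 2 * (D0 σ y / Q y)) (fun y => by ring) (fun y => by ring)
    convert this using 3 with i y
    have := (Q_pos y).ne'
    field_simp
  · have := ((hq.mul he hratio).neg).congr (G₀ := fun y => -Real.tanh y)
      (G₁ := fun y => D0Deriv σ y / Q y - -Real.tanh y * (D0 σ y / Q y))
      (fun y => by ring) (fun y => by ring)
    convert this using 3 with i y
    have := (Q_pos y).ne'
    have := ((hR i).pos y).ne'
    rw [logD, recipDeriv]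
    field_simp
  · exact (hpot (by linarith) hp₁ hK₁).congr (fun _ => rfl) fun y => Q_rpow_eq σ y

theorem Expands.congr_left {F G : ι → ℝ → ℝ} {F₀ F₁ : ℝ → ℝ} (h : Expands e F F₀ F₁)
    (hFG : ∀ i y, F i y = G i y) : Expands e G F₀ F₁ := by
  rwa [← show F = G from funext fun i => funext (hFG i)]

section
variable {α : ι → ℝ} {W₁ W₂ : ι → ℝ → ℝ} {u₀ u₁ p₀ p₁ w₁ m₁ m₂ T₁ T₂ : ℝ → ℝ}

/-- The expansions of `V₁`, `V₁'`, `V₂`, `V₂'`. As `W₁` and `W₂` tend to `1`, their limits are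
`1 - Q²`, `-2 Q Q'`, `1` and `0`. -/
theorem Expands.modes (he : ∀ i, 0 < e i ∧ e i ≤ 1)
    (hu : Expands e (fun i y => R i y ^ 2) u₀ u₁) (hp : Expands e (fun i => logD (R i)) p₀ p₁)
    (hw : Expands e (fun i => pot σ (e i) (R i)) (fun _ => 0) w₁)
    (hl : Expands e (fun i _ => 1 - α i ^ 2) (fun _ => 1) (fun _ => 0))
    (h₁ : Expands e W₁ (fun _ => 1) (fun y => T₁ y + T₂ y))
    (h₂ : Expands e W₂ (fun _ => 1) (fun y => T₁ y - T₂ y))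
    (h₁' : Expands e (fun i => deriv (W₁ i)) (fun _ => 0) (fun y => m₁ y + m₂ y))
    (h₂' : Expands e (fun i => deriv (W₂ i)) (fun _ => 0) (fun y => m₁ y - m₂ y)) :
    Expands e (fun i => modeOne σ (e i) (R i) (1 - α i ^ 2) (W₁ i) (W₂ i))
      (fun y => 1 - u₀ y) (fun y => ((1 - 2 * (σ + 1)⁻¹) * w₁ y - u₁ y - w₁ y)
        + (2 - u₀ y) * (T₁ y + T₂ y) + 2 * p₀ y * (m₁ y + m₂ y) - (T₁ y - T₂ y)) ∧
    Expands e (fun i => modeOneDeriv σ (e i) (R i) (1 - α i ^ 2) (W₁ i) (W₂ i))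
      (fun y => -2 * p₀ y * u₀ y) (fun y => 2 * (p₁ y * (1 - u₀ y) - p₀ y * (u₁ y + w₁ y))
        + 2 * p₀ y * (1 - u₀ y) * (T₁ y + T₂ y) - 2 * p₁ y - 2 * p₀ y * (T₁ y - T₂ y)
        + 2 * (1 - u₀ y) * (m₁ y + m₂ y) - (m₁ y - m₂ y)) ∧
    Expands e (fun i => modeTwo σ (e i) (R i) (1 - α i ^ 2) (W₁ i) (W₂ i))
      (fun _ => 1) (fun y => -(T₁ y + T₂ y) + 2 * (1 - 2 * (σ + 1)⁻¹) * w₁ y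
        + 2 * (T₁ y - T₂ y) + 2 * p₀ y * (m₁ y - m₂ y)) ∧
    Expands e (fun i => modeTwoDeriv σ (e i) (R i) (1 - α i ^ 2) (W₁ i) (W₂ i))
      (fun _ => 0) (fun y => -2 * p₀ y * (T₁ y + T₂ y) + 2 * (1 - 2 * (σ + 1)⁻¹) * w₁ y * p₀ y
        + 2 * p₀ y * (T₁ y - T₂ y) - (m₁ y + m₂ y) + (2 - u₀ y) * (m₁ y - m₂ y)) := by
  have c : ∀ c : ℝ, Expands e (fun _ _ => c) (fun _ => c) (fun _ => 0) := Expands.const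
  have hK := ((c 1).sub hu).sub hw
  have h2p := (c 2).mul he hp
  have hL := (c 2).add ((c (2 * (1 - 2 * (σ + 1)⁻¹))).mul he hw)
  refine ⟨?_, ?_, ?_, ?_⟩
  · exact ((((((((c 2).add ((c (1 - 2 * (σ + 1)⁻¹)).mul he hw)).sub hu).sub hw).mul he h₁).add
      (h2p.mul he h₁')).sub (hl.mul he h₂)).congr (fun y => by ring) (fun y => by ring))
  · exact ((((((h2p.mul he hK).mul he h₁).sub ((h2p.mul he hl).mul he h₂)).add
      (((c 2).mul he hK).mul he h₁')).sub (hl.mul he h₂')).congr (fun y => by ring)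
      (fun y => by ring))
  · exact ((((hl.neg.mul he h₁).add (hL.mul he h₂)).add (h2p.mul he h₂')).congr
      (fun y => by ring) (fun y => by ring))
  · exact ((((((((c (-2)).mul he hp).mul he hl).mul he h₁).add ((hL.mul he hp).mul he h₂)).sub
      (hl.mul he h₁')).add ((((c 2).sub ((c (2 * (σ + 1)⁻¹)).mul he hw)).sub hu).mul he h₂')).congr
      (fun y => by ring) (fun y => by ring))

/-- `ψ = ε ψ₁ + O(ε²)`: at order zero, where `V₁ = 1 - Q²` and `V₂ = 1`, the function `ψ` vanishes
identically. -/
theorem Expands.psi (he : ∀ i, 0 < e i ∧ e i ≤ 1)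
    (hu : Expands e (fun i y => R i y ^ 2) (fun y => Q y ^ 2)
      (fun y => 2 * Q y ^ 2 * (D0 σ y / Q y)))
    (hp : Expands e (fun i => logD (R i)) (fun y => -Real.tanh y)
      (fun y => D0Deriv σ y / Q y - -Real.tanh y * (D0 σ y / Q y)))
    (hw : Expands e (fun i => pot σ (e i) (R i)) (fun _ => 0)
      (fun y => Q y ^ (2 * σ - 2) * Q y ^ 2))
    (hx : Expands e (fun i => rpot σ (e i) (R i)) (fun _ => 0) (fun y => Q y ^ (2 * σ - 2)))
    (hl : Expands e (fun i _ => 1 - α i ^ 2) (fun _ => 1) (fun _ => 0))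
    (hα : ∀ i, 1 / 2 ≤ 1 - α i ^ 2)
    (h₁ : Expands e W₁ (fun _ => 1) (fun y => T1 σ y + T2 σ y))
    (h₂ : Expands e W₂ (fun _ => 1) (fun y => T1 σ y - T2 σ y))
    (h₁' : Expands e (fun i => deriv (W₁ i)) (fun _ => 0) (fun y => T1Deriv σ y + T2Deriv σ y))
    (h₂' : Expands e (fun i => deriv (W₂ i)) (fun _ => 0) (fun y => T1Deriv σ y - T2Deriv σ y)) :
    Expands e (fun i y => psiForm σ (1 - α i ^ 2) (R i y ^ 2) (pot σ (e i) (R i) y)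
      (rpot σ (e i) (R i) y) (logD (R i) y)
      (modeOne σ (e i) (R i) (1 - α i ^ 2) (W₁ i) (W₂ i) y)
      (modeOneDeriv σ (e i) (R i) (1 - α i ^ 2) (W₁ i) (W₂ i) y)
      (modeTwo σ (e i) (R i) (1 - α i ^ 2) (W₁ i) (W₂ i) y)
      (modeTwoDeriv σ (e i) (R i) (1 - α i ^ 2) (W₁ i) (W₂ i) y))
      (fun _ => 0) (psiLimit σ) := by
  have c : ∀ c : ℝ, Expands e (fun _ _ => c) (fun _ => c) (fun _ => 0) := Expands.const
  obtain ⟨v1, v2, v3, v4⟩ := Expands.modes he hu hp hw hl h₁ h₂ h₁' h₂'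
  have hli := hl.inv he (by norm_num : (0 : ℝ) < 1 / 2) fun i _ => hα i
  have hK := ((c 1).sub hu).sub hw
  have hr := (c 1).add ((c σ).mul he hx)
  have hx2 := (c (σ * (2 * σ - 1))).mul he hx
  have hE := (hK.mul he hr).add (hK.add (hx2.mul he (hK.add ((c (2 * σ - 2)).mul he
    (hp.mul he hp)))))
  have hB := (((v1.mul he v3).mul he hE).add (((c 2).mul he (v2.mul he v4)).mul he hr)).add
    (((c 2).mul he ((v2.mul he v3).add (v1.mul he v4))).mul he (hp.mul he ((c 1).add hx2)))
  have := (((v1.mul he v1).mul he ((c 4).add ((c (2 * σ ^ 2 + 2 * σ)).mul he hx))).sub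
    (c 2)).sub (hli.mul he hB)
  refine (this.congr (fun y => ?_) fun y => ?_).congr_left fun i y => ?_
  · linear_combination 4 * Q y ^ 2 * tanh_sq y
  · rw [psiLimit, psiOne, varOne, varTwo, varOneDeriv, varTwoDeriv]
    ring
  · rw [psiForm]; ring

/-- The limit `Q² cos y + 2 (Q'/Q) sin y` of `g₁`. -/
theorem Approx.radiation {h₁ h₂ : ι → ℝ → ℝ} (he : ∀ i, 0 < e i ∧ e i ≤ 1)
    (hu : Approx e (fun i y => R i y ^ 2) u₀) (hp : Approx e (fun i => logD (R i)) p₀)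
    (hw : Approx e (fun i => pot σ (e i) (R i)) (fun _ => 0))
    (hl : Approx e (fun i _ => 1 - α i ^ 2) (fun _ => 1))
    (b₁ : Approx e h₁ (fun y => -Real.cos y)) (b₂ : Approx e h₂ (fun y => -Real.cos y))
    (b₁' : Approx e (fun i => deriv (h₁ i)) (fun y => Real.sin y)) :
    Approx e (fun i => modeOne σ (e i) (R i) (2 * (1 - α i ^ 2)) (h₁ i) (h₂ i))
      (fun y => u₀ y * Real.cos y + 2 * p₀ y * Real.sin y) := by
  have c : ∀ c : ℝ, Approx e (fun _ _ => c) (fun _ => c) := fun k => (Expands.const k).approx he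
  exact (((((((c 2).add ((c (1 - 2 * (σ + 1)⁻¹)).mul he hw)).sub hu).sub hw).mul he b₁).add
    (((c 2).mul he hp).mul he b₁')).sub (((c 2).mul he hl).mul he b₂)).congr fun y => by ring

end

end

section
variable {a σ ε₀ : ℝ}

/-- The tuples `(ω, Q_ω, α, W₁, W₂, h₁, h₂)` with `a ω^(σ-1) ≤ ε₀`: the index type over which the
expansions are uniform. -/
structure SmallTuple (a σ ε₀ : ℝ) where
  ω : ℝ
  R : ℝ → ℝ
  α : ℝ
  W₁ : ℝ → ℝ
  W₂ : ℝ → ℝ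
  h₁ : ℝ → ℝ
  h₂ : ℝ → ℝ
  ω_pos : 0 < ω
  small : a * ω ^ (σ - 1) ≤ ε₀
  tuple : IsFermiTuple (powerNL a σ) ω R α W₁ W₂ h₁ h₂

/-- The small parameter `ε = a ω^(σ-1)`. -/
noncomputable def SmallTuple.ε (t : SmallTuple a σ ε₀) : ℝ := a * t.ω ^ (σ - 1)

theorem SmallTuple.isProfile (hσ : 1 < σ) (t : SmallTuple a σ ε₀) : IsProfile σ t.ε t.R :=
  t.tuple.soliton.isProfile hσ t.ω_pos

/-- Uniform estimates on the internal mode and on the radiation mode. -/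
theorem exists_tuple_bound (hσ : 1 < σ) (ha : 0 < a) : ∃ ε₁, 0 < ε₁ ∧ ∃ C, 0 < C ∧
    ∀ ε₀, ε₀ ≤ ε₁ → ∀ t : SmallTuple a σ ε₀, t.α ^ 2 ≤ 1 / 4 ∧ t.α ^ 2 ≤ C * t.ε ^ 2 ∧ ∀ y,
    |t.W₁ y - 1 - t.ε * (T1 σ y + T2 σ y)| ≤ C * t.ε ^ 2 * (1 + |y|) ^ 2 ∧
    |t.W₂ y - 1 - t.ε * (T1 σ y - T2 σ y)| ≤ C * t.ε ^ 2 * (1 + |y|) ^ 2 ∧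
    |deriv t.W₁ y - t.ε * (T1Deriv σ y + T2Deriv σ y)| ≤ C * t.ε ^ 2 * (1 + |y|) ^ 2 ∧
    |deriv t.W₂ y - t.ε * (T1Deriv σ y - T2Deriv σ y)| ≤ C * t.ε ^ 2 * (1 + |y|) ^ 2 ∧
    |t.h₁ y + Real.cos y| ≤ C * t.ε * (1 + |y|) ∧ |t.h₂ y + Real.cos y| ≤ C * t.ε * (1 + |y|) ∧
    |deriv t.h₁ y - Real.sin y| ≤ C * t.ε * (1 + |y|) ∧
    |deriv t.h₂ y - Real.sin y| ≤ C * t.ε * (1 + |y|) := by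
  obtain ⟨ε₁, hε₁, C, hC, hmode⟩ := exists_mode_expansion hσ
  obtain ⟨ε₂, hε₂, D, hD, hrad⟩ := exists_radiation_bound hσ
  refine ⟨min ε₁ (min ε₂ (1 / (2 * C))), by positivity, 2 * C + C ^ 2 + 2 * D * (1 + C),
    by positivity, fun ε₀ hε₀ t => ?_⟩
  have hε : 0 < t.ε := mul_pos ha (Real.rpow_pos_of_pos t.ω_pos _)
  have hle : t.ε ≤ _ := t.small.trans hε₀
  simp only [le_min_iff] at hle
  obtain ⟨l1, l2, l3⟩ := hle
  rw [le_div_iff₀ (by positivity)] at l3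
  have hR := t.isProfile hσ
  have hm : IsModePair σ t.ε t.R t.α _ _ _ _ := t.tuple.mode.isModePair hσ t.ω_pos hR.pos
  obtain ⟨hα, hW⟩ := hmode _ _ _ _ _ _ _ hε l1 hR hm
  have hα0 := hm.alpha_pos
  have hα1 : t.α ^ 2 ≤ C ^ 2 * t.ε ^ 2 := by
    rw [← mul_pow]; exact pow_le_pow_left₀ hα0.le hα 2
  have hα2 : t.α ≤ 1 / 2 := by linarith
  have hα3 : t.α ^ 2 ≤ 1 / 4 := by nlinarith
  set k := √(1 - 2 * t.α ^ 2) with hk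
  have hk2 : k ^ 2 = 1 - 2 * t.α ^ 2 := Real.sq_sqrt (by linarith)
  have hk0 : 0 ≤ k := Real.sqrt_nonneg _
  have hk1 : k ≤ 1 := by nlinarith
  have hkh : 1 / 2 ≤ k := by nlinarith
  have hkε : 1 - k ≤ C * t.ε := by nlinarith
  have hr : IsRadiationPair σ t.ε t.R k _ _ _ _ :=
    t.tuple.radiation.isRadiationPair hσ t.ω_pos hR.pos hk2
  have hh := hrad _ _ _ _ _ _ _ hε l2 hR hkh hk1 hr
  refine ⟨hα3, hα1.trans ?_, fun y => ?_⟩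
  · have : 0 ≤ (2 * C + 2 * D * (1 + C)) * t.ε ^ 2 := by positivity
    linarith
  obtain ⟨a1, a2, a3, a4⟩ := hW y
  obtain ⟨b1, b2, b3, b4⟩ := hh y
  have hwt : 0 ≤ t.ε ^ 2 * (1 + |y|) ^ 2 := by positivity
  have hwt' : 0 ≤ t.ε * (1 + |y|) := by positivity
  have key : ∀ {x z : ℝ}, |x| ≤ C * t.ε ^ 2 * (1 + |y|) ^ 2 → |z| ≤ C * t.ε ^ 2 * (1 + |y|) ^ 2 →
      |x + z| ≤ (2 * C + C ^ 2 + 2 * D * (1 + C)) * t.ε ^ 2 * (1 + |y|) ^ 2 ∧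
      |x - z| ≤ (2 * C + C ^ 2 + 2 * D * (1 + C)) * t.ε ^ 2 * (1 + |y|) ^ 2 := by
    intro x z hx hz
    have : 0 ≤ (C ^ 2 + 2 * D * (1 + C)) * (t.ε ^ 2 * (1 + |y|) ^ 2) := by positivity
    exact ⟨(abs_add_le _ _).trans (by linarith), (abs_sub _ _).trans (by linarith)⟩
  have key' : ∀ {x z : ℝ}, |x| ≤ D * (t.ε + (1 - k)) * (1 + |y|) →
      |z| ≤ D * (t.ε + (1 - k)) * (1 + |y|) →
      |x + z| ≤ (2 * C + C ^ 2 + 2 * D * (1 + C)) * t.ε * (1 + |y|) ∧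
      |x - z| ≤ (2 * C + C ^ 2 + 2 * D * (1 + C)) * t.ε * (1 + |y|) := by
    intro x z hx hz
    have h1 : 0 ≤ (2 * C + C ^ 2) * (t.ε * (1 + |y|)) := by positivity
    have h2 : D * (t.ε + (1 - k)) * (1 + |y|) ≤ D * (t.ε + C * t.ε) * (1 + |y|) := by gcongr
    exact ⟨(abs_add_le _ _).trans (by linarith), (abs_sub _ _).trans (by linarith)⟩
  refine ⟨?_, ?_, ?_, ?_, ?_, ?_, ?_, ?_⟩
  · convert (key a1 a3).1 using 2; ring
  · convert (key a1 a3).2 using 2; ring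
  · convert (key a2 a4).1 using 2; ring
  · convert (key a2 a4).2 using 2; ring
  · convert (key' b1 b3).1 using 2; ring
  · convert (key' b1 b3).2 using 2; ring
  · convert (key' b2 b4).1 using 2; ring
  · convert (key' b2 b4).2 using 2; ring

theorem SmallTuple.expDecay (hσ : 1 < σ) (ha : 0 < a) (t : SmallTuple a σ ε₀) :
    ExpDecay t.W₁ ∧ ExpDecay t.W₂ ∧ ExpDecay (deriv t.W₁) ∧ ExpDecay (deriv t.W₂) := by
  have hε : 0 < t.ε := mul_pos ha (Real.rpow_pos_of_pos t.ω_pos _)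
  have hR := t.isProfile hσ
  have hm : IsModePair σ t.ε t.R t.α _ _ _ _ := t.tuple.mode.isModePair hσ t.ω_pos hR.pos
  have hc := t.tuple.mode.isCoupled hσ t.ω_pos hR.pos
  obtain ⟨C, hC⟩ := hm.exists_decay hσ hε hR
  have key : ∀ {f g : ℝ → ℝ}, Continuous f → Continuous g →
      (∀ y, |(f y + g y) / 2| ≤ C * Real.exp (-t.α * |y|) ∧
        |(f y - g y) / 2| ≤ C * Real.exp (-t.α * |y|)) → ExpDecay f ∧ ExpDecay g := by
    intro f g cf cg h
    refine ⟨⟨cf, 2 * C, 0, t.α, hm.alpha_pos, fun y => ?_⟩,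
      ⟨cg, 2 * C, 0, t.α, hm.alpha_pos, fun y => ?_⟩⟩ <;>
    · have h1 := abs_le.1 (h y).1
      have h2 := abs_le.1 (h y).2
      rw [pow_zero, one_mul, abs_le]
      constructor <;> linarith
  have k1 := key (continuous_of_hasDerivAt hc.hd₁) (continuous_of_hasDerivAt hc.hd₂)
    fun y => ⟨(hC y).1, (hC y).2.2.1⟩
  have k2 := key (continuous_of_hasDerivAt hc.hdd₁) (continuous_of_hasDerivAt hc.hdd₂)
    fun y => ⟨(hC y).2.1, (hC y).2.2.2⟩
  exact ⟨k1.1, k1.2, k2.1, k2.2⟩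

/-- `Γ = ε Γ₀(σ) + O(ε²)` with `ε = a ω^(σ-1)`. -/
theorem exists_fermiGamma_bound (hσ : 1 < σ) (ha : 0 < a) : ∃ ε₀, 0 < ε₀ ∧ ∃ C, 0 < C ∧
    ∀ t : SmallTuple a σ ε₀, Integrable (fermiIntegrand (powerNL a σ) t.ω t.R t.α t.W₁ t.h₁) ∧
    |fermiGamma (powerNL a σ) t.ω t.R t.α t.W₁ t.h₁ - t.ε * Gamma0 σ| ≤ C * t.ε ^ 2 := by
  obtain ⟨ε₁, hε₁, hsol⟩ := exists_soliton_expansion hσ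
  obtain ⟨ε₂, hε₂, C, hC, hb⟩ := exists_tuple_bound hσ ha
  set ε₀ := min (min ε₁ ε₂) 1 with hε₀
  have le1 : ε₀ ≤ ε₁ := (min_le_left _ _).trans (min_le_left _ _)
  have le2 : ε₀ ≤ ε₂ := (min_le_left _ _).trans (min_le_right _ _)
  have le3 : ε₀ ≤ 1 := min_le_right _ _
  have hpos : ∀ t : SmallTuple a σ ε₀, 0 < t.ε := fun t =>
    mul_pos ha (Real.rpow_pos_of_pos t.ω_pos _)
  have he : ∀ t : SmallTuple a σ ε₀, 0 < t.ε ∧ t.ε ≤ 1 := fun t => ⟨hpos t, t.small.trans le3⟩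
  have hR : ∀ t : SmallTuple a σ ε₀, IsProfile σ t.ε t.R := fun t => t.isProfile hσ
  have hb := fun t : SmallTuple a σ ε₀ => hb ε₀ le2 t
  obtain ⟨eR, eu, ep, ew, ex⟩ := hsol he (fun t => t.small.trans le1) hR
  have hα : ∀ t : SmallTuple a σ ε₀, 1 / 2 ≤ 1 - t.α ^ 2 := fun t => by linarith [(hb t).1]
  have el : Expands (SmallTuple.ε (a := a) (σ := σ) (ε₀ := ε₀)) (fun t _ => 1 - t.α ^ 2)
      (fun _ => 1) (fun _ => 0) :=
    .of_bound hpos (.const 1) (.const 0) (C := C) (k := 0) fun t y => by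
      rw [show 1 - t.α ^ 2 - 1 - t.ε * 0 = -t.α ^ 2 by ring, abs_neg,
        abs_of_nonneg (sq_nonneg _), pow_zero, mul_one]
      exact (hb t).2.1
  have u1 := unifPoly_T1 (ι := SmallTuple a σ ε₀) hσ
  have u2 := unifPoly_T2 (ι := SmallTuple a σ ε₀) hσ
  have u1' := unifPoly_T1Deriv (ι := SmallTuple a σ ε₀) hσ
  have u2' := unifPoly_T2Deriv (ι := SmallTuple a σ ε₀) hσ
  have eW₁ := Expands.of_bound hpos (F := SmallTuple.W₁) (F₀ := fun _ => 1)
    (F₁ := fun y => T1 σ y + T2 σ y) (C := C) (k := 2) (.const 1) (u1.add u2)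
    fun t y => ((hb t).2.2 y).1
  have eW₂ := Expands.of_bound hpos (F := SmallTuple.W₂) (F₀ := fun _ => 1)
    (F₁ := fun y => T1 σ y - T2 σ y) (C := C) (k := 2) (.const 1) (u1.sub u2)
    fun t y => ((hb t).2.2 y).2.1
  have eW₁' := Expands.of_bound hpos (F := fun t => deriv t.W₁) (F₀ := fun _ => 0)
    (F₁ := fun y => T1Deriv σ y + T2Deriv σ y) (C := C) (k := 2) (.const 0) (u1'.add u2')
    fun t y => by rw [sub_zero]; exact ((hb t).2.2 y).2.2.1
  have eW₂' := Expands.of_bound hpos (F := fun t => deriv t.W₂) (F₀ := fun _ => 0)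
    (F₁ := fun y => T1Deriv σ y - T2Deriv σ y) (C := C) (k := 2) (.const 0) (u1'.sub u2')
    fun t y => by rw [sub_zero]; exact ((hb t).2.2 y).2.2.2.1
  have eψ := Expands.psi he eu ep ew ex el hα eW₁ eW₂ eW₁' eW₂'
  have uc := polyGrowth_cos.neg.unifPoly (ι := SmallTuple a σ ε₀)
  have us := polyGrowth_sin.unifPoly (ι := SmallTuple a σ ε₀)
  have eh₁ := Approx.of_bound hpos (F := SmallTuple.h₁) uc (C := C) (k := 1) fun t y => by
    rw [sub_neg_eq_add, pow_one]; exact ((hb t).2.2 y).2.2.2.2.1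
  have eh₂ := Approx.of_bound hpos (F := SmallTuple.h₂) uc (C := C) (k := 1) fun t y => by
    rw [sub_neg_eq_add, pow_one]; exact ((hb t).2.2 y).2.2.2.2.2.1
  have eh₁' := Approx.of_bound hpos (F := fun t => deriv t.h₁) us (C := C) (k := 1)
    fun t y => by rw [pow_one]; exact ((hb t).2.2 y).2.2.2.2.2.2.1
  have eg := Approx.radiation he (eu.approx he) (ep.approx he) (ew.approx he) (el.approx he)
    eh₁ eh₂ eh₁'
  -- `R ψ g₁ = Q (ψ g₁ (R/Q))`, and the factor `Q` makes polynomially bounded remainders integrable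
  obtain ⟨-, -, r, ⟨K, k, hK, hr⟩, hexp⟩ := (eψ.mul_approx he eg).mul_approx he (eR.approx he)
  have hJ : 0 ≤ ∫ y, (1 + |y|) ^ k * Q y :=
    integral_nonneg fun y => mul_nonneg (by positivity) (Q_pos y).le
  refine ⟨ε₀, by positivity, K * (∫ y, (1 + |y|) ^ k * Q y) + 1, by positivity, fun t => ?_⟩
  have hRt := hR t
  obtain ⟨b1, b2, b3, b4⟩ := t.expDecay hσ ha
  have hc := t.tuple.radiation.isCoupled hσ t.ω_pos hRt.pos
  have growth : ∀ {f g : ℝ → ℝ}, Continuous f → PolyGrowth g →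
      (∀ y, |f y - g y| ≤ C * t.ε * (1 + |y|)) → PolyGrowth f := by
    intro f g cf hg h
    have h1 : PolyGrowth fun y => f y - g y :=
      ⟨cf.sub hg.1, C * t.ε, 1, fun y => by rw [pow_one]; exact h y⟩
    simpa using h1.add hg
  have nc := polyGrowth_cos.neg
  obtain ⟨i1, i2, i3⟩ := integral_fermiIntegrand hσ t.ω_pos ha (ε := t.ε) rfl
    (by linarith [hα t]) hRt (t.tuple.mode.isCoupled hσ t.ω_pos hRt.pos) hc b1 b2 b3 b4
    (growth (continuous_of_hasDerivAt hc.hd₁) nc fun y => by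
      rw [sub_neg_eq_add]; exact ((hb t).2.2 y).2.2.2.2.1)
    (growth (continuous_of_hasDerivAt hc.hd₂) nc fun y => by
      rw [sub_neg_eq_add]; exact ((hb t).2.2 y).2.2.2.2.2.1)
    (growth (continuous_of_hasDerivAt hc.hdd₁) polyGrowth_sin fun y =>
      ((hb t).2.2 y).2.2.2.2.2.2.1)
    (growth (continuous_of_hasDerivAt hc.hdd₂) polyGrowth_sin fun y =>
      ((hb t).2.2 y).2.2.2.2.2.2.2)
  refine ⟨i1, ?_⟩
  have hlim : Integrable fun y => Q y * psiLimit σ y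
      * (Q y ^ 2 * Real.cos y + 2 * -Real.tanh y * Real.sin y) := by
    obtain ⟨h1, -, h3, -⟩ := polyGrowth_limit hσ
    exact ((expDecay_Q.mul (polyGrowth_psiLimit hσ)).mul ((h1.mul polyGrowth_cos).add
      (((PolyGrowth.const 2).mul h3).mul polyGrowth_sin))).integrable
  rw [i3, ← integral_psiLimit hσ, ← integral_const_mul,
    ← integral_sub i2 (hlim.const_mul _)]
  have hint := (integrable_weight_mul_Q k).const_mul (K * t.ε ^ 2)
  calc _ ≤ ∫ y, K * t.ε ^ 2 * ((1 + |y|) ^ k * Q y) := by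
        rw [← Real.norm_eq_abs]
        refine norm_integral_le_of_norm_le hint (ae_of_all _ fun y => ?_)
        have h1 := hexp t y
        have hQ := Q_pos y
        have h2 : t.R y = Q y * (t.R y / Q y) := by field_simp
        rw [Real.norm_eq_abs]
        calc _ = |Q y * (t.ε ^ 2 * r t y)| := by
              congr 1
              conv_lhs => rw [mul_assoc (t.R y)]; enter [1, 1]; rw [h2]
              linear_combination Q y * h1
          _ = t.ε ^ 2 * Q y * |r t y| := by
              rw [abs_mul, abs_mul, abs_of_pos hQ, abs_of_nonneg (sq_nonneg t.ε)]; ring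
          _ ≤ t.ε ^ 2 * Q y * (K * (1 + |y|) ^ k) := by
              have := hr t y
              gcongr
          _ = _ := by ring
    _ = K * (∫ y, (1 + |y|) ^ k * Q y) * t.ε ^ 2 := by rw [integral_const_mul]; ring
    _ ≤ _ := by nlinarith [sq_nonneg t.ε]

end
end FermiRule

theorem lemma16 (σ a : ℝ) (hσ : 1 < σ) (ha : 0 < a) :
    MeasureTheory.Integrable (FermiRule.Gamma0Integrand σ) ∧
    ∃ ω₀ : ℝ, 0 < ω₀ ∧ ∃ C : ℝ, 0 < C ∧ ∀ ω : ℝ, 0 < ω → ω < ω₀ →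
      (∃ (R : ℝ → ℝ) (α : ℝ) (W₁ W₂ h₁ h₂ : ℝ → ℝ),
        FermiRule.IsFermiTuple (FermiRule.powerNL a σ) ω R α W₁ W₂ h₁ h₂) ∧
      ∀ (R : ℝ → ℝ) (α : ℝ) (W₁ W₂ h₁ h₂ : ℝ → ℝ),
        FermiRule.IsFermiTuple (FermiRule.powerNL a σ) ω R α W₁ W₂ h₁ h₂ →
        MeasureTheory.Integrable
          (FermiRule.fermiIntegrand (FermiRule.powerNL a σ) ω R α W₁ h₁) ∧
        |FermiRule.fermiGamma (FermiRule.powerNL a σ) ω R α W₁ h₁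
            - a * FermiRule.Gamma0 σ * ω ^ (σ - 1)| ≤ C * ω ^ (2 * (σ - 1)) := by
  refine ⟨(FermiRule.expDecay_Gamma0Integrand hσ).integrable, ?_⟩
  obtain ⟨ε₁, hε₁, hex⟩ := FermiRule.exists_fermiTuple hσ
  obtain ⟨ε₂, hε₂, C, hC, hbound⟩ := FermiRule.exists_fermiGamma_bound hσ ha
  have hs : 0 < σ - 1 := by linarith
  refine ⟨(min ε₁ ε₂ / a) ^ (σ - 1)⁻¹, by positivity, C * a ^ 2, by positivity,
    fun ω hω hlt => ?_⟩
  have hsmall : a * ω ^ (σ - 1) ≤ min ε₁ ε₂ := by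
    have h1 := Real.rpow_le_rpow hω.le hlt.le hs.le
    rw [Real.rpow_inv_rpow (by positivity) hs.ne', le_div_iff₀ ha] at h1
    linarith
  refine ⟨hex a ω ha hω (hsmall.trans (min_le_left _ _)), fun R α W₁ W₂ h₁ h₂ ht => ?_⟩
  obtain ⟨h1, h2⟩ := hbound ⟨ω, R, α, W₁, W₂, h₁, h₂, hω, hsmall.trans (min_le_right _ _), ht⟩
  refine ⟨h1, ?_⟩
  rw [FermiRule.SmallTuple.ε] at h2
  calc _ = _ := by congr 1; ring
    _ ≤ _ := h2
    _ = _ := by rw [mul_comm 2 (σ - 1), Real.rpow_mul hω.le, Real.rpow_two]; ring
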